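/- Let $\mathbb T=\mathbb R/\mathbb Z$, let $1<\beta<2$ and fix an integer $l\ge 2$. For a curve $v:\mathbb T\to\mathbb R^2$ put $$\zeta(v)(s)=-\int_{\mathbb T}\frac{v_s(s+s_*)-v_s(s)}{|v(s+s_*)-v(s)|^{\beta}}\,ds_*,\qquad \Gamma(v)(s,s_*)=\begin{cases}\dfrac{|\sin \pi s_*|}{\pi|v(s+s_*)-v(s)|}, & s_*\ne 0,\\[2mm] \dfrac1{|v_s(s)|}, & s_*=0,\end{cases}$$ where $\Gamma(v)=\infty$ where the denominator vanishes, and $$\Lambda(v)(s)=s\int_{\mathbb T}\frac{v_s\cdot\partial_s\zeta(v)}{|v_s|^2}\,ds_1-\int_0^s\frac{v_s\cdot\partial_s\zeta(v)}{|v_s|^2}\,ds_1 .$$ For $\rho>0$ let $U_\rho=\{w\in\mathbb C:|\operatorname{Im}w|<\rho\}$. Let $K^{l,\rho}$ be the space of $1$-periodic holomorphic $f:U_\rho\to\mathbb C^2$ with $\|f\|_{K^{l,\rho}}=\sum_{a\le l}\sup_{|y|<\rho}\|\partial^a f(\cdot+iy)\|_{L^2(\mathbb T)}<\infty$, and let $K^{l,\rho}_2$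 be the space of holomorphic $F:U_\rho^2\to\mathbb C$, $1$-periodic in each variable, with $\sum_{a+b\le l}\sup_{|y_1|,|y_2|<\rho}\|\partial_1^a\partial_2^bF(\cdot+iy_1,\cdot+iy_2)\|_{L^2(\mathbb T^2)}<\infty$. Put $X_\rho=K^{l,\rho}\times K^{l,\rho}\times K^{l,\rho}\times K^{l,\rho}_2$. For $\rho_0,\kappa,T>0$ with $\kappa T<\rho_0$, we say that $z:\mathbb T\times[0,T]\to\mathbb R^2$ belongs to $Y_{\rho_0,\kappa,T}$ if for each $t\in[0,T]$ the functions $(z,z_s,z_{ss},\Gamma(z))(t)$ extend to an element of $X_{\rho_0-\kappa t}$ whose norm is bounded uniformly in $t\in[0,T]$. In particular $z(\cdot,t)$ is then real-analytic on $\mathbb T$, on a complex strip of width bounded below for $t\in[0,T]$. Let $z_0:\mathbb T\to\mathbb R^2$ be an analytic closed curve that satisfies the arc-chord condition $\Gamma(z_0)\in L^\infty(\mathbb T^2)$ (so $z_0$ is simple and regular). (i) There are $T,\rho_0,\kappa>0$ with $\kappa T<\rho_0$, an analytic solution $z\in Y_{\rho_0,\kappa,T}$ and a function $\lambda:\mathbb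 T\times[0,T]\to\mathbb R$ with $\lambda(0,t)=0$ for all $t\in[0,T]$, such that $z(\cdot,0)=z_0$ and $$z_t(s,t)=-\int_{\mathbb T}\frac{z_s(s+s_*,t)-z_s(s,t)}{|z(s+s_*,t)-z(s,t)|^\beta}\,ds_*+\lambda(s,t)\,z_s(s,t)\qquad\text{on }\mathbb T\times[0,T].$$ (ii) Suppose in addition that $z_0$ is parameterised with constant speed, i.e. $|\partial_s z_0|$ is constant. Then there are $T,\rho_0,\kappa>0$ with $\kappa T<\rho_0$ such that there is one and only one $z\in Y_{\rho_0,\kappa,T}$ that solves this equation on $\mathbb T\times[0,T]$ with $\lambda(\cdot,t)=\Lambda(z(\cdot,t))$ and $z(\cdot,0)=z_0$; moreover $|z_s(s,t)|$ does not depend on $s$ for this solution. -/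

import Mathlib

open Set MeasureTheory
open scoped ENNReal NNReal

/-- The plane with its Euclidean norm. -/
abbrev Plane := EuclideanSpace ℝ (Fin 2)

/-- The complexified plane, in which complexified curves take their values. -/
abbrev CPlane := EuclideanSpace ℂ (Fin 2)

noncomputable section

/-! Curves on the torus `𝕋 = ℝ / ℤ` are `1`-periodic functions on `ℝ`. -/

open Classical in
/-- The arc-chord function `Γ(v)(s, σ)`: `|sin (π σ)| / (π |v (s + σ) - v s|)` for `σ ≠ 0` in
`ℝ / ℤ`, and `1 / |v' s|` for `σ = 0` in `ℝ / ℤ`. It has the value `∞` where the denominator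
vanishes. -/
def arcChordFn (v : ℝ → Plane) (s σ : ℝ) : ℝ≥0∞ :=
  if ∃ n : ℤ, σ = n then (‖deriv v s‖ₑ)⁻¹
  else ENNReal.ofReal |Real.sin (Real.pi * σ)| /
    (ENNReal.ofReal Real.pi * ‖v (s + σ) - v s‖ₑ)

/-- The arc-chord condition `Γ(v) ∈ L^∞(𝕋²)`. -/
def ArcChord (v : ℝ → Plane) : Prop :=
  essSup (fun p : ℝ × ℝ => arcChordFn v p.1 p.2)
    (volume.restrict (Ioc (0 : ℝ) 1 ×ˢ Ioc (0 : ℝ) 1)) < ⊤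

/-- The integrand `(v'(s + σ) - v'(s)) / |v(s + σ) - v(s)|^β` of the contour dynamics equation. -/
def cdeIntegrand (β : ℝ) (v : ℝ → Plane) (s σ : ℝ) : Plane :=
  (‖v (s + σ) - v s‖ ^ β)⁻¹ • (deriv v (s + σ) - deriv v s)

/-- The integral term `ζ(s) = - ∫_𝕋 (v'(s + σ) - v'(s)) / |v(s + σ) - v(s)|^β dσ`. -/
def cdeIntegral (β : ℝ) (v : ℝ → Plane) (s : ℝ) : Plane :=
  -∫ σ in (0 : ℝ)..1, cdeIntegrand β v s σ

/-- The tangential coefficient which keeps the speed independent of the parameter: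
`λ(s) = s ∫_𝕋 (v' · ζ') / |v'|² - ∫_0^s (v' · ζ') / |v'|²`. -/
def tangentialCoeff (β : ℝ) (v : ℝ → Plane) (s : ℝ) : ℝ :=
  s * (∫ r in (0 : ℝ)..1, inner ℝ (deriv v r) (deriv (cdeIntegral β v) r) / ‖deriv v r‖ ^ 2)
    - ∫ r in (0 : ℝ)..s, inner ℝ (deriv v r) (deriv (cdeIntegral β v) r) / ‖deriv v r‖ ^ 2

/-- `z` (written `z t s`) solves `z_t = ζ(z) + lam z_s` on `𝕋 × [0, T]`, where the function `lam`
on `𝕋 × [0, T]` vanishes at `s = 0`. The time derivative is one-sided at `t = 0` and `t = T`. -/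
structure IsCDESolution (β T : ℝ) (z : ℝ → ℝ → Plane) (lam : ℝ → ℝ → ℝ) : Prop where
  periodic : ∀ t ∈ Icc 0 T, Function.Periodic (z t) 1
  periodic_lam : ∀ t ∈ Icc 0 T, Function.Periodic (lam t) 1
  lam_zero : ∀ t ∈ Icc 0 T, lam t 0 = 0
  integrable : ∀ t ∈ Icc 0 T, ∀ s : ℝ,
    IntervalIntegrable (cdeIntegrand β (z t) s) volume 0 1
  equation : ∀ t ∈ Icc 0 T, ∀ s : ℝ,
    HasDerivWithinAt (fun τ => z τ s)
      (cdeIntegral β (z t) s + lam t s • deriv (z t) s) (Icc 0 T) t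

/-! The Banach scale of analytic functions. -/

/-- The open strip `U_ρ = {w : |Im w| < ρ}`. -/
def strip (ρ : ℝ) : Set ℂ := {w | |w.im| < ρ}

/-- The norm of `K^{l,ρ}`:
`∑_{a ≤ l} sup_{|y| < ρ} ‖∂^a f (· + i y)‖_{L²(𝕋)}`. -/
def kNorm (l : ℕ) (ρ : ℝ) (f : ℂ → CPlane) : ℝ≥0∞ :=
  ∑ a ∈ Finset.range (l + 1), ⨆ y : ℝ, ⨆ _ : |y| < ρ,
    eLpNorm (fun x : ℝ => iteratedDeriv a f ((x : ℂ) + (y : ℂ) * Complex.I)) 2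
      (volume.restrict (Ioc (0 : ℝ) 1))

/-- Membership in `K^{l,ρ}`: only the values of `f` on the strip matter. -/
structure MemK (l : ℕ) (ρ : ℝ) (f : ℂ → CPlane) : Prop where
  holo : DifferentiableOn ℂ f (strip ρ)
  periodic : ∀ w ∈ strip ρ, f (w + 1) = f w
  finite : kNorm l ρ f < ⊤

/-- The mixed partial derivative `∂_1^a ∂_2^b F` at `(w₁, w₂)`. -/
def mixedDeriv (a b : ℕ) (F : ℂ × ℂ → ℂ) (w₁ w₂ : ℂ) : ℂ :=
  iteratedDeriv a (fun u => iteratedDeriv b (fun v => F (u, v)) w₂) w₁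

/-- The norm of `K_2^{l,ρ}`:
`∑_{a + b ≤ l} sup_{|y₁|, |y₂| < ρ} ‖∂_1^a ∂_2^b F (· + i y₁, · + i y₂)‖_{L²(𝕋²)}`. -/
def kNorm₂ (l : ℕ) (ρ : ℝ) (F : ℂ × ℂ → ℂ) : ℝ≥0∞ :=
  ∑ p ∈ (Finset.range (l + 1) ×ˢ Finset.range (l + 1)).filter (fun p => p.1 + p.2 ≤ l),
    ⨆ y : ℝ × ℝ, ⨆ _ : |y.1| < ρ ∧ |y.2| < ρ,
      eLpNorm (fun x : ℝ × ℝ => mixedDeriv p.1 p.2 F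
          ((x.1 : ℂ) + (y.1 : ℂ) * Complex.I) ((x.2 : ℂ) + (y.2 : ℂ) * Complex.I)) 2
        (volume.restrict (Ioc (0 : ℝ) 1 ×ˢ Ioc (0 : ℝ) 1))

/-- Membership in `K_2^{l,ρ}`: only the values of `F` on the product of strips matter. -/
structure MemK₂ (l : ℕ) (ρ : ℝ) (F : ℂ × ℂ → ℂ) : Prop where
  holo : DifferentiableOn ℂ F (strip ρ ×ˢ strip ρ)
  periodic_left : ∀ w₁ ∈ strip ρ, ∀ w₂ ∈ strip ρ, F (w₁ + 1, w₂) = F (w₁, w₂)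
  periodic_right : ∀ w₁ ∈ strip ρ, ∀ w₂ ∈ strip ρ, F (w₁, w₂ + 1) = F (w₁, w₂)
  finite : kNorm₂ l ρ F < ⊤

/-- `f` is a complexification of the real curve `v`. -/
def ExtendsCurve (f : ℂ → CPlane) (v : ℝ → Plane) : Prop :=
  ∀ (x : ℝ) (i : Fin 2), f (x : ℂ) i = ((v x i : ℝ) : ℂ)

/-- `G` is a complexification of the arc-chord function of `v`, which is finite everywhere. -/
def ExtendsArcChord (G : ℂ × ℂ → ℂ) (v : ℝ → Plane) : Prop :=
  ∀ s σ : ℝ, arcChordFn v s σ ≠ ⊤ ∧ G ((s : ℂ), (σ : ℂ)) = (((arcChordFn v s σ).toReal : ℝ) : ℂ)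

/-- `(v, v', v'', Γ(v))` belongs to `X_ρ = K^{l,ρ} × K^{l,ρ} × K^{l,ρ} × K_2^{l,ρ}`, with norm at
most `M`. -/
def InX (l : ℕ) (ρ : ℝ) (M : ℝ≥0) (v : ℝ → Plane) : Prop :=
  ∃ (f g h : ℂ → CPlane) (G : ℂ × ℂ → ℂ),
    MemK l ρ f ∧ MemK l ρ g ∧ MemK l ρ h ∧ MemK₂ l ρ G ∧
    ExtendsCurve f v ∧ ExtendsCurve g (deriv v) ∧ ExtendsCurve h (deriv (deriv v)) ∧
    ExtendsArcChord G v ∧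
    kNorm l ρ f + kNorm l ρ g + kNorm l ρ h + kNorm₂ l ρ G ≤ M

/-- `t ↦ (z, z_s, z_ss, Γ(z))(t)` belongs to `Y_{ρ₀,κ,T}`: at each time `t ∈ [0, T]` it lies in
`X_{ρ₀ - κ t}`, and its norm there is bounded uniformly in `t`. -/
def InY (l : ℕ) (ρ₀ κ T : ℝ) (z : ℝ → ℝ → Plane) : Prop :=
  ∃ M : ℝ≥0, ∀ t ∈ Icc 0 T, InX l (ρ₀ - κ * t) M (z t)

end

open scoped Real ComplexConjugate

set_option linter.unusedSectionVars false

noncomputable section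

/-- A period centred at the origin. -/
notation "𝕁" => Icc (-(1 / 2) : ℝ) (1 / 2)

/-- The Wiener algebra of absolutely convergent Fourier series `∑ f_k(x) e^{2π i k s}` whose
coefficients depend continuously on a parameter `x ∈ K`, with norm
`∑_k sup_x e^{ω(x) |k|} |f_k(x)|`. An element is stored as the sequence of its weighted
coefficients `e^{ω |k|} f_k`. -/
def Wien (K : Type) [TopologicalSpace K] [CompactSpace K] (_ω : C(K, ℝ≥0)) : Type :=
  lp (fun _ : ℤ => C(K, ℂ)) 1

theorem continuous_of_hasDerivAt {E : Type} [NormedAddCommGroup E] [NormedSpace ℝ E] {f f' : ℝ → E}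
    (h : ∀ s, HasDerivAt f (f' s) s) : Continuous f :=
  continuous_iff_continuousAt.2 fun s => (h s).continuousAt

namespace Wien

variable {K : Type} [TopologicalSpace K] [CompactSpace K] {ω : C(K, ℝ≥0)}

instance : NormedAddCommGroup (Wien K ω) :=
  inferInstanceAs (NormedAddCommGroup (lp (fun _ : ℤ => C(K, ℂ)) 1))

instance : NormedSpace ℂ (Wien K ω) :=
  inferInstanceAs (NormedSpace ℂ (lp (fun _ : ℤ => C(K, ℂ)) 1))

instance : CompleteSpace (Wien K ω) :=
  inferInstanceAs (CompleteSpace (lp (fun _ : ℤ => C(K, ℂ)) 1))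

/-- The weighted Fourier coefficients. -/
def cf (f : Wien K ω) (k : ℤ) : C(K, ℂ) :=
  (show lp (fun _ : ℤ => C(K, ℂ)) 1 from f) k

theorem summable_cf (f : Wien K ω) : Summable fun k => ‖cf f k‖ := by
  have := lp.memℓp (show lp (fun _ : ℤ => C(K, ℂ)) 1 from f)
  rw [memℓp_gen_iff (by simp)] at this
  simp only [ENNReal.toReal_one, Real.rpow_one] at this
  exact this

/-- The element with given weighted Fourier coefficients. -/
def mk (c : ℤ → C(K, ℂ)) (h : Summable fun k => ‖c k‖) : Wien K ω :=
  (⟨c, (memℓp_gen_iff (by simp)).2 (by simpa using h)⟩ : lp (fun _ : ℤ => C(K, ℂ)) 1)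

@[simp] theorem cf_mk (c : ℤ → C(K, ℂ)) (h : Summable fun k => ‖c k‖) (k : ℤ) :
    cf (mk c h : Wien K ω) k = c k := rfl

@[ext] theorem ext_cf {f g : Wien K ω} (h : ∀ k, cf f k = cf g k) : f = g :=
  lp.ext (funext h)

theorem norm_eq (f : Wien K ω) : ‖f‖ = ∑' k, ‖cf f k‖ := by
  have := lp.norm_eq_tsum_rpow (p := 1) (by simp) (show lp (fun _ : ℤ => C(K, ℂ)) 1 from f)
  simp only [ENNReal.toReal_one, Real.rpow_one, div_one] at this
  exact this

@[simp] theorem cf_add (f g : Wien K ω) (k : ℤ) : cf (f + g) k = cf f k + cf g k := rfl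
@[simp] theorem cf_sub (f g : Wien K ω) (k : ℤ) : cf (f - g) k = cf f k - cf g k := rfl
@[simp] theorem cf_neg (f : Wien K ω) (k : ℤ) : cf (-f) k = -cf f k := rfl
@[simp] theorem cf_zero (k : ℤ) : cf (0 : Wien K ω) k = 0 := rfl
@[simp] theorem cf_smul (c : ℂ) (f : Wien K ω) (k : ℤ) : cf (c • f) k = c • cf f k := rfl

/-- The exponential factor `e^{2π i k w - ω(x) |k|}`. -/
def ex (ω : C(K, ℝ≥0)) (x : K) (w : ℂ) (k : ℤ) : ℂ :=
  Complex.exp (2 * π * Complex.I * k * w - (ω x : ℝ) * |(k : ℝ)|)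

/-- The value of the Fourier series at parameter `x` and complex argument `w`. -/
def ev (f : Wien K ω) (x : K) (w : ℂ) : ℂ := ∑' k, cf f k x * ex ω x w k

/-- `w` lies in the closed strip of convergence at the parameter `x`. -/
def InS (ω : C(K, ℝ≥0)) (x : K) (w : ℂ) : Prop := 2 * π * |w.im| ≤ ω x

@[simp] theorem inS_ofReal (x : K) (s : ℝ) : InS ω x (s : ℂ) := by simp [InS]

theorem norm_ex (x : K) (w : ℂ) (k : ℤ) :
    ‖ex ω x w k‖ = Real.exp (-(2 * π * k * w.im) - ω x * |(k : ℝ)|) := by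
  rw [ex, Complex.norm_exp]
  congr 1
  simp [Complex.mul_re, Complex.mul_im]

theorem norm_ex_le {x : K} {w : ℂ} (h : InS ω x w) (k : ℤ) : ‖ex ω x w k‖ ≤ 1 := by
  rw [norm_ex, Real.exp_le_one_iff]
  have h1 : -(2 * π * k * w.im) ≤ 2 * π * |w.im| * |(k : ℝ)| := by
    have : -((k : ℝ) * w.im) ≤ |w.im| * |(k : ℝ)| := by
      rw [← abs_mul, mul_comm w.im]; exact neg_le_abs _
    nlinarith [Real.pi_pos]
  have h2 := mul_le_mul_of_nonneg_right h (abs_nonneg (k : ℝ))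
  linarith

theorem norm_term_le (f : Wien K ω) {x : K} {w : ℂ} (h : InS ω x w) (k : ℤ) :
    ‖cf f k x * ex ω x w k‖ ≤ ‖cf f k‖ := by
  rw [norm_mul]
  calc _ ≤ ‖cf f k‖ * 1 := mul_le_mul ((cf f k).norm_coe_le_norm x) (norm_ex_le h k)
        (norm_nonneg _) (norm_nonneg _)
    _ = _ := mul_one _

theorem summable_norm_term (f : Wien K ω) {x : K} {w : ℂ} (h : InS ω x w) :
    Summable fun k => ‖cf f k x * ex ω x w k‖ :=
  Summable.of_nonneg_of_le (fun _ => norm_nonneg _) (norm_term_le f h) f.summable_cf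

theorem summable_term (f : Wien K ω) {x : K} {w : ℂ} (h : InS ω x w) :
    Summable fun k => cf f k x * ex ω x w k := (summable_norm_term f h).of_norm

theorem hasSum_ev (f : Wien K ω) {x : K} {w : ℂ} (h : InS ω x w) :
    HasSum (fun k => cf f k x * ex ω x w k) (ev f x w) := (summable_term f h).hasSum

theorem norm_ev_le (f : Wien K ω) {x : K} {w : ℂ} (h : InS ω x w) : ‖ev f x w‖ ≤ ‖f‖ := by
  rw [norm_eq, ev]
  exact (norm_tsum_le_tsum_norm (summable_norm_term f h)).trans
    ((summable_norm_term f h).tsum_le_tsum (norm_term_le f h) f.summable_cf)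

theorem ev_add (f g : Wien K ω) {x : K} {w : ℂ} (h : InS ω x w) :
    ev (f + g) x w = ev f x w + ev g x w := by
  rw [ev, ev, ev, ← (summable_term f h).tsum_add (summable_term g h)]
  simp [add_mul]

theorem ev_smul (c : ℂ) (f : Wien K ω) (x : K) (w : ℂ) : ev (c • f) x w = c * ev f x w := by
  simp [ev, mul_assoc, tsum_mul_left]

theorem ev_neg (f : Wien K ω) (x : K) (w : ℂ) : ev (-f) x w = -ev f x w := by
  simpa using ev_smul (-1) f x w

theorem ev_sub (f g : Wien K ω) {x : K} {w : ℂ} (h : InS ω x w) :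
    ev (f - g) x w = ev f x w - ev g x w := by
  rw [sub_eq_add_neg, ev_add _ _ h, ev_neg, sub_eq_add_neg]

@[simp] theorem ev_zero (x : K) (w : ℂ) : ev (0 : Wien K ω) x w = 0 := by simp [ev]

/-- The unweighted Fourier coefficients. -/
def co (f : Wien K ω) (k : ℤ) (x : K) : ℂ := cf f k x * Real.exp (-(ω x * |(k : ℝ)|))

theorem co_mul_exp (f : Wien K ω) (k : ℤ) (x : K) (w : ℂ) :
    co f k x * Complex.exp (2 * π * Complex.I * k * w) = cf f k x * ex ω x w k := by
  rw [co, ex, sub_eq_add_neg, Complex.exp_add]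
  push_cast
  ring

theorem integral_exp_int (m : ℤ) :
    ∫ s in (0 : ℝ)..1, Complex.exp (2 * π * Complex.I * m * s) = if m = 0 then 1 else 0 := by
  split_ifs with h
  · simp [h]
  · have hc : (2 * π * Complex.I * m : ℂ) ≠ 0 := by
      simp [h, Real.pi_ne_zero, Complex.I_ne_zero]
    rw [integral_exp_mul_complex hc]
    have : Complex.exp (2 * π * Complex.I * m * (1 : ℝ)) = 1 := by
      rw [Complex.exp_eq_one_iff]
      exact ⟨m, by push_cast; ring⟩
    rw [this]
    simp

theorem co_eq_integral (f : Wien K ω) (n : ℤ) (x : K) :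
    co f n x = ∫ s in (0 : ℝ)..1, ev f x s * Complex.exp (-(2 * π * Complex.I * n * s)) := by
  have h := intervalIntegral.hasSum_integral_of_dominated_convergence (μ := volume)
    (a := 0) (b := 1) (ι := ℤ)
    (F := fun k s => cf f k x * ex ω x s k * Complex.exp (-(2 * π * Complex.I * n * s)))
    (f := fun s => ev f x s * Complex.exp (-(2 * π * Complex.I * n * s)))
    (fun k _ => ‖cf f k‖) ?_ ?_ ?_ ?_ ?_
  · rw [← h.tsum_eq]
    have h2 : ∀ k : ℤ, ∫ s in (0 : ℝ)..1, cf f k x * ex ω x s k *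
        Complex.exp (-(2 * π * Complex.I * n * s)) = if k = n then co f n x else 0 := by
      intro k
      have h3 : ∀ s : ℝ, cf f k x * ex ω x s k * Complex.exp (-(2 * π * Complex.I * n * s))
          = co f k x * Complex.exp (2 * π * Complex.I * (k - n : ℤ) * s) := by
        intro s
        rw [← co_mul_exp, mul_assoc, ← Complex.exp_add]
        congr 2
        push_cast
        ring
      simp_rw [h3]
      rw [intervalIntegral.integral_const_mul, integral_exp_int]
      by_cases hk : k = n
      · simp [hk]
      · simp [hk, sub_eq_zero]
    simp_rw [h2]
    simp
  · intro k
    refine Continuous.aestronglyMeasurable ?_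
    unfold ex
    fun_prop
  · intro k
    refine ae_of_all _ fun s _ => ?_
    rw [norm_mul]
    have : ‖Complex.exp (-(2 * π * Complex.I * n * s))‖ = 1 := by
      rw [Complex.norm_exp]
      simp
    rw [this, mul_one]
    exact norm_term_le f (inS_ofReal x s) k
  · exact ae_of_all _ fun _ _ => f.summable_cf
  · exact intervalIntegrable_const
  · exact ae_of_all _ fun s _ => (hasSum_ev f (inS_ofReal x s)).mul_right _

theorem cf_eq_co (f : Wien K ω) (k : ℤ) (x : K) :
    cf f k x = co f k x * Real.exp (ω x * |(k : ℝ)|) := by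
  rw [co, mul_assoc, ← Complex.ofReal_mul, ← Real.exp_add]
  simp

theorem ext_co {f g : Wien K ω} (h : ∀ k x, co f k x = co g k x) : f = g := by
  ext k x
  rw [cf_eq_co, cf_eq_co, h]

theorem ext_ev {f g : Wien K ω} (h : ∀ (x : K) (s : ℝ), ev f x s = ev g x s) : f = g := by
  refine ext_co fun k x => ?_
  rw [co_eq_integral, co_eq_integral]
  simp_rw [h]

/-- The weight in the twisted convolution. -/
def tw (ω : C(K, ℝ≥0)) (j k : ℤ) : C(K, ℂ) :=
  ⟨fun x => (Real.exp (ω x * (|((j + k : ℤ) : ℝ)| - |(j : ℝ)| - |(k : ℝ)|)) : ℂ), by fun_prop⟩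

theorem norm_tw_le (j k : ℤ) : ‖tw ω j k‖ ≤ 1 := by
  refine (ContinuousMap.norm_le _ zero_le_one).2 fun x => ?_
  simp only [tw, ContinuousMap.coe_mk, Complex.norm_real, Real.norm_eq_abs, Real.abs_exp,
    Real.exp_le_one_iff]
  refine mul_nonpos_of_nonneg_of_nonpos (ω x).2 ?_
  push_cast
  linarith [abs_add_le (j : ℝ) (k : ℝ)]

/-- The terms of the product, indexed by pairs. -/
def prodTerm (f g : Wien K ω) (p : ℤ × ℤ) : C(K, ℂ) :=
  cf f p.1 * cf g p.2 * tw ω p.1 p.2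

theorem norm_prodTerm_le (f g : Wien K ω) (p : ℤ × ℤ) :
    ‖prodTerm f g p‖ ≤ ‖cf f p.1‖ * ‖cf g p.2‖ := by
  refine (norm_mul_le _ _).trans ?_
  calc _ ≤ ‖cf f p.1 * cf g p.2‖ * 1 := by gcongr; exact norm_tw_le _ _
    _ ≤ _ := by rw [mul_one]; exact norm_mul_le _ _

/-- Pairs, listed by their sum. -/
def sumEquiv : ℤ × ℤ ≃ ℤ × ℤ where
  toFun p := (p.2, p.1 - p.2)
  invFun q := (q.1 + q.2, q.1)
  left_inv p := by simp
  right_inv q := by simp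

theorem summable_norm_mul (f g : Wien K ω) :
    Summable fun p : ℤ × ℤ => ‖cf f p.1‖ * ‖cf g p.2‖ :=
  f.summable_cf.mul_of_nonneg g.summable_cf (fun _ => norm_nonneg _) fun _ => norm_nonneg _

theorem summable_prodTerm (f g : Wien K ω) :
    Summable fun p : ℤ × ℤ => ‖prodTerm f g (sumEquiv p)‖ :=
  (sumEquiv.summable_iff (f := fun p => ‖prodTerm f g p‖)).2
    (Summable.of_nonneg_of_le (fun _ => norm_nonneg _) (norm_prodTerm_le f g)
      (summable_norm_mul f g))

theorem summable_conv (f g : Wien K ω) :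
    Summable fun n : ℤ => ‖∑' j, prodTerm f g (sumEquiv (n, j))‖ :=
  Summable.of_nonneg_of_le (fun _ => norm_nonneg _)
    (fun n => norm_tsum_le_tsum_norm ((summable_prodTerm f g).prod_factor n))
    (summable_prodTerm f g).prod

instance : Mul (Wien K ω) :=
  ⟨fun f g => mk (fun n => ∑' j, prodTerm f g (sumEquiv (n, j))) (summable_conv f g)⟩

theorem cf_mul (f g : Wien K ω) (n : ℤ) :
    cf (f * g) n = ∑' j, prodTerm f g (sumEquiv (n, j)) := rfl

theorem norm_mul_le' (f g : Wien K ω) : ‖f * g‖ ≤ ‖f‖ * ‖g‖ := by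
  rw [norm_eq (f * g), norm_eq f, norm_eq g,
    f.summable_cf.tsum_mul_tsum g.summable_cf (summable_norm_mul f g)]
  calc _ ≤ ∑' n, ∑' j, ‖prodTerm f g (sumEquiv (n, j))‖ :=
        (summable_conv f g).tsum_le_tsum
          (fun n => norm_tsum_le_tsum_norm ((summable_prodTerm f g).prod_factor n))
          (summable_prodTerm f g).prod
    _ = ∑' p, ‖prodTerm f g (sumEquiv p)‖ := ((summable_prodTerm f g).tsum_prod).symm
    _ = ∑' p, ‖prodTerm f g p‖ := sumEquiv.tsum_eq (fun p => ‖prodTerm f g p‖)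
    _ ≤ _ := Summable.tsum_le_tsum (norm_prodTerm_le f g)
        (Summable.of_nonneg_of_le (fun _ => norm_nonneg _) (norm_prodTerm_le f g)
          (summable_norm_mul f g)) (summable_norm_mul f g)

theorem tw_mul_ex (x : K) (w : ℂ) (j k : ℤ) :
    tw ω j k x * ex ω x w (j + k) = ex ω x w j * ex ω x w k := by
  simp only [tw, ex, ContinuousMap.coe_mk, Complex.ofReal_exp, ← Complex.exp_add]
  congr 1
  push_cast
  ring

theorem ev_mul (f g : Wien K ω) {x : K} {w : ℂ} (h : InS ω x w) :
    ev (f * g) x w = ev f x w * ev g x w := by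
  rw [ev, ev, ev, tsum_mul_tsum_of_summable_norm (summable_norm_term f h)
    (summable_norm_term g h), ← sumEquiv.tsum_eq]
  have hs : Summable fun p : ℤ × ℤ =>
      cf f (sumEquiv p).1 x * ex ω x w (sumEquiv p).1 *
        (cf g (sumEquiv p).2 x * ex ω x w (sumEquiv p).2) :=
    (sumEquiv.summable_iff (f := fun p : ℤ × ℤ => cf f p.1 x * ex ω x w p.1 *
        (cf g p.2 x * ex ω x w p.2))).2
      (summable_mul_of_summable_norm (f := fun k => cf f k x * ex ω x w k)
        (g := fun k => cf g k x * ex ω x w k) (summable_norm_term f h) (summable_norm_term g h))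
  rw [hs.tsum_prod]
  congr 1
  ext n
  have h1 : cf (f * g) n x = ∑' j, prodTerm f g (sumEquiv (n, j)) x := by
    have h3 : Summable fun j => prodTerm f g (sumEquiv (n, j)) :=
      ((summable_prodTerm f g).prod_factor n).of_norm
    rw [cf_mul, ContinuousMap.tsum_apply h3 x]
  rw [h1, ← tsum_mul_right]
  congr 1
  ext j
  have h2 := tw_mul_ex (ω := ω) x w j (n - j)
  rw [add_sub_cancel] at h2
  change cf f j x * cf g (n - j) x * tw ω j (n - j) x * ex ω x w n = _
  rw [mul_assoc, h2]
  simp only [sumEquiv, Equiv.coe_fn_mk]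
  ring

/-- The constant series with parameter-dependent value. -/
def const (c : C(K, ℂ)) : Wien K ω :=
  mk (fun k => if k = 0 then c else 0) (summable_of_ne_finset_zero (s := {0}) (by
    intro k hk
    simp at hk
    simp [hk]))

theorem ev_const (c : C(K, ℂ)) (x : K) (w : ℂ) : ev (const c : Wien K ω) x w = c x := by
  rw [ev, tsum_eq_single 0]
  · simp [const, ex]
  · intro k hk
    simp [const, hk]

theorem norm_const (c : C(K, ℂ)) : ‖(const c : Wien K ω)‖ = ‖c‖ := by
  rw [norm_eq, tsum_eq_single 0]
  · simp [const]
  · intro k hk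
    simp [const, hk]

instance : One (Wien K ω) := ⟨const 1⟩

@[simp] theorem ev_one (x : K) (w : ℂ) : ev (1 : Wien K ω) x w = 1 := ev_const 1 x w

instance : CommRing (Wien K ω) :=
  { (inferInstance : AddCommGroup (Wien K ω)), (inferInstance : Mul (Wien K ω)),
    (inferInstance : One (Wien K ω)) with
    left_distrib := fun a b c => ext_ev fun x s => by simp [ev_mul, ev_add]; ring
    right_distrib := fun a b c => ext_ev fun x s => by simp [ev_mul, ev_add]; ring
    zero_mul := fun a => ext_ev fun x s => by simp [ev_mul]
    mul_zero := fun a => ext_ev fun x s => by simp [ev_mul]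
    mul_assoc := fun a b c => ext_ev fun x s => by simp [ev_mul]; ring
    one_mul := fun a => ext_ev fun x s => by simp [ev_mul]
    mul_one := fun a => ext_ev fun x s => by simp [ev_mul]
    mul_comm := fun a b => ext_ev fun x s => by simp [ev_mul]; ring }

instance : NormedCommRing (Wien K ω) :=
  { (inferInstance : NormedAddCommGroup (Wien K ω)), (inferInstance : CommRing (Wien K ω)) with
    norm_mul_le := norm_mul_le' }

instance : Algebra ℂ (Wien K ω) := Algebra.ofModule
  (fun r f g => ext_ev fun x s => by simp [ev_mul, ev_smul]; ring)
  (fun r f g => ext_ev fun x s => by simp [ev_mul, ev_smul]; ring)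

instance : NormedAlgebra ℂ (Wien K ω) :=
  { (inferInstance : Algebra ℂ (Wien K ω)) with
    norm_smul_le := fun r f => norm_smul_le r f }

/-- Evaluation at a point of the closed strip. -/
def evHom (x : K) (w : ℂ) (h : InS ω x w) : Wien K ω →+* ℂ where
  toFun f := ev f x w
  map_one' := ev_one x w
  map_mul' f g := ev_mul f g h
  map_zero' := ev_zero x w
  map_add' f g := ev_add f g h

theorem continuous_ev (x : K) (w : ℂ) (h : InS ω x w) : Continuous fun f : Wien K ω => ev f x w := by
  refine AddMonoidHomClass.continuous_of_bound (evHom x w h) 1 fun f => ?_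
  rw [one_mul]
  exact norm_ev_le f h

theorem ev_exp (f : Wien K ω) {x : K} {w : ℂ} (h : InS ω x w) :
    ev (NormedSpace.exp f) x w = Complex.exp (ev f x w) := by
  let _ : NormedAlgebra ℚ (Wien K ω) := NormedAlgebra.restrictScalars ℚ ℂ _
  rw [Complex.exp_eq_exp_ℂ]
  exact NormedSpace.map_exp (evHom x w h) (continuous_ev x w h) f

theorem ev_periodic (f : Wien K ω) (x : K) (w : ℂ) : ev f x (w + 1) = ev f x w := by
  unfold ev
  congr 1
  ext k
  congr 1
  unfold ex
  rw [Complex.exp_eq_exp_iff_exists_int]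
  exact ⟨k, by ring⟩

theorem continuous_ev_param (f : Wien K ω) :
    Continuous fun p : K × ℝ => ev f p.1 p.2 := by
  refine continuous_tsum (u := fun k => ‖cf f k‖) ?_ f.summable_cf fun k p =>
    norm_term_le f (inS_ofReal _ _) k
  intro k
  unfold ex
  fun_prop

theorem differentiableOn_ev (f : Wien K ω) (x : K) :
    DifferentiableOn ℂ (ev f x) {w | 2 * π * |w.im| < ω x} := by
  refine Complex.differentiableOn_tsum_of_summable_norm (u := fun k => ‖cf f k‖) f.summable_cf ?_ ?_
    fun k w hw => norm_term_le f (le_of_lt hw) k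
  · intro k
    unfold ex
    fun_prop
  · exact isOpen_lt (by fun_prop) continuous_const

/-- An inverse of the exponential near `1`: `exp (log1p x) = 1 + x` for small `x`. -/
theorem exists_log1p (K : Type) [TopologicalSpace K] [CompactSpace K] (ω : C(K, ℝ≥0)) :
    ∃ l : Wien K ω → Wien K ω, l 0 = 0 ∧ ContDiffAt ℝ 1 l 0 ∧
      ∃ ε > 0, ∀ x, ‖x‖ < ε → NormedSpace.exp (l x) = 1 + x ∧ ‖l x‖ < 1 := by
  have h0 : ContDiffAt ℝ 1 (NormedSpace.exp : Wien K ω → Wien K ω) 0 :=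
    (NormedSpace.exp_analytic (𝕂 := ℝ) (0 : Wien K ω)).contDiffAt
  have h1 : HasFDerivAt (NormedSpace.exp : Wien K ω → Wien K ω)
      ((ContinuousLinearEquiv.refl ℝ (Wien K ω) : Wien K ω ≃L[ℝ] Wien K ω) :
        Wien K ω →L[ℝ] Wien K ω) 0 :=
    (hasStrictFDerivAt_exp_zero (𝕂 := ℝ) (𝔸 := Wien K ω)).hasFDerivAt
  have h2 := h0.to_localInverse h1 one_ne_zero
  have hz : h0.localInverse h1 one_ne_zero 1 = 0 := by
    have := h0.localInverse_apply_image h1 one_ne_zero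
    rwa [NormedSpace.exp_zero] at this
  rw [NormedSpace.exp_zero] at h2
  have hs := h0.hasStrictFDerivAt' h1 one_ne_zero
  have h3 := hs.eventually_right_inverse
  rw [NormedSpace.exp_zero] at h3
  have hadd : Filter.Tendsto (fun x : Wien K ω => 1 + x) (nhds 0) (nhds 1) := by
    have : Continuous fun x : Wien K ω => 1 + x := by fun_prop
    simpa using this.tendsto 0
  have h4 : Filter.Tendsto (fun x => h0.localInverse h1 one_ne_zero (1 + x)) (nhds 0) (nhds 0) := by
    have := h2.continuousAt.tendsto
    rw [hz] at this
    exact this.comp hadd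
  refine ⟨fun x => h0.localInverse h1 one_ne_zero (1 + x), by simpa using hz, ?_, ?_⟩
  · refine ContDiffAt.comp (0 : Wien K ω) (g := h0.localInverse h1 one_ne_zero) ?_ (by fun_prop)
    simpa using h2
  · have h5 := (hadd.eventually h3).and (h4.eventually (Metric.ball_mem_nhds 0 one_pos))
    obtain ⟨ε, hε, h⟩ := Metric.eventually_nhds_iff.1 h5
    refine ⟨ε, hε, fun x hx => ?_⟩
    have := h (y := x) (by simpa using hx)
    exact ⟨this.1, by simpa using this.2⟩

end Wien

namespace Wien

variable {K : Type} [TopologicalSpace K] [CompactSpace K] {ω : C(K, ℝ≥0)}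
variable {K' : Type} [TopologicalSpace K'] [CompactSpace K'] {ω' : C(K', ℝ≥0)}

theorem cf_eq_mul (f : Wien K ω) (k : ℤ) (x : K) :
    co f k x = cf f k x * Real.exp (-(ω x * |(k : ℝ)|)) := rfl

/-- The data of an operator which acts on the Fourier coefficients by
`(T f)_k(x') = ∫ ν_k(x', c) f_k(π(x', c)) dμ(c)`. -/
structure OpData (ω : C(K, ℝ≥0)) (ω' : C(K', ℝ≥0)) where
  μ : Measure ℝ
  pr : K' → ℝ → K
  ker : ℤ → K' → ℝ → ℂ
  bd : ℤ → ℝ → ℝ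
  C : ℝ
  cont_pr : Continuous (Function.uncurry pr)
  meas : ∀ k x, AEStronglyMeasurable (ker k x) μ
  cont : ∀ k c, Continuous fun x => ker k x c
  int_bd : ∀ k, Integrable (bd k) μ
  le_bd : ∀ k x c, ‖ker k x c‖ * Real.exp ((ω' x - ω (pr x c)) * |(k : ℝ)|) ≤ bd k c
  C_nonneg : 0 ≤ C
  le_C : ∀ k x, ∫ c, ‖ker k x c‖ * Real.exp ((ω' x - ω (pr x c)) * |(k : ℝ)|) ∂μ ≤ C

namespace OpData

variable (D : OpData ω ω')

/-- The kernel in terms of weighted coefficients. -/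
def wker (k : ℤ) (x : K') (c : ℝ) : ℂ :=
  D.ker k x c * (Real.exp ((ω' x - ω (D.pr x c)) * |(k : ℝ)|) : ℝ)

theorem norm_wker (k : ℤ) (x : K') (c : ℝ) :
    ‖D.wker k x c‖ = ‖D.ker k x c‖ * Real.exp ((ω' x - ω (D.pr x c)) * |(k : ℝ)|) := by
  rw [wker, norm_mul, Complex.norm_real, Real.norm_eq_abs, Real.abs_exp]

theorem aesm_wker (k : ℤ) (x : K') : AEStronglyMeasurable (D.wker k x) D.μ := by
  refine (D.meas k x).mul (Continuous.aestronglyMeasurable ?_)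
  have : Continuous fun c => D.pr x c := D.cont_pr.comp (by fun_prop : Continuous fun c => (x, c))
  fun_prop

theorem integrable_wker (k : ℤ) (x : K') : Integrable (D.wker k x) D.μ :=
  (D.int_bd k).mono' (D.aesm_wker k x) (ae_of_all _ fun c => by
    rw [norm_wker]; exact D.le_bd k x c)

theorem integrable_coef (k : ℤ) (x : K') (g : C(K, ℂ)) :
    Integrable (fun c => D.wker k x c * g (D.pr x c)) D.μ := by
  refine (D.integrable_wker k x).mul_bdd (c := ‖g‖) (Continuous.aestronglyMeasurable ?_)
    (ae_of_all _ fun c => g.norm_coe_le_norm _)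
  have : Continuous fun c => D.pr x c := D.cont_pr.comp (by fun_prop : Continuous fun c => (x, c))
  fun_prop

variable [FirstCountableTopology K']

/-- The action on one weighted coefficient. -/
def coefMap (k : ℤ) (g : C(K, ℂ)) : C(K', ℂ) where
  toFun x := ∫ c, D.wker k x c * g (D.pr x c) ∂D.μ
  continuous_toFun := by
    refine continuous_of_dominated (bound := fun c => D.bd k c * ‖g‖)
      (fun x => (D.integrable_coef k x g).aestronglyMeasurable) (fun x => ae_of_all _ fun c => ?_)
      ((D.int_bd k).mul_const _) (ae_of_all _ fun c => ?_)
    · rw [norm_mul, norm_wker]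
      exact mul_le_mul (D.le_bd k x c) (g.norm_coe_le_norm _) (norm_nonneg _)
        ((by positivity : (0:ℝ) ≤ _).trans (D.le_bd k x c))
    · have : Continuous fun x => D.pr x c :=
        D.cont_pr.comp (by fun_prop : Continuous fun x => (x, c))
      have h2 := D.cont k c
      unfold wker
      fun_prop

theorem norm_coefMap_le (k : ℤ) (g : C(K, ℂ)) : ‖D.coefMap k g‖ ≤ D.C * ‖g‖ := by
  refine (ContinuousMap.norm_le _ (mul_nonneg D.C_nonneg (norm_nonneg _))).2 fun x => ?_
  change ‖∫ c, D.wker k x c * g (D.pr x c) ∂D.μ‖ ≤ _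
  calc _ ≤ ∫ c, ‖D.wker k x c‖ * ‖g‖ ∂D.μ := by
        refine norm_integral_le_of_norm_le ((D.integrable_wker k x).norm.mul_const _)
          (ae_of_all _ fun c => ?_)
        rw [norm_mul]
        exact mul_le_mul_of_nonneg_left (g.norm_coe_le_norm _) (norm_nonneg _)
    _ = (∫ c, ‖D.wker k x c‖ ∂D.μ) * ‖g‖ := integral_mul_const _ _
    _ ≤ _ := by
        refine mul_le_mul_of_nonneg_right ?_ (norm_nonneg _)
        simp_rw [norm_wker]
        exact D.le_C k x

theorem summable_coefMap (f : Wien K ω) : Summable fun k => ‖D.coefMap k (cf f k)‖ :=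
  Summable.of_nonneg_of_le (fun _ => norm_nonneg _) (fun k => D.norm_coefMap_le k _)
    (f.summable_cf.mul_left _)

/-- The bounded operator between Wiener algebras. -/
def op : Wien K ω →L[ℂ] Wien K' ω' :=
  LinearMap.mkContinuous
    { toFun := fun f => Wien.mk (fun k => D.coefMap k (cf f k)) (D.summable_coefMap f)
      map_add' := fun f g => by
        ext k x
        simp only [cf_mk, cf_add, ContinuousMap.add_apply]
        change ∫ c, _ ∂D.μ = (∫ c, _ ∂D.μ) + ∫ c, _ ∂D.μ
        rw [← integral_add (D.integrable_coef k x _) (D.integrable_coef k x _)]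
        simp [mul_add]
      map_smul' := fun a f => by
        ext k x
        simp only [cf_mk, cf_smul, RingHom.id_apply, ContinuousMap.smul_apply]
        change ∫ c, _ ∂D.μ = a • ∫ c, _ ∂D.μ
        rw [← integral_smul]
        congr 1
        ext c
        simp
        ring } D.C fun f => by
    simp only [LinearMap.coe_mk, AddHom.coe_mk, norm_eq, cf_mk]
    rw [← tsum_mul_left]
    exact (D.summable_coefMap f).tsum_le_tsum (fun k => D.norm_coefMap_le k _)
      (f.summable_cf.mul_left _)

theorem norm_op_le (f : Wien K ω) : ‖D.op f‖ ≤ D.C * ‖f‖ :=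
  D.op.le_of_opNorm_le (LinearMap.mkContinuous_norm_le _ D.C_nonneg _) f

theorem cf_op (f : Wien K ω) (k : ℤ) (x : K') :
    cf (D.op f) k x = ∫ c, D.wker k x c * cf f k (D.pr x c) ∂D.μ := rfl

theorem co_op (f : Wien K ω) (k : ℤ) (x : K') :
    co (D.op f) k x = ∫ c, D.ker k x c * co f k (D.pr x c) ∂D.μ := by
  rw [cf_eq_mul, cf_op, ← integral_mul_const]
  congr 1
  ext c
  rw [cf_eq_mul, wker]
  have : ((Real.exp ((ω' x - ω (D.pr x c)) * |(k : ℝ)|) : ℝ) : ℂ) *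
      (Real.exp (-(ω' x * |(k : ℝ)|)) : ℝ) = (Real.exp (-(ω (D.pr x c) * |(k : ℝ)|)) : ℝ) := by
    rw [← Complex.ofReal_mul, ← Real.exp_add]
    congr 2
    ring
  rw [← this]
  ring

end OpData

/-- The operator `(T f)(x')(s) = ∫ n(x', c) f(π(x', c))(s + α(x', c)) dμ(c)`. -/
def shiftData (μ : Measure ℝ) (pr : K' → ℝ → K) (n : K' → ℝ → ℝ) (al : K' → ℝ → ℝ) (b : ℝ → ℝ)
    (hpr : Continuous (Function.uncurry pr)) (hal : Continuous (Function.uncurry al))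
    (hn : ∀ x, AEStronglyMeasurable (n x) μ) (hn' : ∀ c, Continuous fun x => n x c)
    (hb : Integrable b μ) (hnb : ∀ x c, |n x c| ≤ b c) (hω : ∀ x c, ω' x ≤ ω (pr x c)) :
    OpData ω ω' where
  μ := μ
  pr := pr
  ker k x c := n x c * Complex.exp (2 * π * Complex.I * k * al x c)
  bd _ := b
  C := ∫ c, |b c| ∂μ
  cont_pr := hpr
  meas k x := by
    have h1 : AEStronglyMeasurable (fun c => (n x c : ℂ)) μ :=
      Complex.continuous_ofReal.comp_aestronglyMeasurable (hn x)
    refine h1.mul (Continuous.aestronglyMeasurable ?_)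
    have : Continuous fun c => al x c := hal.comp (by fun_prop : Continuous fun c => (x, c))
    fun_prop
  cont k c := by
    have : Continuous fun x => al x c := hal.comp (by fun_prop : Continuous fun x => (x, c))
    have := hn' c
    fun_prop
  int_bd _ := hb
  le_bd k x c := by
    rw [norm_mul, Complex.norm_exp, Complex.norm_real, Real.norm_eq_abs]
    have h1 : (2 * π * Complex.I * k * al x c : ℂ).re = 0 := by simp
    rw [h1, Real.exp_zero, mul_one]
    have h2 : Real.exp ((ω' x - ω (pr x c)) * |(k : ℝ)|) ≤ 1 := by
      rw [Real.exp_le_one_iff]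
      exact mul_nonpos_of_nonpos_of_nonneg (sub_nonpos.2 (NNReal.coe_le_coe.2 (hω x c)))
        (abs_nonneg _)
    calc _ ≤ |n x c| * 1 := by gcongr
      _ ≤ _ := by rw [mul_one]; exact hnb x c
  C_nonneg := integral_nonneg fun c => abs_nonneg _
  le_C k x := by
    refine integral_mono_of_nonneg (ae_of_all _ fun c => by positivity) hb.abs
      (ae_of_all _ fun c => ?_)
    simp only
    rw [norm_mul, Complex.norm_exp, Complex.norm_real, Real.norm_eq_abs]
    have h1 : (2 * π * Complex.I * k * al x c : ℂ).re = 0 := by simp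
    rw [h1, Real.exp_zero, mul_one]
    have h2 : Real.exp ((ω' x - ω (pr x c)) * |(k : ℝ)|) ≤ 1 := by
      rw [Real.exp_le_one_iff]
      exact mul_nonpos_of_nonpos_of_nonneg (sub_nonpos.2 (NNReal.coe_le_coe.2 (hω x c)))
        (abs_nonneg _)
    calc _ ≤ |n x c| * 1 := by gcongr
      _ ≤ _ := by rw [mul_one]; exact (hnb x c).trans (le_abs_self _)

variable [FirstCountableTopology K']

theorem ev_shift (μ : Measure ℝ) (pr : K' → ℝ → K) (n : K' → ℝ → ℝ) (al : K' → ℝ → ℝ) (b : ℝ → ℝ)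
    (hpr : Continuous (Function.uncurry pr)) (hal : Continuous (Function.uncurry al))
    (hn : ∀ x, AEStronglyMeasurable (n x) μ) (hn' : ∀ c, Continuous fun x => n x c)
    (hb : Integrable b μ) (hnb : ∀ x c, |n x c| ≤ b c) (hω : ∀ x c, ω' x ≤ ω (pr x c))
    (f : Wien K ω) (x : K') (w : ℂ) (hw : InS ω' x w) :
    ev ((shiftData μ pr n al b hpr hal hn hn' hb hnb hω).op f) x w =
      ∫ c, n x c * ev f (pr x c) (w + al x c) ∂μ := by
  set D := shiftData μ pr n al b hpr hal hn hn' hb hnb hω with hD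
  have hal' : Continuous fun c => al x c := hal.comp (by fun_prop : Continuous fun c => (x, c))
  have hpr' : Continuous fun c => pr x c := hpr.comp (by fun_prop : Continuous fun c => (x, c))
  have hw' : ∀ c, InS ω (pr x c) (w + al x c) := fun c => by
    unfold InS at hw ⊢
    simp only [Complex.add_im, Complex.ofReal_im, add_zero]
    exact hw.trans (NNReal.coe_le_coe.2 (hω x c))
  set F : ℤ → ℝ → ℂ := fun k c => n x c * (cf f k (pr x c) * ex ω (pr x c) (w + al x c) k) with hF
  have hFb : ∀ k c, ‖F k c‖ ≤ b c * ‖cf f k‖ := fun k c => by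
    simp only [hF]
    rw [norm_mul, Complex.norm_real, Real.norm_eq_abs]
    exact mul_le_mul (hnb x c) (norm_term_le f (hw' c) k) (norm_nonneg _)
      ((abs_nonneg _).trans (hnb x c))
  have hFm : ∀ k, AEStronglyMeasurable (F k) μ := fun k => by
    have h1 : AEStronglyMeasurable (fun c => (n x c : ℂ)) μ :=
      Complex.continuous_ofReal.comp_aestronglyMeasurable (hn x)
    refine h1.mul (Continuous.aestronglyMeasurable ?_)
    unfold ex
    fun_prop
  have hFi : ∀ k, Integrable (F k) μ := fun k =>
    (hb.mul_const ‖cf f k‖).mono' (hFm k) (ae_of_all _ (hFb k))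
  have hs : Summable fun k => ∫ c, ‖F k c‖ ∂μ := by
    refine Summable.of_nonneg_of_le (fun k => integral_nonneg fun c => norm_nonneg _) (fun k => ?_)
      (f.summable_cf.mul_left (∫ c, b c ∂μ))
    rw [← integral_mul_const]
    exact integral_mono (hFi k).norm (hb.mul_const _) (hFb k)
  have h := hasSum_integral_of_summable_integral_norm hFi hs
  have h2 : ∀ c, ∑' k, F k c = n x c * ev f (pr x c) (w + al x c) := fun c => by
    rw [ev, ← tsum_mul_left]
  simp_rw [h2] at h
  rw [← h.tsum_eq, ev]
  congr 1
  ext k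
  rw [← co_mul_exp, OpData.co_op, ← integral_mul_const]
  congr 1
  ext c
  simp only [hF, ← co_mul_exp]
  simp only [hD, shiftData]
  rw [mul_assoc, mul_assoc, mul_comm _ (co f k _ * _), mul_assoc, ← Complex.exp_add]
  congr 3
  ring

end Wien

/-- The parameter interval `[-1/2, 1/2]` of the kernel variable. -/
abbrev Sg : Type := 𝕁

/-- The projection to `[-1/2, 1/2]`. -/
def prSg (c : ℝ) : Sg := projIcc (-(1 / 2)) (1 / 2) (by norm_num) c

theorem continuous_prSg : Continuous prSg := continuous_projIcc (h := by norm_num)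

theorem prSg_of_mem {c : ℝ} (h : c ∈ 𝕁) : (prSg c : ℝ) = c := by
  rw [prSg, projIcc_of_mem _ h]

theorem mul_mem_Sg {c : ℝ} (hc : c ∈ Icc (0 : ℝ) 1) (x : Sg) :
    c * (x : ℝ) ∈ 𝕁 := by
  obtain ⟨x, hx1, hx2⟩ := x
  obtain ⟨h1, h2⟩ := hc
  constructor <;> simp only <;> nlinarith

namespace Wien

variable {K : Type} [TopologicalSpace K] [CompactSpace K] [FirstCountableTopology K]
  {ω : C(K, ℝ≥0)}
variable {K' : Type} [TopologicalSpace K'] [CompactSpace K'] [FirstCountableTopology K']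
  {ω' : C(K', ℝ≥0)}

/-- The weight on `K × [-1/2, 1/2]` which depends on the first variable only. -/
abbrev lw (ω : C(K, ℝ≥0)) : C(K × Sg, ℝ≥0) := ω.comp ContinuousMap.fst

/-- `(A f)(x, σ)(s) = ∫ n(c) f(x)(s + c σ) dμ(c)`. -/
def avgOp (μ : Measure ℝ) (n : ℝ → ℝ) (hn : Integrable n μ) : Wien K ω →L[ℂ] Wien (K × Sg) (lw ω) :=
  (shiftData μ (fun x _ => x.1) (fun _ c => n c) (fun x c => c * x.2) (fun c => |n c|)
    (by fun_prop) (by fun_prop) (fun _ => hn.aestronglyMeasurable) (fun _ => continuous_const)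
    hn.abs (fun _ _ => le_rfl) (fun _ _ => le_rfl)).op

theorem ev_avgOp (μ : Measure ℝ) (n : ℝ → ℝ) (hn : Integrable n μ) (f : Wien K ω) (x : K) (σ : Sg)
    {w : ℂ} (hw : InS ω x w) :
    ev (avgOp μ n hn f) (x, σ) w = ∫ c, n c * ev f x (w + c * (σ : ℝ)) ∂μ := by
  refine (ev_shift _ _ _ _ _ _ _ _ _ _ _ _ _ (x, σ) _ hw).trans ?_
  push_cast
  rfl

/-- The mean `∫_0^1 f(x)(s + c σ) dc`. -/
def avg : Wien K ω →L[ℂ] Wien (K × Sg) (lw ω) :=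
  avgOp (volume.restrict (Icc 0 1)) (fun _ => 1) (by simp)

theorem ev_avg (f : Wien K ω) (x : K) (σ : Sg) {w : ℂ} (hw : InS ω x w) :
    ev (avg f) (x, σ) w = ∫ c in (0 : ℝ)..1, ev f x (w + c * (σ : ℝ)) := by
  rw [avg, ev_avgOp _ _ _ _ _ _ hw, intervalIntegral.integral_of_le zero_le_one,
    integral_Icc_eq_integral_Ioc]
  simp

/-- The mean `∫_0^1 c f(x)(s + c σ) dc`. -/
def avgc : Wien K ω →L[ℂ] Wien (K × Sg) (lw ω) :=
  avgOp (volume.restrict (Icc 0 1)) (fun c => c) (continuous_id.integrableOn_Icc)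

theorem ev_avgc (f : Wien K ω) (x : K) (σ : Sg) {w : ℂ} (hw : InS ω x w) :
    ev (avgc f) (x, σ) w = ∫ c in (0 : ℝ)..1, (c : ℂ) * ev f x (w + c * (σ : ℝ)) := by
  refine (ev_avgOp _ _ _ _ _ _ hw).trans ?_
  rw [intervalIntegral.integral_of_le zero_le_one, integral_Icc_eq_integral_Ioc]

/-- The translate `f(x)(s + σ)`. -/
def sh : Wien K ω →L[ℂ] Wien (K × Sg) (lw ω) :=
  avgOp (Measure.dirac 1) (fun _ => 1) (by simp)

theorem ev_sh (f : Wien K ω) (x : K) (σ : Sg) {w : ℂ} (hw : InS ω x w) :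
    ev (sh f) (x, σ) w = ev f x (w + (σ : ℝ)) := by
  rw [sh, ev_avgOp _ _ _ _ _ _ hw]
  simp

/-- `f(x)(s)`, as a function which does not depend on `σ`. -/
def pull : Wien K ω →L[ℂ] Wien (K × Sg) (lw ω) :=
  avgOp (Measure.dirac 0) (fun _ => 1) (by simp)

theorem ev_pull (f : Wien K ω) (x : K) (σ : Sg) {w : ℂ} (hw : InS ω x w) :
    ev (pull f) (x, σ) w = ev f x w := by
  rw [pull, ev_avgOp _ _ _ _ _ _ hw]
  simp

/-- The integral `∫ n(σ) f(x, σ)(s) dσ` over `[-1/2, 1/2]`. -/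
def intOp (n : ℝ → ℝ) (hn : IntegrableOn n 𝕁) :
    Wien (K × Sg) (lw ω) →L[ℂ] Wien K ω :=
  (shiftData (volume.restrict 𝕁) (fun x c => (x, prSg c)) (fun _ c => n c)
    (fun _ _ => 0) (fun c => |n c|) (by have := continuous_prSg; fun_prop) (by fun_prop)
    (fun _ => hn.aestronglyMeasurable) (fun _ => continuous_const)
    hn.abs (fun _ _ => le_rfl) (fun _ _ => le_rfl)).op

theorem ev_intOp (n : ℝ → ℝ) (hn : IntegrableOn n 𝕁)
    (f : Wien (K × Sg) (lw ω)) (x : K) {w : ℂ} (hw : InS ω x w) :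
    ev (intOp n hn f) x w = ∫ c in (-(1 / 2) : ℝ)..(1 / 2), n c * ev f (x, prSg c) w := by
  refine (ev_shift _ _ _ _ _ _ _ _ _ _ _ _ _ x _ hw).trans ?_
  rw [intervalIntegral.integral_of_le (by norm_num), integral_Icc_eq_integral_Ioc]
  simp

/-- The mean `∫_0^1 f(x, c σ)(s) dc`. -/
def cavg : Wien (K × Sg) (lw ω) →L[ℂ] Wien (K × Sg) (lw ω) :=
  (shiftData (volume.restrict (Icc 0 1)) (fun x c => (x.1, prSg (c * x.2))) (fun _ _ => 1)
    (fun _ _ => 0) (fun _ => 1) (by have := continuous_prSg; fun_prop) (by fun_prop)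
    (fun _ => aestronglyMeasurable_const) (fun _ => continuous_const)
    (by simp) (fun _ _ => by simp) (fun _ _ => le_rfl)).op

theorem ev_cavg (f : Wien (K × Sg) (lw ω)) (x : K) (σ : Sg) {w : ℂ} (hw : InS ω x w) :
    ev (cavg f) (x, σ) w = ∫ c in (0 : ℝ)..1, ev f (x, prSg (c * σ)) w := by
  refine (ev_shift _ _ _ _ _ _ _ _ _ _ _ _ _ (x, σ) _ hw).trans ?_
  rw [intervalIntegral.integral_of_le zero_le_one, integral_Icc_eq_integral_Ioc]
  simp

/-- Change of parameters, with passage to a smaller weight. -/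
def restr (p : C(K', K)) (h : ∀ x, ω' x ≤ ω (p x)) : Wien K ω →L[ℂ] Wien K' ω' :=
  (shiftData (Measure.dirac 0) (fun x _ => p x) (fun _ _ => 1)
    (fun _ _ => 0) (fun _ => 1) (by fun_prop) (by fun_prop)
    (fun _ => aestronglyMeasurable_const) (fun _ => continuous_const)
    (by simp) (fun _ _ => by simp) (fun x _ => h x)).op

theorem ev_restr (p : C(K', K)) (h : ∀ x, ω' x ≤ ω (p x)) (f : Wien K ω) (x : K') {w : ℂ}
    (hw : InS ω' x w) : ev (restr p h f) x w = ev f (p x) w := by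
  refine (ev_shift _ _ _ _ _ _ _ _ _ _ _ _ _ x _ hw).trans ?_
  simp

/-- The Fourier multiplier `f_k(x) ↦ m_k(x) f_k(p(x))`, with passage to a smaller weight. -/
def mulData (p : C(K', K)) (m : ℤ → C(K', ℂ)) (C : ℝ) (hC : 0 ≤ C)
    (h : ∀ k x, ‖m k x‖ * Real.exp ((ω' x - ω (p x)) * |(k : ℝ)|) ≤ C) : OpData ω ω' where
  μ := Measure.dirac 0
  pr x _ := p x
  ker k x _ := m k x
  bd _ _ := C
  C := C
  cont_pr := by fun_prop
  meas k x := aestronglyMeasurable_const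
  cont k c := by fun_prop
  int_bd k := by simp
  le_bd k x c := h k x
  C_nonneg := hC
  le_C k x := by simpa using h k x

theorem co_mulData (p : C(K', K)) (m : ℤ → C(K', ℂ)) (C : ℝ) (hC : 0 ≤ C)
    (h : ∀ k x, ‖m k x‖ * Real.exp ((ω' x - ω (p x)) * |(k : ℝ)|) ≤ C) (f : Wien K ω)
    (k : ℤ) (x : K') : co ((mulData p m C hC h).op f) k x = m k x * co f k (p x) := by
  rw [OpData.co_op]
  simp [mulData]

/-- A bounded Fourier multiplier. -/
def mul₁ (m : ℤ → ℂ) (C : ℝ) (hC : 0 ≤ C) (h : ∀ k, ‖m k‖ ≤ C) : Wien K ω →L[ℂ] Wien K ω :=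
  (mulData (.id K) (fun k => .const K (m k)) C hC fun k x => by simpa using h k).op

theorem co_mul₁ (m : ℤ → ℂ) (C : ℝ) (hC : 0 ≤ C) (h : ∀ k, ‖m k‖ ≤ C) (f : Wien K ω)
    (k : ℤ) (x : K) : co (mul₁ m C hC h f) k x = m k * co f k x := by
  rw [mul₁, co_mulData]
  rfl

/-- Multiplication of each coefficient by the value at `s = 0`: `f ↦ f(x)(0)`. -/
def ev0 : Wien K ω →L[ℂ] Wien K ω :=
  LinearMap.mkContinuous
    { toFun := fun f => const ⟨fun x => ev f x 0, by
        have := (continuous_ev_param f).comp (by fun_prop : Continuous fun x : K => (x, (0 : ℝ)))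
        simpa [Function.comp_def] using this⟩
      map_add' := fun f g => ext_ev fun x s => by
        have h : InS ω x 0 := by simp [InS]
        simp [ev_const, ev_add _ _ (inS_ofReal x s), ev_add _ _ h]
      map_smul' := fun a f => ext_ev fun x s => by
        simp [ev_const, ev_smul] } 1 fun f => by
    rw [one_mul]
    simp only [LinearMap.coe_mk, AddHom.coe_mk, norm_const]
    exact (ContinuousMap.norm_le _ (norm_nonneg _)).2 fun x => norm_ev_le f (by simp [InS])

theorem ev_ev0 (f : Wien K ω) (x : K) (w : ℂ) : ev (ev0 f) x w = ev f x 0 := ev_const _ _ _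

/-- Complex conjugation on the real axis. -/
def conjOp : Wien K ω →L[ℝ] Wien K ω :=
  LinearMap.mkContinuous
    { toFun := fun f => mk (fun k => star (cf f (-k))) (by
        have := (Equiv.neg ℤ).summable_iff.2 f.summable_cf
        simpa [Function.comp_def] using this)
      map_add' := fun f g => by ext k x; simp
      map_smul' := fun a f => by
        ext k x
        have h1 : (a • f : Wien K ω) = (a : ℂ) • f := rfl
        rw [h1, cf_mk, cf_smul]
        change star ((a : ℂ) * cf f (-k) x) = (a : ℂ) * star (cf f (-k) x)
        rw [star_mul', Complex.star_def, Complex.conj_ofReal] } 1 fun f => by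
    simp only [LinearMap.coe_mk, AddHom.coe_mk, norm_eq, cf_mk, one_mul, norm_star]
    exact ((Equiv.neg ℤ).tsum_eq fun k => ‖cf f k‖).le

theorem co_conjOp (f : Wien K ω) (k : ℤ) (x : K) :
    co (conjOp f) k x = starRingEnd ℂ (co f (-k) x) := by
  change starRingEnd ℂ (cf f (-k) x) * _ = starRingEnd ℂ (cf f (-k) x * _)
  rw [map_mul, Complex.conj_ofReal]
  simp

theorem ev_conjOp (f : Wien K ω) (x : K) (w : ℂ) :
    ev (conjOp f) x w = starRingEnd ℂ (ev f x (starRingEnd ℂ w)) := by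
  rw [ev, ev, Complex.conj_tsum, ← (Equiv.neg ℤ).tsum_eq]
  congr 1
  ext k
  rw [← co_mul_exp, ← co_mul_exp, co_conjOp, map_mul, ← Complex.exp_conj]
  have : starRingEnd ℂ (2 : ℂ) = 2 := Complex.conj_ofNat 2
  simp [this]

/-- The real part on the real axis. -/
def reOp : Wien K ω →L[ℝ] Wien K ω := (1 / 2 : ℝ) • (ContinuousLinearMap.id ℝ _ + conjOp)

theorem reOp_apply (f : Wien K ω) : reOp f = (1 / 2 : ℂ) • (f + conjOp f) := by
  have : (1 / 2 : ℂ) = ((1 / 2 : ℝ) : ℂ) := by norm_num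
  rw [this]
  rfl

theorem ev_reOp (f : Wien K ω) (x : K) (s : ℝ) : ev (reOp f) x s = (ev f x s).re := by
  rw [reOp_apply, ev_smul, ev_add _ _ (inS_ofReal x s), ev_conjOp, Complex.conj_ofReal,
    Complex.add_conj]
  push_cast
  ring

theorem ev_I_smul (f : Wien K ω) (x : K) (w : ℂ) :
    ev (Complex.I • f) x w = Complex.I * ev f x w := ev_smul _ _ _ _

/-- Multiplication by `-i`, followed by the real part. -/
def imOp : Wien K ω →L[ℝ] Wien K ω :=
  reOp ∘L ((-Complex.I) • ContinuousLinearMap.id ℂ (Wien K ω)).restrictScalars ℝ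

theorem ev_imOp (f : Wien K ω) (x : K) (s : ℝ) : ev (imOp f) x s = (ev f x s).im := by
  change ev (reOp ((-Complex.I) • f)) x s = _
  rw [ev_reOp, ev_smul]
  simp

/-- The weight `2 π ρ (1 - r / 2)` on the unit interval. -/
def wt (ρ : ℝ) : C(unitInterval, ℝ≥0) :=
  ⟨fun r => (2 * π * ρ * (1 - r / 2)).toNNReal, by fun_prop⟩

theorem wt_apply {ρ : ℝ} (hρ : 0 ≤ ρ) (r : unitInterval) :
    (wt ρ r : ℝ) = 2 * π * ρ * (1 - r / 2) := by
  have h : (r : ℝ) ≤ 1 := r.2.2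
  simp only [wt, ContinuousMap.coe_mk]
  rw [Real.coe_toNNReal]
  have := Real.pi_pos
  have : (0:ℝ) ≤ 1 - r / 2 := by linarith
  positivity

theorem volterra_bound {ρ : ℝ} (hρ : 0 < ρ) (k : ℤ) (r : ℝ) (hr : r ∈ Icc (0 : ℝ) 1) :
    ∫ u in (0 : ℝ)..1, (1 + 2 * π * |(k : ℝ)|) * r *
      Real.exp (-(π * ρ * r * (1 - u)) * |(k : ℝ)|) ≤ 1 + 2 / ρ := by
  obtain ⟨h0, h1⟩ := hr
  have hpi := Real.pi_pos
  have key : r ≤ 1 ∧ ∫ u in (0 : ℝ)..1, (1 + 2 * π * |(k : ℝ)|) * r *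
      Real.exp (-(π * ρ * r * (1 - u)) * |(k : ℝ)|) ≤
      1 + 2 * π * |(k : ℝ)| *  ∫ u in (0 : ℝ)..1, r *
      Real.exp (-(π * ρ * r * (1 - u)) * |(k : ℝ)|) := by
    refine ⟨h1, ?_⟩
    have : ∀ u : ℝ, (1 + 2 * π * |(k : ℝ)|) * r *
      Real.exp (-(π * ρ * r * (1 - u)) * |(k : ℝ)|) = r *
      Real.exp (-(π * ρ * r * (1 - u)) * |(k : ℝ)|) + 2 * π * |(k : ℝ)| * (r *
      Real.exp (-(π * ρ * r * (1 - u)) * |(k : ℝ)|)) := fun u => by ring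
    simp_rw [this]
    have hc : Continuous fun u : ℝ => r * Real.exp (-(π * ρ * r * (1 - u)) * |(k : ℝ)|) := by
      fun_prop
    rw [intervalIntegral.integral_add (hc.intervalIntegrable _ _)
      ((hc.const_mul _).intervalIntegrable _ _),
      intervalIntegral.integral_const_mul (2 * π * |(k : ℝ)|)]
    refine add_le_add ?_ le_rfl
    calc _ ≤ ∫ u in (0 : ℝ)..1, (1 : ℝ) := by
          refine intervalIntegral.integral_mono_on zero_le_one
            (hc.intervalIntegrable _ _) (by simp) fun u hu => ?_
          have : Real.exp (-(π * ρ * r * (1 - u)) * |(k : ℝ)|) ≤ 1 := by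
            rw [Real.exp_le_one_iff, neg_mul, neg_nonpos]
            have : 0 ≤ 1 - u := by linarith [hu.2]
            positivity
          calc _ ≤ (1 : ℝ) * 1 := by gcongr
            _ = 1 := one_mul 1
      _ = 1 := by simp
  refine key.2.trans ?_
  by_cases hk : k = 0
  · simp [hk]
    positivity
  have hk' : 0 < |(k : ℝ)| := by positivity
  have hA : 0 < π * ρ * |(k : ℝ)| := by positivity
  have hint : ∫ u in (0 : ℝ)..1, r * Real.exp (-(π * ρ * r * (1 - u)) * |(k : ℝ)|) =
      Real.exp (-(π * ρ * r * (1 - 1)) * |(k : ℝ)|) / (π * ρ * |(k : ℝ)|) -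
      Real.exp (-(π * ρ * r * (1 - 0)) * |(k : ℝ)|) / (π * ρ * |(k : ℝ)|) := by
    refine intervalIntegral.integral_eq_sub_of_hasDerivAt (f := fun u : ℝ =>
      Real.exp (-(π * ρ * r * (1 - u)) * |(k : ℝ)|) / (π * ρ * |(k : ℝ)|))
      (fun u _ => ?_) (Continuous.intervalIntegrable (by fun_prop) _ _)
    have h1 : HasDerivAt (fun u : ℝ => -(π * ρ * r * (1 - u)) * |(k : ℝ)|)
        (π * ρ * r * |(k : ℝ)|) u := by
      have := ((((hasDerivAt_id u).const_sub 1).const_mul (π * ρ * r)).neg).mul_const |(k : ℝ)|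
      simpa using this
    convert! (h1.exp.div_const (π * ρ * |(k : ℝ)|)) using 1
    field_simp
  rw [hint]
  have h2 : Real.exp (-(π * ρ * r * (1 - 1)) * |(k : ℝ)|) / (π * ρ * |(k : ℝ)|) -
      Real.exp (-(π * ρ * r * (1 - 0)) * |(k : ℝ)|) / (π * ρ * |(k : ℝ)|) ≤
      1 / (π * ρ * |(k : ℝ)|) := by
    have : 0 ≤ Real.exp (-(π * ρ * r * (1 - 0)) * |(k : ℝ)|) / (π * ρ * |(k : ℝ)|) := by
      positivity
    simp only [sub_self, mul_zero, neg_zero, zero_mul, Real.exp_zero] at this ⊢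
    linarith
  calc _ ≤ 1 + 2 * π * |(k : ℝ)| * (1 / (π * ρ * |(k : ℝ)|)) := by gcongr
    _ = _ := by field_simp

/-- The Volterra operator
`(J f)_k(r) = (1 + 2π|k|) ∫_0^r e^{i T m_k (r - r')} f_k(r') dr'`. It gains one derivative because the
width of the strip decreases in `r`. -/
def volterra (m : ℤ → ℝ) (T ρ : ℝ) (hρ : 0 < ρ) : OpData (wt ρ) (wt ρ) where
  μ := volume.restrict (Icc 0 1)
  pr r u := r * projIcc 0 1 zero_le_one u
  ker k r u := (((1 + 2 * π * |(k : ℝ)|) * r : ℝ) : ℂ) *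
    Complex.exp (Complex.I * (T * m k * r * (1 - u) : ℝ))
  bd k _ := 1 + 2 * π * |(k : ℝ)|
  C := 1 + 2 / ρ
  cont_pr := by
    have : Continuous (projIcc (0 : ℝ) 1 zero_le_one) := continuous_projIcc
    fun_prop
  meas k r := Continuous.aestronglyMeasurable (by fun_prop)
  cont k u := by fun_prop
  int_bd k := integrable_const _
  le_bd k r u := by
    rw [norm_mul, mul_comm Complex.I, Complex.norm_exp_ofReal_mul_I, Complex.norm_real,
      Real.norm_eq_abs, mul_one, wt_apply hρ.le, wt_apply hρ.le]
    have h0 : (0 : ℝ) ≤ r := r.2.1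
    have h1 : (r : ℝ) ≤ 1 := r.2.2
    have hpi := Real.pi_pos
    rw [abs_of_nonneg (by positivity)]
    set v := projIcc (0 : ℝ) 1 zero_le_one u with hv
    have h2 : (v : ℝ) ≤ 1 := v.2.2
    have h3 : Real.exp ((2 * π * ρ * (1 - r / 2) -
        2 * π * ρ * (1 - ((r * v : unitInterval) : ℝ) / 2)) * |(k : ℝ)|) ≤ 1 := by
      rw [Real.exp_le_one_iff]
      refine mul_nonpos_of_nonpos_of_nonneg ?_ (abs_nonneg _)
      have : (2 * π * ρ * (1 - r / 2) -
        2 * π * ρ * (1 - ((r * v : unitInterval) : ℝ) / 2)) =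
          -(π * ρ * r * (1 - v)) := by
        push_cast; ring
      rw [this, neg_nonpos]
      have : 0 ≤ 1 - (v : ℝ) := by linarith
      positivity
    calc _ ≤ ((1 + 2 * π * |(k : ℝ)|) * 1) * 1 := by gcongr
      _ = _ := by ring
  C_nonneg := by positivity
  le_C k r := by
    refine le_trans (le_of_eq ?_) (volterra_bound hρ k r r.2)
    rw [intervalIntegral.integral_of_le zero_le_one, ← integral_Icc_eq_integral_Ioc]
    refine setIntegral_congr_fun measurableSet_Icc fun u hu => ?_
    have h0 : (0 : ℝ) ≤ r := r.2.1
    have hpi := Real.pi_pos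
    rw [norm_mul, mul_comm Complex.I, Complex.norm_exp_ofReal_mul_I, Complex.norm_real,
      Real.norm_eq_abs, mul_one, wt_apply hρ.le, wt_apply hρ.le, abs_of_nonneg (by positivity),
      projIcc_of_mem _ hu]
    congr 2
    push_cast
    ring

theorem co_volterra (m : ℤ → ℝ) (T ρ : ℝ) (hρ : 0 < ρ) (f : Wien unitInterval (wt ρ)) (k : ℤ)
    (r : unitInterval) : co ((volterra m T ρ hρ).op f) k r =
      (1 + 2 * π * |(k : ℝ)|) * ∫ r' in (0 : ℝ)..r,
        Complex.exp (Complex.I * (T * m k * (r - r') : ℝ)) * co f k (projIcc 0 1 zero_le_one r') := by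
  rw [OpData.co_op]
  have h := intervalIntegral.smul_integral_comp_mul_left (a := 0) (b := 1)
    (fun r' : ℝ => Complex.exp (Complex.I * (T * m k * (r - r') : ℝ)) *
      co f k (projIcc 0 1 zero_le_one r')) (r : ℝ)
  simp only [mul_zero, mul_one] at h
  rw [← h, intervalIntegral.integral_of_le zero_le_one, ← integral_Icc_eq_integral_Ioc,
    ← integral_smul, ← integral_const_mul]
  refine setIntegral_congr_fun measurableSet_Icc fun u hu => ?_
  have h2 : r * projIcc (0 : ℝ) 1 zero_le_one u = projIcc (0 : ℝ) 1 zero_le_one (r * u) := by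
    have : (r : ℝ) * u ∈ Icc (0 : ℝ) 1 := by
      obtain ⟨⟨h1, h2⟩, h3, h4⟩ := And.intro r.2 hu
      constructor <;> nlinarith
    rw [projIcc_of_mem _ this, projIcc_of_mem _ hu]
    rfl
  simp only [volterra, h2, Complex.real_smul]
  push_cast
  have h3 : (T * m k * r * (1 - u) : ℂ) = T * m k * (r - r * u) := by ring
  rw [h3]
  ring

end Wien

/-- Picard iteration: a small multiple of a map which is `C¹` at the origin, composed with uniformly
bounded linear maps, has a unique small fixed point. -/
theorem exists_unique_small_fixedPoint {X : Type} [NormedAddCommGroup X] [NormedSpace ℂ X]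
    [CompleteSpace X] (N : X → X) (hN : ContDiffAt ℝ 1 N 0) (J : ℝ → X →L[ℂ] X) (C : ℝ)
    (hJ : ∀ T f, ‖J T f‖ ≤ C * ‖f‖) :
    ∃ δ₀ > 0, (∀ δ, 0 < δ → δ ≤ δ₀ → ∃ T₀ > 0, ∀ T : ℝ, 0 < T → T ≤ T₀ →
        ∃ ψ, ‖ψ‖ ≤ δ ∧ ψ = (T : ℂ) • J T (N ψ)) ∧
      ∃ T₀ > 0, ∀ T : ℝ, 0 < T → T ≤ T₀ → ∀ ψ₁ ψ₂, ‖ψ₁‖ ≤ δ₀ → ‖ψ₂‖ ≤ δ₀ →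
        ψ₁ = (T : ℂ) • J T (N ψ₁) → ψ₂ = (T : ℂ) • J T (N ψ₂) → ψ₁ = ψ₂ := by
  obtain ⟨L, t, ht, hL⟩ := hN.exists_lipschitzOnWith
  obtain ⟨ε, hε, hεt⟩ := Metric.mem_nhds_iff.1 ht
  have hsub : ∀ x, ‖x‖ ≤ ε / 2 → x ∈ t := fun x hx => hεt (by simp; linarith)
  set C' := |C| + 1 with hC'
  have hC'p : 0 < C' := by positivity
  have hlip : ∀ T : ℝ, 0 < T → ∀ x y, ‖x‖ ≤ ε / 2 → ‖y‖ ≤ ε / 2 →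
      ‖(T : ℂ) • J T (N x) - (T : ℂ) • J T (N y)‖ ≤ T * C' * L * ‖x - y‖ := by
    intro T hT x y hx hy
    rw [← smul_sub, ← map_sub, norm_smul, Complex.norm_real, Real.norm_eq_abs, abs_of_pos hT]
    have h1 := hL.dist_le_mul x (hsub x hx) y (hsub y hy)
    rw [dist_eq_norm, dist_eq_norm] at h1
    have h2 := hJ T (N x - N y)
    have h3 : C * ‖N x - N y‖ ≤ C' * (L * ‖x - y‖) := by
      have : C ≤ C' := by rw [hC']; linarith [le_abs_self C]
      gcongr
    calc _ ≤ T * (C' * (L * ‖x - y‖)) := by gcongr; linarith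
      _ = _ := by ring
  have hhalf : ∀ T : ℝ, 0 < T → T ≤ 1 / (2 * C' * (L + 1)) → T * C' * L ≤ 1 / 2 := by
    intro T hT h
    have hL0 : (0 : ℝ) ≤ L := L.2
    rw [le_div_iff₀ (by positivity)] at h
    nlinarith [mul_pos hT hC'p]
  refine ⟨ε / 2, by positivity, ?_, 1 / (2 * C' * (L + 1)), by positivity, ?_⟩
  · intro δ hδ hδ0
    refine ⟨min (1 / (2 * C' * (L + 1))) (δ / (2 * C' * (‖N 0‖ + 1))), by positivity, ?_⟩
    intro T hT hT0
    have hT1 := hT0.trans (min_le_left _ _)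
    have hT2 := hT0.trans (min_le_right _ _)
    have hΦ0 : ‖(T : ℂ) • J T (N 0)‖ ≤ δ / 2 := by
      rw [norm_smul, Complex.norm_real, Real.norm_eq_abs, abs_of_pos hT]
      have h1 := hJ T (N 0)
      have h3 : C * ‖N 0‖ ≤ C' * (‖N 0‖ + 1) := by
        have : C ≤ C' := by rw [hC']; linarith [le_abs_self C]
        have := norm_nonneg (N 0)
        gcongr
        linarith
      rw [le_div_iff₀ (by positivity)] at hT2
      calc _ ≤ T * (C' * (‖N 0‖ + 1)) := by gcongr; linarith
        _ ≤ _ := by linarith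
    set Φ : X → X := fun ψ => (T : ℂ) • J T (N ψ) with hΦ
    have hmaps : MapsTo Φ (Metric.closedBall 0 δ) (Metric.closedBall 0 δ) := by
      intro x hx
      simp only [mem_closedBall_zero_iff] at hx ⊢
      have h1 := hlip T hT x 0 (hx.trans hδ0) (by simp; positivity)
      have h2 := hhalf T hT hT1
      rw [sub_zero] at h1
      have h3 : ‖Φ x‖ ≤ ‖Φ x - Φ 0‖ + ‖Φ 0‖ := by
        simpa using norm_add_le (Φ x - Φ 0) (Φ 0)
      have h4 : T * C' * L * ‖x‖ ≤ 1 / 2 * δ := by gcongr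
      have h5 : ‖Φ x - Φ 0‖ ≤ T * C' * L * ‖x‖ := h1
      have h6 : ‖Φ 0‖ ≤ δ / 2 := hΦ0
      linarith
    have hcontr : ContractingWith (1 / 2) (hmaps.restrict Φ _ _) := by
      refine ⟨by norm_num, LipschitzWith.of_dist_le_mul fun x y => ?_⟩
      rw [Subtype.dist_eq, Subtype.dist_eq, dist_eq_norm, dist_eq_norm]
      have hx : ‖(x : X)‖ ≤ δ := mem_closedBall_zero_iff.1 x.2
      have hy : ‖(y : X)‖ ≤ δ := mem_closedBall_zero_iff.1 y.2
      have h1 := hlip T hT x y (hx.trans hδ0) (hy.trans hδ0)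
      have h2 := hhalf T hT hT1
      refine h1.trans ?_
      push_cast
      gcongr
    obtain ⟨y, hy, hfix, -⟩ := hcontr.exists_fixedPoint' (x := (0 : X))
      (Metric.isClosed_closedBall.isComplete) hmaps (by simp [hδ.le]) (edist_ne_top _ _)
    exact ⟨y, by simpa using hy, hfix.symm⟩
  · intro T hT hT0 ψ₁ ψ₂ h₁ h₂ e₁ e₂
    have h3 := hlip T hT ψ₁ ψ₂ h₁ h₂
    rw [← e₁, ← e₂] at h3
    have h4 := hhalf T hT hT0
    have h5 : ‖ψ₁ - ψ₂‖ ≤ 1 / 2 * ‖ψ₁ - ψ₂‖ := h3.trans (by gcongr)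
    have h6 := norm_nonneg (ψ₁ - ψ₂)
    exact sub_eq_zero.1 (norm_eq_zero.1 (by linarith))

/-- The odd kernel `σ |σ|^{-β}`. -/
def kap (β σ : ℝ) : ℝ := σ * |σ| ^ (-β)

theorem integrableOn_abs_rpow {a : ℝ} (ha : -1 < a) :
    IntegrableOn (fun σ : ℝ => |σ| ^ a) 𝕁 := by
  have h : IntegrableOn (fun σ : ℝ => |σ| ^ a) (Ioc (-(1 / 2)) 0) ∧
      IntegrableOn (fun σ : ℝ => |σ| ^ a) (Ioc 0 (1 / 2)) := by
    have h0 : IntegrableOn (fun σ : ℝ => |σ| ^ a) (Ioc 0 (1 / 2)) := by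
      have := intervalIntegral.intervalIntegrable_rpow' (a := 0) (b := 1 / 2) ha
      rw [intervalIntegrable_iff_integrableOn_Ioc_of_le (by norm_num)] at this
      exact this.congr_fun (fun x hx => by simp only; rw [abs_of_pos hx.1]) measurableSet_Ioc
    refine ⟨?_, h0⟩
    have h1 : IntervalIntegrable (fun σ : ℝ => |σ| ^ a) volume 0 (1 / 2) :=
      (intervalIntegrable_iff_integrableOn_Ioc_of_le (by norm_num)).2 h0
    have h2 := ((IntervalIntegrable.iff_comp_neg (by finiteness)).1 h1).symm
    rw [neg_zero, intervalIntegrable_iff_integrableOn_Ioc_of_le (by norm_num)] at h2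
    simpa using h2
  rw [integrableOn_Icc_iff_integrableOn_Ioc, ← Ioc_union_Ioc_eq_Ioc (b := 0) (by norm_num)
    (by norm_num)]
  exact h.1.union h.2

theorem abs_kap {β : ℝ} (σ : ℝ) : |kap β σ| = |σ| * |σ| ^ (-β) := by
  rw [kap, abs_mul, abs_of_nonneg (Real.rpow_nonneg (abs_nonneg _) _)]

theorem abs_kap_le {β : ℝ} (hβ : 1 < β) (σ : ℝ) : |kap β σ| = |σ| ^ (1 - β) := by
  rw [abs_kap]
  by_cases h : σ = 0
  · simp [h, Real.zero_rpow (by linarith : 1 - β ≠ 0)]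
  · have : 0 < |σ| := by positivity
    rw [sub_eq_add_neg, Real.rpow_add this, Real.rpow_one]

theorem measurable_kap (β : ℝ) : Measurable (kap β) := by
  unfold kap
  fun_prop

theorem integrableOn_kap {β : ℝ} (hβ₁ : 1 < β) (hβ₂ : β < 2) :
    IntegrableOn (kap β) 𝕁 := by
  refine (integrableOn_abs_rpow (a := 1 - β) (by linarith)).mono'
    (measurable_kap β).aestronglyMeasurable (ae_of_all _ fun σ => ?_)
  rw [Real.norm_eq_abs, abs_kap_le hβ₁]

namespace Wien

variable {K : Type} [TopologicalSpace K] [CompactSpace K] [FirstCountableTopology K]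
  {ω : C(K, ℝ≥0)}

/-- The factor `2π|k| + 1`. -/
theorem one_add_pos (k : ℤ) : (0 : ℝ) < 1 + 2 * π * |(k : ℝ)| := by
  have := Real.pi_pos
  positivity

theorem co_add (f g : Wien K ω) (k : ℤ) (x : K) : co (f + g) k x = co f k x + co g k x := by
  simp [co, add_mul]
theorem co_sub (f g : Wien K ω) (k : ℤ) (x : K) : co (f - g) k x = co f k x - co g k x := by
  simp [co, sub_mul]
theorem co_smul (c : ℂ) (f : Wien K ω) (k : ℤ) (x : K) : co (c • f) k x = c * co f k x := by
  simp [co, mul_assoc]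
theorem co_const (c : C(K, ℂ)) (k : ℤ) (x : K) :
    co (const c : Wien K ω) k x = if k = 0 then c x else 0 := by
  by_cases h : k = 0 <;> simp [co, const, h]

/-- The multiplier `1 / (1 + 2π|k|)`. -/
def mB : Wien K ω →L[ℂ] Wien K ω :=
  mul₁ (fun k => ((1 + 2 * π * |(k : ℝ)|)⁻¹ : ℝ)) 1 zero_le_one fun k => by
    have := Real.pi_pos
    rw [Complex.norm_real, Real.norm_eq_abs, abs_inv, abs_of_pos (one_add_pos k)]
    exact inv_le_one_of_one_le₀ (by simp; positivity)

/-- The multiplier `2πik / (1 + 2π|k|)`. -/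
def mB' : Wien K ω →L[ℂ] Wien K ω :=
  mul₁ (fun k => 2 * π * Complex.I * k * ((1 + 2 * π * |(k : ℝ)|)⁻¹ : ℝ)) 1 zero_le_one
    fun k => by
    have := Real.pi_pos
    rw [norm_mul, Complex.norm_real, Real.norm_eq_abs, abs_inv, abs_of_pos (one_add_pos k)]
    simp only [norm_mul, Complex.norm_real, Complex.norm_I, Complex.norm_ofNat, Complex.norm_intCast,
      Real.norm_eq_abs, abs_of_pos this]
    rw [← div_eq_mul_inv, div_le_one (one_add_pos k)]
    linarith

/-- The multiplier `-1 / (2πik)` for `k ≠ 0`, an antiderivative of `f_0 - f`. -/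
def mQ : Wien K ω →L[ℂ] Wien K ω :=
  mul₁ (fun k => -(2 * π * Complex.I * k)⁻¹) 1 zero_le_one fun k => by
    have := Real.pi_pos
    by_cases h : k = 0
    · simp [h]
    rw [norm_neg, norm_inv]
    simp only [norm_mul, Complex.norm_real, Complex.norm_I, Complex.norm_ofNat, Complex.norm_intCast,
      Real.norm_eq_abs, abs_of_pos this]
    refine inv_le_one_of_one_le₀ ?_
    have h1 : (1 : ℝ) ≤ |(k : ℝ)| := by
      rw [← Int.cast_abs]; exact_mod_cast Int.one_le_abs h
    have := Real.pi_gt_three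
    nlinarith

theorem co_mB (f : Wien K ω) (k : ℤ) (x : K) :
    co (mB f) k x = ((1 + 2 * π * |(k : ℝ)|)⁻¹ : ℝ) * co f k x := co_mul₁ _ _ _ _ _ _ _

theorem co_mB' (f : Wien K ω) (k : ℤ) (x : K) :
    co (mB' f) k x = 2 * π * Complex.I * k * co (mB f) k x := by
  rw [mB', co_mul₁, co_mB]
  ring

theorem co_mQ (f : Wien K ω) (k : ℤ) (x : K) :
    co (mQ f) k x = -(2 * π * Complex.I * k)⁻¹ * co f k x := co_mul₁ _ _ _ _ _ _ _

/-- Termwise differentiation. -/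
theorem hasDerivAt_ev {f g : Wien K ω} {x : K}
    (h : ∀ k, co g k x = 2 * π * Complex.I * k * co f k x) (s : ℝ) :
    HasDerivAt (fun s : ℝ => ev f x s) (ev g x s) s := by
  have key := hasDerivAt_tsum (u := fun k => ‖cf g k‖) (y₀ := s) g.summable_cf
    (g := fun k (s : ℝ) => cf f k x * ex ω x s k) (g' := fun k (s : ℝ) => cf g k x * ex ω x s k)
    (fun k s => ?_) (fun k s => norm_term_le g (inS_ofReal x s) k)
    (summable_term f (inS_ofReal x s)) s
  · exact key
  · simp_rw [← co_mul_exp, h k]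
    have h1 : HasDerivAt (fun s : ℝ => (2 * π * Complex.I * k * s : ℂ))
        (2 * π * Complex.I * k) s := by
      simpa using (Complex.ofRealCLM.hasDerivAt (x := s)).const_mul (2 * π * Complex.I * k : ℂ)
    convert! (h1.cexp.const_mul (co f k x)) using 1
    ring

theorem hasDerivAt_ev_mQ (f : Wien K ω) (x : K) (s : ℝ) :
    HasDerivAt (fun s : ℝ => ev (mQ f) x s) (co f 0 x - ev f x s) s := by
  have h := hasDerivAt_ev (f := mQ f)
    (g := const ⟨fun x => co f 0 x, by unfold co; fun_prop⟩ - f) (x := x) (fun k => ?_) s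
  · rwa [ev_sub _ _ (inS_ofReal x s), ev_const] at h
  · rw [co_sub, co_const, co_mQ]
    by_cases hk : k = 0
    · simp [hk]
    · have : (2 * π * Complex.I * k : ℂ) ≠ 0 := by
        simp [hk, Real.pi_ne_zero, Complex.I_ne_zero]
      rw [if_neg hk]
      field_simp
      ring

section contDiff

variable {X : Type} [NormedAddCommGroup X] [NormedSpace ℝ X]
variable {K' : Type} [TopologicalSpace K'] [CompactSpace K'] {ω' : C(K', ℝ≥0)}

theorem contDiffAt_clm (L : Wien K ω →L[ℂ] Wien K' ω') {f : X → Wien K ω} {x : X}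
    (hf : ContDiffAt ℝ 1 f x) : ContDiffAt ℝ 1 (fun y => L (f y)) x :=
  (L.restrictScalars ℝ).contDiff.contDiffAt.comp x hf

theorem contDiffAt_rclm (L : Wien K ω →L[ℝ] Wien K' ω') {f : X → Wien K ω} {x : X}
    (hf : ContDiffAt ℝ 1 f x) : ContDiffAt ℝ 1 (fun y => L (f y)) x :=
  L.contDiff.contDiffAt.comp x hf

theorem contDiffAt_mul {f g : X → Wien K ω} {x : X}
    (hf : ContDiffAt ℝ 1 f x) (hg : ContDiffAt ℝ 1 g x) : ContDiffAt ℝ 1 (fun y => f y * g y) x :=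
  hf.mul hg

theorem contDiffAt_exp {f : X → Wien K ω} {x : X} (hf : ContDiffAt ℝ 1 f x) :
    ContDiffAt ℝ 1 (fun y => NormedSpace.exp (f y)) x :=
  (NormedSpace.exp_analytic (𝕂 := ℝ) (f x)).contDiffAt.comp x hf

theorem contDiffAt_smul (c : ℂ) {f : X → Wien K ω} {x : X} (hf : ContDiffAt ℝ 1 f x) :
    ContDiffAt ℝ 1 (fun y => c • f y) x :=
  contDiffAt_clm (c • ContinuousLinearMap.id ℂ (Wien K ω)) hf

end contDiff

end Wien

/-! Calculus of the kernel `|∫_s^{s+σ} E|^{-β}` of a unit tangent field `E`. -/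

/-- The mean `∫_0^1 f(s + c σ) dc`. -/
def av (f : ℝ → ℂ) (s σ : ℝ) : ℂ := ∫ c in (0 : ℝ)..1, f (s + c * σ)

/-- The mean `∫_0^1 c f(s + c σ) dc`. -/
def avc (f : ℝ → ℂ) (s σ : ℝ) : ℂ := ∫ c in (0 : ℝ)..1, (c : ℂ) * f (s + c * σ)

theorem continuous_av {f : ℝ → ℂ} (hf : Continuous f) :
    Continuous fun p : ℝ × ℝ => av f p.1 p.2 := by
  unfold av
  exact intervalIntegral.continuous_parametric_intervalIntegral_of_continuous' (by fun_prop) _ _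

theorem continuous_avc {f : ℝ → ℂ} (hf : Continuous f) :
    Continuous fun p : ℝ × ℝ => avc f p.1 p.2 := by
  unfold avc
  exact intervalIntegral.continuous_parametric_intervalIntegral_of_continuous' (by fun_prop) _ _

/-- Differentiation of an integral over a compact interval with an integrable weight. -/
theorem hasDerivAt_weighted_integral {n : ℝ → ℝ} {a b : ℝ} (hab : a ≤ b)
    (hn : IntegrableOn n (Icc a b)) {g g' : ℝ → ℝ → ℂ} {s : ℝ}
    (hg : ∀ u, ContinuousOn (g u) (Icc a b))
    (hg' : ContinuousOn (fun p : ℝ × ℝ => g' p.1 p.2) (univ ×ˢ Icc a b))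
    (h : ∀ u, ∀ σ ∈ Icc a b, HasDerivAt (fun u => g u σ) (g' u σ) u) :
    HasDerivAt (fun u => ∫ σ in a..b, n σ * g u σ) (∫ σ in a..b, n σ * g' s σ) s := by
  have hn' : IntegrableOn (fun σ => (n σ : ℂ)) (Icc a b) := hn.ofReal
  obtain ⟨C, hC⟩ := (isCompact_Icc.prod isCompact_Icc).exists_bound_of_continuousOn
    (hg'.mono (show Icc (s - 1) (s + 1) ×ˢ Icc a b ⊆ _ from prod_mono (subset_univ _) le_rfl))
  have hslice : ContinuousOn (fun σ => g' s σ) (Icc a b) :=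
    hg'.comp (by fun_prop : ContinuousOn (fun σ : ℝ => (s, σ)) (Icc a b))
      fun σ hσ => ⟨mem_univ _, hσ⟩
  simp_rw [intervalIntegral.integral_of_le hab, ← integral_Icc_eq_integral_Ioc]
  have hnb : Icc (s - 1) (s + 1) ∈ nhds s := Icc_mem_nhds (by linarith) (by linarith)
  refine (hasDerivAt_integral_of_dominated_loc_of_deriv_le (s := Icc (s - 1) (s + 1))
    (F := fun u σ => (n σ : ℂ) * g u σ) (F' := fun u σ => (n σ : ℂ) * g' u σ)
    (bound := fun σ => |n σ| * C) hnb ?_ ?_ ?_ ?_ ?_ ?_).2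
  · exact Filter.Eventually.of_forall fun u =>
      hn'.aestronglyMeasurable.mul ((hg u).aestronglyMeasurable measurableSet_Icc)
  · exact hn'.mul_continuousOn (hg s) isCompact_Icc
  · exact hn'.aestronglyMeasurable.mul (hslice.aestronglyMeasurable measurableSet_Icc)
  · refine (ae_restrict_iff' measurableSet_Icc).2 (ae_of_all _ fun σ hσ u hu => ?_)
    rw [norm_mul, Complex.norm_real, Real.norm_eq_abs]
    exact mul_le_mul_of_nonneg_left (hC (u, σ) ⟨hu, hσ⟩) (abs_nonneg _)
  · exact hn.abs.mul_const C
  · exact (ae_restrict_iff' measurableSet_Icc).2 (ae_of_all _ fun σ hσ u _ =>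
      (h u σ hσ).const_mul _)

theorem hasDerivAt_av {f f' : ℝ → ℂ} (h : ∀ s, HasDerivAt f (f' s) s) (hf' : Continuous f')
    (s σ : ℝ) : HasDerivAt (fun u => av f u σ) (av f' s σ) s := by
  have hf : Continuous f := continuous_of_hasDerivAt h
  have := hasDerivAt_weighted_integral (n := fun _ => 1) (a := 0) (b := 1) zero_le_one (by simp)
    (g := fun u c => f (u + c * σ)) (g' := fun u c => f' (u + c * σ)) (s := s)
    (fun u => by fun_prop) (by fun_prop) fun u c _ => by
      exact HasDerivAt.comp_add_const u (c * σ) (h _)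
  simpa [av] using this

theorem hasDerivAt_av_right {f f' : ℝ → ℂ} (h : ∀ s, HasDerivAt f (f' s) s) (hf' : Continuous f')
    (s σ : ℝ) : HasDerivAt (fun σ => av f s σ) (avc f' s σ) σ := by
  have hf : Continuous f := continuous_of_hasDerivAt h
  have := hasDerivAt_weighted_integral (n := fun _ => 1) (a := 0) (b := 1) zero_le_one (by simp)
    (g := fun σ c => f (s + c * σ)) (g' := fun σ c => c * f' (s + c * σ)) (s := σ)
    (fun u => by fun_prop) (by fun_prop) fun u c _ => by
      have h1 : HasDerivAt (fun u : ℝ => s + c * u) c u := by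
        simpa using ((hasDerivAt_id u).const_mul c).const_add s
      have h2 := (h (s + c * u)).scomp u h1
      rw [Complex.real_smul] at h2
      exact h2
  simpa [av, avc] using this

theorem mul_av {f f' : ℝ → ℂ} (h : ∀ s, HasDerivAt f (f' s) s) (hf' : Continuous f')
    (s σ : ℝ) : σ * av f' s σ = f (s + σ) - f s := by
  have := intervalIntegral.smul_integral_comp_add_mul (a := 0) (b := 1) f' σ s
  simp only [mul_zero, add_zero, mul_one] at this
  rw [av]
  simp_rw [mul_comm _ σ]
  rw [← Complex.real_smul, this]
  exact intervalIntegral.integral_eq_sub_of_hasDerivAt (fun x _ => h x)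
    (hf'.intervalIntegrable _ _)

/-- The square of the chord-arc ratio. -/
def dq (E : ℝ → ℂ) (s σ : ℝ) : ℝ := ‖av E s σ‖ ^ 2

/-- The power `dq ^ (-β/2 - 1)`. -/
def vq (β : ℝ) (E : ℝ → ℂ) (s σ : ℝ) : ℝ := dq E s σ ^ (-(β / 2) - 1)

theorem dq_eq (E : ℝ → ℂ) (s σ : ℝ) : (dq E s σ : ℂ) = av E s σ * conj (av E s σ) := by
  rw [Complex.mul_conj, Complex.normSq_eq_norm_sq]; rfl

/-- The derivative of `dq` in the base point. -/
def dqs (E E' : ℝ → ℂ) (s σ : ℝ) : ℂ :=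
  av E' s σ * conj (av E s σ) + av E s σ * conj (av E' s σ)

/-- The derivative of `dq` in the increment. -/
def dqd (E E' : ℝ → ℂ) (s σ : ℝ) : ℂ :=
  avc E' s σ * conj (av E s σ) + av E s σ * conj (avc E' s σ)

/-- `(dq ^ (-β/2) - 1) / σ`. -/
def gq (β : ℝ) (E E' : ℝ → ℂ) (s σ : ℝ) : ℂ :=
  -(β / 2) * ∫ c in (0 : ℝ)..1, vq β E s (c * σ) * dqd E E' s (c * σ)

/-- The velocity of the curve with tangent field `E` of unit length, `E'` being the derivative. -/
def zetaU (β : ℝ) (E E' : ℝ → ℂ) (s : ℝ) : ℂ :=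
  -∫ σ in (-(1 / 2) : ℝ)..(1 / 2), kap β σ * (av E' s σ * dq E s σ * vq β E s σ)

/-- The dispersive term `-∫ (k(s + σ) - k(s)) |σ|^{-β} dσ`, in terms of the derivative of `k`. -/
def dispU (β : ℝ) (k' : ℝ → ℂ) (s : ℝ) : ℂ :=
  -∫ σ in (-(1 / 2) : ℝ)..(1 / 2), kap β σ * av k' s σ

/-- The lower order part of the derivative of the velocity. -/
def remU (β : ℝ) (E E' k : ℝ → ℂ) (s : ℝ) : ℂ :=
  -Complex.I * (∫ σ in (-(1 / 2) : ℝ)..(1 / 2), kap β σ * ((k (s + σ) - k s) * gq β E E' s σ))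
    - Complex.I * (∫ σ in (-(1 / 2) : ℝ)..(1 / 2), kap β σ *
      (k (s + σ) * av E' s σ * conj (E s) * dq E s σ * vq β E s σ))
    + (β / 2) * (conj (E s) * ∫ σ in (-(1 / 2) : ℝ)..(1 / 2), kap β σ *
      (av E' s σ * vq β E s σ * dqs E E' s σ))

section

variable {β : ℝ} {E E' E'' : ℝ → ℂ}

theorem hasDerivAt_dq_aux {a a' : ℂ} {f : ℝ → ℂ} {s : ℝ} (hf : HasDerivAt f a' s) (ha : f s = a) :
    HasDerivAt (fun u => ‖f u‖ ^ 2) (a' * conj a + a * conj a').re s := by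
  have h1 := hf.norm_sq
  rw [ha] at h1
  convert! h1 using 1
  rw [Complex.inner]
  simp only [Complex.add_re, Complex.mul_re, Complex.conj_re, Complex.conj_im]
  ring

theorem conj_add_real (a b : ℂ) : (((a * conj b + b * conj a).re : ℝ) : ℂ) =
    a * conj b + b * conj a := by
  apply Complex.ext
  · simp
  · simp; ring

theorem continuous_dq (hE : Continuous E) : Continuous fun p : ℝ × ℝ => dq E p.1 p.2 := by
  have := continuous_av hE
  unfold dq
  fun_prop

theorem continuousOn_vq (hE : Continuous E) (hpos : ∀ s, ∀ σ ∈ 𝕁, 0 < dq E s σ) :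
    ContinuousOn (fun p : ℝ × ℝ => vq β E p.1 p.2) (univ ×ˢ 𝕁) := by
  unfold vq
  exact (continuous_dq hE).continuousOn.rpow_const fun p hp => Or.inl (hpos p.1 p.2 hp.2).ne'

theorem dq_mul_vq {s σ : ℝ} (h : 0 < dq E s σ) : dq E s σ * vq β E s σ = dq E s σ ^ (-(β / 2)) := by
  rw [vq, Real.rpow_sub h, Real.rpow_one]
  field_simp

theorem hasDerivAt_dq (hE : ∀ s, HasDerivAt E (E' s) s) (hE' : Continuous E') (s σ : ℝ) :
    HasDerivAt (fun u => dq E u σ) (dqs E E' s σ).re s :=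
  hasDerivAt_dq_aux (hasDerivAt_av hE hE' s σ) rfl

theorem hasDerivAt_dq_right (hE : ∀ s, HasDerivAt E (E' s) s) (hE' : Continuous E') (s σ : ℝ) :
    HasDerivAt (fun u => dq E s u) (dqd E E' s σ).re σ :=
  hasDerivAt_dq_aux (hasDerivAt_av_right hE hE' s σ) rfl

theorem dqs_re (s σ : ℝ) : ((dqs E E' s σ).re : ℂ) = dqs E E' s σ := conj_add_real _ _
theorem dqd_re (s σ : ℝ) : ((dqd E E' s σ).re : ℂ) = dqd E E' s σ := conj_add_real _ _

theorem continuous_dqs (hE : Continuous E) (hE' : Continuous E') :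
    Continuous fun p : ℝ × ℝ => dqs E E' p.1 p.2 := by
  have h1 := continuous_av hE
  have h2 := continuous_av hE'
  have h3 : Continuous (starRingEnd ℂ) := Complex.continuous_conj
  unfold dqs
  fun_prop

theorem continuous_dqd (hE : Continuous E) (hE' : Continuous E') :
    Continuous fun p : ℝ × ℝ => dqd E E' p.1 p.2 := by
  have h1 := continuous_av hE
  have h2 := continuous_avc hE'
  have h3 : Continuous (starRingEnd ℂ) := Complex.continuous_conj
  unfold dqd
  fun_prop

theorem hasDerivAt_dq_mul_vq (hE : ∀ s, HasDerivAt E (E' s) s) (hE' : Continuous E') {s σ : ℝ}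
    (hpos : ∀ s, 0 < dq E s σ) :
    HasDerivAt (fun u => (dq E u σ * vq β E u σ : ℂ)) (-(β / 2) * (vq β E s σ * dqs E E' s σ)) s := by
  have h1 : ∀ u, (dq E u σ * vq β E u σ : ℂ) = ((dq E u σ ^ (-(β / 2)) : ℝ) : ℂ) := fun u => by
    rw [← dq_mul_vq (hpos u)]
    push_cast
    rfl
  simp_rw [h1]
  have h2 := ((hasDerivAt_dq hE hE' s σ).rpow_const (p := -(β / 2)) (Or.inl (hpos s).ne')).ofReal_comp
  convert! h2 using 1
  rw [Complex.ofReal_mul, Complex.ofReal_mul, dqs_re, vq]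
  push_cast
  ring

theorem continuousOn_slice {g : ℝ → ℝ → ℂ}
    (h : ContinuousOn (fun p : ℝ × ℝ => g p.1 p.2) (univ ×ˢ 𝕁)) (s : ℝ) :
    ContinuousOn (g s) 𝕁 :=
  h.comp (by fun_prop : ContinuousOn (fun σ : ℝ => (s, σ)) 𝕁)
    fun _ hσ => ⟨mem_univ _, hσ⟩

theorem continuousOn_vq_slice (hE : Continuous E)
    (hpos : ∀ s, ∀ σ ∈ 𝕁, 0 < dq E s σ) (s : ℝ) :
    ContinuousOn (fun σ => (vq β E s σ : ℂ)) 𝕁 :=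
  continuousOn_slice (g := fun s σ => (vq β E s σ : ℂ))
    (Complex.continuous_ofReal.comp_continuousOn (continuousOn_vq hE hpos)) s

theorem smul_mem_half {c σ : ℝ} (hc : c ∈ Icc (0 : ℝ) 1) (hσ : σ ∈ 𝕁) :
    c * σ ∈ 𝕁 := mul_mem_Sg hc ⟨σ, hσ⟩

theorem mul_gq (hE : ∀ s, HasDerivAt E (E' s) s) (hE' : Continuous E') {s σ : ℝ}
    (hu : ‖E s‖ = 1) (hσ : σ ∈ 𝕁)
    (hpos : ∀ s, ∀ σ ∈ 𝕁, 0 < dq E s σ) :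
    σ * gq β E E' s σ = dq E s σ * vq β E s σ - 1 := by
  have hEc : Continuous E := continuous_of_hasDerivAt hE
  have h1 := intervalIntegral.integral_eq_sub_of_hasDerivAt (a := 0) (b := 1)
    (f := fun c => ((dq E s (c * σ) ^ (-(β / 2)) : ℝ) : ℂ))
    (f' := fun c => σ * (-(β / 2) * (vq β E s (c * σ) * dqd E E' s (c * σ)))) ?_ ?_
  · rw [gq, ← intervalIntegral.integral_const_mul, ← intervalIntegral.integral_const_mul, h1]
    have h0 : dq E s (0 * σ) = 1 := by
      simp [dq, av, hu]
    rw [h0, one_mul, ← dq_mul_vq (hpos s σ hσ)]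
    simp
  · intro c hc
    rw [uIcc_of_le zero_le_one] at hc
    have hp := hpos s _ (smul_mem_half hc hσ)
    have h2 : HasDerivAt (fun c : ℝ => c * σ) σ c := by
      simpa using (hasDerivAt_id c).mul_const σ
    have h3 := (((hasDerivAt_dq_right hE hE' s (c * σ)).rpow_const (p := -(β / 2))
      (Or.inl hp.ne')).comp c h2).ofReal_comp
    convert! h3 using 1
    rw [Complex.ofReal_mul, Complex.ofReal_mul, Complex.ofReal_mul, dqd_re, vq]
    push_cast
    ring
  · refine ContinuousOn.intervalIntegrable ?_
    rw [uIcc_of_le zero_le_one]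
    have h4 : ContinuousOn (fun c : ℝ => (vq β E s (c * σ) : ℂ)) (Icc 0 1) :=
      ContinuousOn.comp (g := fun σ => (vq β E s σ : ℂ)) (f := fun c : ℝ => c * σ)
        (continuousOn_vq_slice (β := β) hEc hpos s) (by fun_prop)
        fun c hc => smul_mem_half hc hσ
    have h6 : Continuous fun c : ℝ => dqd E E' s (c * σ) :=
      Continuous.comp (g := fun p : ℝ × ℝ => dqd E E' p.1 p.2) (f := fun c : ℝ => (s, c * σ))
        (continuous_dqd hEc hE') (by fun_prop)
    exact ContinuousOn.mul continuousOn_const (ContinuousOn.mul continuousOn_const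
      (ContinuousOn.mul h4 h6.continuousOn))

theorem continuousOn_gq (hE : Continuous E) (hE' : Continuous E') (s : ℝ)
    (hpos : ∀ s, ∀ σ ∈ 𝕁, 0 < dq E s σ) :
    ContinuousOn (gq β E E' s) 𝕁 := by
  have h1 : Continuous fun σ => (vq β E s (prSg σ) : ℂ) * dqd E E' s (prSg σ) := by
    have hp : Continuous fun σ => (prSg σ : ℝ) := continuous_subtype_val.comp continuous_prSg
    have h2 : Continuous fun σ => (vq β E s (prSg σ) : ℂ) :=
      ContinuousOn.comp_continuous (g := fun σ => (vq β E s σ : ℂ)) (f := fun σ => (prSg σ : ℝ))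
        (continuousOn_vq_slice (β := β) hE hpos s) hp fun σ => (prSg σ).2
    have h3 : Continuous fun σ => dqd E E' s (prSg σ) :=
      Continuous.comp (g := fun p : ℝ × ℝ => dqd E E' p.1 p.2) (f := fun c : ℝ => (s, (prSg c : ℝ)))
        (continuous_dqd hE hE') (by fun_prop)
    exact h2.mul h3
  have h4 : Continuous fun σ : ℝ => -(β / 2 : ℂ) * ∫ c in (0 : ℝ)..1,
      (vq β E s (prSg (c * σ)) : ℂ) * dqd E E' s (prSg (c * σ)) :=
    continuous_const.mul
      (intervalIntegral.continuous_parametric_intervalIntegral_of_continuous'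
        (f := fun σ c => (vq β E s (prSg (c * σ)) : ℂ) * dqd E E' s (prSg (c * σ)))
        (Continuous.comp (g := fun σ => (vq β E s (prSg σ) : ℂ) * dqd E E' s (prSg σ))
          (f := fun p : ℝ × ℝ => p.2 * p.1) h1 (by fun_prop)) _ _)
  refine h4.continuousOn.congr fun σ hσ => ?_
  simp only [gq]
  congr 1
  refine intervalIntegral.integral_congr fun c hc => ?_
  rw [uIcc_of_le zero_le_one] at hc
  rw [prSg_of_mem (smul_mem_half hc hσ)]

theorem intervalIntegrable_kap_mul (hβ₁ : 1 < β) (hβ₂ : β < 2) {g : ℝ → ℂ}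
    (hg : ContinuousOn g 𝕁) :
    IntervalIntegrable (fun σ => kap β σ * g σ) volume (-(1 / 2)) (1 / 2) := by
  rw [intervalIntegrable_iff_integrableOn_Icc_of_le (by norm_num)]
  have h : IntegrableOn (fun σ => (kap β σ : ℂ)) 𝕁 :=
    (integrableOn_kap hβ₁ hβ₂).ofReal
  exact h.mul_continuousOn hg isCompact_Icc

/-- The derivative of the velocity, split into the dispersive term and the remainder. -/
theorem hasDerivAt_zetaU (hβ₁ : 1 < β) (hβ₂ : β < 2) {k k' : ℝ → ℂ}
    (hE : ∀ s, HasDerivAt E (E' s) s) (hE'k : ∀ s, E' s = Complex.I * k s * E s)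
    (hk : ∀ s, HasDerivAt k (k' s) s) (hk' : Continuous k') (hu : ∀ s, ‖E s‖ = 1)
    (hpos : ∀ s, ∀ σ ∈ 𝕁, 0 < dq E s σ) (s : ℝ) :
    HasDerivAt (zetaU β E E') (E s * (Complex.I * dispU β k' s + remU β E E' k s)) s := by
  have hEc : Continuous E := continuous_of_hasDerivAt hE
  have hkc : Continuous k := continuous_of_hasDerivAt hk
  set E'' : ℝ → ℂ := fun s => Complex.I * k' s * E s + Complex.I * k s * E' s with hE''
  have hE'c : Continuous E' := by
    rw [funext hE'k]; fun_prop
  have hE''c : Continuous E'' := by fun_prop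
  have hE'd : ∀ s, HasDerivAt E' (E'' s) s := fun s => by
    rw [funext hE'k]
    exact ((hk s).const_mul Complex.I).mul (hE s)
  have hav := continuous_av hEc
  have hav' := continuous_av hE'c
  have hav'' := continuous_av hE''c
  have hdq := continuous_dq hEc
  have hvq := Complex.continuous_ofReal.comp_continuousOn (continuousOn_vq (β := β) hEc hpos)
  have hdqs := continuous_dqs hEc hE'c
  have hdq' := Complex.continuous_ofReal.comp hdq
  have hcE : Continuous fun s => conj (E s) := Complex.continuous_conj.comp hEc
  have hmain : HasDerivAt (zetaU β E E') (-∫ σ in (-(1 / 2) : ℝ)..(1 / 2), kap β σ *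
      (av E'' s σ * (dq E s σ * vq β E s σ) +
        av E' s σ * (-(β / 2) * (vq β E s σ * dqs E E' s σ)))) s := by
    have h0 := (hasDerivAt_weighted_integral (n := kap β) (by norm_num) (integrableOn_kap hβ₁ hβ₂)
      (g := fun s σ => av E' s σ * (dq E s σ * vq β E s σ))
      (g' := fun s σ => av E'' s σ * (dq E s σ * vq β E s σ) +
        av E' s σ * (-(β / 2) * (vq β E s σ * dqs E E' s σ))) (s := s) ?_ ?_ ?_).neg
    · convert! h0 using 1
      ext u
      simp only [zetaU, Pi.neg_apply, mul_assoc]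
    · intro u
      exact continuousOn_slice (g := fun s σ => av E' s σ * (dq E s σ * vq β E s σ))
        (hav'.continuousOn.mul (hdq'.continuousOn.mul hvq)) u
    · exact (hav''.continuousOn.mul (hdq'.continuousOn.mul hvq)).add
        (hav'.continuousOn.mul (continuousOn_const.mul (hvq.mul hdqs.continuousOn)))
    · intro u σ hσ
      exact (hasDerivAt_av hE'd hE''c u σ).mul
        (hasDerivAt_dq_mul_vq hE hE'c fun s => hpos s σ hσ)
  convert! hmain using 1
  have hEE : E s * conj (E s) = 1 := by
    rw [Complex.mul_conj, Complex.normSq_eq_norm_sq, hu s]; simp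
  set DV : ℝ → ℂ := fun σ => dq E s σ * vq β E s σ with hDV
  have cdv : ContinuousOn DV 𝕁 :=
    continuousOn_slice (g := fun s σ => (dq E s σ * vq β E s σ : ℂ)) (hdq'.continuousOn.mul hvq) s
  have cav' : Continuous (av E' s) := hav'.comp (by fun_prop : Continuous fun σ : ℝ => (s, σ))
  have cavk : Continuous (av k' s) :=
    (continuous_av hk').comp (by fun_prop : Continuous fun σ : ℝ => (s, σ))
  have cvq := continuousOn_vq_slice (β := β) hEc hpos s
  have cdqs : Continuous (dqs E E' s) := hdqs.comp (by fun_prop : Continuous fun σ : ℝ => (s, σ))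
  have cgq := continuousOn_gq (β := β) hEc hE'c s hpos
  have cks : Continuous fun σ => k (s + σ) := by fun_prop
  set A1 : ℝ → ℂ := av k' s
  set A2 : ℝ → ℂ := fun σ => (k (s + σ) - k s) * gq β E E' s σ with hA2
  set A3 : ℝ → ℂ := fun σ => k (s + σ) * av E' s σ * conj (E s) * dq E s σ * vq β E s σ with hA3
  set A4 : ℝ → ℂ := fun σ => av E' s σ * vq β E s σ * dqs E E' s σ with hA4
  have i1 := intervalIntegrable_kap_mul hβ₁ hβ₂ (g := A1) cavk.continuousOn
  have i2 := intervalIntegrable_kap_mul hβ₁ hβ₂ (g := A2)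
    ((cks.continuousOn.sub continuousOn_const).mul cgq)
  have i3 := intervalIntegrable_kap_mul hβ₁ hβ₂ (g := A3) (by
    have : A3 = fun σ => k (s + σ) * av E' s σ * conj (E s) * DV σ := by
      ext σ; simp only [hA3, hDV]; ring
    rw [this]
    exact ((cks.continuousOn.mul cav'.continuousOn).mul continuousOn_const).mul cdv)
  have i4 := intervalIntegrable_kap_mul hβ₁ hβ₂ (g := A4)
    ((cav'.continuousOn.mul cvq).mul cdqs.continuousOn)
  have hpt : ∀ σ ∈ uIcc (-(1 / 2) : ℝ) (1 / 2), kap β σ *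
      (av E'' s σ * (dq E s σ * vq β E s σ) +
        av E' s σ * (-(β / 2) * (vq β E s σ * dqs E E' s σ))) =
      E s * (Complex.I * (kap β σ * A1 σ) + Complex.I * (kap β σ * A2 σ) +
        Complex.I * (kap β σ * A3 σ)) + (-(β / 2)) * (kap β σ * A4 σ) := by
    intro σ hσ
    rw [uIcc_of_le (by norm_num)] at hσ
    by_cases h0 : σ = 0
    · simp [h0, kap]
    have hσ0 : (σ : ℂ) ≠ 0 := by exact_mod_cast h0
    have e1 := mul_av hE'd hE''c s σ
    have e2 := mul_av hk hk' s σ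
    have e3 := mul_av hE hE'c s σ
    have e4 := mul_gq (β := β) hE hE'c (hu s) hσ hpos
    have e5 : av E'' s σ * DV σ = E s * (Complex.I * A1 σ + Complex.I * A2 σ + Complex.I * A3 σ) := by
      apply mul_left_cancel₀ hσ0
      have e4' : DV σ = 1 + σ * gq β E E' s σ := by rw [e4]; ring
      have e6 : A3 σ = k (s + σ) * av E' s σ * conj (E s) * DV σ := by
        simp only [hA3, hDV]; ring
      rw [e6, ← mul_assoc, e1, hE'k, hE'k]
      have e7 : E (s + σ) = E s + σ * av E' s σ := by rw [e3]; ring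
      rw [e7]
      simp only [hA2]
      have e8 : σ * (E s * (Complex.I * A1 σ + Complex.I * ((k (s + σ) - k s) * gq β E E' s σ) +
          Complex.I * (k (s + σ) * av E' s σ * conj (E s) * DV σ))) =
          E s * Complex.I * (σ * A1 σ) + E s * Complex.I * (k (s + σ) - k s) * (σ * gq β E E' s σ)
          + (E s * conj (E s)) * Complex.I * k (s + σ) * (σ * av E' s σ) * DV σ := by ring
      rw [e8, hEE, e4', e2]
      ring
    have e9 : kap β σ * (av E'' s σ * (dq E s σ * vq β E s σ) +
        av E' s σ * (-(β / 2) * (vq β E s σ * dqs E E' s σ))) = kap β σ * (av E'' s σ * DV σ) +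
        (-(β / 2)) * (kap β σ * A4 σ) := by
      simp only [hDV, hA4]; ring
    rw [e9, e5]
    ring
  rw [intervalIntegral.integral_congr hpt, intervalIntegral.integral_add
    ((((i1.const_mul _).add (i2.const_mul _)).add (i3.const_mul _)).const_mul _) (i4.const_mul _),
    intervalIntegral.integral_const_mul, intervalIntegral.integral_const_mul,
    intervalIntegral.integral_add ((i1.const_mul _).add (i2.const_mul _)) (i3.const_mul _),
    intervalIntegral.integral_add (i1.const_mul _) (i2.const_mul _),
    intervalIntegral.integral_const_mul, intervalIntegral.integral_const_mul,
    intervalIntegral.integral_const_mul, dispU, remU]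
  change E s * (Complex.I * -(∫ σ in (-(1 / 2) : ℝ)..(1 / 2), kap β σ * A1 σ) +
    (-Complex.I * (∫ σ in (-(1 / 2) : ℝ)..(1 / 2), kap β σ * A2 σ)
      - Complex.I * (∫ σ in (-(1 / 2) : ℝ)..(1 / 2), kap β σ * A3 σ)
      + (β / 2) * (conj (E s) * ∫ σ in (-(1 / 2) : ℝ)..(1 / 2), kap β σ * A4 σ))) = _
  linear_combination ((β / 2) * ∫ σ in (-(1 / 2) : ℝ)..(1 / 2), kap β σ * A4 σ) * hEE

end

namespace Wien

/-- A local inverse of `x ↦ exp x - 1` at the origin of a Wiener algebra. -/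
def log1p {K : Type} [TopologicalSpace K] [CompactSpace K] {ω : C(K, ℝ≥0)} :
    Wien K ω → Wien K ω := (exists_log1p K ω).choose

theorem log1p_zero {K : Type} [TopologicalSpace K] [CompactSpace K] {ω : C(K, ℝ≥0)} :
    log1p (0 : Wien K ω) = 0 := (exists_log1p K ω).choose_spec.1

theorem contDiffAt_log1p {K : Type} [TopologicalSpace K] [CompactSpace K] {ω : C(K, ℝ≥0)} :
    ContDiffAt ℝ 1 (log1p : Wien K ω → Wien K ω) 0 := (exists_log1p K ω).choose_spec.2.1

theorem exp_log1p (K : Type) [TopologicalSpace K] [CompactSpace K] (ω : C(K, ℝ≥0)) :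
    ∃ ε > 0, ∀ x : Wien K ω, ‖x‖ < ε → NormedSpace.exp (log1p x) = 1 + x ∧ ‖log1p x‖ < 1 :=
  (exists_log1p K ω).choose_spec.2.2

/-- The Wiener algebra in the time variable. -/
abbrev W1 (ρ : ℝ) : Type := Wien unitInterval (wt ρ)
/-- The Wiener algebra in the time and the kernel variable. -/
abbrev W2 (ρ : ℝ) : Type := Wien (unitInterval × Sg) (lw (wt ρ))

/-- A base tangent field `E` with its angular speed `k`, the derivative `k'`, and the powers
`V = D^{-β/2-1}` and `M = D^{-1}` of the chord-arc function `D` of `E`. -/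
structure Base (ρ : ℝ) where
  E : W1 ρ
  k : W1 ρ
  k' : W1 ρ
  V : W2 ρ
  M : W2 ρ

variable {ρ : ℝ}

/-- The chord-arc function `D` of a tangent field. -/
def chord (E : W1 ρ) : W2 ρ := avg E * avg (conjOp E)

/-- The power `D^{-β/2-1}` near the base point. -/
def Base.pow (B : Base ρ) (β : ℝ) (D : W2 ρ) : W2 ρ :=
  B.V * NormedSpace.exp ((-(β / 2 + 1) : ℂ) • log1p ((D - chord B.E) * B.M))

theorem Base.contDiffAt_pow (B : Base ρ) (β : ℝ) : ContDiffAt ℝ 1 (B.pow β) (chord B.E) := by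
  have h1 : ContDiffAt ℝ 1 (fun D : W2 ρ => (D - chord B.E) * B.M) (chord B.E) :=
    contDiffAt_mul (contDiffAt_id.sub contDiffAt_const) contDiffAt_const
  have h2 : ContDiffAt ℝ 1 (fun D : W2 ρ => log1p ((D - chord B.E) * B.M)) (chord B.E) := by
    refine ContDiffAt.comp (chord B.E) (g := log1p) ?_ h1
    simpa using contDiffAt_log1p
  exact contDiffAt_mul contDiffAt_const (contDiffAt_exp (contDiffAt_smul _ h2))

/-- The perturbation of the angle. -/
def phi (ψ : W1 ρ) : W1 ρ := reOp (mB ψ)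

/-- The angular speed. -/
def Base.kk (B : Base ρ) (ψ : W1 ρ) : W1 ρ := B.k + reOp (mB' ψ)

/-- The tangent field. -/
def Base.tan (B : Base ρ) (ψ : W1 ρ) : W1 ρ := B.E * NormedSpace.exp (Complex.I • phi ψ)

/-- The derivative of the tangent field. -/
def Base.tan' (B : Base ρ) (ψ : W1 ρ) : W1 ρ := Complex.I • (B.kk ψ * B.tan ψ)

section ops

variable (β : ℝ) (hβ₁ : 1 < β) (hβ₂ : β < 2) (V : W2 ρ) (E E' k : W1 ρ)

/-- The difference quotient `(D^{-β/2} - 1) / σ`. -/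
def gOp : W2 ρ :=
  (-(β / 2) : ℂ) • cavg (V * (avgc E' * avg (conjOp E) + avg E * avgc (conjOp E')))

/-- The velocity. -/
def zOp : W1 ρ := -intOp (kap β) (integrableOn_kap hβ₁ hβ₂) (avg E' * chord E * V)

/-- The lower order part of the derivative of the velocity. -/
def rOp : W1 ρ :=
  -Complex.I • intOp (kap β) (integrableOn_kap hβ₁ hβ₂) ((sh k - pull k) * gOp β V E E')
  - Complex.I • intOp (kap β) (integrableOn_kap hβ₁ hβ₂)
      (sh k * avg E' * pull (conjOp E) * chord E * V)
  + (β / 2 : ℂ) • (conjOp E * intOp (kap β) (integrableOn_kap hβ₁ hβ₂)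
      (avg E' * V * (avg E' * avg (conjOp E) + avg E * avg (conjOp E'))))

variable (n : ℝ → ℝ) (hn : IntegrableOn n 𝕁)

/-- The tangential velocity. -/
def lOp (R : W1 ρ) : W1 ρ :=
  mQ (reOp R) - ev0 (mQ (reOp R)) + ev0 (intOp n hn (chord E * V))

end ops

variable (β : ℝ) (hβ₁ : 1 < β) (hβ₂ : β < 2) (n : ℝ → ℝ)
  (hn : IntegrableOn n 𝕁)

/-- `pow` at the chord-arc function of the tangent field. -/
def Base.vv (B : Base ρ) (ψ : W1 ρ) : W2 ρ := B.pow β (chord (B.tan ψ))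

/-- The remainder at a perturbation of the base. -/
def Base.rr (B : Base ρ) (ψ : W1 ρ) : W1 ρ :=
  rOp β hβ₁ hβ₂ (B.vv β ψ) (B.tan ψ) (B.tan' ψ) (B.kk ψ)

/-- The tangential velocity at a perturbation of the base. -/
def Base.ll (B : Base ρ) (ψ : W1 ρ) : W1 ρ :=
  lOp (B.vv β ψ) (B.tan ψ) n hn (B.rr β hβ₁ hβ₂ ψ)

/-- The nonlinearity in the equation for the angle. -/
def Base.nonlin (B : Base ρ) (ψ : W1 ρ) : W1 ρ :=
  imOp (B.rr β hβ₁ hβ₂ ψ) + B.ll β hβ₁ hβ₂ n hn ψ * B.kk ψ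
    + -intOp (kap β) (integrableOn_kap hβ₁ hβ₂) (avg B.k')

theorem Base.contDiffAt_tan (B : Base ρ) (x : W1 ρ) : ContDiffAt ℝ 1 B.tan x :=
  contDiffAt_mul contDiffAt_const (contDiffAt_exp (contDiffAt_smul _
    (contDiffAt_rclm reOp (contDiffAt_clm mB contDiffAt_id))))

theorem Base.contDiffAt_kk (B : Base ρ) (x : W1 ρ) : ContDiffAt ℝ 1 B.kk x :=
  contDiffAt_const.add (contDiffAt_rclm reOp (contDiffAt_clm mB' contDiffAt_id))

theorem Base.contDiffAt_tan' (B : Base ρ) (x : W1 ρ) : ContDiffAt ℝ 1 B.tan' x :=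
  contDiffAt_smul _ (contDiffAt_mul (B.contDiffAt_kk x) (B.contDiffAt_tan x))

theorem Base.contDiffAt_chord (B : Base ρ) (x : W1 ρ) :
    ContDiffAt ℝ 1 (fun ψ => chord (B.tan ψ)) x :=
  contDiffAt_mul (contDiffAt_clm avg (B.contDiffAt_tan x))
    (contDiffAt_clm avg (contDiffAt_rclm conjOp (B.contDiffAt_tan x)))

@[simp] theorem Base.tan_zero (B : Base ρ) : B.tan 0 = B.E := by
  simp [Base.tan, phi, NormedSpace.exp_zero]

theorem Base.contDiffAt_vv (B : Base ρ) : ContDiffAt ℝ 1 (B.vv β) 0 := by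
  refine ContDiffAt.comp (0 : W1 ρ) (g := B.pow β) ?_ (B.contDiffAt_chord 0)
  rw [B.tan_zero]
  exact B.contDiffAt_pow β

theorem Base.contDiffAt_rr (B : Base ρ) : ContDiffAt ℝ 1 (B.rr β hβ₁ hβ₂) 0 := by
  have hV := B.contDiffAt_vv β
  have hE := B.contDiffAt_tan 0
  have hE' := B.contDiffAt_tan' 0
  have hk := B.contDiffAt_kk 0
  have hF := contDiffAt_rclm conjOp hE
  have hF' := contDiffAt_rclm conjOp hE'
  have hG : ContDiffAt ℝ 1 (fun ψ => gOp β (B.vv β ψ) (B.tan ψ) (B.tan' ψ)) 0 :=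
    contDiffAt_smul _ (contDiffAt_clm cavg (contDiffAt_mul hV
      ((contDiffAt_mul (contDiffAt_clm avgc hE') (contDiffAt_clm avg hF)).add
        (contDiffAt_mul (contDiffAt_clm avg hE) (contDiffAt_clm avgc hF')))))
  refine ((contDiffAt_smul _ (contDiffAt_clm _ (contDiffAt_mul
    ((contDiffAt_clm sh hk).sub (contDiffAt_clm pull hk)) hG))).sub
    (contDiffAt_smul _ (contDiffAt_clm _ (contDiffAt_mul (contDiffAt_mul (contDiffAt_mul
      (contDiffAt_mul (contDiffAt_clm sh hk) (contDiffAt_clm avg hE')) (contDiffAt_clm pull hF))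
      (B.contDiffAt_chord 0)) hV)))).add
    (contDiffAt_smul _ (contDiffAt_mul hF (contDiffAt_clm _ (contDiffAt_mul
      (contDiffAt_mul (contDiffAt_clm avg hE') hV)
      ((contDiffAt_mul (contDiffAt_clm avg hE') (contDiffAt_clm avg hF)).add
        (contDiffAt_mul (contDiffAt_clm avg hE) (contDiffAt_clm avg hF')))))))

theorem Base.contDiffAt_nonlin (B : Base ρ) :
    ContDiffAt ℝ 1 (B.nonlin β hβ₁ hβ₂ n hn) 0 := by
  have hR := B.contDiffAt_rr β hβ₁ hβ₂
  have hQ := contDiffAt_clm mQ (contDiffAt_rclm reOp hR)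
  have hl : ContDiffAt ℝ 1 (B.ll β hβ₁ hβ₂ n hn) 0 :=
    (hQ.sub (contDiffAt_clm ev0 hQ)).add (contDiffAt_clm ev0 (contDiffAt_clm _
      (contDiffAt_mul (B.contDiffAt_chord 0) (B.contDiffAt_vv β))))
  exact ((contDiffAt_rclm imOp hR).add (contDiffAt_mul hl (B.contDiffAt_kk 0))).add contDiffAt_const

section eval

variable {β} {E E' k : W1 ρ} {V : W2 ρ} {r : unitInterval}

/-- The restriction to the real axis at a given time. -/
def rl {ω : C(unitInterval, ℝ≥0)} (f : Wien unitInterval ω) (r : unitInterval) (s : ℝ) : ℂ := ev f r s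

theorem ev_avg_eq {ω : C(unitInterval, ℝ≥0)} (f : Wien unitInterval ω) (σ : Sg) (s : ℝ) : ev (avg f) (r, σ) s = av (rl f r) s σ := by
  rw [ev_avg _ _ _ (inS_ofReal r s)]
  simp [av, rl]

theorem ev_avgc_eq {ω : C(unitInterval, ℝ≥0)} (f : Wien unitInterval ω) (σ : Sg) (s : ℝ) : ev (avgc f) (r, σ) s = avc (rl f r) s σ := by
  rw [ev_avgc _ _ _ (inS_ofReal r s)]
  simp [avc, rl]

theorem av_conj (f : ℝ → ℂ) (s σ : ℝ) : av (fun s => conj (f s)) s σ = conj (av f s σ) := by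
  rw [av, av, intervalIntegral.integral_of_le zero_le_one,
    intervalIntegral.integral_of_le zero_le_one, ← integral_conj]

theorem avc_conj (f : ℝ → ℂ) (s σ : ℝ) : avc (fun s => conj (f s)) s σ = conj (avc f s σ) := by
  rw [avc, avc, intervalIntegral.integral_of_le zero_le_one,
    intervalIntegral.integral_of_le zero_le_one, ← integral_conj]
  simp

theorem rl_conj {ω : C(unitInterval, ℝ≥0)} (f : Wien unitInterval ω) : rl (conjOp f) r = fun s => conj (rl f r s) := by
  ext s
  simp [rl, ev_conjOp]

theorem ev_chord (f : W1 ρ) (σ : Sg) (s : ℝ) : ev (chord f) (r, σ) s = dq (rl f r) s σ := by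
  rw [chord, ev_mul _ _ (inS_ofReal _ s), ev_avg_eq, ev_avg_eq, rl_conj, av_conj, dq_eq]

theorem ev_gOp (hV : ∀ (σ : Sg) (s : ℝ), ev V (r, σ) s = vq β (rl E r) s σ) (σ : Sg) (s : ℝ) :
    ev (gOp β V E E') (r, σ) s = gq β (rl E r) (rl E' r) s σ := by
  rw [gOp, ev_smul, ev_cavg _ _ _ (inS_ofReal r s), gq]
  congr 1
  refine intervalIntegral.integral_congr fun c hc => ?_
  rw [uIcc_of_le zero_le_one] at hc
  rw [ev_mul _ _ (inS_ofReal _ s), ev_add _ _ (inS_ofReal _ s), ev_mul _ _ (inS_ofReal _ s),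
    ev_mul _ _ (inS_ofReal _ s), hV, ev_avg_eq, ev_avg_eq, ev_avgc_eq, ev_avgc_eq, rl_conj, rl_conj,
    av_conj, avc_conj, prSg_of_mem (mul_mem_Sg hc σ), dqd]

theorem ev_intOp_kap {ω : C(unitInterval, ℝ≥0)} (hβ₁ : 1 < β) (hβ₂ : β < 2)
    (f : Wien (unitInterval × Sg) (lw ω)) (g : ℝ → ℂ) (s : ℝ)
    (h : ∀ σ : Sg, ev f (r, σ) s = g σ) :
    ev (intOp (kap β) (integrableOn_kap hβ₁ hβ₂) f) r s =
      ∫ σ in (-(1 / 2) : ℝ)..(1 / 2), kap β σ * g σ := by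
  rw [ev_intOp _ _ _ _ (inS_ofReal r s)]
  refine intervalIntegral.integral_congr fun c hc => ?_
  rw [uIcc_of_le (by norm_num)] at hc
  rw [h, prSg_of_mem hc]

theorem ev_zOp (hβ₁ : 1 < β) (hβ₂ : β < 2)
    (hV : ∀ (σ : Sg) (s : ℝ), ev V (r, σ) s = vq β (rl E r) s σ) (s : ℝ) :
    ev (zOp β hβ₁ hβ₂ V E E') r s = zetaU β (rl E r) (rl E' r) s := by
  rw [zOp, ev_neg, zetaU, ev_intOp_kap hβ₁ hβ₂ _
    (fun σ => av (rl E' r) s σ * dq (rl E r) s σ * vq β (rl E r) s σ)]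
  intro σ
  rw [ev_mul _ _ (inS_ofReal _ s), ev_mul _ _ (inS_ofReal _ s), hV, ev_avg_eq, ev_chord]

theorem ev_rOp (hβ₁ : 1 < β) (hβ₂ : β < 2)
    (hV : ∀ (σ : Sg) (s : ℝ), ev V (r, σ) s = vq β (rl E r) s σ) (s : ℝ) :
    ev (rOp β hβ₁ hβ₂ V E E' k) r s = remU β (rl E r) (rl E' r) (rl k r) s := by
  have hs := inS_ofReal (ω := wt ρ) r s
  rw [rOp, ev_add _ _ hs, ev_sub _ _ hs, ev_smul, ev_smul, ev_smul, ev_mul _ _ hs, remU,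
    ev_intOp_kap hβ₁ hβ₂ _ (fun σ => (rl k r (s + σ) - rl k r s) * gq β (rl E r) (rl E' r) s σ),
    ev_intOp_kap hβ₁ hβ₂ _ (fun σ => rl k r (s + σ) * av (rl E' r) s σ * conj (rl E r s) *
      dq (rl E r) s σ * vq β (rl E r) s σ),
    ev_intOp_kap hβ₁ hβ₂ _ (fun σ => av (rl E' r) s σ * vq β (rl E r) s σ *
      dqs (rl E r) (rl E' r) s σ)]
  · rw [ev_conjOp, Complex.conj_ofReal]
    rfl
  · intro σ
    have hs' := inS_ofReal (ω := lw (wt ρ)) (r, σ) s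
    rw [ev_mul _ _ hs', ev_mul _ _ hs', ev_add _ _ hs', ev_mul _ _ hs', ev_mul _ _ hs', hV,
      ev_avg_eq, ev_avg_eq, ev_avg_eq, ev_avg_eq, rl_conj, rl_conj, av_conj, av_conj, dqs]
  · intro σ
    have hs' := inS_ofReal (ω := lw (wt ρ)) (r, σ) s
    rw [ev_mul _ _ hs', ev_mul _ _ hs', ev_mul _ _ hs', ev_mul _ _ hs', hV, ev_chord, ev_avg_eq,
      ev_sh _ _ _ hs, ev_pull _ _ _ hs, ev_conjOp, Complex.conj_ofReal]
    simp [rl]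
  · intro σ
    have hs' := inS_ofReal (ω := lw (wt ρ)) (r, σ) s
    rw [ev_mul _ _ hs', ev_sub _ _ hs', ev_gOp hV, ev_sh _ _ _ hs, ev_pull _ _ _ hs]
    simp [rl]

theorem ev_lOp (hV : ∀ (σ : Sg) (s : ℝ), ev V (r, σ) s = vq β (rl E r) s σ)
    (R : W1 ρ) (s : ℝ) : ev (lOp V E n hn R) r s = ev (mQ (reOp R)) r s - ev (mQ (reOp R)) r 0 +
      ((∫ σ in (-(1 / 2) : ℝ)..(1 / 2), n σ * (dq (rl E r) 0 σ * vq β (rl E r) 0 σ) : ℝ) : ℂ) := by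
  have hs := inS_ofReal (ω := wt ρ) r s
  rw [lOp, ev_add _ _ hs, ev_sub _ _ hs, ev_ev0, ev_ev0]
  congr 1
  have h0 := ev_intOp n hn (chord E * V) r (inS_ofReal r 0)
  rw [Complex.ofReal_zero] at h0
  rw [h0, ← intervalIntegral.integral_ofReal]
  refine intervalIntegral.integral_congr fun c hc => ?_
  rw [uIcc_of_le (by norm_num)] at hc
  have hs' := inS_ofReal (ω := lw (wt ρ)) (r, prSg c) 0
  rw [Complex.ofReal_zero] at hs'
  have h1 := hV (prSg c) 0
  have h2 := ev_chord (r := r) E (prSg c) 0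
  rw [Complex.ofReal_zero] at h1 h2
  rw [ev_mul _ _ hs', h1, h2, prSg_of_mem hc]
  push_cast
  rfl

end eval

end Wien

/-- A polynomial is dominated by an exponential. -/
theorem sq_mul_exp_le {a x : ℝ} (ha : 0 < a) (hx : 0 ≤ x) : x ^ 2 * Real.exp (-(a * x)) ≤ 4 / a ^ 2 := by
  have h1 : a * x / 2 ≤ Real.exp (a * x / 2) := by linarith [Real.add_one_le_exp (a * x / 2)]
  have h2 : (a * x / 2) ^ 2 ≤ Real.exp (a * x) := by
    calc _ ≤ Real.exp (a * x / 2) ^ 2 := by gcongr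
      _ = _ := by rw [← Real.exp_nat_mul]; congr 1; push_cast; ring
  rw [Real.exp_neg, ← div_eq_mul_inv, div_le_div_iff₀ (Real.exp_pos _) (by positivity)]
  nlinarith

theorem mul_exp_le {a x : ℝ} (ha : 0 < a) : x * Real.exp (-(a * x)) ≤ 1 / a := by
  have h1 : a * x ≤ Real.exp (a * x) := by linarith [Real.add_one_le_exp (a * x)]
  rw [Real.exp_neg, ← div_eq_mul_inv, div_le_div_iff₀ (Real.exp_pos _) ha]
  linarith

namespace Wien

section general

variable {K : Type} [TopologicalSpace K] [CompactSpace K] [FirstCountableTopology K]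
  {ω : C(K, ℝ≥0)}

theorem co_reOp (f : Wien K ω) (n : ℤ) (x : K) :
    co (reOp f) n x = (co f n x + conj (co f (-n) x)) / 2 := by
  rw [reOp_apply, co_smul, co_add, co_conjOp]
  ring

/-- The second derivative, as a map to absolutely convergent Fourier series. -/
def der2 (a : ℝ) (ha : 0 < a) (h : ∀ x, a ≤ ω x) : Wien K ω →L[ℂ] Wien K (0 : C(K, ℝ≥0)) :=
  (mulData (.id K) (fun n => .const K ((2 * π * Complex.I * n) ^ 2))
    (4 * π ^ 2 * (4 / a ^ 2)) (by positivity) fun n x => by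
    have h1 : ‖(2 * π * Complex.I * n : ℂ) ^ 2‖ = 4 * π ^ 2 * |(n : ℝ)| ^ 2 := by
      simp only [norm_pow, norm_mul, Complex.norm_real, Complex.norm_I, Complex.norm_ofNat,
        Complex.norm_intCast, Real.norm_eq_abs, abs_of_pos Real.pi_pos]
      ring
    simp only [ContinuousMap.const_apply, ContinuousMap.zero_apply, NNReal.coe_zero, zero_sub,
      ContinuousMap.id_apply, h1]
    have h2 : Real.exp (-(ω x : ℝ) * |(n : ℝ)|) ≤ Real.exp (-(a * |(n : ℝ)|)) := by
      rw [Real.exp_le_exp]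
      have := mul_le_mul_of_nonneg_right (h x) (abs_nonneg (n : ℝ))
      linarith
    calc _ ≤ 4 * π ^ 2 * |(n : ℝ)| ^ 2 * Real.exp (-(a * |(n : ℝ)|)) := by gcongr
      _ = 4 * π ^ 2 * (|(n : ℝ)| ^ 2 * Real.exp (-(a * |(n : ℝ)|))) := by ring
      _ ≤ _ := by
        have := sq_mul_exp_le ha (abs_nonneg (n : ℝ))
        gcongr).op

theorem co_der2 (a : ℝ) (ha : 0 < a) (h : ∀ x, a ≤ ω x) (f : Wien K ω) (n : ℤ) (x : K) :
    co (der2 a ha h f) n x = (2 * π * Complex.I * n) ^ 2 * co f n x := by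
  rw [der2, co_mulData]
  rfl

/-- Termwise differentiation, between algebras with different weights. -/
theorem hasDerivAt_ev' {ω' : C(K, ℝ≥0)} {f : Wien K ω} {g : Wien K ω'} {x : K}
    (h : ∀ k, co g k x = 2 * π * Complex.I * k * co f k x) (s : ℝ) :
    HasDerivAt (fun s : ℝ => ev f x s) (ev g x s) s := by
  have key := hasDerivAt_tsum (u := fun k => ‖cf g k‖) (y₀ := s) g.summable_cf
    (g := fun k (s : ℝ) => cf f k x * ex ω x s k) (g' := fun k (s : ℝ) => cf g k x * ex ω' x s k)
    (fun k s => ?_) (fun k s => norm_term_le g (inS_ofReal x s) k)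
    (summable_term f (inS_ofReal x s)) s
  · exact key
  · simp_rw [← co_mul_exp, h k]
    have h1 : HasDerivAt (fun s : ℝ => (2 * π * Complex.I * k * s : ℂ))
        (2 * π * Complex.I * k) s := by
      simpa using (Complex.ofRealCLM.hasDerivAt (x := s)).const_mul (2 * π * Complex.I * k : ℂ)
    convert! (h1.cexp.const_mul (co f k x)) using 1
    ring

/-- The real symbol of the dispersive operator: `2πn ∫ (1 - e^{2πinσ}) |σ|^{-β} dσ`. -/
def dsym (β : ℝ) (n : ℤ) : ℝ :=
  (2 * π * n) ^ 2 * ∫ σ in (-(1 / 2) : ℝ)..(1 / 2), kap β σ *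
    ∫ c in (0 : ℝ)..1, Real.sin (2 * π * n * c * σ)

theorem dsym_neg (β : ℝ) (n : ℤ) : dsym β (-n) = -dsym β n := by
  have h : ∀ c σ : ℝ, Real.sin (2 * π * (-n : ℤ) * c * σ) =
      -Real.sin (2 * π * n * c * σ) := fun c σ => by
    rw [← Real.sin_neg]; push_cast; congr 1; ring
  simp only [dsym, h, intervalIntegral.integral_neg, mul_neg]
  push_cast
  ring

theorem co_disp {β : ℝ} (hβ₁ : 1 < β) (hβ₂ : β < 2) (g : Wien K ω) (n : ℤ) (x : K) :
    (2 * π * Complex.I * n) ^ 2 *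
      co (-intOp (kap β) (integrableOn_kap hβ₁ hβ₂) (avg g)) n x =
    Complex.I * dsym β n * co g n x := by
  have hpi : ∀ c σ : ℝ, Complex.exp (2 * π * Complex.I * n * (c * σ : ℝ)) =
      Real.cos (2 * π * n * c * σ) + Real.sin (2 * π * n * c * σ) * Complex.I := by
    intro c σ
    rw [Complex.ofReal_cos, Complex.ofReal_sin, ← Complex.exp_mul_I]
    congr 1
    push_cast
    ring
  have h1 : ∀ σ : Sg, co (avg g) n (x, σ) = ((∫ c in (0 : ℝ)..1, Real.cos (2 * π * n * c * σ)
      : ℝ) + (∫ c in (0 : ℝ)..1, Real.sin (2 * π * n * c * σ) : ℝ) * Complex.I) *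
      co g n x := by
    intro σ
    have h0 : co (avg g) n (x, σ) = ∫ c in Icc (0 : ℝ) 1, ((1 : ℝ) : ℂ) *
        Complex.exp (2 * π * Complex.I * n * (c * σ : ℝ)) * co g n x := by
      rw [avg, avgOp, OpData.co_op]
      rfl
    rw [h0, integral_Icc_eq_integral_Ioc, ← intervalIntegral.integral_of_le zero_le_one,
      intervalIntegral.integral_mul_const]
    congr 1
    simp_rw [hpi, Complex.ofReal_one, one_mul]
    rw [intervalIntegral.integral_add (Continuous.intervalIntegrable (by fun_prop) _ _)
      (Continuous.intervalIntegrable (by fun_prop) _ _), intervalIntegral.integral_mul_const,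
      intervalIntegral.integral_ofReal, intervalIntegral.integral_ofReal]
  have h2 : co (intOp (kap β) (integrableOn_kap hβ₁ hβ₂) (avg g)) n x =
      (∫ σ in (-(1 / 2) : ℝ)..(1 / 2), (kap β σ : ℂ) *
        ((∫ c in (0 : ℝ)..1, Real.cos (2 * π * n * c * σ)
      : ℝ) + (∫ c in (0 : ℝ)..1, Real.sin (2 * π * n * c * σ) : ℝ) * Complex.I)) *
        co g n x := by
    have h0 : co (intOp (kap β) (integrableOn_kap hβ₁ hβ₂) (avg g)) n x =
        ∫ σ in 𝕁, (kap β σ : ℂ) *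
        Complex.exp (2 * π * Complex.I * n * (0 : ℝ)) * co (avg g) n (x, prSg σ) := by
      rw [intOp, OpData.co_op]
      rfl
    rw [h0, integral_Icc_eq_integral_Ioc, ← intervalIntegral.integral_of_le (by norm_num),
      ← intervalIntegral.integral_mul_const]
    refine intervalIntegral.integral_congr fun σ hσ => ?_
    rw [uIcc_of_le (by norm_num)] at hσ
    simp only [h1, prSg_of_mem hσ]
    simp
    ring
  have hc1 : Continuous fun σ : ℝ => ∫ c in (0 : ℝ)..1, Real.cos (2 * π * n * c * σ) :=
    intervalIntegral.continuous_parametric_intervalIntegral_of_continuous' (by fun_prop) _ _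
  have hc2 : Continuous fun σ : ℝ => ∫ c in (0 : ℝ)..1, Real.sin (2 * π * n * c * σ) :=
    intervalIntegral.continuous_parametric_intervalIntegral_of_continuous' (by fun_prop) _ _
  have i1 := intervalIntegrable_kap_mul hβ₁ hβ₂ (g := fun σ =>
    ((∫ c in (0 : ℝ)..1, Real.cos (2 * π * n * c * σ) : ℝ) : ℂ))
    (Complex.continuous_ofReal.comp hc1).continuousOn
  have i2 := intervalIntegrable_kap_mul hβ₁ hβ₂ (g := fun σ =>
    ((∫ c in (0 : ℝ)..1, Real.sin (2 * π * n * c * σ) : ℝ) : ℂ))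
    (Complex.continuous_ofReal.comp hc2).continuousOn
  have hodd : ∫ σ in (-(1 / 2) : ℝ)..(1 / 2), (kap β σ : ℂ) *
      ((∫ c in (0 : ℝ)..1, Real.cos (2 * π * n * c * σ) : ℝ) : ℂ) = 0 := by
    have h := intervalIntegral.integral_comp_neg (a := -(1 / 2)) (b := 1 / 2) (fun σ : ℝ =>
      (kap β σ : ℂ) * ((∫ c in (0 : ℝ)..1, Real.cos (2 * π * n * c * σ) : ℝ) : ℂ))
    have h3 : ∀ σ : ℝ, (kap β (-σ) : ℂ) *
        ((∫ c in (0 : ℝ)..1, Real.cos (2 * π * n * c * (-σ)) : ℝ) : ℂ) =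
        -((kap β σ : ℂ) * ((∫ c in (0 : ℝ)..1, Real.cos (2 * π * n * c * σ) : ℝ) : ℂ)) := by
      intro σ
      have : ∀ c : ℝ, Real.cos (2 * π * n * c * (-σ)) = Real.cos (2 * π * n * c * σ) :=
        fun c => by rw [mul_neg, Real.cos_neg]
      simp_rw [this]
      simp [kap]
    simp_rw [h3] at h
    rw [intervalIntegral.integral_neg, neg_neg] at h
    exact self_eq_neg.1 h.symm
  have h5 : co (-intOp (kap β) (integrableOn_kap hβ₁ hβ₂) (avg g)) n x =
      -co (intOp (kap β) (integrableOn_kap hβ₁ hβ₂) (avg g)) n x := by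
    simp [co]
  rw [h5, h2]
  simp_rw [mul_add, ← mul_assoc]
  rw [intervalIntegral.integral_add i1 (i2.mul_const _), hodd, zero_add,
    intervalIntegral.integral_mul_const, dsym]
  have h6 : ∫ σ in (-(1 / 2) : ℝ)..(1 / 2), (kap β σ : ℂ) *
      ((∫ c in (0 : ℝ)..1, Real.sin (2 * π * n * c * σ) : ℝ) : ℂ) =
      ((∫ σ in (-(1 / 2) : ℝ)..(1 / 2), kap β σ *
        ∫ c in (0 : ℝ)..1, Real.sin (2 * π * n * c * σ) : ℝ) : ℂ) := by
    rw [← intervalIntegral.integral_ofReal]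
    congr 1
    ext σ
    push_cast
    rfl
  rw [h6]
  push_cast
  have hI := Complex.I_sq
  linear_combination (-(2 * π * n) ^ 2 * ((∫ σ in (-(1 / 2) : ℝ)..(1 / 2), kap β σ *
        ∫ c in (0 : ℝ)..1, Real.sin (2 * π * n * c * σ) : ℝ) : ℂ) * Complex.I *
        co g n x : ℂ) * hI

end general

/-- The projection of the real line to the unit interval. -/
def pI (r : ℝ) : unitInterval := projIcc 0 1 zero_le_one r

theorem continuous_pI : Continuous pI := continuous_projIcc (h := zero_le_one)

@[simp] theorem pI_coe (r : unitInterval) : pI r = r := projIcc_val _ r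

/-- Integration of a Fourier series in time, termwise. -/
theorem ev_eq_integral {ω ω' : C(unitInterval, ℝ≥0)} {f : Wien unitInterval ω}
    {g : Wien unitInterval ω'} {c : ℤ → ℂ}
    (h : ∀ n (r : unitInterval), co f n r = c n + ∫ r' in (0 : ℝ)..r, co g n (pI r'))
    (r : unitInterval) (s : ℝ) : ev f r s = ev f 0 s + ∫ r' in (0 : ℝ)..r, ev g (pI r') s := by
  have h0 : ∀ n, co f n 0 = c n := fun n => by simpa using h n 0
  have hs := intervalIntegral.hasSum_integral_of_dominated_convergence (μ := volume)
    (a := 0) (b := r) (ι := ℤ) (F := fun n r' => cf g n (pI r') * ex ω' (pI r') s n)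
    (f := fun r' => ev g (pI r') s) (fun n _ => ‖cf g n‖) ?_ ?_ ?_ ?_ ?_
  · have h1 := (hasSum_ev f (inS_ofReal r s)).sub (hasSum_ev f (inS_ofReal 0 s))
    have h2 : ∀ n, cf f n r * ex ω r s n - cf f n 0 * ex ω 0 s n =
        ∫ r' in (0 : ℝ)..r, cf g n (pI r') * ex ω' (pI r') s n := by
      intro n
      simp_rw [← co_mul_exp]
      rw [intervalIntegral.integral_mul_const, ← sub_mul, h n r, h0 n, add_sub_cancel_left]
    simp_rw [h2] at h1
    have h3 := hs.unique h1
    rw [h3]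
    ring
  · intro n
    have := continuous_pI
    refine Continuous.aestronglyMeasurable ?_
    unfold ex
    fun_prop
  · exact fun n => ae_of_all _ fun r' _ => norm_term_le g (inS_ofReal _ s) n
  · exact ae_of_all _ fun _ _ => g.summable_cf
  · exact intervalIntegrable_const
  · exact ae_of_all _ fun r' _ => hasSum_ev g (inS_ofReal _ s)

theorem wt_ge {ρ : ℝ} (hρ : 0 ≤ ρ) (r : unitInterval) : π * ρ ≤ wt ρ r := by
  rw [wt_apply hρ]
  have h : (r : ℝ) ≤ 1 := r.2.2
  nlinarith [mul_nonneg Real.pi_pos.le hρ]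

end Wien

/-- A tangent field of unit length with its angular speed `k`, and chord-arc function `dq`
bounded away from zero. -/
structure UnitState (E k k' : ℝ → ℂ) : Prop where
  norm_eq : ∀ s, ‖E s‖ = 1
  hasDerivAt : ∀ s, HasDerivAt E (Complex.I * k s * E s) s
  conj_k : ∀ s, conj (k s) = k s
  hasDerivAt_k : ∀ s, HasDerivAt k (k' s) s
  continuous_k' : Continuous k'
  dq_pos : ∀ s, ∀ σ ∈ 𝕁, 0 < dq E s σ

namespace Wien

variable {ρ : ℝ}

/-- The data of a base are those of an actual tangent field, at each time. -/
structure IsBase (β : ℝ) (B : Base ρ) : Prop where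
  state : ∀ r, UnitState (rl B.E r) (rl B.k r) (rl B.k' r)
  V : ∀ (r) (σ : Sg) (s : ℝ), ev B.V (r, σ) s = vq β (rl B.E r) s σ
  M : ∀ (r) (σ : Sg) (s : ℝ), ev B.M (r, σ) s * dq (rl B.E r) s σ = 1

theorem rl_phi (ψ : W1 ρ) (r : unitInterval) (s : ℝ) :
    rl (phi ψ) r s = ((ev (mB ψ) r s).re : ℂ) := ev_reOp _ _ _

theorem rl_tan (B : Base ρ) (ψ : W1 ρ) (r : unitInterval) (s : ℝ) :
    rl (B.tan ψ) r s = rl B.E r s * Complex.exp (Complex.I * rl (phi ψ) r s) := by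
  rw [rl, Base.tan, ev_mul _ _ (inS_ofReal r s), ev_exp _ (inS_ofReal r s), ev_I_smul]
  rfl

theorem rl_kk (B : Base ρ) (ψ : W1 ρ) (r : unitInterval) (s : ℝ) :
    rl (B.kk ψ) r s = rl B.k r s + ((ev (mB' ψ) r s).re : ℂ) := by
  rw [rl, Base.kk, ev_add _ _ (inS_ofReal r s), ev_reOp]
  rfl

theorem rl_tan' (B : Base ρ) (ψ : W1 ρ) (r : unitInterval) (s : ℝ) :
    rl (B.tan' ψ) r s = Complex.I * rl (B.kk ψ) r s * rl (B.tan ψ) r s := by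
  rw [rl, Base.tan', ev_I_smul, ev_mul _ _ (inS_ofReal r s), mul_assoc]
  rfl

/-- The second derivative of the perturbation of the angle. -/
def phi2 (hρ : 0 < ρ) (ψ : W1 ρ) : Wien unitInterval 0 :=
  der2 (π * ρ) (mul_pos Real.pi_pos hρ) (wt_ge hρ.le) (phi ψ)

theorem co_kk_sub (ψ : W1 ρ) (n : ℤ) (r : unitInterval) :
    co (reOp (mB' ψ)) n r = 2 * π * Complex.I * n * co (phi ψ) n r := by
  rw [phi, co_reOp, co_reOp, co_mB', co_mB']
  simp only [map_mul, Complex.conj_ofReal, Complex.conj_I, map_intCast, map_ofNat]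
  push_cast
  ring

theorem continuous_rl {ω : C(unitInterval, ℝ≥0)} (f : Wien unitInterval ω) (r : unitInterval) :
    Continuous (rl f r) :=
  (continuous_ev_param f).comp (by fun_prop : Continuous fun s : ℝ => (r, s))

theorem rl_periodic {ω : C(unitInterval, ℝ≥0)} (f : Wien unitInterval ω) (r : unitInterval) :
    Function.Periodic (rl f r) 1 := fun s => by
  rw [rl, Complex.ofReal_add, Complex.ofReal_one, ev_periodic]
  rfl

/-- The tangent field and the kernel of a perturbation of the base are the geometric ones. -/
def IsState (β : ℝ) (hρ : 0 < ρ) (B : Base ρ) (ψ : W1 ρ) : Prop := ∀ r,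
  UnitState (rl (B.tan ψ) r) (rl (B.kk ψ) r) (fun s => rl B.k' r s + rl (phi2 hρ ψ) r s) ∧
    ∀ (σ : Sg) (s : ℝ), ev (B.vv β ψ) (r, σ) s = vq β (rl (B.tan ψ) r) s σ

/-- The power of the chord-arc function, for tangent fields near the base. -/
theorem exists_pow (β : ℝ) (B : Base ρ) (hB : IsBase β B) :
    ∃ ε > 0, ∀ P : W1 ρ, ‖P - B.E‖ < ε → ∀ (r : unitInterval) (σ : Sg) (s : ℝ),
      0 < dq (rl P r) s σ ∧ ev (B.pow β (chord P)) (r, σ) s = vq β (rl P r) s σ := by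
  obtain ⟨ε, hε, hlog⟩ := exp_log1p (unitInterval × Sg) (lw (wt ρ))
  have hc : ContinuousAt (fun P => (chord P - chord B.E) * B.M) B.E := by
    have h1 : Continuous (chord : W1 ρ → W2 ρ) :=
      (avg (K := unitInterval) (ω := wt ρ)).continuous.mul
        ((avg (K := unitInterval) (ω := wt ρ)).continuous.comp
          (conjOp (K := unitInterval) (ω := wt ρ)).continuous)
    exact ((h1.sub continuous_const).mul continuous_const).continuousAt
  obtain ⟨δ, hδ, hδ'⟩ := Metric.continuousAt_iff.1 hc ε hε
  refine ⟨δ, hδ, fun P hP r σ s => ?_⟩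
  have hx : ‖(chord P - chord B.E) * B.M‖ < ε := by
    have := hδ' (x := P) (by rwa [dist_eq_norm])
    simpa [dist_eq_norm] using this
  obtain ⟨hl1, hl2⟩ := hlog _ hx
  have hs := inS_ofReal (ω := lw (wt ρ)) (r, σ) s
  have hd := (hB.state r).dq_pos s σ σ.2
  set D := dq (rl P r) s σ with hD
  set D₀ := dq (rl B.E r) s σ with hD₀
  set l := ev (log1p ((chord P - chord B.E) * B.M)) (r, σ) s with hl
  have h1 : Complex.exp l = ((D / D₀ : ℝ) : ℂ) := by
    rw [hl, ← ev_exp _ hs, hl1, ev_add _ _ hs, ev_one, ev_mul _ _ hs, ev_sub _ _ hs, ev_chord,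
      ev_chord, ← hD, ← hD₀]
    have hM := hB.M r σ s
    rw [← hD₀] at hM
    have : (D₀ : ℂ) ≠ 0 := by exact_mod_cast hd.ne'
    push_cast
    field_simp
    linear_combination (D - D₀ : ℂ) * hM
  have h2 : 0 ≤ D := by rw [hD]; unfold dq; positivity
  have h3 : 0 < D := by
    refine lt_of_le_of_ne h2 fun h => ?_
    rw [← h, zero_div] at h1
    exact Complex.exp_ne_zero _ h1
  have h4 : 0 < D / D₀ := by positivity
  have h5 : l = (Real.log (D / D₀) : ℂ) := by
    have h6 : ‖l‖ < 1 := (norm_ev_le _ hs).trans_lt hl2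
    have h7 := (abs_le.1 (Complex.abs_im_le_norm l))
    have hpi := Real.pi_gt_three
    rw [Complex.ofReal_log h4.le, ← h1, Complex.log_exp (by linarith) (by linarith)]
  refine ⟨h3, ?_⟩
  rw [Base.pow, ev_mul _ _ hs, hB.V, ev_exp _ hs, ev_smul, ← hl, h5, vq, vq, ← hD, ← hD₀]
  have h8 : (-(β / 2 + 1) : ℂ) * (Real.log (D / D₀) : ℂ) =
    ((Real.log (D / D₀) * (-(β / 2) - 1) : ℝ) : ℂ) := by push_cast; ring
  rw [h8, ← Complex.ofReal_exp, ← Real.rpow_def_of_pos h4, ← Complex.ofReal_mul,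
    ← Real.mul_rpow hd.le h4.le, mul_div_cancel₀ _ hd.ne']

theorem exists_state (β : ℝ) (hρ : 0 < ρ) (B : Base ρ) (hB : IsBase β B) :
    ∃ δ > 0, ∀ ψ : W1 ρ, ‖ψ‖ ≤ δ → IsState β hρ B ψ := by
  obtain ⟨ε, hε, hpow⟩ := exists_pow β B hB
  obtain ⟨δ, hδ, hδ'⟩ := Metric.continuousAt_iff.1 (B.contDiffAt_tan 0).continuousAt ε hε
  refine ⟨δ / 2, by positivity, fun ψ hψ r => ?_⟩
  have key := hpow (B.tan ψ) (by
    have := hδ' (x := ψ) (by rw [dist_zero_right]; linarith)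
    rwa [B.tan_zero, dist_eq_norm] at this) r
  have hst := hB.state r
  have hnorm : ∀ s, ‖rl (B.tan ψ) r s‖ = 1 := fun s => by
    rw [rl_tan, norm_mul, hst.norm_eq, rl_phi, mul_comm Complex.I, Complex.norm_exp_ofReal_mul_I,
      mul_one]
  have hphi : ∀ s, HasDerivAt (rl (phi ψ) r) (rl (reOp (mB' ψ)) r s) s := fun s =>
    hasDerivAt_ev (fun k => co_kk_sub ψ k r) s
  have hk2 : ∀ s, HasDerivAt (rl (reOp (mB' ψ)) r) (rl (phi2 hρ ψ) r s) s := fun s =>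
    hasDerivAt_ev' (fun k => by rw [phi2, co_der2, co_kk_sub]; ring) s
  have hkk : rl (B.kk ψ) r = fun s => rl B.k r s + rl (reOp (mB' ψ)) r s := by
    ext s
    rw [rl_kk, rl, rl, ev_reOp]
  refine ⟨⟨hnorm, fun s => ?_, fun s => ?_, fun s => ?_, ?_, fun s σ hσ => (key ⟨σ, hσ⟩ s).1⟩,
    fun σ s => (key σ s).2⟩
  · have h1 : rl (B.tan ψ) r = fun s => rl B.E r s * Complex.exp (Complex.I * rl (phi ψ) r s) :=
      funext fun s => rl_tan B ψ r s
    have h2 := (hst.hasDerivAt s).mul (((hphi s).const_mul Complex.I).cexp)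
    rw [h1]
    convert! h2 using 1
    rw [hkk]
    ring
  · rw [rl_kk, map_add, hst.conj_k, Complex.conj_ofReal]
  · rw [hkk]
    exact (hst.hasDerivAt_k s).add (hk2 s)
  · exact (continuous_rl _ r).add (continuous_rl _ r)

section

variable {β : ℝ} (hβ₁ : 1 < β) (hβ₂ : β < 2) (n : ℝ → ℝ)
  (hn : IntegrableOn n 𝕁)

/-- The tangential velocity of a unit state. -/
theorem ll_props {B : Base ρ} {ψ : W1 ρ} {r : unitInterval}
    (hV : ∀ (σ : Sg) (s : ℝ), ev (B.vv β ψ) (r, σ) s = vq β (rl (B.tan ψ) r) s σ) :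
    (∀ s, rl (B.rr β hβ₁ hβ₂ ψ) r s = remU β (rl (B.tan ψ) r) (rl (B.tan' ψ) r) (rl (B.kk ψ) r) s) ∧
    (∀ s, conj (rl (B.ll β hβ₁ hβ₂ n hn ψ) r s) = rl (B.ll β hβ₁ hβ₂ n hn ψ) r s) ∧
    (∀ s, HasDerivAt (rl (B.ll β hβ₁ hβ₂ n hn ψ) r)
      ((((co (B.rr β hβ₁ hβ₂ ψ) 0 r).re : ℝ) : ℂ) - ((rl (B.rr β hβ₁ hβ₂ ψ) r s).re : ℝ)) s) ∧
    rl (B.ll β hβ₁ hβ₂ n hn ψ) r 0 = ((∫ σ in (-(1 / 2) : ℝ)..(1 / 2),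
      n σ * (dq (rl (B.tan ψ) r) 0 σ * vq β (rl (B.tan ψ) r) 0 σ) : ℝ) : ℂ) := by
  have h0 := fun s => ev_lOp n hn hV (B.rr β hβ₁ hβ₂ ψ) s
  have hreal : ∀ s : ℝ, conj (ev (mQ (reOp (B.rr β hβ₁ hβ₂ ψ))) r s) =
      ev (mQ (reOp (B.rr β hβ₁ hβ₂ ψ))) r s := by
    intro s
    have : conjOp (mQ (reOp (B.rr β hβ₁ hβ₂ ψ))) = mQ (reOp (B.rr β hβ₁ hβ₂ ψ)) := by
      refine ext_co fun k x => ?_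
      rw [co_conjOp, co_mQ, co_mQ, co_reOp, co_reOp]
      simp only [map_mul, map_add, map_neg, map_div₀, map_inv₀, Complex.conj_conj,
        Complex.conj_ofReal, Complex.conj_I, map_intCast, map_ofNat, neg_neg]
      push_cast
      rw [show (2 * π * -Complex.I * -k : ℂ) = 2 * π * Complex.I * k by ring, add_comm]
    have h := ev_conjOp (mQ (reOp (B.rr β hβ₁ hβ₂ ψ))) r s
    rw [this, Complex.conj_ofReal] at h
    exact h.symm
  refine ⟨fun s => ev_rOp hβ₁ hβ₂ hV s, fun s => ?_, fun s => ?_, ?_⟩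
  · rw [rl, Base.ll, h0, map_add, map_sub, hreal, Complex.conj_ofReal]
    have := hreal 0
    rw [Complex.ofReal_zero] at this
    rw [this]
  · have h1 : rl (B.ll β hβ₁ hβ₂ n hn ψ) r = fun s => _ := funext fun s => h0 s
    rw [h1]
    refine (((hasDerivAt_ev_mQ (reOp (B.rr β hβ₁ hβ₂ ψ)) r s).sub_const _).add_const _).congr_deriv ?_
    rw [ev_reOp, co_reOp, neg_zero, Complex.add_conj]
    simp [rl]
  · rw [rl, Base.ll, h0, Complex.ofReal_zero, sub_self, zero_add]

theorem rl_nonlin (B : Base ρ) (ψ : W1 ρ) (r : unitInterval) (s : ℝ) :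
    rl (B.nonlin β hβ₁ hβ₂ n hn ψ) r s = ((rl (B.rr β hβ₁ hβ₂ ψ) r s).im : ℝ) +
      rl (B.ll β hβ₁ hβ₂ n hn ψ) r s * rl (B.kk ψ) r s + dispU β (rl B.k' r) s := by
  have hs := inS_ofReal (ω := wt ρ) r s
  rw [rl, Base.nonlin, ev_add _ _ hs, ev_add _ _ hs, ev_mul _ _ hs, ev_imOp, ev_neg, dispU,
    ev_intOp_kap hβ₁ hβ₂ (avg B.k') (fun σ => av (rl B.k' r) s σ)]
  · rfl
  · intro σ
    rw [ev_avg_eq]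

end

/-- Variation of constants. -/
theorem volterra_scalar {a : ℝ} {F u : ℝ → ℂ} (hF : Continuous F)
    (hu : ∀ r, u r = ∫ r' in (0 : ℝ)..r, Complex.exp (Complex.I * (a * (r - r') : ℝ)) * F r') (r : ℝ) :
    HasDerivAt u (Complex.I * a * u r + F r) r := by
  have h1 : u = fun r : ℝ => Complex.exp (Complex.I * a * r) *
      ∫ r' in (0 : ℝ)..r, Complex.exp (-(Complex.I * a * r')) * F r' := by
    ext r
    rw [hu, ← intervalIntegral.integral_const_mul]
    congr 1
    ext r'
    rw [← mul_assoc, ← Complex.exp_add]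
    congr 2
    push_cast
    ring
  have h2 : HasDerivAt (fun r : ℝ => Complex.exp (Complex.I * a * r))
      (Complex.exp (Complex.I * a * r) * (Complex.I * a)) r := by
    have : HasDerivAt (fun r : ℝ => (Complex.I * a * r : ℂ)) (Complex.I * a) r := by
      simpa using (Complex.ofRealCLM.hasDerivAt (x := r)).const_mul (Complex.I * a : ℂ)
    exact this.cexp
  have h3 : HasDerivAt (fun t : ℝ => ∫ r' in (0 : ℝ)..t, Complex.exp (-(Complex.I * a * r')) * F r')
      (Complex.exp (-(Complex.I * a * r)) * F r) r :=
    (Continuous.integral_hasStrictDerivAt (by fun_prop) 0 r).hasDerivAt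
  have h4 := h2.mul h3
  rw [h1]
  convert! h4 using 1
  rw [← mul_assoc (Complex.exp _) (Complex.exp _), ← Complex.exp_add]
  simp
  ring

theorem continuous_co_pI {ω : C(unitInterval, ℝ≥0)} (f : Wien unitInterval ω) (n : ℤ) :
    Continuous fun r => co f n (pI r) := by
  have := continuous_pI
  unfold co
  fun_prop

section

variable {β : ℝ} (hβ₁ : 1 < β) (hβ₂ : β < 2)

/-- The dispersive term of the perturbation of the angle. -/
def dispOp (hρ : 0 < ρ) (ψ : W1 ρ) : Wien unitInterval 0 :=
  -intOp (kap β) (integrableOn_kap hβ₁ hβ₂) (avg (phi2 hρ ψ))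

theorem rl_dispOp (hρ : 0 < ρ) (ψ : W1 ρ) (r : unitInterval) (s : ℝ) :
    rl (dispOp hβ₁ hβ₂ hρ ψ) r s = dispU β (rl (phi2 hρ ψ) r) s := by
  rw [rl, dispOp, ev_neg, dispU,
    ev_intOp_kap hβ₁ hβ₂ (avg (phi2 hρ ψ)) (fun σ => av (rl (phi2 hρ ψ) r) s σ)]
  intro σ
  rw [ev_avg_eq]

theorem co_intOp_avg {ω : C(unitInterval, ℝ≥0)} {ω' : C(unitInterval, ℝ≥0)}
    {f : Wien unitInterval ω} {g : Wien unitInterval ω'} {n : ℤ} {c : ℂ} {r : unitInterval}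
    (h : co g n r = c * co f n r) :
    co (intOp (kap β) (integrableOn_kap hβ₁ hβ₂) (avg g)) n r =
      c * co (intOp (kap β) (integrableOn_kap hβ₁ hβ₂) (avg f)) n r := by
  have h1 : ∀ σ : Sg, co (avg g) n (r, σ) = c * co (avg f) n (r, σ) := by
    intro σ
    rw [avg, avgOp, OpData.co_op, avg, avgOp, OpData.co_op, ← integral_const_mul]
    congr 1
    ext u
    change _ * co g n r = c * (_ * co f n r)
    rw [h]
    simp only [shiftData]
    ring
  rw [intOp, OpData.co_op, intOp, OpData.co_op, ← integral_const_mul]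
  congr 1
  ext u
  change _ * co (avg g) n (r, prSg u) = c * (_ * co (avg f) n (r, prSg u))
  rw [h1]
  simp only [shiftData]
  ring

theorem co_dispOp (hρ : 0 < ρ) (ψ : W1 ρ) (n : ℤ) (r : unitInterval) :
    co (dispOp hβ₁ hβ₂ hρ ψ) n r = Complex.I * dsym β n * co (phi ψ) n r := by
  have h0 : ∀ {ω : C(unitInterval, ℝ≥0)} (f : Wien unitInterval ω), co (-f) n r = -co f n r :=
    fun f => by simp [co]
  rw [← co_disp hβ₁ hβ₂, dispOp, h0, h0,
    co_intOp_avg (f := phi ψ) (g := phi2 hρ ψ) hβ₁ hβ₂ (co_der2 _ _ _ _ _ _)]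
  ring

theorem co_restr_id {ω ω' : C(unitInterval, ℝ≥0)} (h : ∀ x, ω' x ≤ ω (ContinuousMap.id _ x))
    (f : Wien unitInterval ω) (k : ℤ) (x : unitInterval) :
    co (restr (.id _) h f : Wien unitInterval ω') k x = co f k x := by
  rw [co_eq_integral, co_eq_integral]
  simp_rw [ev_restr (ContinuousMap.id _) h f _ (inS_ofReal _ _)]
  rfl

variable (n : ℝ → ℝ)  (hn : IntegrableOn n 𝕁)

/-- The equation for the angle, integrated in time. -/
theorem phi_eq_integral (hρ : 0 < ρ) {B : Base ρ} {ψ : W1 ρ} {T : ℝ}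
    (hfix : ψ = (T : ℂ) • (volterra (dsym β) T ρ hρ).op (B.nonlin β hβ₁ hβ₂ n hn ψ))
    (hreal : ∀ r s, conj (rl (B.nonlin β hβ₁ hβ₂ n hn ψ) r s) = rl (B.nonlin β hβ₁ hβ₂ n hn ψ) r s)
    (r : unitInterval) (s : ℝ) :
    rl (phi ψ) r s = ∫ r' in (0 : ℝ)..r, T * (dispU β (rl (phi2 hρ ψ) (pI r')) s +
      rl (B.nonlin β hβ₁ hβ₂ n hn ψ) (pI r') s) := by
  set N := B.nonlin β hβ₁ hβ₂ n hn ψ with hN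
  have hle : ∀ x, (0 : C(unitInterval, ℝ≥0)) x ≤ wt ρ (ContinuousMap.id _ x) := fun x => zero_le
  have hcoN : ∀ k r, conj (co N (-k) r) = co N k r := by
    intro k r
    have : conjOp N = N := ext_ev fun x s => by
      rw [ev_conjOp, Complex.conj_ofReal]
      exact hreal x s
    rw [← co_conjOp, this]
  have h1 : ∀ k r, co (mB ψ) k r = T * ∫ r' in (0 : ℝ)..r,
      Complex.exp (Complex.I * (T * dsym β k * (r - r') : ℝ)) * co N k (pI r') := by
    intro k r
    rw [co_mB]
    conv_lhs => rw [hfix]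
    rw [co_smul, co_volterra]
    have := (one_add_pos k).ne'
    have h : ((1 + 2 * π * |(k : ℝ)| : ℝ) : ℂ) ≠ 0 := by exact_mod_cast this
    push_cast at h ⊢
    field_simp
    rfl
  have h2 : ∀ k r, conj (co (mB ψ) (-k) r) = co (mB ψ) k r := by
    intro k r
    rw [h1, h1, map_mul, Complex.conj_ofReal, intervalIntegral.integral_of_le r.2.1,
      intervalIntegral.integral_of_le r.2.1, ← integral_conj]
    congr 2
    ext r'
    rw [map_mul, hcoN, ← Complex.exp_conj, map_mul, Complex.conj_I, Complex.conj_ofReal, dsym_neg]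
    congr 2
    push_cast
    ring
  have h3 : phi ψ = mB ψ := ext_co fun k r => by
    rw [phi, co_reOp, h2]
    ring
  have h4 : ∀ k (r : unitInterval), co (phi ψ) k r = 0 + ∫ r' in (0 : ℝ)..r,
      co ((T : ℂ) • (dispOp hβ₁ hβ₂ hρ ψ + restr (.id _) hle N)) k (pI r') := by
    intro k r
    set u : ℝ → ℂ := fun r => ∫ r' in (0 : ℝ)..r,
      Complex.exp (Complex.I * (T * dsym β k * (r - r') : ℝ)) * (T * co N k (pI r')) with hu
    have hur : ∀ r : unitInterval, co (phi ψ) k r = u r := by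
      intro r
      rw [h3, h1, hu, ← intervalIntegral.integral_const_mul]
      congr 1
      ext r'
      ring
    have hc := continuous_co_pI N k
    have hd := fun r => volterra_scalar (a := T * dsym β k) (F := fun r => T * co N k (pI r)) (u := u)
      (by fun_prop) (fun _ => rfl) r
    have hcu : Continuous u := continuous_of_hasDerivAt hd
    have h5 := intervalIntegral.integral_eq_sub_of_hasDerivAt (a := 0) (b := r) (fun x _ => hd x)
      (Continuous.intervalIntegrable (by fun_prop) _ _)
    have hu0 : u 0 = 0 := by simp [hu]
    rw [hu0, sub_zero] at h5
    rw [hur, ← h5, zero_add]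
    refine intervalIntegral.integral_congr fun x hx => ?_
    rw [uIcc_of_le r.2.1] at hx
    have hx1 : x ∈ Icc (0 : ℝ) 1 := ⟨hx.1, hx.2.trans r.2.2⟩
    have h6 : u x = co (phi ψ) k (pI x) := by
      rw [hur, pI, projIcc_of_mem _ hx1]
    rw [co_smul, co_add, co_dispOp, co_restr_id, h6]
    push_cast
    ring
  have h5 := ev_eq_integral h4 r s
  have h6 : ev (phi ψ) 0 s = 0 := by
    have := fun k => h4 k 0
    simp only [Set.Icc.coe_zero, intervalIntegral.integral_same, add_zero] at this
    rw [ev]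
    simp_rw [← co_mul_exp, this]
    simp
  rw [rl, h5, h6, zero_add]
  congr 1
  ext r'
  rw [ev_smul, ev_add _ _ (inS_ofReal _ _), ev_restr (ContinuousMap.id _) hle N _ (inS_ofReal _ _)]
  congr 2
  exact rl_dispOp hβ₁ hβ₂ hρ ψ _ s

end

end Wien

theorem conj_deriv_of_conj {k k' : ℝ → ℂ} (h : ∀ s, conj (k s) = k s)
    (hk : ∀ s, HasDerivAt k (k' s) s) (s : ℝ) : conj (k' s) = k' s := by
  have h1 : HasDerivAt (fun s => conj (k s)) (conj (k' s)) s := (hk s).star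
  rw [show (fun s => conj (k s)) = k from funext h] at h1
  exact h1.unique (hk s)

theorem dispU_add {β : ℝ} (hβ₁ : 1 < β) (hβ₂ : β < 2) {f g : ℝ → ℂ} (hf : Continuous f)
    (hg : Continuous g) (s : ℝ) : dispU β (fun s => f s + g s) s = dispU β f s + dispU β g s := by
  have h : ∀ σ, av (fun s => f s + g s) s σ = av f s σ + av g s σ := fun σ =>
    intervalIntegral.integral_add (Continuous.intervalIntegrable (by fun_prop) _ _)
      (Continuous.intervalIntegrable (by fun_prop) _ _)
  have hc : ∀ {f : ℝ → ℂ}, Continuous f → ContinuousOn (fun σ => av f s σ) 𝕁 :=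
    fun hf => ((continuous_av hf).comp (by fun_prop : Continuous fun σ : ℝ => (s, σ))).continuousOn
  simp only [dispU, h, mul_add]
  rw [intervalIntegral.integral_add (intervalIntegrable_kap_mul hβ₁ hβ₂ (hc hf))
    (intervalIntegrable_kap_mul hβ₁ hβ₂ (hc hg)), neg_add]

theorem dispU_conj {β : ℝ} {f : ℝ → ℂ} (hf : ∀ s, conj (f s) = f s) (s : ℝ) :
    conj (dispU β f s) = dispU β f s := by
  have h : ∀ σ, conj (av f s σ) = av f s σ := fun σ => by
    rw [← Wien.av_conj]
    simp_rw [hf]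
  rw [dispU, map_neg, intervalIntegral.integral_of_le (by norm_num), ← integral_conj]
  simp only [map_mul, Complex.conj_ofReal, h]

/-- A curve whose tangent moves by rotation and uniform stretching, from its velocity. -/
theorem exists_moving_curve {E Z R : ℝ → ℝ → ℂ} {E₀ : ℝ → ℂ} {m : ℝ → ℝ} {T : ℝ}
    (hmc : Continuous m) (hEc : Continuous fun p : ℝ × ℝ => E p.1 p.2)
    (hZc : Continuous fun p : ℝ × ℝ => Z p.1 p.2) (hRc : Continuous fun p : ℝ × ℝ => R p.1 p.2)
    (hE : ∀ r s, r ∈ Icc (0 : ℝ) 1 →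
      E r s = E₀ s * Complex.exp (Complex.I * ∫ r' in (0 : ℝ)..r, T * R r' s))
    (hZ : ∀ r s, HasDerivAt (Z r) (E r s * (Complex.I * R r s + m r)) s)
    {z₀ : ℝ → ℂ} {L₀ : ℝ} (hL₀ : 0 < L₀) (hz : ∀ s, HasDerivAt z₀ (L₀ * E₀ s) s)
    (hper : Function.Periodic z₀ 1) (hZper : ∀ r, Function.Periodic (Z r) 1) :
    ∃ (L : ℝ → ℝ) (W : ℝ → ℝ → ℂ), Continuous L ∧ (∀ r, 0 < L r) ∧ L 0 = L₀ ∧ W 0 = z₀ ∧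
      (∀ r, Function.Periodic (W r) 1) ∧
      (∀ r s, r ∈ Icc (0 : ℝ) 1 → HasDerivAt (W r) (L r * E r s) s) ∧
      ∀ (r s : ℝ), HasDerivAt (fun r => W r s) (T * L r * Z r s) r := by
  set L : ℝ → ℝ := fun r => L₀ * Real.exp (∫ r' in (0 : ℝ)..r, T * m r') with hL
  have hLd : ∀ r, HasDerivAt L (T * m r * L r) r := by
    intro r
    have h1 : HasDerivAt (fun r => ∫ r' in (0 : ℝ)..r, T * m r') (T * m r) r :=
      (Continuous.integral_hasStrictDerivAt (by fun_prop) 0 r).hasDerivAt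
    refine (h1.exp.const_mul L₀).congr_deriv ?_
    simp only [hL]; ring
  have hLc : Continuous L := continuous_of_hasDerivAt hLd
  have hslice : ∀ {f : ℝ → ℝ → ℂ}, (Continuous fun p : ℝ × ℝ => f p.1 p.2) → ∀ s,
      Continuous fun r => f r s := fun hf s =>
    hf.comp (by fun_prop : Continuous fun r : ℝ => (r, s))
  set W : ℝ → ℝ → ℂ := fun r s => z₀ s + ∫ r' in (0 : ℝ)..r, T * L r' * Z r' s with hW
  have hWr : ∀ r s, HasDerivAt (fun r => W r s) (T * L r * Z r s) r := by
    intro r s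
    have := hslice hZc s
    exact ((Continuous.integral_hasStrictDerivAt (by fun_prop) 0 r).hasDerivAt).const_add (z₀ s)
  refine ⟨L, W, hLc, fun r => by positivity, by simp [hL], by simp [hW], ?_, ?_, hWr⟩
  · intro r s
    simp only [hW]
    rw [hper s]
    simp_rw [hZper _ s]
  · intro r s hr
    have hRs := hslice hRc s
    set ph : ℝ → ℂ := fun r => ∫ r' in (0 : ℝ)..r, T * R r' s with hph
    have hphd : ∀ r, HasDerivAt ph (T * R r s) r := fun r =>
      (Continuous.integral_hasStrictDerivAt (by fun_prop) 0 r).hasDerivAt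
    have hLE : ∀ r : ℝ, HasDerivAt (fun r => L r * (E₀ s * Complex.exp (Complex.I * ph r)))
        (T * L r * (E₀ s * Complex.exp (Complex.I * ph r) * (Complex.I * R r s + m r))) r := by
      intro r
      refine ((hLd r).ofReal_comp.mul
        ((((hphd r).const_mul Complex.I).cexp).const_mul (E₀ s))).congr_deriv ?_
      push_cast
      ring
    have h1 : HasDerivAt (fun s => ∫ r' in (0 : ℝ)..r, ((fun _ => (1 : ℝ)) r' : ℝ) *
        (T * L r' * Z r' s)) (∫ r' in (0 : ℝ)..r, ((fun _ => (1 : ℝ)) r' : ℝ) * (T * L r' *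
          (E r' s * (Complex.I * R r' s + m r')))) s := by
      refine hasDerivAt_weighted_integral (n := fun _ => 1) hr.1 (by simp)
        (g := fun s r' => T * L r' * Z r' s)
        (g' := fun s r' => T * L r' * (E r' s * (Complex.I * R r' s + m r')))
        (fun u => ?_) ?_ fun u r' _ => ?_
      · have := hslice hZc u
        fun_prop
      · have h1 := hEc.comp continuous_swap
        have h2 := hRc.comp continuous_swap
        simp only [Function.comp_def, Prod.fst_swap, Prod.snd_swap] at h1 h2
        exact Continuous.continuousOn (by fun_prop)
      · exact (hZ r' u).const_mul _
    simp only [Complex.ofReal_one, one_mul] at h1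
    have h2 : ∫ r' in (0 : ℝ)..r, T * L r' * (E r' s * (Complex.I * R r' s + m r')) =
        L r * E r s - L₀ * E₀ s := by
      have hphc : Continuous ph := continuous_of_hasDerivAt hphd
      have h3 := intervalIntegral.integral_eq_sub_of_hasDerivAt (a := 0) (b := r)
        (fun x _ => hLE x) (Continuous.intervalIntegrable (by fun_prop) _ _)
      have hE' := hE r s hr
      rw [← hE'] at h3
      simp only [hph, hL, intervalIntegral.integral_same, mul_zero, Complex.exp_zero, mul_one,
        Real.exp_zero] at h3
      rw [← h3]
      refine intervalIntegral.integral_congr fun x hx => ?_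
      rw [uIcc_of_le hr.1] at hx
      have hx1 : x ∈ Icc (0 : ℝ) 1 := ⟨hx.1, hx.2.trans hr.2⟩
      rw [hE x s hx1]
    rw [h2] at h1
    refine ((hz s).add h1).congr_deriv ?_
    ring

namespace Wien

variable {ρ β : ℝ} (hβ₁ : 1 < β) (hβ₂ : β < 2) (n : ℝ → ℝ)
  (hn : IntegrableOn n 𝕁)

/-- The velocity, including its tangential part. -/
def Base.vel (B : Base ρ) (ψ : W1 ρ) : W1 ρ :=
  zOp β hβ₁ hβ₂ (B.vv β ψ) (B.tan ψ) (B.tan' ψ) + B.ll β hβ₁ hβ₂ n hn ψ * B.tan ψ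

/-- The rate of change of the angle. -/
def Base.rate (hρ : 0 < ρ) (B : Base ρ) (ψ : W1 ρ) : Wien unitInterval 0 :=
  dispOp hβ₁ hβ₂ hρ ψ + restr (.id _) (ω := wt ρ) (fun _ => zero_le) (B.nonlin β hβ₁ hβ₂ n hn ψ)

theorem rl_rate (hρ : 0 < ρ) (B : Base ρ) (ψ : W1 ρ) (r : unitInterval) (s : ℝ) :
    rl (B.rate hβ₁ hβ₂ n hn hρ ψ) r s =
      dispU β (rl (phi2 hρ ψ) r) s + rl (B.nonlin β hβ₁ hβ₂ n hn ψ) r s := by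
  rw [rl, Base.rate, ev_add _ _ (inS_ofReal _ _), ← rl_dispOp hβ₁ hβ₂]
  congr 1
  exact ev_restr _ _ _ _ (inS_ofReal _ _)

theorem rl_vel {B : Base ρ} {ψ : W1 ρ} {r : unitInterval}
    (hV : ∀ (σ : Sg) (s : ℝ), ev (B.vv β ψ) (r, σ) s = vq β (rl (B.tan ψ) r) s σ) (s : ℝ) :
    rl (B.vel hβ₁ hβ₂ n hn ψ) r s = zetaU β (rl (B.tan ψ) r) (rl (B.tan' ψ) r) s +
      rl (B.ll β hβ₁ hβ₂ n hn ψ) r s * rl (B.tan ψ) r s := by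
  rw [rl, Base.vel, ev_add _ _ (inS_ofReal _ _), ev_mul _ _ (inS_ofReal _ _), ev_zOp hβ₁ hβ₂ hV]
  rfl

/-- The mean stretching rate. -/
def Base.mean (B : Base ρ) (ψ : W1 ρ) (r : unitInterval) : ℝ := (co (B.rr β hβ₁ hβ₂ ψ) 0 r).re

theorem nonlin_real {B : Base ρ} {ψ : W1 ρ} (hρ : 0 < ρ) (hB : IsBase β B)
    (hψ : IsState β hρ B ψ)
    (r : unitInterval) (s : ℝ) : conj (rl (B.nonlin β hβ₁ hβ₂ n hn ψ) r s) =
      rl (B.nonlin β hβ₁ hβ₂ n hn ψ) r s := by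
  rw [rl_nonlin, map_add, map_add, map_mul, Complex.conj_ofReal,
    (ll_props hβ₁ hβ₂ n hn (hψ r).2).2.1, (hψ r).1.conj_k,
    dispU_conj (conj_deriv_of_conj (hB.state r).conj_k (hB.state r).hasDerivAt_k)]

/-- The derivative of the velocity: rotation and uniform stretching. -/
theorem hasDerivAt_vel {B : Base ρ} {ψ : W1 ρ} (hρ : 0 < ρ) {r : unitInterval}
    (hψ : UnitState (rl (B.tan ψ) r) (rl (B.kk ψ) r)
        (fun s => rl B.k' r s + rl (phi2 hρ ψ) r s))
    (hV : ∀ (σ : Sg) (s : ℝ), ev (B.vv β ψ) (r, σ) s = vq β (rl (B.tan ψ) r) s σ) (s : ℝ) :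
    HasDerivAt (rl (B.vel hβ₁ hβ₂ n hn ψ) r) (rl (B.tan ψ) r s *
      (Complex.I * rl (B.rate hβ₁ hβ₂ n hn hρ ψ) r s + B.mean hβ₁ hβ₂ ψ r)) s := by
  have h0 : rl (B.vel hβ₁ hβ₂ n hn ψ) r = _ := funext fun s => rl_vel hβ₁ hβ₂ n hn hV s
  obtain ⟨h1, -, h3, -⟩ := ll_props hβ₁ hβ₂ n hn hV
  have h4 := hasDerivAt_zetaU hβ₁ hβ₂ (E' := rl (B.tan' ψ) r)
    (fun s => by rw [rl_tan']; exact hψ.hasDerivAt s) (fun s => rl_tan' B ψ r s)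
    hψ.hasDerivAt_k hψ.continuous_k' hψ.norm_eq hψ.dq_pos s
  rw [h0]
  refine (h4.add ((h3 s).mul (hψ.hasDerivAt s))).congr_deriv ?_
  rw [rl_rate, rl_nonlin, dispU_add hβ₁ hβ₂ (continuous_rl _ _) (continuous_rl _ _), ← h1 s,
    Base.mean]
  have h5 := Complex.re_add_im (rl (B.rr β hβ₁ hβ₂ ψ) r s)
  linear_combination (-rl (B.tan ψ) r s) * h5

/-- Every small fixed point gives a moving curve. -/
theorem exists_flow {B : Base ρ} {ψ : W1 ρ} (hρ : 0 < ρ) (hB : IsBase β B)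
    (hconst : ∀ r s, rl B.E r s = rl B.E 0 s) {T : ℝ}
    (hψ : IsState β hρ B ψ)
    (hfix : ψ = (T : ℂ) • (volterra (dsym β) T ρ hρ).op (B.nonlin β hβ₁ hβ₂ n hn ψ))
    {z₀ : ℝ → ℂ} {L₀ : ℝ} (hL₀ : 0 < L₀) (hz : ∀ s, HasDerivAt z₀ (L₀ * rl B.E 0 s) s)
    (hper : Function.Periodic z₀ 1) :
    ∃ (L : ℝ → ℝ) (W : ℝ → ℝ → ℂ), Continuous L ∧ (∀ r, 0 < L r) ∧ L 0 = L₀ ∧ W 0 = z₀ ∧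
      (∀ r, Function.Periodic (W r) 1) ∧
      (∀ (r : unitInterval) s, HasDerivAt (W r) (L r * rl (B.tan ψ) r s) s) ∧
      ∀ (r s : ℝ), HasDerivAt (fun r => W r s)
        (T * L r * (zetaU β (rl (B.tan ψ) (pI r)) (rl (B.tan' ψ) (pI r)) s +
          rl (B.ll β hβ₁ hβ₂ n hn ψ) (pI r) s * rl (B.tan ψ) (pI r) s)) r := by
  have hpI := continuous_pI
  have hcont : ∀ {ω : C(unitInterval, ℝ≥0)} (f : Wien unitInterval ω),
      Continuous fun p : ℝ × ℝ => rl f (pI p.1) p.2 := fun f =>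
    (continuous_ev_param f).comp (by fun_prop : Continuous fun p : ℝ × ℝ => (pI p.1, p.2))
  obtain ⟨L, W, h1, h2, h3, h4, h5, h6, h7⟩ := exists_moving_curve (T := T)
    (E := fun r => rl (B.tan ψ) (pI r)) (Z := fun r => rl (B.vel hβ₁ hβ₂ n hn ψ) (pI r))
    (R := fun r => rl (B.rate hβ₁ hβ₂ n hn hρ ψ) (pI r)) (E₀ := rl B.E 0)
    (m := fun r => B.mean hβ₁ hβ₂ ψ (pI r))
    (Complex.continuous_re.comp (continuous_co_pI _ _)) (hcont _) (hcont _) (hcont _)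
    (fun r s hr => by
      rw [rl_tan, hconst, phi_eq_integral hβ₁ hβ₂ n hn hρ hfix
        (fun r s => nonlin_real hβ₁ hβ₂ n hn hρ hB hψ r s)]
      simp_rw [← rl_rate]
      congr 4
      rw [pI, projIcc_of_mem _ hr])
    (fun r s => hasDerivAt_vel hβ₁ hβ₂ n hn hρ (hψ _).1 (hψ _).2 s) hL₀ hz hper
    (fun r => rl_periodic _ _)
  refine ⟨L, W, h1, h2, h3, h4, h5, fun r s => ?_, fun r s => ?_⟩
  · have := h6 r s r.2
    rwa [pI_coe] at this
  · refine (h7 r s).congr_deriv ?_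
    rw [rl_vel hβ₁ hβ₂ n hn (hψ _).2]

end Wien

theorem summable_exp_neg_abs {a : ℝ} (ha : 0 < a) :
    Summable fun k : ℤ => Real.exp (-(a * |(k : ℝ)|)) := by
  have h : Summable fun n : ℕ => Real.exp (-(a * n)) := by
    have h1 : Real.exp (-a) < 1 := by simpa using ha
    refine (summable_geometric_of_lt_one (Real.exp_pos _).le h1).congr fun n => ?_
    rw [← Real.exp_nat_mul]
    congr 1
    ring
  refine Summable.of_nat_of_neg ?_ ?_ <;> simpa using h

/-- Fourier inversion for continuous periodic functions with summable coefficients. -/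
theorem hasSum_fourier {f : ℝ → ℂ} (hf : Continuous f) (hper : Function.Periodic f 1)
    (h : Summable fun k : ℤ => ‖∫ s in (0 : ℝ)..1, f s * Complex.exp (-(2 * π * Complex.I * k * s))‖)
    (s : ℝ) : HasSum (fun k : ℤ => (∫ s in (0 : ℝ)..1, f s *
      Complex.exp (-(2 * π * Complex.I * k * s))) * Complex.exp (2 * π * Complex.I * k * s))
      (f s) := by
  let F : C(AddCircle (1 : ℝ), ℂ) := ⟨hper.lift, continuous_coinduced_dom.2 hf⟩
  have hc : ∀ k : ℤ, fourierCoeff F k = ∫ s in (0 : ℝ)..1, f s *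
      Complex.exp (-(2 * π * Complex.I * k * s)) := by
    intro k
    rw [fourierCoeff_eq_intervalIntegral F k 0]
    simp only [zero_add, div_one, one_smul]
    refine intervalIntegral.integral_congr fun s _ => ?_
    rw [fourier_coe_apply, smul_eq_mul, mul_comm]
    congr 2
    push_cast
    ring
  have h1 : Summable (fourierCoeff F) := by
    refine Summable.of_norm ?_
    simp_rw [hc]
    exact h
  have h2 := has_pointwise_sum_fourier_series_of_summable h1 s
  simp_rw [hc, smul_eq_mul, fourier_coe_apply] at h2
  simp only [Complex.ofReal_one, div_one] at h2
  exact h2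

namespace Wien

section

variable {K : Type} [TopologicalSpace K] [CompactSpace K] [FirstCountableTopology K]

/-- A family of periodic functions with exponentially decaying coefficients belongs to a Wiener
algebra. -/
theorem exists_of_coef {ω : C(K, ℝ≥0)} {F : K → ℝ → ℂ} (hF : ∀ x, Continuous (F x))
    (hFc : ∀ k : ℤ, Continuous fun x => ∫ s in (0 : ℝ)..1, F x s *
      Complex.exp (-(2 * π * Complex.I * k * s))) (hper : ∀ x, Function.Periodic (F x) 1)
    {a b : ℝ} {c : ℤ → ℝ} (hab : a < b) (hω : ∀ x, ω x ≤ a) (hc0 : ∀ k, 0 ≤ c k)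
    (hc : ∃ B, ∀ k, c k ≤ B * Real.exp (-(b * |(k : ℝ)|)))
    (h : ∀ (k : ℤ) x, ‖∫ s in (0 : ℝ)..1, F x s *
      Complex.exp (-(2 * π * Complex.I * k * s))‖ ≤ c k) :
    ∃ f : Wien K ω, (∀ x (s : ℝ), ev f x s = F x s) ∧
      ∀ k, ‖cf f k‖ ≤ c k * Real.exp (a * |(k : ℝ)|) := by
  obtain ⟨B, hB⟩ := hc
  let cc : ℤ → C(K, ℂ) := fun k => ⟨fun x => (∫ s in (0 : ℝ)..1, F x s *
      Complex.exp (-(2 * π * Complex.I * k * s))) * Real.exp (ω x * |(k : ℝ)|), by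
    have := hFc k
    fun_prop⟩
  have h1 : ∀ k, ‖cc k‖ ≤ c k * Real.exp (a * |(k : ℝ)|) := by
    intro k
    refine (ContinuousMap.norm_le _ (mul_nonneg (hc0 k) (Real.exp_pos _).le)).2 fun x => ?_
    change ‖(∫ s in (0 : ℝ)..1, F x s * Complex.exp (-(2 * π * Complex.I * k * s))) *
      (Real.exp (ω x * |(k : ℝ)|) : ℂ)‖ ≤ _
    rw [norm_mul, Complex.norm_real, Real.norm_eq_abs, abs_of_pos (Real.exp_pos _)]
    have := hω x
    have := h k x
    have := hc0 k
    gcongr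
  have h2 : ∀ k, ‖cc k‖ ≤ B * Real.exp (-((b - a) * |(k : ℝ)|)) := by
    intro k
    refine (h1 k).trans ((mul_le_mul_of_nonneg_right (hB k) (Real.exp_pos _).le).trans (le_of_eq ?_))
    rw [mul_assoc, ← Real.exp_add]
    congr 2
    ring
  have hsum : Summable fun k => ‖cc k‖ := Summable.of_nonneg_of_le (fun _ => norm_nonneg _) h2
    ((summable_exp_neg_abs (sub_pos.2 hab)).mul_left B)
  refine ⟨mk cc hsum, fun x s => ?_, fun k => by rw [cf_mk]; exact h1 k⟩
  have hco : ∀ k, co (mk cc hsum : Wien K ω) k x = ∫ s in (0 : ℝ)..1, F x s *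
      Complex.exp (-(2 * π * Complex.I * k * s)) := by
    intro k
    rw [co, cf_mk]
    change (_ * (Real.exp (ω x * |(k : ℝ)|) : ℂ)) * (Real.exp (-(ω x * |(k : ℝ)|)) : ℂ) = _
    rw [mul_assoc, ← Complex.ofReal_mul, ← Real.exp_add, add_neg_cancel, Real.exp_zero,
      Complex.ofReal_one, mul_one]
  rw [ev]
  simp_rw [← co_mul_exp, hco]
  refine (hasSum_fourier (hF x) (hper x) ?_ s).tsum_eq
  have hb : Summable fun k => ‖co (mk cc hsum : Wien K ω) k x‖ := by
    refine Summable.of_nonneg_of_le (fun _ => norm_nonneg _) (fun k => ?_) hsum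
    rw [co, cf_mk, norm_mul, Complex.norm_real, Real.norm_eq_abs, abs_of_pos (Real.exp_pos _)]
    refine (mul_le_of_le_one_right (norm_nonneg _) ?_).trans ((cc k).norm_coe_le_norm x)
    rw [Real.exp_le_one_iff]
    have : (0 : ℝ) ≤ ω x * |(k : ℝ)| := by positivity
    linarith
  simpa only [hco] using hb

end

end Wien

theorem isOpen_strip (ρ : ℝ) : IsOpen (strip ρ) := isOpen_lt (by fun_prop) continuous_const

theorem convex_strip (ρ : ℝ) : Convex ℝ (strip ρ) := by
  have : strip ρ = Complex.imCLM ⁻¹' Ioo (-ρ) ρ := by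
    ext w; simp [strip, abs_lt]
  rw [this]
  exact (convex_Ioo _ _).linear_preimage Complex.imCLM.toLinearMap

theorem add_int_of_add_one {f : ℂ → ℂ} {ρ : ℝ} (h : ∀ w ∈ strip ρ, f (w + 1) = f w) (m : ℤ) :
    ∀ w ∈ strip ρ, f (w + m) = f w := by
  have hn : ∀ (m : ℕ), ∀ w ∈ strip ρ, f (w + m) = f w := by
    intro m
    induction m with
    | zero => simp
    | succ m ih =>
      intro w hw
      rw [Nat.cast_succ, ← add_assoc, h _ (by simpa [strip] using hw), ih w hw]
  intro w hw
  obtain ⟨m, rfl | rfl⟩ := m.eq_nat_or_neg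
  · exact hn m w hw
  · have := hn m (w + ((-m : ℤ) : ℂ)) (by simpa [strip] using hw)
    rw [← this]
    congr 1
    push_cast
    ring

theorem abs_le_of_mem_uIcc_zero {t y : ℝ} (h : t ∈ uIcc 0 y) : |t| ≤ |y| := by
  simpa using abs_sub_left_of_mem_uIcc h

/-- Shifting the line of integration in a Fourier coefficient. -/
theorem integral_shift {f : ℂ → ℂ} {ρ y : ℝ} (hf : DifferentiableOn ℂ f (strip ρ))
    (hper : ∀ w ∈ strip ρ, f (w + 1) = f w) (hy : |y| < ρ) (k : ℤ) :
    ∫ s in (0 : ℝ)..1, f s * Complex.exp (-(2 * π * Complex.I * k * s)) =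
      ∫ s in (0 : ℝ)..1, f (s + y * Complex.I) *
        Complex.exp (-(2 * π * Complex.I * k * (s + y * Complex.I))) := by
  set g : ℂ → ℂ := fun w => f w * Complex.exp (-(2 * π * Complex.I * k * w)) with hg
  have hsub : (uIcc (0 : ℂ).re (1 + y * Complex.I : ℂ).re ×ℂ
      uIcc (0 : ℂ).im (1 + y * Complex.I : ℂ).im) ⊆ strip ρ := by
    intro w hw
    have h2 := hw.2
    simp at h2
    exact (abs_le_of_mem_uIcc_zero h2).trans_lt hy
  have h := Complex.integral_boundary_rect_eq_zero_of_differentiableOn g 0 (1 + y * Complex.I)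
    ((hf.mul (by fun_prop)).mono hsub)
  simp only [Complex.zero_re, Complex.zero_im, Complex.add_re, Complex.one_re, Complex.mul_re,
    Complex.ofReal_re, Complex.I_re, mul_zero, Complex.ofReal_im, Complex.I_im, mul_one, sub_self,
    add_zero, Complex.add_im, Complex.one_im, Complex.mul_im, zero_add, Complex.ofReal_zero,
    zero_mul, Complex.ofReal_one] at h
  have h3 : ∫ t in (0 : ℝ)..y, g (1 + t * Complex.I) = ∫ t in (0 : ℝ)..y, g (t * Complex.I) := by
    refine intervalIntegral.integral_congr fun t ht => ?_
    have h4 : (t * Complex.I : ℂ) ∈ strip ρ := by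
      simpa [strip] using (abs_le_of_mem_uIcc_zero ht).trans_lt hy
    simp only [hg]
    rw [add_comm, hper _ h4]
    congr 1
    rw [mul_add, mul_one, neg_add, Complex.exp_add]
    have : Complex.exp (-(2 * π * Complex.I * k)) = 1 :=
      Complex.exp_eq_one_iff.2 ⟨-k, by push_cast; ring⟩
    rw [this, mul_one]
  rw [h3, add_sub_cancel_right, sub_eq_zero] at h
  exact h

theorem norm_coef_le {f : ℂ → ℂ} {ρ y B : ℝ} (hf : DifferentiableOn ℂ f (strip ρ))
    (hper : ∀ w ∈ strip ρ, f (w + 1) = f w) (hy : |y| < ρ)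
    (hB : ∀ t, |t| = |y| → ∫ s in (0 : ℝ)..1, ‖f (s + t * Complex.I)‖ ≤ B) (k : ℤ) :
    ‖∫ s in (0 : ℝ)..1, f s * Complex.exp (-(2 * π * Complex.I * k * s))‖ ≤
      B * Real.exp (-(2 * π * |y| * |(k : ℝ)|)) := by
  obtain ⟨t, ht, htk⟩ : ∃ t : ℝ, |t| = |y| ∧ k * t = -(|y| * |(k : ℝ)|) := by
    rcases le_total 0 (k : ℝ) with h | h
    · exact ⟨-|y|, by simp, by rw [abs_of_nonneg h]; ring⟩
    · exact ⟨|y|, by simp, by rw [abs_of_nonpos h]; ring⟩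
  rw [integral_shift hf hper (ht.trans_lt hy) k]
  have h1 : ∀ s : ℝ, ‖f (s + t * Complex.I) *
        Complex.exp (-(2 * π * Complex.I * k * (s + t * Complex.I)))‖ =
      ‖f (s + t * Complex.I)‖ * Real.exp (-(2 * π * |y| * |(k : ℝ)|)) := by
    intro s
    rw [norm_mul, Complex.norm_exp]
    congr 2
    have : (-(2 * π * Complex.I * k * (s + t * Complex.I)) : ℂ) =
        ((2 * π * (k * t) : ℝ) : ℂ) + ((-(2 * π * k * s) : ℝ) : ℂ) * Complex.I := by
      push_cast
      linear_combination (-2 * π * k * t : ℂ) * Complex.I_sq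
    rw [this, htk]
    simp
    ring
  refine (intervalIntegral.norm_integral_le_integral_norm zero_le_one).trans ?_
  simp_rw [h1]
  rw [intervalIntegral.integral_mul_const]
  exact mul_le_mul_of_nonneg_right (hB t ht) (Real.exp_pos _).le

theorem norm_coef_le_of_bound {f : ℂ → ℂ} {ρ y B : ℝ} (hf : DifferentiableOn ℂ f (strip ρ))
    (hper : ∀ w ∈ strip ρ, f (w + 1) = f w) (hy : |y| < ρ) (hB : ∀ w ∈ strip ρ, ‖f w‖ ≤ B) (k : ℤ) :
    ‖∫ s in (0 : ℝ)..1, f s * Complex.exp (-(2 * π * Complex.I * k * s))‖ ≤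
      B * Real.exp (-(2 * π * |y| * |(k : ℝ)|)) := by
  refine norm_coef_le hf hper hy (fun t ht => ?_) k
  have h : ∀ s : ℝ, (s + t * Complex.I : ℂ) ∈ strip ρ := fun s => by
    simpa [strip, ht] using hy
  have := intervalIntegral.norm_integral_le_of_norm_le_const (a := 0) (b := 1) (C := B)
    (f := fun s : ℝ => ‖f (s + t * Complex.I)‖) fun s _ => by rw [norm_norm]; exact hB _ (h s)
  rw [sub_zero, abs_one, mul_one] at this
  exact (le_abs_self _).trans this

/-- A bounded holomorphic function on a strip varies slowly in the imaginary direction. -/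
theorem norm_sub_le_of_strip {f : ℂ → ℂ} {ρ B : ℝ} (hρ : 0 < ρ) (hf : DifferentiableOn ℂ f (strip ρ))
    (hB : ∀ w ∈ strip ρ, ‖f w‖ ≤ B) {w w' : ℂ} (hw : |w.im| ≤ ρ / 2) (hw' : |w'.im| ≤ ρ / 2) :
    ‖f w - f w'‖ ≤ 3 * B / ρ * ‖w - w'‖ := by
  have hmem : ∀ u : ℂ, |u.im| ≤ ρ / 2 → u ∈ strip ρ := fun u hu =>
    lt_of_le_of_lt hu (by linarith)
  refine Convex.norm_image_sub_le_of_norm_deriv_le (s := {u : ℂ | |u.im| ≤ ρ / 2})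
    (fun u hu => hf.differentiableAt ((isOpen_strip ρ).mem_nhds (hmem u hu))) (fun u hu => ?_) ?_ hw' hw
  · have h1 : ∀ v ∈ Metric.closedBall u (ρ / 3), v ∈ strip ρ := by
      intro v hv
      have h2 := Complex.abs_im_le_norm (v - u)
      rw [mem_closedBall_iff_norm] at hv
      have h3 : |v.im| ≤ |(v - u).im| + |u.im| := by
        have := abs_add_le (v - u).im u.im
        simpa using this
      have h4 : |u.im| ≤ ρ / 2 := hu
      change |v.im| < ρ
      linarith
    have h5 := Complex.norm_deriv_le_of_forall_mem_sphere_norm_le (c := u) (R := ρ / 3) (C := B)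
      (by positivity) ?_ fun v hv => hB v (h1 v (Metric.sphere_subset_closedBall hv))
    · refine h5.trans (le_of_eq ?_)
      field_simp
    · refine DifferentiableOn.diffContOnCl ?_
      exact hf.mono fun v hv => h1 v (Metric.closure_ball_subset_closedBall hv)
  · have : {u : ℂ | |u.im| ≤ ρ / 2} = Complex.imLm ⁻¹' (Icc (-(ρ / 2)) (ρ / 2)) := by
      ext u
      simp [abs_le]
    rw [this]
    exact (convex_Icc _ _).linear_preimage _

namespace Wien

variable {K : Type} [TopologicalSpace K] [CompactSpace K] [FirstCountableTopology K]

/-- Real powers of a series which is positive on the real axis. -/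
theorem exists_rpow {ω : C(K, ℝ≥0)} (f : Wien K ω) {a c : ℝ} (ha : 0 < a) (hω : ∀ x, a ≤ ω x)
    (hc : 0 < c) {d : K → ℝ → ℝ} (hd : ∀ x s, c ≤ d x s) (hfd : ∀ x (s : ℝ), ev f x s = d x s)
    (γ : ℝ) : ∃ ρ₀ > 0, ∀ ω' : C(K, ℝ≥0), (∀ x, (ω' x : ℝ) ≤ ρ₀) →
      ∃ g : Wien K ω', ∀ x (s : ℝ), ev g x s = ((d x s ^ γ : ℝ) : ℂ) := by
  have hpi := Real.pi_pos
  set ρ := a / (2 * π) with hρ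
  have hρp : 0 < ρ := by positivity
  have hin : ∀ x, ∀ w ∈ strip ρ, 2 * π * |w.im| < ω x := by
    intro x w hw
    have hw' : |w.im| < ρ := hw
    rw [hρ, lt_div_iff₀ (by positivity)] at hw'
    exact lt_of_lt_of_le (by linarith) (hω x)
  have hdiff : ∀ x, DifferentiableOn ℂ (ev f x) (strip ρ) := fun x =>
    (differentiableOn_ev f x).mono (hin x)
  have hbd : ∀ x, ∀ w ∈ strip ρ, ‖ev f x w‖ ≤ ‖f‖ := fun x w hw => norm_ev_le f (hin x w hw).le
  set ρ₁ := min (ρ / 2) (c * ρ / (6 * (‖f‖ + 1))) with hρ₁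
  have hρ₁p : 0 < ρ₁ := by positivity
  have hre : ∀ x, ∀ w ∈ strip ρ₁, c / 2 ≤ (ev f x w).re := by
    intro x w hw
    have hw' : |w.im| < ρ₁ := hw
    have h1 := norm_sub_le_of_strip hρp (hdiff x) (hbd x) (w := w) (w' := (w.re : ℂ))
      (hw'.le.trans (min_le_left _ _)) (by simp; positivity)
    have h2 : ‖w - (w.re : ℂ)‖ = |w.im| := by
      have : w - (w.re : ℂ) = (w.im : ℂ) * Complex.I := by
        apply Complex.ext <;> simp
      rw [this]; simp
    have h3 : 3 * ‖f‖ / ρ * |w.im| ≤ c / 2 := by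
      have h4 : |w.im| ≤ c * ρ / (6 * (‖f‖ + 1)) := hw'.le.trans (min_le_right _ _)
      calc 3 * ‖f‖ / ρ * |w.im| ≤ 3 * (‖f‖ + 1) / ρ * (c * ρ / (6 * (‖f‖ + 1))) := by
            gcongr; linarith
        _ = c / 2 := by field_simp; norm_num
    rw [h2, hfd] at h1
    have h5 := Complex.abs_re_le_norm (ev f x w - d x w.re)
    rw [Complex.sub_re, Complex.ofReal_re] at h5
    have h6 := (abs_le.1 (h5.trans (h1.trans h3))).1
    linarith [hd x w.re]
  set B := (c / 2) ^ γ + ‖f‖ ^ γ with hB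
  have hstrip : strip ρ₁ ⊆ strip ρ := fun w hw =>
    lt_of_lt_of_le (show |w.im| < ρ₁ from hw) ((min_le_left _ _).trans (by linarith))
  have hpow : ∀ x, ∀ w ∈ strip ρ₁, ‖ev f x w ^ (γ : ℂ)‖ ≤ B := by
    intro x w hw
    rw [Complex.norm_cpow_real]
    have h1 : c / 2 ≤ ‖ev f x w‖ := (hre x w hw).trans (Complex.re_le_norm _)
    have h2 := hbd x w (hstrip hw)
    have h3 : 0 < c / 2 := by positivity
    rcases le_total 0 γ with h | h
    · have := Real.rpow_le_rpow (norm_nonneg _) h2 h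
      have := Real.rpow_nonneg h3.le γ
      linarith
    · have := Real.rpow_le_rpow_of_nonpos h3 h1 h
      have := Real.rpow_nonneg (norm_nonneg f) γ
      linarith
  refine ⟨π * ρ₁ / 2, by positivity, fun ω' hω' => ?_⟩
  have hcont : Continuous fun p : K × ℝ => d p.1 p.2 := by
    have h1 := Complex.continuous_re.comp (continuous_ev_param f)
    refine h1.congr fun p => ?_
    simp [hfd]
  have hdp : Continuous fun p : K × ℝ => ((d p.1 p.2 ^ γ : ℝ) : ℂ) :=
    Complex.continuous_ofReal.comp
      (hcont.rpow_const fun p => Or.inl (lt_of_lt_of_le hc (hd _ _)).ne')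
  refine (exists_of_coef (ω := ω') (F := fun x s => ((d x s ^ γ : ℝ) : ℂ))
    (a := π * ρ₁ / 2) (b := π * ρ₁)
    (c := fun k => B * Real.exp (-(2 * π * |ρ₁ / 2| * |(k : ℝ)|))) ?_ ?_ (fun x s => ?_)
    (by have : 0 < π * ρ₁ := by positivity
        linarith) hω' (fun k => ?_) ⟨B, fun k => ?_⟩ fun k x => ?_).imp fun g hg => hg.1
  · exact fun x => hdp.comp (by fun_prop : Continuous fun s : ℝ => (x, s))
  · exact fun k => intervalIntegral.continuous_parametric_intervalIntegral_of_continuous'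
      (by fun_prop) _ _
  · have h1 := ev_periodic f x s
    have h2 : ev f x ((s + 1 : ℝ) : ℂ) = ev f x (s + 1) := by push_cast; rfl
    rw [← h2, hfd, hfd, Complex.ofReal_inj] at h1
    simp only [h1]
  · positivity
  · rw [abs_of_pos (by positivity : 0 < ρ₁ / 2)]
    refine le_of_eq ?_
    congr 2
    ring
  · have h1 := norm_coef_le_of_bound (f := fun w => ev f x w ^ (γ : ℂ)) (ρ := ρ₁) (y := ρ₁ / 2)
      (B := B) (fun w hw => ?_) (fun w _ => by simp only [ev_periodic])
      (by rw [abs_of_pos (by positivity)]; linarith) (hpow x) k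
    · refine le_trans (le_of_eq ?_) h1
      congr 1
      refine intervalIntegral.integral_congr fun s _ => ?_
      rw [hfd, Complex.ofReal_cpow (hc.le.trans (hd _ _))]
    · have h2 := (hdiff x w (hstrip hw)).mono hstrip
      refine h2.cpow (differentiableWithinAt_const _) (Or.inl ?_)
      linarith [hre x w hw]

end Wien

/-- Two holomorphic functions agree on a preconnected set if they agree near a real point of it. -/
theorem eqOn_of_eqOn_real {f g : ℂ → ℂ} {U : Set ℂ} (ho : IsOpen U) (hU : IsPreconnected U)
    (hf : DifferentiableOn ℂ f U) (hg : DifferentiableOn ℂ g U) {x : ℝ} (hx : (x : ℂ) ∈ U)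
    (h : ∀ y : ℝ, (y : ℂ) ∈ U → f y = g y) : EqOn f g U := by
  refine (hf.analyticOnNhd ho).eqOn_of_preconnected_of_frequently_eq (hg.analyticOnNhd ho) hU hx ?_
  have ht : Filter.Tendsto (fun y : ℝ => (y : ℂ)) (nhdsWithin x {x}ᶜ) (nhdsWithin (x : ℂ) {(x : ℂ)}ᶜ) := by
    refine tendsto_nhdsWithin_iff.2 ⟨?_, ?_⟩
    · exact (Complex.continuous_ofReal.tendsto x).mono_left nhdsWithin_le_nhds
    · filter_upwards [self_mem_nhdsWithin] with y hy
      simpa using hy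
  refine ht.frequently (Filter.Eventually.frequently ?_)
  have h1 : ∀ᶠ y : ℝ in nhds x, (y : ℂ) ∈ U :=
    Complex.continuous_ofReal.continuousAt.eventually (ho.mem_nhds hx)
  filter_upwards [nhdsWithin_le_nhds h1] with y hy using h y hy

/-- Local holomorphic extension of a real-analytic function. -/
theorem exists_local_extension {f : ℝ → ℂ} {x : ℝ} (hf : AnalyticAt ℝ f x) :
    ∃ r > 0, ∃ g : ℂ → ℂ, DifferentiableOn ℂ g (Metric.ball x r) ∧
      ∀ y : ℝ, (y : ℂ) ∈ Metric.ball (x : ℂ) r → g y = f y := by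
  obtain ⟨p, R, hp⟩ := hf
  obtain ⟨r, hr0, hr⟩ := ENNReal.lt_iff_exists_nnreal_btwn.1 hp.r_pos
  have hr0' : 0 < r := by exact_mod_cast hr0
  have hs := p.summable_norm_mul_pow (hr.trans_le hp.r_le)
  refine ⟨r, hr0', fun w => ∑' n, (w - x) ^ n * p.coeff n, ?_, fun y hy => ?_⟩
  · refine Complex.differentiableOn_tsum_of_summable_norm hs (fun n => by fun_prop) Metric.isOpen_ball ?_
    intro n w hw
    rw [norm_mul, norm_pow, FormalMultilinearSeries.norm_apply_eq_norm_coef, mul_comm]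
    have : ‖w - x‖ ≤ r := by
      rw [← dist_eq_norm]; exact (Metric.mem_ball.1 hw).le
    gcongr
  · have h1 := hp.hasSum (y := y - x) ?_
    · rw [add_sub_cancel] at h1
      refine (tsum_congr fun n => ?_).trans h1.tsum_eq
      rw [FormalMultilinearSeries.apply_eq_pow_smul_coeff, Complex.real_smul]
      push_cast
      rfl
    · rw [Metric.mem_ball, Complex.dist_eq, ← Complex.ofReal_sub, Complex.norm_real] at hy
      rw [Metric.mem_eball, edist_zero_right]
      refine lt_trans ?_ hr
      rw [enorm_lt_coe]
      exact_mod_cast hy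

/-- A periodic real-analytic function extends holomorphically to a strip. -/
theorem exists_strip_extension {f : ℝ → ℂ} (hf : AnalyticOnNhd ℝ f univ)
    (hper : Function.Periodic f 1) :
    ∃ ρ > 0, ∃ F : ℂ → ℂ, DifferentiableOn ℂ F (strip ρ) ∧ (∀ w ∈ strip ρ, F (w + 1) = F w) ∧
      (∃ B, ∀ w ∈ strip ρ, ‖F w‖ ≤ B) ∧ ∀ s : ℝ, F s = f s := by
  choose r hr g hg hgf using fun x : ℝ => exists_local_extension (hf x (mem_univ x))
  obtain ⟨δ, hδ, hcov⟩ := lebesgue_number_lemma_of_metric (s := (fun x : ℝ => (x : ℂ)) '' Icc 0 1)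
    (c := fun x : ℝ => Metric.ball (x : ℂ) (r x))
    (isCompact_Icc.image Complex.continuous_ofReal) (fun _ => Metric.isOpen_ball)
    fun w _ => by
      obtain ⟨x, -, rfl⟩ := ‹w ∈ _›
      exact mem_iUnion.2 ⟨x, Metric.mem_ball_self (hr x)⟩
  have hloc : ∀ x : ℝ, ∃ h : ℂ → ℂ, DifferentiableOn ℂ h (Metric.ball x δ) ∧
      ∀ y : ℝ, (y : ℂ) ∈ Metric.ball (x : ℂ) δ → h y = f y := by
    intro x
    obtain ⟨i, hi⟩ := hcov (Int.fract x : ℝ)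
      ⟨_, ⟨Int.fract_nonneg x, (Int.fract_lt_one x).le⟩, rfl⟩
    have hm : ∀ w : ℂ, w ∈ Metric.ball (x : ℂ) δ →
        w - (⌊x⌋ : ℝ) ∈ Metric.ball ((Int.fract x : ℝ) : ℂ) δ := by
      intro w hw
      rw [Metric.mem_ball, dist_eq_norm] at hw ⊢
      convert hw using 2
      rw [← Int.self_sub_floor]
      push_cast
      ring
    refine ⟨fun w => g i (w - (⌊x⌋ : ℝ)), ?_, fun y hy => ?_⟩
    · exact (hg i).comp (by fun_prop) fun w hw => hi (hm w hw)
    · have h1 := hgf i (y - (⌊x⌋ : ℝ)) (by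
        have := hi (hm y hy)
        push_cast at this ⊢
        exact this)
      have h2 := hper.sub_zsmul_eq ⌊x⌋ (x := y)
      simp only [zsmul_eq_mul, mul_one] at h2
      push_cast at h1 ⊢
      rw [h1, h2]
  choose h hh hhf using hloc
  set F : ℂ → ℂ := fun w => h w.re w with hF
  have hball : ∀ w : ℂ, |w.im| < δ / 2 → w ∈ Metric.ball ((w.re : ℝ) : ℂ) δ := by
    intro w hw
    have : w - (w.re : ℂ) = (w.im : ℂ) * Complex.I := by
      apply Complex.ext <;> simp
    rw [Metric.mem_ball, dist_eq_norm, this]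
    simp
    linarith
  have key : ∀ x₁ x₂ : ℝ, ∀ w : ℂ, w ∈ Metric.ball (x₁ : ℂ) δ → w ∈ Metric.ball (x₂ : ℂ) δ →
      (w.re : ℂ) ∈ Metric.ball (x₁ : ℂ) δ → (w.re : ℂ) ∈ Metric.ball (x₂ : ℂ) δ →
      h x₁ w = h x₂ w := by
    intro x₁ x₂ w h1 h2 h3 h4
    exact eqOn_of_eqOn_real (Metric.isOpen_ball.inter Metric.isOpen_ball)
      ((convex_ball _ _).inter (convex_ball _ _)).isPreconnected
      ((hh x₁).mono inter_subset_left) ((hh x₂).mono inter_subset_right) (x := w.re) ⟨h3, h4⟩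
      (fun y hy => by rw [hhf _ _ hy.1, hhf _ _ hy.2]) ⟨h1, h2⟩
  have hdF : DifferentiableOn ℂ F (strip (δ / 2)) := by
    intro w₀ hw₀
    have hw₀' : |w₀.im| < δ / 2 := hw₀
    have h1 : DifferentiableAt ℂ (h w₀.re) w₀ :=
      (hh w₀.re).differentiableAt (Metric.isOpen_ball.mem_nhds (hball w₀ hw₀'))
    refine (h1.congr_of_eventuallyEq ?_).differentiableWithinAt
    have h2 : ∀ᶠ w : ℂ in nhds w₀, |w.im| < δ / 2 :=
      (isOpen_lt (by fun_prop) continuous_const).mem_nhds hw₀'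
    have h3 : ∀ᶠ w : ℂ in nhds w₀, w ∈ Metric.ball (w₀.re : ℂ) δ :=
      Metric.isOpen_ball.mem_nhds (hball w₀ hw₀')
    have h4 : ∀ᶠ w : ℂ in nhds w₀, (w.re : ℂ) ∈ Metric.ball (w₀.re : ℂ) δ := by
      refine (Continuous.continuousAt (by fun_prop : Continuous fun w : ℂ => (w.re : ℂ))).eventually
        (Metric.isOpen_ball.mem_nhds ?_)
      exact Metric.mem_ball_self hδ
    filter_upwards [h2, h3, h4] with w hw2 hw3 hw4
    exact key _ _ w (hball w hw2) hw3 (Metric.mem_ball_self hδ) hw4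
  have hperF : ∀ w ∈ strip (δ / 2), F (w + 1) = F w := by
    intro w hw
    have hb := hball w hw
    have h1 : DifferentiableOn ℂ (fun u => h (w + 1).re (u + 1)) (Metric.ball (w.re : ℂ) δ) := by
      refine (hh (w + 1).re).comp (by fun_prop) fun u hu => ?_
      rw [Metric.mem_ball, dist_eq_norm] at hu ⊢
      convert hu using 2
      simp
    refine eqOn_of_eqOn_real Metric.isOpen_ball (convex_ball _ _).isPreconnected h1 (hh w.re)
      (Metric.mem_ball_self hδ) (fun y hy => ?_) hb
    rw [hhf _ _ hy]
    have h2 := hhf (w + 1).re (y + 1) (by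
      rw [Metric.mem_ball, dist_eq_norm] at hy ⊢
      convert hy using 2
      simp)
    push_cast at h2
    rw [h2, hper y]
  have hsub : strip (δ / 4) ⊆ strip (δ / 2) := fun w hw =>
    lt_trans (show |w.im| < δ / 4 from hw) (by linarith)
  have hK : IsCompact (Icc (0 : ℝ) 1 ×ℂ Icc (-(δ / 4)) (δ / 4)) :=
    IsCompact.reProdIm isCompact_Icc isCompact_Icc
  obtain ⟨B, hB⟩ := hK.exists_bound_of_continuousOn (f := F) (hdF.continuousOn.mono fun w hw => by
    have := abs_le.2 hw.2
    change |w.im| < δ / 2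
    linarith)
  refine ⟨δ / 4, by positivity, F, hdF.mono hsub, fun w hw => hperF w (hsub hw), ⟨B, ?_⟩, fun s => ?_⟩
  · intro w hw
    have hw' : |w.im| < δ / 4 := hw
    rw [← add_int_of_add_one hperF (-⌊w.re⌋) w (hsub hw)]
    refine hB _ ⟨?_, ?_⟩
    · simp only [mem_preimage, Complex.add_re, Complex.intCast_re]
      push_cast
      exact ⟨by linarith [Int.floor_le w.re], by linarith [Int.lt_floor_add_one w.re]⟩
    · simpa using abs_le.1 hw'.le
  · simp only [hF, Complex.ofReal_re]
    exact hhf s s (Metric.mem_ball_self hδ)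

theorem av_periodic {f : ℝ → ℂ} (hf : Function.Periodic f 1) (σ : ℝ) :
    Function.Periodic (fun s => av f s σ) 1 := fun s => by
  simp only [av]
  refine intervalIntegral.integral_congr fun c _ => ?_
  rw [← hf (s + c * σ)]
  congr 1
  ring

theorem exists_dq_lower {E : ℝ → ℂ} (hE : Continuous E) (hper : Function.Periodic E 1)
    (hpos : ∀ s, ∀ σ ∈ 𝕁, 0 < dq E s σ) :
    ∃ c > 0, ∀ s, ∀ σ ∈ 𝕁, c ≤ dq E s σ := by
  have hK : IsCompact (Icc (0 : ℝ) 1 ×ˢ 𝕁) := isCompact_Icc.prod isCompact_Icc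
  obtain ⟨p, hp, hmin⟩ := hK.exists_isMinOn ⟨(0, 0), by constructor <;> simp⟩
    (continuous_dq hE).continuousOn
  refine ⟨dq E p.1 p.2, hpos _ _ hp.2, fun s σ hσ => ?_⟩
  have h1 : dq E s σ = dq E (Int.fract s) σ := by
    have := (av_periodic hper σ).sub_zsmul_eq ⌊s⌋ (x := s)
    simp only [zsmul_eq_mul, mul_one] at this
    rw [dq, dq, ← Int.self_sub_floor, this]
  rw [h1]
  exact hmin (show (Int.fract s, σ) ∈ _ from ⟨⟨Int.fract_nonneg s, (Int.fract_lt_one s).le⟩, hσ⟩)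

/-- The angular speed of a unit tangent field. -/
def angSpeed (E : ℝ → ℂ) (s : ℝ) : ℂ := -Complex.I * (conj (E s) * deriv E s)

theorem analyticOnNhd_conj {f : ℝ → ℂ} (hf : AnalyticOnNhd ℝ f univ) :
    AnalyticOnNhd ℝ (fun s => conj (f s)) univ :=
  (Complex.conjCLE.toContinuousLinearMap).comp_analyticOnNhd hf

theorem analyticOnNhd_angSpeed {E : ℝ → ℂ} (hE : AnalyticOnNhd ℝ E univ) :
    AnalyticOnNhd ℝ (angSpeed E) univ :=
  analyticOnNhd_const.mul ((analyticOnNhd_conj hE).mul hE.deriv)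

theorem periodic_deriv {f : ℝ → ℂ} (hf : Function.Periodic f 1) : Function.Periodic (deriv f) 1 :=
  fun s => by
    rw [← deriv_comp_add_const]
    congr 1
    exact funext hf

/-- A unit tangent field with its derived quantities. -/
theorem unitState_of_analytic {E : ℝ → ℂ} (hE : AnalyticOnNhd ℝ E univ) (hu : ∀ s, ‖E s‖ = 1)
    (hpos : ∀ s, ∀ σ ∈ 𝕁, 0 < dq E s σ) :
    UnitState E (angSpeed E) (deriv (angSpeed E)) := by
  have hd : ∀ s, HasDerivAt E (deriv E s) s := fun s =>
    (hE s (mem_univ s)).differentiableAt.hasDerivAt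
  have hEE : ∀ s, E s * conj (E s) = 1 := fun s => by
    rw [Complex.mul_conj, Complex.normSq_eq_norm_sq, hu]
    simp
  have hk := analyticOnNhd_angSpeed hE
  refine ⟨hu, fun s => ?_, fun s => ?_, fun s => (hk s (mem_univ s)).differentiableAt.hasDerivAt,
    continuous_iff_continuousAt.2 fun s => (hk.deriv s (mem_univ s)).continuousAt, hpos⟩
  · refine (hd s).congr_deriv ?_
    rw [angSpeed]
    linear_combination (-deriv E s) * hEE s + (E s * conj (E s) * deriv E s) * Complex.I_sq
  · have h1 : HasDerivAt (fun s => E s * conj (E s)) _ s := (hd s).mul (hd s).star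
    rw [show (fun s => E s * conj (E s)) = fun _ => 1 from funext hEE] at h1
    have h2 := h1.unique (hasDerivAt_const s 1)
    have h2' : deriv E s * conj (E s) + E s * conj (deriv E s) = 0 := h2
    rw [angSpeed]
    simp only [map_mul, map_neg, Complex.conj_I, Complex.conj_conj]
    linear_combination Complex.I * h2'

namespace Wien

theorem wt_le {ρ : ℝ} (hρ : 0 ≤ ρ) (r : unitInterval) : (wt ρ r : ℝ) ≤ 2 * π * ρ := by
  rw [wt_apply hρ]
  have h : (0 : ℝ) ≤ r := r.2.1
  nlinarith [mul_nonneg Real.pi_pos.le hρ]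

/-- A periodic real-analytic function, as a time-independent element of a Wiener algebra. -/
theorem exists_of_analytic {f : ℝ → ℂ} (hf : AnalyticOnNhd ℝ f univ) (hper : Function.Periodic f 1) :
    ∃ ρ₀ > 0, ∀ ρ, 0 < ρ → ρ ≤ ρ₀ → ∃ g : W1 ρ, ∀ r s, rl g r s = f s := by
  obtain ⟨δ, hδ, F, hF, hFper, ⟨B, hB⟩, hFf⟩ := exists_strip_extension hf hper
  have hfc : Continuous f := continuous_iff_continuousAt.2 fun s => (hf s (mem_univ s)).continuousAt
  have hB0 : 0 ≤ B := (norm_nonneg _).trans (hB 0 (by simpa [strip] using hδ))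
  have hpi := Real.pi_pos
  refine ⟨δ / 4, by positivity, fun ρ hρ hρδ => ?_⟩
  refine (exists_of_coef (ω := wt ρ) (F := fun _ s => f s) (a := 2 * π * (δ / 4))
    (b := 2 * π * (δ / 2)) (c := fun k => B * Real.exp (-(2 * π * |δ / 2| * |(k : ℝ)|)))
    (fun _ => hfc) (fun _ => continuous_const) (fun _ => hper) (by gcongr; norm_num) (fun r => (wt_le hρ.le r).trans (by gcongr))
    (fun k => by positivity) ⟨B, fun k => ?_⟩ fun k x => ?_).imp fun g hg => hg.1
  · rw [abs_of_pos (by positivity : 0 < δ / 2)]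
  · have h1 := norm_coef_le_of_bound hF hFper (y := δ / 2)
      (by rw [abs_of_pos (by positivity)]; linarith) hB k
    simpa only [hFf] using h1

/-- The base belonging to an analytic unit tangent field. -/
theorem exists_base (β : ℝ) {E : ℝ → ℂ} (hE : AnalyticOnNhd ℝ E univ) (hper : Function.Periodic E 1)
    (hu : ∀ s, ‖E s‖ = 1) (hpos : ∀ s, ∀ σ ∈ 𝕁, 0 < dq E s σ) :
    ∃ ρ₀ > 0, ∀ ρ, 0 < ρ → ρ ≤ ρ₀ → ∃ B : Base ρ, IsBase β B ∧ ∀ r s, rl B.E r s = E s := by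
  have hpi := Real.pi_pos
  have hEc : Continuous E := continuous_iff_continuousAt.2 fun s => (hE s (mem_univ s)).continuousAt
  have hk := analyticOnNhd_angSpeed hE
  have hkper : Function.Periodic (angSpeed E) 1 := fun s => by
    rw [angSpeed, angSpeed, hper s, periodic_deriv hper s]
  obtain ⟨ρ₁, hρ₁, h1⟩ := exists_of_analytic hE hper
  obtain ⟨ρ₂, hρ₂, h2⟩ := exists_of_analytic hk hkper
  obtain ⟨ρ₃, hρ₃, h3⟩ := exists_of_analytic hk.deriv (periodic_deriv hkper)
  obtain ⟨c, hc, hcd⟩ := exists_dq_lower hEc hper hpos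
  obtain ⟨e, he⟩ := h1 ρ₁ hρ₁ le_rfl
  have hrle : ∀ r, rl e r = E := fun r => funext (he r)
  have hpow := fun γ => exists_rpow (chord e) (a := π * ρ₁) (c := c)
    (d := fun p s => dq E s p.2) (by positivity) (fun p => wt_ge hρ₁.le p.1) hc
    (fun p s => hcd s p.2 p.2.2) (fun p s => by
      obtain ⟨r, σ⟩ := p
      rw [ev_chord, hrle]) γ
  obtain ⟨ρ₄, hρ₄, h4⟩ := hpow (-(β / 2) - 1)
  obtain ⟨ρ₅, hρ₅, h5⟩ := hpow (-1)
  refine ⟨min (min (min ρ₁ ρ₂) ρ₃) (min (ρ₄ / (2 * π)) (ρ₅ / (2 * π))), by positivity,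
    fun ρ hρ hle => ?_⟩
  simp only [le_min_iff] at hle
  obtain ⟨⟨⟨hl1, hl2⟩, hl3⟩, hl4, hl5⟩ := hle
  rw [le_div_iff₀ (by positivity)] at hl4 hl5
  obtain ⟨BE, hBE⟩ := h1 ρ hρ hl1
  obtain ⟨Bk, hBk⟩ := h2 ρ hρ hl2
  obtain ⟨Bk', hBk'⟩ := h3 ρ hρ hl3
  obtain ⟨BV, hBV⟩ := h4 (lw (wt ρ)) fun p => (wt_le hρ.le p.1).trans (by linarith)
  obtain ⟨BM, hBM⟩ := h5 (lw (wt ρ)) fun p => (wt_le hρ.le p.1).trans (by linarith)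
  refine ⟨⟨BE, Bk, Bk', BV, BM⟩, ⟨fun r => ?_, fun r σ s => ?_, fun r σ s => ?_⟩, hBE⟩
  · change UnitState (rl BE r) (rl Bk r) (rl Bk' r)
    rw [funext (hBE r), funext (hBk r), funext (hBk' r)]
    exact unitState_of_analytic hE hu hpos
  · change ev BV (r, σ) s = vq β (rl BE r) s σ
    rw [funext (hBE r), hBV, vq]
  · change ev BM (r, σ) s * dq (rl BE r) s σ = 1
    rw [funext (hBE r), hBM, ← Complex.ofReal_mul, Real.rpow_neg_one,
      inv_mul_cancel₀ (hpos s σ σ.2).ne', Complex.ofReal_one]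

end Wien

/-- An autonomous scalar equation with bounded positive right-hand side has a global solution. -/
theorem exists_clock {g : ℝ → ℝ} (hg : Continuous g) (hpos : ∀ x, 0 < g x) {C : ℝ}
    (hC : ∀ x, g x ≤ C) :
    ∃ h : ℝ → ℝ, h 0 = 0 ∧ StrictMono h ∧ Function.Surjective h ∧ ∀ t, HasDerivAt h (g (h t)) t := by
  have hCp : 0 < C := (hpos 0).trans_le (hC 0)
  set Φ : ℝ → ℝ := fun x => ∫ y in (0 : ℝ)..x, (g y)⁻¹ with hΦ
  have hgi : Continuous fun y => (g y)⁻¹ := hg.inv₀ fun x => (hpos x).ne'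
  have hd : ∀ x, HasDerivAt Φ (g x)⁻¹ x := fun x =>
    (hgi.integral_hasStrictDerivAt 0 x).hasDerivAt
  have hmono : StrictMono Φ := strictMono_of_deriv_pos fun x => by
    rw [(hd x).deriv]; exact inv_pos.2 (hpos x)
  have hcont : Continuous Φ := continuous_of_hasDerivAt hd
  have hmono2 : Monotone fun x => Φ x - x / C := by
    refine monotone_of_deriv_nonneg (fun x => ?_) fun x => ?_
    · exact ((hd x).sub ((hasDerivAt_id x).div_const C)).differentiableAt
    · have := ((hd x).sub ((hasDerivAt_id x).div_const C)).deriv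
      have h2 : deriv (fun x => Φ x - x / C) x = (g x)⁻¹ - 1 / C := this
      rw [h2, sub_nonneg, one_div]
      exact inv_anti₀ (hpos x) (hC x)
  have h0 : Φ 0 = 0 := by simp [hΦ]
  have hsurj : Function.Surjective Φ := by
    refine hcont.surjective ?_ ?_
    · refine Filter.tendsto_atTop_mono' _ ?_ (Filter.tendsto_id.atTop_div_const hCp)
      filter_upwards [Filter.eventually_ge_atTop 0] with x hx
      have := hmono2 hx
      simp only [h0, zero_div, sub_zero] at this
      simp only [id]
      linarith
    · refine Filter.tendsto_atBot_mono' _ ?_ (Filter.tendsto_id.atBot_div_const hCp)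
      filter_upwards [Filter.eventually_le_atBot 0] with x hx
      have := hmono2 hx
      simp only [h0, zero_div, sub_zero] at this
      simp only [id]
      linarith
  set e := hmono.orderIsoOfSurjective Φ hsurj with he
  have hsymm : ∀ t, Φ (e.symm t) = t := fun t => e.apply_symm_apply t
  refine ⟨e.symm, ?_, e.symm.strictMono, e.symm.surjective, fun t => ?_⟩
  · apply hmono.injective
    rw [hsymm, h0]
  · have := HasDerivAt.of_local_left_inverse (e.symm.continuous.continuousAt (x := t))
      (hd (e.symm t)) (inv_ne_zero (hpos _).ne') (Filter.Eventually.of_forall hsymm)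
    rwa [inv_inv] at this

/-- A moving curve of speed independent of the parameter: `z_t = ζ + lam z_s`, in complex notation,
with tangential velocity `lam L^{-β}`. -/
structure IsFlow (β : ℝ) (n : ℝ → ℝ) (T : ℝ) (z : ℝ → ℝ → ℂ) (L m : ℝ → ℝ) (E k k' : ℝ → ℝ → ℂ)
    (lam : ℝ → ℝ → ℝ) : Prop where
  pos : ∀ t, 0 < L t
  periodic : ∀ t, Function.Periodic (z t) 1
  periodic_lam : ∀ t, Function.Periodic (lam t) 1
  state : ∀ t, UnitState (E t) (k t) (k' t)
  hasDerivAt : ∀ t ∈ Icc 0 T, ∀ s, HasDerivAt (z t) (L t * E t s) s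
  hasDerivAt_time : ∀ t ∈ Icc 0 T, ∀ s, HasDerivAt (fun t => z t s)
    ((L t ^ (1 - β) : ℝ) * (zetaU β (E t) (fun s => Complex.I * k t s * E t s) s +
      lam t s * E t s)) t
  hasDerivAt_lam : ∀ t s, HasDerivAt (lam t)
    (m t - (remU β (E t) (fun s => Complex.I * k t s * E t s) (k t) s).re) s
  continuous_rem : ∀ t, Continuous (remU β (E t) (fun s => Complex.I * k t s * E t s) (k t))
  lam_zero : ∀ t, lam t 0 = ∫ σ in (-(1 / 2) : ℝ)..(1 / 2), n σ * (dq (E t) 0 σ * vq β (E t) 0 σ)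

/-- Uniform bounds for a family of unit tangent fields in a strip. -/
structure StripBound (ρ B c : ℝ) (E : ℝ → ℂ) : Prop where
  ext : ∃ F : ℂ → ℂ, DifferentiableOn ℂ F (strip ρ) ∧ (∀ w ∈ strip ρ, F (w + 1) = F w) ∧
    (∀ w ∈ strip ρ, ‖F w‖ ≤ B) ∧ ∀ s : ℝ, F s = E s
  dq_ge : ∀ s, ∀ σ ∈ 𝕁, c ≤ dq E s σ

namespace Wien

theorem exists_stripBound {ρ : ℝ} (hρ : 0 < ρ) (f : W1 ρ)
    (hpos : ∀ r s, ∀ σ ∈ 𝕁, 0 < dq (rl f r) s σ) :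
    ∃ c > 0, ∀ r, StripBound (ρ / 2) ‖f‖ c (rl f r) := by
  have hK : IsCompact ((univ : Set (unitInterval × Sg)) ×ˢ Icc (0 : ℝ) 1) :=
    isCompact_univ.prod isCompact_Icc
  have hc : Continuous fun p : (unitInterval × Sg) × ℝ => (ev (chord f) p.1 p.2).re :=
    Complex.continuous_re.comp (continuous_ev_param (chord f))
  obtain ⟨p, hp, hmin⟩ := hK.exists_isMinOn ⟨((0, prSg 0), 0), by constructor <;> simp⟩ hc.continuousOn
  obtain ⟨⟨r₀, σ₀⟩, s₀⟩ := p
  refine ⟨dq (rl f r₀) s₀ σ₀, hpos _ _ _ σ₀.2, fun r => ⟨⟨ev f r, ?_, fun w _ => ev_periodic _ _ _,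
    fun w hw => norm_ev_le f ?_, fun s => rfl⟩, fun s σ hσ => ?_⟩⟩
  · refine (differentiableOn_ev f r).mono fun w hw => ?_
    have hw' : |w.im| < ρ / 2 := hw
    have := wt_ge hρ.le r
    change 2 * π * |w.im| < _
    nlinarith [Real.pi_pos]
  · have hw' : |w.im| < ρ / 2 := hw
    have := wt_ge hρ.le r
    change 2 * π * |w.im| ≤ _
    nlinarith [Real.pi_pos]
  · have h1 : dq (rl f r) s σ = dq (rl f r) (Int.fract s) σ := by
      have := (av_periodic (rl_periodic f r) σ).sub_zsmul_eq ⌊s⌋ (x := s)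
      simp only [zsmul_eq_mul, mul_one] at this
      rw [dq, dq, ← Int.self_sub_floor, this]
    rw [h1]
    have h2 := hmin (show ((r, ⟨σ, hσ⟩), Int.fract s) ∈ (univ : Set (unitInterval × Sg)) ×ˢ
      Icc (0 : ℝ) 1 from ⟨mem_univ _, Int.fract_nonneg s, (Int.fract_lt_one s).le⟩)
    simpa [ev_chord] using h2

theorem exists_isFlow {β : ℝ} (hβ₁ : 1 < β) (hβ₂ : β < 2) {n : ℝ → ℝ}
    (hn : IntegrableOn n 𝕁) {E₀ : ℝ → ℂ} (hE : AnalyticOnNhd ℝ E₀ univ)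
    (hper : Function.Periodic E₀ 1) (hu : ∀ s, ‖E₀ s‖ = 1)
    (hpos : ∀ s, ∀ σ ∈ 𝕁, 0 < dq E₀ s σ)
    {z₀ : ℝ → ℂ} {L₀ : ℝ} (hL₀ : 0 < L₀) (hz : ∀ s, HasDerivAt z₀ (L₀ * E₀ s) s)
    (hzper : Function.Periodic z₀ 1) :
    ∃ T > 0, ∃ z L m E k k' lam, IsFlow β n T z L m E k k' lam ∧ z 0 = z₀ ∧
      ∃ ρ > 0, ∃ c > 0, ∃ B, ∀ t ∈ Icc 0 T, StripBound ρ B c (E t) ∧ c ≤ L t ∧ L t ≤ B ∧ ‖z t 0‖ ≤ B := by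
  obtain ⟨ρ, hρ, hbase⟩ := exists_base β hE hper hu hpos
  obtain ⟨B, hB, hBE⟩ := hbase ρ hρ le_rfl
  obtain ⟨δ₁, hδ₁, hst⟩ := exists_state β hρ B hB
  obtain ⟨δ₀, hδ₀, hfix, -⟩ := exists_unique_small_fixedPoint (B.nonlin β hβ₁ hβ₂ n hn)
    (B.contDiffAt_nonlin β hβ₁ hβ₂ n hn) (fun T => (volterra (dsym β) T ρ hρ).op) (1 + 2 / ρ)
    (fun T f => OpData.norm_op_le _ f)
  obtain ⟨T, hT, hTfix⟩ := hfix (min δ₀ δ₁) (lt_min hδ₀ hδ₁) (min_le_left _ _)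
  obtain ⟨ψ, hψδ, hψ⟩ := hTfix T hT le_rfl
  have hst' := hst ψ (hψδ.trans (min_le_right _ _))
  obtain ⟨L, W, hLc, hLpos, hL0, hW0, hWper, hWs, hWr⟩ := exists_flow hβ₁ hβ₂ n hn hρ hB
    (fun r s => by rw [hBE, hBE]) hst' hψ hL₀ (z₀ := z₀) (fun s => by rw [hBE]; exact hz s) hzper
  have hpI := continuous_pI
  set g : ℝ → ℝ := fun r => (T * L (pI r) ^ β)⁻¹ with hg
  have hgpos : ∀ x, 0 < g x := fun x => by
    have := hLpos (pI x)
    positivity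
  have hgc : Continuous g := by
    refine Continuous.inv₀ ?_ fun x => ?_
    · refine continuous_const.mul (Continuous.rpow_const (by fun_prop) fun x => Or.inl (hLpos _).ne')
    · have := hLpos (pI x)
      positivity
  have hcptL := isCompact_Icc.exists_isMaxOn (s := Icc (0 : ℝ) 1) ⟨0, by simp⟩ hLc.continuousOn
  have hcptl := isCompact_Icc.exists_isMinOn (s := Icc (0 : ℝ) 1) ⟨0, by simp⟩ hLc.continuousOn
  have hcptg := isCompact_Icc.exists_isMaxOn (s := Icc (0 : ℝ) 1) ⟨0, by simp⟩ hgc.continuousOn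
  have hWc : Continuous fun r => W r 0 := continuous_of_hasDerivAt fun r => hWr r 0
  obtain ⟨CW, hCW⟩ := isCompact_Icc.exists_bound_of_continuousOn (s := Icc (0 : ℝ) 1) hWc.continuousOn
  obtain ⟨xL, hxL, hmaxL⟩ := hcptL
  obtain ⟨xl, hxl, hminl⟩ := hcptl
  obtain ⟨xg, hxg, hmaxg⟩ := hcptg
  obtain ⟨h, h0, hmono, hsurj, hder⟩ := exists_clock hgc hgpos (C := g xg) (fun x => by
    have h1 := hmaxg (pI x).2
    have h2 : g (pI x) = g x := by simp only [hg, pI_coe]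
    exact h2 ▸ h1)
  obtain ⟨T', hT'⟩ := hsurj 1
  have hT'pos : 0 < T' := by
    by_contra hcon
    have := hmono.monotone (not_lt.1 hcon)
    rw [h0, hT'] at this
    linarith
  have hmem : ∀ t ∈ Icc 0 T', h t ∈ Icc (0 : ℝ) 1 := fun t ht => by
    rw [← h0, ← hT']
    exact ⟨hmono.monotone ht.1, hmono.monotone ht.2⟩
  have hpIh : ∀ t ∈ Icc 0 T', (pI (h t) : ℝ) = h t := fun t ht => by
    rw [pI, projIcc_of_mem _ (hmem t ht)]
  have hll := fun r => ll_props hβ₁ hβ₂ n hn (hst' r).2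
  have hre : ∀ r s, ((rl (B.ll β hβ₁ hβ₂ n hn ψ) r s).re : ℂ) = rl (B.ll β hβ₁ hβ₂ n hn ψ) r s :=
    fun r s => Complex.conj_eq_iff_re.1 ((hll r).2.1 s)
  obtain ⟨c, hc, hstrip⟩ := exists_stripBound hρ (B.tan ψ) fun r s σ hσ => (hst' r).1.dq_pos s σ hσ
  have htan' : ∀ r, (fun s => Complex.I * rl (B.kk ψ) r s * rl (B.tan ψ) r s) = rl (B.tan' ψ) r :=
    fun r => (funext fun s => rl_tan' B ψ r s).symm
  refine ⟨T', hT'pos, fun t => W (h t), fun t => L (h t), fun t => B.mean hβ₁ hβ₂ ψ (pI (h t)),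
    fun t => rl (B.tan ψ) (pI (h t)), fun t => rl (B.kk ψ) (pI (h t)),
    fun t s => rl B.k' (pI (h t)) s + rl (phi2 hρ ψ) (pI (h t)) s,
    fun t s => (rl (B.ll β hβ₁ hβ₂ n hn ψ) (pI (h t)) s).re, ?_, ?_, ?_⟩
  · refine ⟨fun t => hLpos _, fun t => hWper _,
      fun t s => by simp only [rl_periodic _ _ s], fun t => (hst' _).1, fun t ht s => ?_,
      fun t ht s => ?_, fun t s => ?_, fun t => ?_, fun t => ?_⟩
    · have := hWs (pI (h t)) s
      rwa [hpIh t ht] at this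
    · have h1 := (hWr (h t) s).scomp t (hder t)
      refine h1.congr_deriv ?_
      have hL := hLpos (h t)
      rw [htan', hre, Complex.real_smul]
      simp only [hg]
      rw [hpIh t ht, Real.rpow_sub hL, Real.rpow_one, mul_inv, mul_comm T⁻¹, div_eq_mul_inv]
      push_cast
      have hTc : (T : ℂ) ≠ 0 := by exact_mod_cast hT.ne'
      field_simp
    · have h1 := (hll (pI (h t))).2.2.1 s
      have h2 := Complex.reCLM.hasFDerivAt.comp_hasDerivAt s h1
      refine h2.congr_deriv ?_
      rw [htan', ← (hll (pI (h t))).1 s]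
      simp [Base.mean]
    · rw [htan', ← show rl _ _ = remU _ _ _ _ from funext (hll (pI (h t))).1]
      exact continuous_rl _ _
    · rw [(hll (pI (h t))).2.2.2, Complex.ofReal_re]
  · simp only [h0, hW0]
  · refine ⟨ρ / 2, by positivity, min c (L xl), lt_min hc (hLpos _),
      max (max ‖B.tan ψ‖ (L xL)) CW, fun t ht => ⟨⟨?_, ?_⟩, ?_, ?_, ?_⟩⟩
    · obtain ⟨F, hF1, hF2, hF3, hF4⟩ := (hstrip (pI (h t))).ext
      exact ⟨F, hF1, hF2, fun w hw => (hF3 w hw).trans ((le_max_left _ _).trans (le_max_left _ _)), hF4⟩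
    · exact fun s σ hσ => (min_le_left _ _).trans ((hstrip (pI (h t))).dq_ge s σ hσ)
    · exact (min_le_right _ _).trans (hminl (hmem t ht))
    · exact (hmaxL (hmem t ht)).trans ((le_max_right _ _).trans (le_max_left _ _))
    · exact (hCW _ (hmem t ht)).trans (le_max_right _ _)

end Wien

theorem strip_mono {ρ ρ' : ℝ} (h : ρ ≤ ρ') : strip ρ ⊆ strip ρ' := fun _ hw => lt_of_lt_of_le hw h

section

variable {E : Type} [NormedAddCommGroup E] [NormedSpace ℂ E]

theorem closedBall_subset_strip {ρ ρ' : ℝ} {w : ℂ} (hw : w ∈ strip ρ') {v : ℂ}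
    (hv : v ∈ Metric.closedBall w (ρ - ρ')) : v ∈ strip ρ := by
  have h2 := Complex.abs_im_le_norm (v - w)
  rw [mem_closedBall_iff_norm] at hv
  have h3 : |v.im| ≤ |(v - w).im| + |w.im| := by
    have := abs_add_le (v - w).im w.im
    simpa using this
  have h4 : |w.im| < ρ' := hw
  change |v.im| < ρ
  linarith

theorem diffContOnCl_of_strip {f : ℂ → E} {ρ ρ' : ℝ} (hf : DifferentiableOn ℂ f (strip ρ)) {w : ℂ}
    (hw : w ∈ strip ρ') : DiffContOnCl ℂ f (Metric.ball w (ρ - ρ')) :=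
  DifferentiableOn.diffContOnCl (hf.mono fun _ hv =>
    closedBall_subset_strip hw (Metric.closure_ball_subset_closedBall hv))

/-- Cauchy's estimate for the derivative in a smaller strip. -/
theorem norm_deriv_le_of_strip {f : ℂ → E} {ρ ρ' B : ℝ} (hρ : ρ' < ρ)
    (hf : DifferentiableOn ℂ f (strip ρ)) (hB : ∀ w ∈ strip ρ, ‖f w‖ ≤ B) {w : ℂ} (hw : w ∈ strip ρ') :
    ‖deriv f w‖ ≤ B / (ρ - ρ') :=
  Complex.norm_deriv_le_of_forall_mem_sphere_norm_le (sub_pos.2 hρ) (diffContOnCl_of_strip hf hw)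
    fun _ hv => hB _ (closedBall_subset_strip hw (Metric.sphere_subset_closedBall hv))

theorem norm_iteratedDeriv_le_of_strip [CompleteSpace E] {f : ℂ → E} {ρ ρ' B : ℝ} (hρ : ρ' < ρ)
    (hf : DifferentiableOn ℂ f (strip ρ)) (hB : ∀ w ∈ strip ρ, ‖f w‖ ≤ B) {w : ℂ} (hw : w ∈ strip ρ')
    (n : ℕ) : ‖iteratedDeriv n f w‖ ≤ n.factorial * B / (ρ - ρ') ^ n :=
  Complex.norm_iteratedDeriv_le_of_forall_mem_sphere_norm_le n (sub_pos.2 hρ)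
    (diffContOnCl_of_strip hf hw)
    fun _ hv => hB _ (closedBall_subset_strip hw (Metric.sphere_subset_closedBall hv))

theorem periodic_deriv_of_strip {f : ℂ → E} {ρ : ℝ} (h : ∀ w ∈ strip ρ, f (w + 1) = f w) :
    ∀ w ∈ strip ρ, deriv f (w + 1) = deriv f w := by
  intro w hw
  rw [← deriv_comp_add_const]
  refine Filter.EventuallyEq.deriv_eq ?_
  filter_upwards [(isOpen_strip ρ).mem_nhds hw] with u hu using h u hu

/-- The bound for the norm of `K^{l,ρ'}` by a supremum bound on a larger strip. -/
def kBound (l : ℕ) (ρ ρ' B : ℝ) : ℝ :=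
  ∑ a ∈ Finset.range (l + 1), a.factorial * B / (ρ - ρ') ^ a

theorem memK_of_bound (l : ℕ) {f : ℂ → CPlane} {ρ ρ' B : ℝ} (hρ : ρ' < ρ)
    (hf : DifferentiableOn ℂ f (strip ρ)) (hper : ∀ w ∈ strip ρ, f (w + 1) = f w)
    (hB : ∀ w ∈ strip ρ, ‖f w‖ ≤ B) (hB0 : 0 ≤ B) :
    MemK l ρ' f ∧ kNorm l ρ' f ≤ ENNReal.ofReal (kBound l ρ ρ' B) := by
  have hsub := sub_pos.2 hρ
  have h : kNorm l ρ' f ≤ ENNReal.ofReal (kBound l ρ ρ' B) := by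
    rw [kBound, ENNReal.ofReal_sum_of_nonneg fun a _ => by positivity, kNorm]
    refine Finset.sum_le_sum fun a _ => iSup₂_le fun y hy => ?_
    refine (eLpNorm_le_of_ae_bound (C := a.factorial * B / (ρ - ρ') ^ a)
      (ae_of_all _ fun x => ?_)).trans (le_of_eq ?_)
    · exact norm_iteratedDeriv_le_of_strip hρ hf hB (by simpa [strip] using hy) a
    · simp
  exact ⟨⟨hf.mono (strip_mono hρ.le), fun w hw => hper w (strip_mono hρ.le hw),
    h.trans_lt ENNReal.ofReal_lt_top⟩, h⟩

/-- Separately holomorphic functions on a product of strips, bounded and periodic in each variable. -/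
structure SepHolo (ρ C : ℝ) (F : ℂ × ℂ → ℂ) : Prop where
  left : ∀ v ∈ strip ρ, DifferentiableOn ℂ (fun u => F (u, v)) (strip ρ)
  right : ∀ u ∈ strip ρ, DifferentiableOn ℂ (fun v => F (u, v)) (strip ρ)
  bound : ∀ u ∈ strip ρ, ∀ v ∈ strip ρ, ‖F (u, v)‖ ≤ C

/-- The second partial derivative of a bounded separately holomorphic function. -/
theorem SepHolo.deriv_right {ρ ρ' C : ℝ} {F : ℂ × ℂ → ℂ} (hF : SepHolo ρ C F) (hρ : ρ' < ρ)
    (hρ' : 0 < ρ') : SepHolo ρ' (C / (ρ - ρ')) fun p => deriv (fun v => F (p.1, v)) p.2 := by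
  have hsub := strip_mono hρ.le
  have hC : 0 ≤ C := (norm_nonneg _).trans (hF.bound 0 (hsub (by simpa [strip] using hρ')) 0
    (hsub (by simpa [strip] using hρ')))
  refine ⟨fun v hv => ?_, fun u hu => ?_, fun u hu v hv =>
    norm_deriv_le_of_strip hρ (hF.right u (hsub hu)) (hF.bound u (hsub hu)) hv⟩
  · set δ := (ρ - ρ') / 2 with hδ
    have hδp : 0 < δ := by have := sub_pos.2 hρ; positivity
    have key : TendstoLocallyUniformlyOn (fun (h : ℝ) u => ((h : ℂ))⁻¹ * (F (u, v + h) - F (u, v)))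
        (fun u => deriv (fun v => F (u, v)) v) (nhdsWithin 0 (Ioi 0)) (strip ρ') := by
      refine TendstoUniformlyOn.tendstoLocallyUniformlyOn ?_
      rw [Metric.tendstoUniformlyOn_iff]
      intro ε hε
      have hmem : Ioo (0 : ℝ) (min δ (ε * δ ^ 2 / (2 * C + 1))) ∈ nhdsWithin (0 : ℝ) (Ioi 0) :=
        Ioo_mem_nhdsGT (by positivity)
      filter_upwards [hmem] with h hh u hu
      have hh1 : h < δ := hh.2.trans_le (min_le_left _ _)
      have hh2 : h < ε * δ ^ 2 / (2 * C + 1) := hh.2.trans_le (min_le_right _ _)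
      have hd1 := hF.right u (hsub hu)
      set φ : ℂ → ℂ := fun v => F (u, v) with hφ
      have hstr : ∀ x ∈ Metric.ball v δ, x ∈ strip (ρ' + δ) := by
        intro x hx
        refine closedBall_subset_strip hv (Metric.ball_subset_closedBall ?_)
        simpa using hx
      have hd' : ∀ x ∈ Metric.ball v δ, HasDerivAt φ (deriv φ x) x := fun x hx =>
        (hd1.differentiableAt ((isOpen_strip ρ).mem_nhds
          (strip_mono (by rw [hδ]; linarith) (hstr x hx)))).hasDerivAt
      have hd2 : ∀ x ∈ Metric.ball v δ, ‖deriv φ x - deriv φ v‖ ≤ 2 * C / δ ^ 2 * ‖x - v‖ := by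
        intro x hx
        have hdd : DifferentiableOn ℂ (deriv φ) (strip ρ) := hd1.deriv (isOpen_strip ρ)
        refine Convex.norm_image_sub_le_of_norm_deriv_le (s := Metric.ball v δ) (fun y hy =>
          hdd.differentiableAt ((isOpen_strip ρ).mem_nhds
          (strip_mono (by rw [hδ]; linarith) (hstr y hy)))) (fun y hy => ?_) (convex_ball _ _)
          (Metric.mem_ball_self hδp) hx
        have h1 := norm_iteratedDeriv_le_of_strip (ρ' := ρ' + δ) (by rw [hδ]; linarith) hd1
          (hF.bound u (hsub hu)) (hstr y hy) 2
        rw [iteratedDeriv_succ, iteratedDeriv_one] at h1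
        refine h1.trans (le_of_eq ?_)
        rw [hδ]
        rw [show ρ - (ρ' + (ρ - ρ') / 2) = (ρ - ρ') / 2 by ring]
        norm_num
      have hmv : (v + h : ℂ) ∈ Metric.closedBall v h := by
        simp [abs_of_pos hh.1]
      have h3 := Convex.norm_image_sub_le_of_norm_deriv_le (f := fun x => φ x - x * deriv φ v)
        (s := Metric.closedBall v h) (C := 2 * C / δ ^ 2 * h) (x := v) (y := v + h)
        (fun y hy => ?_) (fun y hy => ?_) (convex_closedBall _ _)
        (Metric.mem_closedBall_self hh.1.le) hmv
      · have hhp : (h : ℂ) ≠ 0 := by exact_mod_cast hh.1.ne'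
        have e : deriv φ v - (h : ℂ)⁻¹ * (φ (v + h) - φ v) = -(h : ℂ)⁻¹ *
            (φ (v + h) - (v + h) * deriv φ v - (φ v - v * deriv φ v)) := by
          field_simp
          ring
        rw [dist_eq_norm]
        change ‖deriv φ v - (h : ℂ)⁻¹ * (φ (v + h) - φ v)‖ < ε
        rw [e, norm_mul, norm_neg, norm_inv, Complex.norm_real, Real.norm_eq_abs, abs_of_pos hh.1,
          inv_mul_lt_iff₀ hh.1]
        refine h3.trans_lt ?_
        rw [add_sub_cancel_left, Complex.norm_real, Real.norm_eq_abs, abs_of_pos hh.1, mul_comm]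
        refine mul_lt_mul_of_pos_left ?_ hh.1
        rw [lt_div_iff₀ (by positivity)] at hh2
        rw [div_mul_eq_mul_div, div_lt_iff₀ (by positivity)]
        linarith [hh.1]
      · have hy' : y ∈ Metric.ball v δ := Metric.closedBall_subset_ball hh1 hy
        exact ((hd' y hy').differentiableAt).sub (by fun_prop)
      · have hy' : y ∈ Metric.ball v δ := Metric.closedBall_subset_ball hh1 hy
        have h4 := ((hd' y hy').sub ((hasDerivAt_id y).mul_const (deriv φ v))).deriv
        have h5 : deriv (fun x => φ x - x * deriv φ v) y = deriv φ y - 1 * deriv φ v := h4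
        rw [h5, one_mul]
        refine (hd2 y hy').trans ?_
        have := mem_closedBall_iff_norm.1 hy
        gcongr
    refine key.differentiableOn ?_ (isOpen_strip ρ')
    filter_upwards [Ioo_mem_nhdsGT hδp] with h hh
    have h1 : v + h ∈ strip ρ := by
      have : |v.im| < ρ' := hv
      simpa [strip] using this.trans hρ
    exact (((hF.left _ h1).sub (hF.left v (hsub hv))).const_mul _).mono hsub
  · exact ((hF.right u (hsub hu)).deriv (isOpen_strip ρ)).mono hsub

theorem SepHolo.iteratedDeriv_right (n : ℕ) : ∀ {ρ : ℝ} {F : ℂ × ℂ → ℂ} {d C : ℝ}, 0 < d →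
    n * d < ρ → SepHolo ρ C F →
      SepHolo (ρ - n * d) (C / d ^ n) fun p => iteratedDeriv n (fun v => F (p.1, v)) p.2 := by
  induction n with
  | zero => intro ρ F d C hd hρ hF; simpa using hF
  | succ n ih =>
    intro ρ F d C hd hρ hF
    push_cast at hρ
    have h1 := hF.deriv_right (ρ' := ρ - d) (by linarith) (by nlinarith)
    rw [sub_sub_cancel] at h1
    have h2 := ih hd (by linarith) h1
    have e1 : ρ - d - n * d = ρ - (n + 1 : ℕ) * d := by push_cast; ring
    have e2 : C / d / d ^ n = C / d ^ (n + 1) := by rw [div_div, pow_succ']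
    rw [e1, e2] at h2
    simp only [iteratedDeriv_succ']
    exact h2

theorem SepHolo.norm_mixedDeriv_le {ρ d C : ℝ} {F : ℂ × ℂ → ℂ} (hF : SepHolo ρ C F) (hd : 0 < d)
    (a b : ℕ) (hρ : (b + 1) * d < ρ) {u v : ℂ} (hu : u ∈ strip (ρ - (b + 1) * d))
    (hv : v ∈ strip (ρ - (b + 1) * d)) :
    ‖mixedDeriv a b F u v‖ ≤ a.factorial * (C / d ^ b) / d ^ a := by
  have h1 := SepHolo.iteratedDeriv_right b (d := d) hd (by linarith) hF
  have hv' : v ∈ strip (ρ - b * d) := strip_mono (by linarith) hv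
  have h2 := norm_iteratedDeriv_le_of_strip (ρ := ρ - b * d) (ρ' := ρ - (b + 1) * d) (by linarith)
    (h1.left v hv') (fun u hu => h1.bound u hu v hv') hu a
  rw [show ρ - b * d - (ρ - (b + 1) * d) = d by ring] at h2
  exact h2

/-- The bound for the norm of `K_2^{l,ρ}` by a supremum bound on a larger product of strips. -/
def kBound₂ (l : ℕ) (d C : ℝ) : ℝ :=
  ∑ p ∈ (Finset.range (l + 1) ×ˢ Finset.range (l + 1)).filter (fun p => p.1 + p.2 ≤ l),
    p.1.factorial * (C / d ^ p.2) / d ^ p.1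

theorem memK₂_of_bound (l : ℕ) {F : ℂ × ℂ → ℂ} {ρ d ρ' C : ℝ} (hd : 0 < d) (hC : 0 ≤ C)
    (hρ' : 0 < ρ') (hρ : ρ' + (l + 1) * d ≤ ρ) (hF : SepHolo ρ C F)
    (hjoint : DifferentiableOn ℂ F (strip ρ ×ˢ strip ρ))
    (h1 : ∀ u ∈ strip ρ, ∀ v ∈ strip ρ, F (u + 1, v) = F (u, v))
    (h2 : ∀ u ∈ strip ρ, ∀ v ∈ strip ρ, F (u, v + 1) = F (u, v)) :
    MemK₂ l ρ' F ∧ kNorm₂ l ρ' F ≤ ENNReal.ofReal (kBound₂ l d C) := by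
  have hle : ρ' ≤ ρ := by nlinarith [show (0 : ℝ) ≤ l from by positivity]
  have hs := strip_mono hle
  have h : kNorm₂ l ρ' F ≤ ENNReal.ofReal (kBound₂ l d C) := by
    rw [kBound₂, ENNReal.ofReal_sum_of_nonneg fun a _ => by positivity, kNorm₂]
    refine Finset.sum_le_sum fun p hp => iSup₂_le fun y hy => ?_
    have hp2 : p.1 + p.2 ≤ l := (Finset.mem_filter.1 hp).2
    have hb : (p.2 : ℝ) ≤ l := by exact_mod_cast (by omega : p.2 ≤ l)
    have hbd : (p.2 + 1) * d ≤ (l + 1) * d := by gcongr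
    refine (eLpNorm_le_of_ae_bound (C := p.1.factorial * (C / d ^ p.2) / d ^ p.1)
      (ae_of_all _ fun x => ?_)).trans (le_of_eq ?_)
    · refine hF.norm_mixedDeriv_le hd p.1 p.2 (by linarith) ?_ ?_
      · have := hy.1
        have h3 : |y.1| < ρ - (p.2 + 1) * d := by linarith
        simpa [strip] using h3
      · have := hy.2
        have h3 : |y.2| < ρ - (p.2 + 1) * d := by linarith
        simpa [strip] using h3
    · have : (volume : Measure (ℝ × ℝ)) (Ioc (0 : ℝ) 1 ×ˢ Ioc (0 : ℝ) 1) = 1 := by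
        rw [Measure.volume_eq_prod, Measure.prod_prod]
        simp
      rw [Measure.restrict_apply_univ, this]
      simp
  exact ⟨⟨hjoint.mono (prod_mono hs hs), fun u hu v hv => h1 u (hs hu) v (hs hv),
    fun u hu v hv => h2 u (hs hu) v (hs hv), h.trans_lt ENNReal.ofReal_lt_top⟩, h⟩

end

/-- The complexified average of the derivative along a segment. -/
def segAvg (f : ℂ → ℂ) (p : ℂ × ℂ) : ℂ := ∫ c in (0 : ℝ)..1, deriv f (p.1 + c * p.2)

theorem add_mul_mem_strip {ρ : ℝ} {u v : ℂ} (hu : u ∈ strip (ρ / 4)) (hv : v ∈ strip (ρ / 4)) {c : ℝ}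
    (hc : c ∈ Icc (0 : ℝ) 1) : u + c * v ∈ strip (ρ / 2) := by
  have h1 : |u.im| < ρ / 4 := hu
  have h2 : |v.im| < ρ / 4 := hv
  change |(u + c * v).im| < ρ / 2
  have h3 : (u + c * v).im = u.im + c * v.im := by simp
  rw [h3]
  have h4 := abs_add_le u.im (c * v.im)
  rw [abs_mul, abs_of_nonneg hc.1] at h4
  nlinarith [hc.2, abs_nonneg v.im]

theorem mul_segAvg {f : ℂ → ℂ} {ρ : ℝ} (hρ : 0 < ρ) (hf : DifferentiableOn ℂ f (strip ρ)) {u v : ℂ}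
    (hu : u ∈ strip (ρ / 4)) (hv : v ∈ strip (ρ / 4)) : v * segAvg f (u, v) = f (u + v) - f u := by
  have hs := strip_mono (show ρ / 2 ≤ ρ by linarith)
  have hd : ∀ c ∈ uIcc (0 : ℝ) 1, HasDerivAt (fun c : ℝ => f (u + c * v)) (v * deriv f (u + c * v)) c := by
    intro c hc
    rw [uIcc_of_le zero_le_one] at hc
    have h1 := (hf.differentiableAt ((isOpen_strip ρ).mem_nhds
      (hs (add_mul_mem_strip hu hv hc)))).hasDerivAt
    have h2 : HasDerivAt (fun c : ℝ => u + c * v) v c := by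
      simpa using ((Complex.ofRealCLM.hasDerivAt (x := c)).mul_const v).const_add u
    have h3 := h1.comp c h2
    rwa [mul_comm] at h3
  have hcont : ContinuousOn (fun c : ℝ => v * deriv f (u + c * v)) (uIcc 0 1) := by
    rw [uIcc_of_le zero_le_one]
    refine continuousOn_const.mul (ContinuousOn.comp (g := deriv f) (t := strip ρ)
      (hf.deriv (isOpen_strip ρ)).continuousOn (by fun_prop) fun c hc =>
        hs (add_mul_mem_strip hu hv hc))
  have h := intervalIntegral.integral_eq_sub_of_hasDerivAt hd hcont.intervalIntegrable
  rw [intervalIntegral.integral_const_mul] at h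
  simpa [segAvg] using h

theorem differentiableOn_segAvg {f : ℂ → ℂ} {ρ B : ℝ} (hρ : 0 < ρ) (hf : DifferentiableOn ℂ f (strip ρ))
    (hB : ∀ w ∈ strip ρ, ‖f w‖ ≤ B) :
    DifferentiableOn ℂ (segAvg f) (strip (ρ / 4) ×ˢ strip (ρ / 4)) := by
  have hs := strip_mono (show ρ / 2 ≤ ρ by linarith)
  have hop := isOpen_strip ρ
  have hd1 := hf.deriv hop
  have hd2 := hd1.deriv hop
  intro p hp
  refine DifferentiableAt.differentiableWithinAt ?_
  have hU : IsOpen (strip (ρ / 4) ×ˢ strip (ρ / 4)) := (isOpen_strip _).prod (isOpen_strip _)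
  have hmem : ∀ q ∈ strip (ρ / 4) ×ˢ strip (ρ / 4), ∀ c ∈ Icc (0 : ℝ) 1, q.1 + c * q.2 ∈ strip ρ :=
    fun q hq c hc => hs (add_mul_mem_strip hq.1 hq.2 hc)
  have hB' : ∀ w ∈ strip (ρ / 2), ‖deriv (deriv f) w‖ ≤ 2 * B / (ρ - ρ / 2) ^ 2 := by
    intro w hw
    have h1 := norm_iteratedDeriv_le_of_strip (ρ' := ρ / 2) (by linarith) hf hB hw 2
    rw [iteratedDeriv_succ, iteratedDeriv_one] at h1
    simpa using h1
  have hslice : ∀ q ∈ strip (ρ / 4) ×ˢ strip (ρ / 4),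
      ContinuousOn (fun c : ℝ => deriv f (q.1 + c * q.2)) (Icc 0 1) := fun q hq =>
    ContinuousOn.comp (g := deriv f) (t := strip ρ) hd1.continuousOn (by fun_prop) fun c hc =>
      hmem q hq c hc
  have key := intervalIntegral.hasFDerivAt_integral_of_dominated_of_fderiv_le (𝕜 := ℂ) (μ := volume)
    (a := 0) (b := 1) (F := fun (q : ℂ × ℂ) (c : ℝ) => deriv f (q.1 + c * q.2))
    (F' := fun q c => deriv (deriv f) (q.1 + c * q.2) •
      (ContinuousLinearMap.fst ℂ ℂ ℂ + (c : ℂ) • ContinuousLinearMap.snd ℂ ℂ ℂ))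
    (bound := fun _ => 2 * B / (ρ - ρ / 2) ^ 2 * 2) (x₀ := p) (hU.mem_nhds hp) ?_ ?_ ?_ ?_ ?_ ?_
  · exact key.differentiableAt
  · filter_upwards [hU.mem_nhds hp] with q hq
    rw [uIoc_of_le zero_le_one]
    exact ((hslice q hq).mono Ioc_subset_Icc_self).aestronglyMeasurable measurableSet_Ioc
  · refine ContinuousOn.intervalIntegrable ?_
    rw [uIcc_of_le zero_le_one]
    exact hslice p hp
  · rw [uIoc_of_le zero_le_one]
    refine ContinuousOn.aestronglyMeasurable ?_ measurableSet_Ioc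
    refine ContinuousOn.smul (ContinuousOn.comp (g := deriv (deriv f)) (t := strip ρ)
      hd2.continuousOn (by fun_prop) fun c hc => hmem p hp c (Ioc_subset_Icc_self hc)) ?_
    fun_prop
  · refine ae_of_all _ fun c hc q hq => ?_
    rw [uIoc_of_le zero_le_one] at hc
    have hc' := Ioc_subset_Icc_self hc
    rw [norm_smul]
    have h1 := hB' _ (add_mul_mem_strip hq.1 hq.2 hc')
    have h2 : ‖ContinuousLinearMap.fst ℂ ℂ ℂ + (c : ℂ) • ContinuousLinearMap.snd ℂ ℂ ℂ‖ ≤ 2 := by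
      refine (norm_add_le _ _).trans ?_
      rw [norm_smul, Complex.norm_real, Real.norm_eq_abs, abs_of_nonneg hc'.1]
      have h3 := ContinuousLinearMap.norm_fst_le ℂ ℂ ℂ
      have h4 := ContinuousLinearMap.norm_snd_le ℂ ℂ ℂ
      nlinarith [hc'.1, hc'.2, norm_nonneg (ContinuousLinearMap.snd ℂ ℂ ℂ)]
    exact mul_le_mul h1 h2 (norm_nonneg _) ((norm_nonneg _).trans h1)
  · exact intervalIntegrable_const
  · refine ae_of_all _ fun c hc q hq => ?_
    rw [uIoc_of_le zero_le_one] at hc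
    have h1 := (hd1.differentiableAt (hop.mem_nhds (hmem q hq c (Ioc_subset_Icc_self hc)))).hasDerivAt
    have h2 : HasFDerivAt (fun q : ℂ × ℂ => q.1 + c * q.2)
        (ContinuousLinearMap.fst ℂ ℂ ℂ + (c : ℂ) • ContinuousLinearMap.snd ℂ ℂ ℂ) q :=
      (hasFDerivAt_fst).add ((hasFDerivAt_snd).const_mul (c : ℂ))
    exact h1.comp_hasFDerivAt q h2

/-- The complexified square of the reciprocal of the arc-chord function. -/
def chordSq (F : Fin 2 → ℂ → ℂ) (p : ℂ × ℂ) : ℂ :=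
  open Classical in
  if Complex.sin (π * p.2) = 0 then ∑ i, deriv (F i) p.1 ^ 2
  else ∑ i, (π * (F i (p.1 + p.2) - F i p.1) / Complex.sin (π * p.2)) ^ 2

theorem sin_pi_eq_zero {w : ℂ} : Complex.sin (π * w) = 0 ↔ ∃ n : ℤ, w = n := by
  have hpi : (π : ℂ) ≠ 0 := by exact_mod_cast Real.pi_ne_zero
  rw [Complex.sin_eq_zero_iff]
  refine exists_congr fun n => ?_
  rw [mul_comm (n : ℂ), mul_right_inj' hpi]

theorem sin_pi_add_one (w : ℂ) : Complex.sin (π * (w + 1)) = -Complex.sin (π * w) := by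
  rw [mul_add, mul_one, Complex.sin_add_pi]

section

variable {F : Fin 2 → ℂ → ℂ} {ρ B : ℝ}

theorem chordSq_add_right (hper : ∀ i, ∀ w ∈ strip ρ, F i (w + 1) = F i w) {u v : ℂ}
    (huv : u + v ∈ strip ρ) : chordSq F (u, v + 1) = chordSq F (u, v) := by
  simp only [chordSq, sin_pi_add_one, neg_eq_zero]
  split_ifs with h
  · rfl
  · refine Finset.sum_congr rfl fun i _ => ?_
    rw [← add_assoc, hper i _ huv, div_neg, neg_sq]

theorem chordSq_add_left (hper : ∀ i, ∀ w ∈ strip ρ, F i (w + 1) = F i w) {u v : ℂ}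
    (hu : u ∈ strip ρ) (huv : u + v ∈ strip ρ) : chordSq F (u + 1, v) = chordSq F (u, v) := by
  simp only [chordSq]
  split_ifs with h
  · refine Finset.sum_congr rfl fun i _ => ?_
    rw [periodic_deriv_of_strip (hper i) u hu]
  · refine Finset.sum_congr rfl fun i _ => ?_
    rw [add_right_comm, hper i _ huv, hper i _ hu]

theorem chordSq_add_int (hper : ∀ i, ∀ w ∈ strip ρ, F i (w + 1) = F i w) {u v : ℂ}
    (huv : u + v ∈ strip ρ) (n : ℤ) : chordSq F (u, v + n) = chordSq F (u, v) := by
  have hnat : ∀ (m : ℕ) (v : ℂ), u + v ∈ strip ρ → chordSq F (u, v + m) = chordSq F (u, v) := by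
    intro m
    induction m with
    | zero => intro v _; simp
    | succ m ih =>
      intro v hv
      rw [Nat.cast_succ, ← add_assoc, chordSq_add_right hper (by simpa [strip] using hv), ih v hv]
  obtain ⟨m, rfl | rfl⟩ := n.eq_nat_or_neg
  · simpa using hnat m v huv
  · have := hnat m (v + ((-m : ℤ) : ℂ)) (by simpa [strip] using huv)
    rw [← this]
    congr 2
    push_cast
    ring

/-- The sine quotient `sin (π w) / (π w)`. -/
def sincPi : ℂ → ℂ := dslope (fun w => Complex.sin (π * w) / π) 0

theorem differentiable_sincPi : Differentiable ℂ sincPi := by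
  have h : DifferentiableOn ℂ (fun w : ℂ => Complex.sin (π * w) / π) univ := by fun_prop
  exact differentiableOn_univ.1 ((Complex.differentiableOn_dslope Filter.univ_mem).2 h)

theorem sincPi_zero : sincPi 0 = 1 := by
  rw [sincPi, dslope_same]
  have h : HasDerivAt (fun w : ℂ => Complex.sin (π * w) / π)
      (Complex.cos (π * 0) * (π * 1) / π) 0 :=
    (((hasDerivAt_id (0 : ℂ)).const_mul (π : ℂ)).csin).div_const _
  rw [h.deriv]
  simp [Real.pi_ne_zero]

theorem sincPi_of_ne {w : ℂ} (hw : w ≠ 0) : sincPi w = Complex.sin (π * w) / (π * w) := by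
  rw [sincPi, dslope_of_ne _ hw, slope_def_field]
  simp
  rw [div_div]

theorem chordSq_eq (hρ : 0 < ρ) (hF : ∀ i, DifferentiableOn ℂ (F i) (strip ρ)) {u v : ℂ}
    (hu : u ∈ strip (ρ / 4)) (hv : v ∈ strip (ρ / 4)) (h0 : sincPi v ≠ 0) :
    chordSq F (u, v) = ∑ i, (segAvg (F i) (u, v) / sincPi v) ^ 2 := by
  have hpi : (π : ℂ) ≠ 0 := by exact_mod_cast Real.pi_ne_zero
  by_cases hv0 : v = 0
  · subst hv0
    simp [chordSq, sincPi_zero, segAvg]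
  · rw [sincPi_of_ne hv0] at h0
    have hs : Complex.sin (π * v) ≠ 0 := fun h => h0 (by rw [h, zero_div])
    simp only [chordSq, if_neg hs]
    refine Finset.sum_congr rfl fun i _ => ?_
    rw [← mul_segAvg hρ (hF i) hu hv, sincPi_of_ne hv0]
    congr 1
    field_simp

theorem differentiableOn_chordSq (hρ : 0 < ρ) (hF : ∀ i, DifferentiableOn ℂ (F i) (strip ρ))
    (hper : ∀ i, ∀ w ∈ strip ρ, F i (w + 1) = F i w) (hB : ∀ i, ∀ w ∈ strip ρ, ‖F i w‖ ≤ B) :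
    DifferentiableOn ℂ (chordSq F) (strip (ρ / 4) ×ˢ strip (ρ / 4)) := by
  have hU : IsOpen (strip (ρ / 4) ×ˢ strip (ρ / 4)) := (isOpen_strip _).prod (isOpen_strip _)
  have hadd : ∀ {u v : ℂ}, u ∈ strip (ρ / 4) → v ∈ strip (ρ / 4) → u + v ∈ strip ρ := by
    intro u v hu hv
    have := add_mul_mem_strip hu hv (c := 1) (by simp)
    rw [Complex.ofReal_one, one_mul] at this
    exact strip_mono (by linarith) this
  have hzero : ∀ u ∈ strip (ρ / 4), DifferentiableAt ℂ (chordSq F) (u, 0) := by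
    intro u hu
    have hp : ((u, 0) : ℂ × ℂ) ∈ strip (ρ / 4) ×ˢ strip (ρ / 4) := ⟨hu, by simp [strip]; positivity⟩
    have h1 : ∀ᶠ p : ℂ × ℂ in nhds (u, 0), sincPi p.2 ≠ 0 :=
      (differentiable_sincPi.continuous.comp continuous_snd).continuousAt.eventually_ne
        (by simp [sincPi_zero])
    refine DifferentiableAt.congr_of_eventuallyEq
      (f := fun p => ∑ i, (segAvg (F i) p / sincPi p.2) ^ 2) ?_ ?_
    · have hS : DifferentiableAt ℂ (fun p : ℂ × ℂ => sincPi p.2) (u, 0) :=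
        DifferentiableAt.comp (g := sincPi) (f := Prod.snd) (u, 0)
          differentiable_sincPi.differentiableAt differentiableAt_snd
      have hne : (fun p : ℂ × ℂ => sincPi p.2) (u, 0) ≠ 0 := by simp [sincPi_zero]
      have hA := fun i => (differentiableOn_segAvg hρ (hF i) (hB i)).differentiableAt (hU.mem_nhds hp)
      simp only [div_eq_mul_inv]
      exact DifferentiableAt.fun_sum fun i _ => ((hA i).fun_mul (hS.fun_inv hne)).fun_pow 2
    · filter_upwards [h1, hU.mem_nhds hp] with p hp1 hp2
      exact chordSq_eq hρ hF hp2.1 hp2.2 hp1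
  rintro ⟨u, v⟩ ⟨hu, hv⟩
  refine DifferentiableAt.differentiableWithinAt ?_
  by_cases hs : Complex.sin (π * v) = 0
  · obtain ⟨n, hn⟩ := sin_pi_eq_zero.1 hs
    have h1 : DifferentiableAt ℂ (fun p : ℂ × ℂ => chordSq F (p.1, p.2 - n)) (u, v) := by
      have h2 : DifferentiableAt ℂ (chordSq F) ((fun p : ℂ × ℂ => (p.1, p.2 - (n : ℂ))) (u, v)) := by
        simp only [hn, sub_self]
        exact hzero u hu
      exact DifferentiableAt.comp (g := chordSq F) (f := fun p : ℂ × ℂ => (p.1, p.2 - (n : ℂ))) (u, v)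
        h2 (by fun_prop)
    refine h1.congr_of_eventuallyEq ?_
    filter_upwards [hU.mem_nhds (show (u, v) ∈ _ from ⟨hu, hv⟩)] with p hp
    have := chordSq_add_int hper (u := p.1) (v := p.2) (hadd hp.1 hp.2) (-n)
    simp only [Int.cast_neg, ← sub_eq_add_neg] at this
    rw [this]
  · have h1 : ∀ᶠ p : ℂ × ℂ in nhds (u, v), Complex.sin (π * p.2) ≠ 0 :=
      (Continuous.continuousAt (by fun_prop)).eventually_ne hs
    have hd1 : ∀ i, DifferentiableAt ℂ (fun p : ℂ × ℂ => F i (p.1 + p.2)) (u, v) := fun i =>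
      DifferentiableAt.comp (g := F i) (u, v)
        ((hF i).differentiableAt ((isOpen_strip ρ).mem_nhds (hadd hu hv))) (by fun_prop)
    have hd2 : ∀ i, DifferentiableAt ℂ (fun p : ℂ × ℂ => F i p.1) (u, v) := fun i =>
      DifferentiableAt.comp (g := F i) (u, v) ((hF i).differentiableAt ((isOpen_strip ρ).mem_nhds
        (strip_mono (by linarith) hu))) (by fun_prop)
    refine DifferentiableAt.congr_of_eventuallyEq (f := fun p => ∑ i, (π *
      (F i (p.1 + p.2) - F i p.1) / Complex.sin (π * p.2)) ^ 2) ?_ ?_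
    · have hS : DifferentiableAt ℂ (fun p : ℂ × ℂ => Complex.sin (π * p.2)) (u, v) := by
        fun_prop
      have hne : (fun p : ℂ × ℂ => Complex.sin (π * p.2)) (u, v) ≠ 0 := hs
      simp only [div_eq_mul_inv]
      exact DifferentiableAt.fun_sum fun i _ =>
        ((((hd1 i).fun_sub (hd2 i)).const_mul _).fun_mul (hS.fun_inv hne)).fun_pow 2
    · filter_upwards [h1] with p hp
      simp only [chordSq, if_neg hp]

end

theorem two_mul_norm_le_sin {v : ℂ} (hv : |v.re| ≤ 1 / 2) : 2 * ‖v‖ ≤ ‖Complex.sin (π * v)‖ := by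
  have hpi := Real.pi_pos
  have h1 : ‖Complex.sin (π * v)‖ ^ 2 =
      Real.sin (π * v.re) ^ 2 + Real.sinh (π * v.im) ^ 2 := by
    rw [Complex.sin_eq, ← Complex.normSq_eq_norm_sq]
    have e1 : ((π : ℂ) * v).re = π * v.re := by simp
    have e2 : ((π : ℂ) * v).im = π * v.im := by simp
    rw [e1, e2, ← Complex.ofReal_sin, ← Complex.ofReal_cosh, ← Complex.ofReal_cos,
      ← Complex.ofReal_sinh, ← Complex.ofReal_mul, ← Complex.ofReal_mul, Complex.normSq_add_mul_I]
    have h2 := Real.sin_sq_add_cos_sq (π * v.re)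
    have h3 := Real.cosh_sq (π * v.im)
    rw [mul_pow, mul_pow, h3]
    linear_combination Real.sinh (π * v.im) ^ 2 * h2
  have h2 : (2 * v.re) ^ 2 ≤ Real.sin (π * v.re) ^ 2 := by
    have hx : ∀ x : ℝ, 0 ≤ x → x ≤ 1 / 2 → 2 * x ≤ Real.sin (π * x) := by
      intro x h0 h1
      have := Real.mul_le_sin (x := π * x) (by positivity) (by nlinarith)
      have e : 2 / π * (π * x) = 2 * x := by field_simp
      linarith
    have h4 := hx |v.re| (abs_nonneg _) hv
    have h5 : Real.sin (π * |v.re|) ^ 2 = Real.sin (π * v.re) ^ 2 := by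
      rcases abs_choice v.re with h | h <;> rw [h]
      rw [mul_neg, Real.sin_neg, neg_sq]
    rw [← h5, ← sq_abs, abs_mul, abs_two]
    gcongr
  have h3 : (2 * v.im) ^ 2 ≤ Real.sinh (π * v.im) ^ 2 := by
    have h4 : 2 * |v.im| ≤ Real.sinh (π * |v.im|) := by
      have := Real.self_le_sinh_iff.2 (show 0 ≤ π * |v.im| by positivity)
      nlinarith [Real.pi_gt_three, abs_nonneg v.im]
    have h5 : Real.sinh (π * |v.im|) ^ 2 = Real.sinh (π * v.im) ^ 2 := by
      rcases abs_choice v.im with h | h <;> rw [h]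
      rw [mul_neg, Real.sinh_neg, neg_sq]
    rw [← h5, ← sq_abs, abs_mul, abs_two]
    gcongr
  refine abs_le_of_sq_le_sq' ?_ (norm_nonneg _) |>.2
  have h4 : ‖v‖ ^ 2 = v.re ^ 2 + v.im ^ 2 := by
    rw [← Complex.normSq_eq_norm_sq, Complex.normSq_apply]
    ring
  rw [h1, mul_pow, h4]
  nlinarith

section

variable {F : Fin 2 → ℂ → ℂ} {ρ B : ℝ}

theorem norm_segAvg_le {f : ℂ → ℂ} (hρ : 0 < ρ) (hf : DifferentiableOn ℂ f (strip ρ))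
    (hB : ∀ w ∈ strip ρ, ‖f w‖ ≤ B) {u v : ℂ} (hu : u ∈ strip (ρ / 4)) (hv : v ∈ strip (ρ / 4)) :
    ‖segAvg f (u, v)‖ ≤ B / (ρ - ρ / 2) := by
  have h := intervalIntegral.norm_integral_le_of_norm_le_const (a := 0) (b := 1)
    (C := B / (ρ - ρ / 2)) (f := fun c : ℝ => deriv f (u + c * v)) fun c hc => by
      rw [uIoc_of_le zero_le_one] at hc
      exact norm_deriv_le_of_strip (by linarith) hf hB
        (add_mul_mem_strip hu hv (Ioc_subset_Icc_self hc))
  simpa [segAvg] using h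

theorem norm_chordSq_le (hρ : 0 < ρ) (hF : ∀ i, DifferentiableOn ℂ (F i) (strip ρ))
    (hper : ∀ i, ∀ w ∈ strip ρ, F i (w + 1) = F i w) (hB : ∀ i, ∀ w ∈ strip ρ, ‖F i w‖ ≤ B)
    {u v : ℂ} (hu : u ∈ strip (ρ / 4)) (hv : v ∈ strip (ρ / 4)) :
    ‖chordSq F (u, v)‖ ≤ 8 * (B / (ρ - ρ / 2)) ^ 2 := by
  have hpi := Real.pi_pos
  set M := B / (ρ - ρ / 2) with hM
  have hadd : ∀ {u v : ℂ}, u ∈ strip (ρ / 4) → v ∈ strip (ρ / 4) → u + v ∈ strip ρ := by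
    intro u v hu hv
    have := add_mul_mem_strip hu hv (c := 1) (by simp)
    rw [Complex.ofReal_one, one_mul] at this
    exact strip_mono (by linarith) this
  wlog hre : |v.re| ≤ 1 / 2 generalizing v
  · have h1 := chordSq_add_int hper (hadd hu hv) (-round v.re)
    rw [← h1]
    refine this (by simpa [strip] using hv) ?_
    have := abs_sub_round v.re
    push_cast
    simpa [← sub_eq_add_neg] using this
  have hM0 : 0 ≤ M := (norm_nonneg _).trans (norm_segAvg_le hρ (hF 0) (hB 0) hu hv)
  have hsum : ∀ a : Fin 2 → ℂ, (∀ i, ‖a i‖ ≤ 2 * M) → ‖∑ i, a i ^ 2‖ ≤ 8 * M ^ 2 := by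
    intro a ha
    refine (norm_sum_le _ _).trans ?_
    simp only [Fin.sum_univ_two, norm_pow]
    have h0 := pow_le_pow_left₀ (norm_nonneg _) (ha 0) 2
    have h1 := pow_le_pow_left₀ (norm_nonneg _) (ha 1) 2
    linarith
  by_cases hs : Complex.sin (π * v) = 0
  · simp only [chordSq, if_pos hs]
    refine hsum _ fun i => ?_
    have := norm_deriv_le_of_strip (ρ' := ρ / 2) (by linarith) (hF i) (hB i)
      (strip_mono (by linarith) hu)
    linarith
  · simp only [chordSq, if_neg hs]
    refine hsum _ fun i => ?_
    have hv0 : v ≠ 0 := fun h => hs (by simp [h])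
    have hv0' := norm_pos_iff.2 hv0
    rw [← mul_segAvg hρ (hF i) hu hv, norm_div, norm_mul, norm_mul, Complex.norm_real,
      Real.norm_eq_abs, abs_of_pos hpi]
    have h1 := norm_segAvg_le hρ (hF i) (hB i) hu hv
    have h2 := two_mul_norm_le_sin hre
    rw [div_le_iff₀ (by linarith)]
    calc π * (‖v‖ * ‖segAvg (F i) (u, v)‖) ≤ 4 * (‖v‖ * M) := by
          gcongr
          exact Real.pi_le_four
      _ = 2 * M * (2 * ‖v‖) := by ring
      _ ≤ _ := by gcongr

/-- A real curve with a bounded holomorphic extension to a strip and a chord-arc bound. -/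
structure HoloCurve (ρ B c : ℝ) (v : ℝ → Plane) : Prop where
  ext : ∃ F : Fin 2 → ℂ → ℂ, (∀ i, DifferentiableOn ℂ (F i) (strip ρ)) ∧
    (∀ i, ∀ w ∈ strip ρ, F i (w + 1) = F i w) ∧ (∀ i, ∀ w ∈ strip ρ, ‖F i w‖ ≤ B) ∧
    ∀ i (s : ℝ), F i s = (v s i : ℝ)
  chord : ∀ s σ, c * |Real.sin (π * σ)| ≤ ‖v (s + σ) - v s‖

theorem plane_norm_sq (x : Plane) : ‖x‖ ^ 2 = ∑ i, x i ^ 2 := by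
  rw [EuclideanSpace.norm_eq, Real.sq_sqrt (Finset.sum_nonneg fun _ _ => by positivity)]
  simp

theorem hasDerivAt_plane {v : ℝ → Plane} {d : Plane} {s : ℝ}
    (h : ∀ i, HasDerivAt (fun s => v s i) (d i) s) : HasDerivAt v d s := by
  have h1 : HasDerivAt (fun s => WithLp.ofLp (v s)) (WithLp.ofLp d) s := hasDerivAt_pi.2 h
  exact ((PiLp.continuousLinearEquiv 2 ℝ fun _ : Fin 2 => ℝ).symm.toContinuousLinearMap.hasFDerivAt
    (x := WithLp.ofLp (v s))).comp_hasDerivAt s h1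

theorem ofReal_deriv_of_ext {f : ℂ → ℂ} {g : ℝ → ℝ} (hρ : 0 < ρ) (hf : DifferentiableOn ℂ f (strip ρ))
    (hg : ∀ s : ℝ, f s = g s) (s : ℝ) : HasDerivAt g (deriv f s).re s ∧ ((deriv f s).re : ℂ) = deriv f s := by
  have h1 : HasDerivAt f (deriv f s) s :=
    (hf.differentiableAt ((isOpen_strip ρ).mem_nhds (by simpa [strip] using hρ))).hasDerivAt
  have h2 := h1.comp_ofReal
  have h3 := h1.real_of_complex
  simp only [hg, Complex.ofReal_re] at h2 h3
  refine ⟨h3, ?_⟩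
  exact h3.ofReal_comp.unique h2

theorem extendsCurve_deriv {f : ℂ → CPlane} {v : ℝ → Plane} (hρ : 0 < ρ)
    (hf : DifferentiableOn ℂ f (strip ρ)) (h : ExtendsCurve f v) :
    ExtendsCurve (deriv f) (deriv v) := by
  intro s i
  have hfd : HasDerivAt f (deriv f s) s :=
    (hf.differentiableAt ((isOpen_strip ρ).mem_nhds (by simpa [strip] using hρ))).hasDerivAt
  have hcomp : ∀ i, deriv (fun w => f w i) s = deriv f s i := fun i =>
    ((EuclideanSpace.proj (𝕜 := ℂ) i).hasFDerivAt.comp_hasDerivAt (s : ℂ) hfd).deriv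
  have hc := fun i => ofReal_deriv_of_ext hρ (differentiableOn_euclidean.1 hf i)
    (g := fun s => v s i) (fun s => h s i) s
  have hv : HasDerivAt v (WithLp.toLp 2 fun i => (deriv (fun w => f w i) s).re) s :=
    hasDerivAt_plane fun i => (hc i).1
  rw [hv.deriv, ← hcomp]
  exact (hc i).2.symm

theorem kNorm_mono {l : ℕ} {ρ ρ' : ℝ} (h : ρ' ≤ ρ) (f : ℂ → CPlane) : kNorm l ρ' f ≤ kNorm l ρ f :=
  Finset.sum_le_sum fun _ _ => iSup_mono fun _ => iSup_mono' fun hy => ⟨lt_of_lt_of_le hy h, le_rfl⟩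

theorem kNorm₂_mono {l : ℕ} {ρ ρ' : ℝ} (h : ρ' ≤ ρ) (f : ℂ × ℂ → ℂ) : kNorm₂ l ρ' f ≤ kNorm₂ l ρ f :=
  Finset.sum_le_sum fun _ _ => iSup_mono fun _ => iSup_mono' fun hy =>
    ⟨⟨lt_of_lt_of_le hy.1 h, lt_of_lt_of_le hy.2 h⟩, le_rfl⟩

theorem MemK.mono {l : ℕ} {ρ ρ' : ℝ} (h : ρ' ≤ ρ) {f : ℂ → CPlane} (hf : MemK l ρ f) : MemK l ρ' f :=
  ⟨hf.holo.mono (strip_mono h), fun w hw => hf.periodic w (strip_mono h hw),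
    (kNorm_mono h f).trans_lt hf.finite⟩

theorem MemK₂.mono {l : ℕ} {ρ ρ' : ℝ} (h : ρ' ≤ ρ) {f : ℂ × ℂ → ℂ} (hf : MemK₂ l ρ f) :
    MemK₂ l ρ' f :=
  ⟨hf.holo.mono (prod_mono (strip_mono h) (strip_mono h)),
    fun w hw v hv => hf.periodic_left w (strip_mono h hw) v (strip_mono h hv),
    fun w hw v hv => hf.periodic_right w (strip_mono h hw) v (strip_mono h hv),
    (kNorm₂_mono h f).trans_lt hf.finite⟩

theorem InX.mono {l : ℕ} {ρ ρ' : ℝ} {M : ℝ≥0} {v : ℝ → Plane} (h : ρ' ≤ ρ) (hv : InX l ρ M v) :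
    InX l ρ' M v := by
  obtain ⟨f, g, k, G, h1, h2, h3, h4, h5, h6, h7, h8, h9⟩ := hv
  refine ⟨f, g, k, G, h1.mono h, h2.mono h, h3.mono h, h4.mono h, h5, h6, h7, h8, le_trans ?_ h9⟩
  gcongr <;> first | exact kNorm_mono h _ | exact kNorm₂_mono h _

/-- On the real plane the complexified square is real and bounded below. -/
theorem chordSq_real {v : ℝ → Plane} {c : ℝ} (hρ : 0 < ρ) (hc : 0 < c)
    (hF : ∀ i, DifferentiableOn ℂ (F i) (strip ρ)) (hper : ∀ i, ∀ w ∈ strip ρ, F i (w + 1) = F i w)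
    (hB : ∀ i, ∀ w ∈ strip ρ, ‖F i w‖ ≤ B) (hv : ∀ i (s : ℝ), F i s = (v s i : ℝ))
    (hch : ∀ s σ, c * |Real.sin (π * σ)| ≤ ‖v (s + σ) - v s‖) (s σ : ℝ) :
    ∃ x : ℝ, chordSq F (s, σ) = x ∧ (π * c) ^ 2 ≤ x ∧ arcChordFn v s σ ≠ ⊤ ∧
      (arcChordFn v s σ).toReal = x ^ (-(1 / 2) : ℝ) := by
  have hpi := Real.pi_pos
  have hsin : ∀ σ : ℝ, (Complex.sin (π * σ) = 0) ↔ ∃ n : ℤ, σ = n := by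
    intro σ
    rw [sin_pi_eq_zero]
    refine exists_congr fun n => ⟨fun h => by exact_mod_cast h, fun h => by rw [h]; simp⟩
  have hne : ∀ σ : ℝ, ¬ (∃ n : ℤ, σ = n) → 0 < |Real.sin (π * σ)| ∧
      chordSq F (s, σ) = ((π * ‖v (s + σ) - v s‖ / |Real.sin (π * σ)|) ^ 2 : ℝ) := by
    intro σ hσ
    have h1 : Complex.sin (π * σ) ≠ 0 := fun h => hσ ((hsin σ).1 h)
    have h2 : Real.sin (π * σ) ≠ 0 := by
      intro h
      apply h1
      rw [← Complex.ofReal_mul, ← Complex.ofReal_sin, h, Complex.ofReal_zero]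
    refine ⟨abs_pos.2 h2, ?_⟩
    simp only [chordSq, if_neg h1]
    rw [div_pow, mul_pow, plane_norm_sq, sq_abs]
    push_cast
    rw [Finset.mul_sum, Finset.sum_div]
    refine Finset.sum_congr rfl fun i _ => ?_
    have h3 := hv i (s + σ)
    push_cast at h3
    rw [h3, hv i s]
    simp only [PiLp.sub_apply]
    push_cast
    rw [div_pow, mul_pow]
  have hlow : ∀ σ : ℝ, ¬ (∃ n : ℤ, σ = n) →
      (π * c) ^ 2 ≤ (π * ‖v (s + σ) - v s‖ / |Real.sin (π * σ)|) ^ 2 := by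
    intro σ hσ
    have h1 := (hne σ hσ).1
    have h2 := hch s σ
    refine pow_le_pow_left₀ (by positivity) ?_ 2
    rw [le_div_iff₀ h1, mul_assoc]
    gcongr
  by_cases hσ : ∃ n : ℤ, σ = n
  · have h1 := (hsin σ).2 hσ
    have hd := fun i => ofReal_deriv_of_ext hρ (hF i) (hv i) s
    have hvd : HasDerivAt v (WithLp.toLp 2 fun i => (deriv (F i) s).re) s :=
      hasDerivAt_plane fun i => (hd i).1
    have h2 : chordSq F (s, σ) = ((‖deriv v s‖ ^ 2 : ℝ) : ℂ) := by
      simp only [chordSq, if_pos h1]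
      rw [plane_norm_sq, hvd.deriv]
      push_cast
      exact Finset.sum_congr rfl fun i _ => by rw [(hd i).2]
    have h3 : (π * c) ^ 2 ≤ ‖deriv v s‖ ^ 2 := by
      have hco : ContinuousAt (fun τ : ℝ => (chordSq F (s, τ)).re) σ := by
        have hU : IsOpen (strip (ρ / 4) ×ˢ strip (ρ / 4)) := (isOpen_strip _).prod (isOpen_strip _)
        have h4 : ContinuousAt (chordSq F) ((fun τ : ℝ => ((s : ℂ), (τ : ℂ))) σ) :=
          ((differentiableOn_chordSq hρ hF hper hB).differentiableAt (hU.mem_nhds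
            ⟨by simp [strip]; positivity, by simp [strip]; positivity⟩)).continuousAt
        have h5 : ContinuousAt (fun τ : ℝ => ((s : ℂ), (τ : ℂ))) σ := by fun_prop
        exact Complex.continuous_re.continuousAt.comp (ContinuousAt.comp (g := chordSq F)
          (f := fun τ : ℝ => ((s : ℂ), (τ : ℂ))) h4 h5)
      have ht : Filter.Tendsto (fun τ : ℝ => (chordSq F (s, τ)).re) (nhdsWithin σ {σ}ᶜ)
          (nhds (‖deriv v s‖ ^ 2)) := by
        have := hco.tendsto.mono_left (nhdsWithin_le_nhds (s := {σ}ᶜ))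
        rwa [h2, Complex.ofReal_re] at this
      refine ge_of_tendsto ht ?_
      obtain ⟨n, rfl⟩ := hσ
      have h6 : ∀ᶠ τ in nhdsWithin (n : ℝ) {(n : ℝ)}ᶜ, τ ∈ Ioo ((n : ℝ) - 1) (n + 1) :=
        nhdsWithin_le_nhds (Ioo_mem_nhds (by linarith) (by linarith))
      filter_upwards [h6, self_mem_nhdsWithin] with τ hτ hτn
      have h7 : ¬ ∃ m : ℤ, τ = m := by
        rintro ⟨m, rfl⟩
        have ha : (n : ℝ) - 1 < m := hτ.1
        have hb : (m : ℝ) < n + 1 := hτ.2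
        have ha' : n - 1 < m := by exact_mod_cast ha
        have hb' : m < n + 1 := by exact_mod_cast hb
        exact hτn (by rw [mem_singleton_iff]; exact_mod_cast (by omega : m = n))
      rw [(hne τ h7).2, Complex.ofReal_re]
      exact hlow τ h7
    have h4 : 0 < ‖deriv v s‖ := by
      have : 0 < ‖deriv v s‖ ^ 2 := lt_of_lt_of_le (by positivity) h3
      exact lt_of_le_of_ne (norm_nonneg _) fun h => by rw [← h] at this; simp at this
    refine ⟨_, h2, h3, ?_, ?_⟩
    · simp only [arcChordFn, if_pos hσ]
      rw [ne_eq, ENNReal.inv_eq_top, enorm_eq_zero]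
      exact norm_pos_iff.1 h4
    · simp only [arcChordFn, if_pos hσ]
      rw [ENNReal.toReal_inv, toReal_enorm, ← Real.rpow_natCast, ← Real.rpow_mul h4.le]
      norm_num
      rw [Real.rpow_neg_one]
  · obtain ⟨h1, h2⟩ := hne σ hσ
    have h3 : 0 < ‖v (s + σ) - v s‖ := lt_of_lt_of_le (by positivity) (hch s σ)
    refine ⟨_, h2, hlow σ hσ, ?_, ?_⟩
    · simp only [arcChordFn, if_neg hσ]
      refine (ENNReal.div_lt_top ENNReal.ofReal_ne_top ?_).ne
      refine mul_ne_zero ?_ ?_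
      · rw [ne_eq, ENNReal.ofReal_eq_zero, not_le]; exact hpi
      · rw [ne_eq, enorm_eq_zero]; exact norm_pos_iff.1 h3
    · simp only [arcChordFn, if_neg hσ]
      rw [ENNReal.toReal_div, ENNReal.toReal_mul, ENNReal.toReal_ofReal h1.le,
        ENNReal.toReal_ofReal hpi.le, toReal_enorm, ← Real.rpow_natCast,
        ← Real.rpow_mul (by positivity)]
      norm_num
      rw [Real.rpow_neg_one, inv_div]

end

theorem re_chordSq_ge {F : Fin 2 → ℂ → ℂ} {ρ K a : ℝ} (hρ : 0 < ρ) (ha : 0 < a)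
    (hH : SepHolo ρ K (chordSq F)) (hreal : ∀ s σ : ℝ, a ≤ (chordSq F (s, σ)).re)
    {u v : ℂ} (hu : u ∈ strip (min (ρ / 2) (a * ρ / (12 * (K + 1)))))
    (hv : v ∈ strip (min (ρ / 2) (a * ρ / (12 * (K + 1))))) :
    a / 2 ≤ (chordSq F (u, v)).re := by
  have h0 : ∀ x : ℝ, (x : ℂ) ∈ strip ρ := fun x => by simpa [strip] using hρ
  have hK : 0 ≤ K := (norm_nonneg _).trans (hH.bound 0 (h0 0) 0 (h0 0))
  have him : ∀ w : ℂ, ‖w - (w.re : ℂ)‖ = |w.im| := fun w => by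
    have : w - (w.re : ℂ) = (w.im : ℂ) * Complex.I := by apply Complex.ext <;> simp
    rw [this]; simp
  have hu1 : |u.im| < min (ρ / 2) (a * ρ / (12 * (K + 1))) := hu
  have hv1 : |v.im| < min (ρ / 2) (a * ρ / (12 * (K + 1))) := hv
  obtain ⟨hu2, hu3⟩ := lt_min_iff.1 hu1
  obtain ⟨hv2, hv3⟩ := lt_min_iff.1 hv1
  have hvs : v ∈ strip ρ := hv2.trans (by linarith)
  have h1 := norm_sub_le_of_strip hρ (hH.left v hvs) (fun u hu => hH.bound u hu v hvs) (w := u)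
    (w' := (u.re : ℂ)) hu2.le (by simp; positivity)
  have h2 := norm_sub_le_of_strip hρ (hH.right u.re (h0 _)) (fun v hv => hH.bound _ (h0 u.re) v hv)
    (w := v) (w' := (v.re : ℂ)) hv2.le (by simp; positivity)
  rw [him] at h1 h2
  have hsmall : ∀ y : ℝ, y < a * ρ / (12 * (K + 1)) → 0 ≤ y → 3 * K / ρ * y ≤ a / 4 := by
    intro y hy hy0
    calc 3 * K / ρ * y ≤ 3 * (K + 1) / ρ * (a * ρ / (12 * (K + 1))) := by
          gcongr; linarith
      _ = a / 4 := by field_simp; norm_num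
  have h3 := hsmall _ hu3 (abs_nonneg _)
  have h4 := hsmall _ hv3 (abs_nonneg _)
  have h5 := (abs_le.1 ((Complex.abs_re_le_norm _).trans (h1.trans h3))).1
  have h6 := (abs_le.1 ((Complex.abs_re_le_norm _).trans (h2.trans h4))).1
  rw [Complex.sub_re] at h5 h6
  have := hreal u.re v.re
  linarith

/-- Curves with uniform holomorphic and chord-arc bounds lie in a bounded set of `X_ρ`. -/
theorem exists_inX (l : ℕ) {ρ B c : ℝ} (hρ : 0 < ρ) (hc : 0 < c) :
    ∃ ρ' > 0, ∃ M : ℝ≥0, ∀ v, HoloCurve ρ B c v → InX l ρ' M v := by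
  have hpi := Real.pi_pos
  set K := 8 * (B / (ρ - ρ / 2)) ^ 2 with hK
  have hK0 : 0 ≤ K := by positivity
  set a := (π * c) ^ 2 with ha
  have hap : 0 < a := by positivity
  set ρ₂ := min (ρ / 4 / 2) (a * (ρ / 4) / (12 * (K + 1))) with hρ₂
  have hρ₂p : 0 < ρ₂ := by positivity
  have hρ₂8 : ρ₂ ≤ ρ / 8 := (min_le_left _ _).trans (by linarith)
  set C := (a / 2) ^ (-(1 / 2) : ℝ) with hC
  have hC0 : 0 ≤ C := Real.rpow_nonneg (by positivity) _
  set d := ρ₂ / (2 * (l + 1)) with hd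
  have hdp : 0 < d := by positivity
  refine ⟨ρ₂ / 2, by positivity, Real.toNNReal (kBound l ρ (ρ₂ / 2) (2 * B)) +
    Real.toNNReal (kBound l (ρ / 2) (ρ₂ / 2) (2 * B / (ρ - ρ / 2))) +
    Real.toNNReal (kBound l (ρ / 4) (ρ₂ / 2) (2 * B / (ρ - ρ / 2) / (ρ / 2 - ρ / 4))) +
    Real.toNNReal (kBound₂ l d C), ?_⟩
  rintro v ⟨⟨F, hF, hper, hB, hv⟩, hch⟩
  have hB0 : 0 ≤ B := (norm_nonneg _).trans (hB 0 0 (by simpa [strip] using hρ))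
  set f : ℂ → CPlane := fun w => WithLp.toLp 2 fun i => F i w with hf
  have hfd : DifferentiableOn ℂ f (strip ρ) := differentiableOn_euclidean.2 hF
  have hfper : ∀ w ∈ strip ρ, f (w + 1) = f w := fun w hw => by
    simp only [hf]
    congr 1
    ext i
    exact hper i w hw
  have hfB : ∀ w ∈ strip ρ, ‖f w‖ ≤ 2 * B := fun w hw => by
    rw [EuclideanSpace.norm_eq]
    refine Real.sqrt_le_iff.2 ⟨by positivity, ?_⟩
    simp only [Fin.sum_univ_two]
    have h0 := pow_le_pow_left₀ (norm_nonneg _) (hB 0 w hw) 2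
    have h1 := pow_le_pow_left₀ (norm_nonneg _) (hB 1 w hw) 2
    change ‖F 0 w‖ ^ 2 + ‖F 1 w‖ ^ 2 ≤ _
    nlinarith [sq_nonneg B]
  have hs1 := strip_mono (show ρ / 2 ≤ ρ by linarith)
  have hs2 := strip_mono (show ρ / 4 ≤ ρ / 2 by linarith)
  have hgd : DifferentiableOn ℂ (deriv f) (strip (ρ / 2)) := (hfd.deriv (isOpen_strip ρ)).mono hs1
  have hgper : ∀ w ∈ strip (ρ / 2), deriv f (w + 1) = deriv f w := fun w hw =>
    periodic_deriv_of_strip hfper w (hs1 hw)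
  have hgB : ∀ w ∈ strip (ρ / 2), ‖deriv f w‖ ≤ 2 * B / (ρ - ρ / 2) := fun w hw =>
    norm_deriv_le_of_strip (by linarith) hfd hfB hw
  have hhd : DifferentiableOn ℂ (deriv (deriv f)) (strip (ρ / 4)) :=
    (hgd.deriv (isOpen_strip _)).mono hs2
  have hhper : ∀ w ∈ strip (ρ / 4), deriv (deriv f) (w + 1) = deriv (deriv f) w := fun w hw =>
    periodic_deriv_of_strip hgper w (hs2 hw)
  have hhB : ∀ w ∈ strip (ρ / 4), ‖deriv (deriv f) w‖ ≤ 2 * B / (ρ - ρ / 2) / (ρ / 2 - ρ / 4) :=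
    fun w hw => norm_deriv_le_of_strip (by linarith) hgd hgB hw
  have hden1 : 0 < ρ - ρ / 2 := by linarith
  have hden2 : 0 < ρ / 2 - ρ / 4 := by linarith
  obtain ⟨m1, n1⟩ := memK_of_bound l (ρ' := ρ₂ / 2) (by linarith) hfd hfper hfB (by positivity)
  obtain ⟨m2, n2⟩ := memK_of_bound l (ρ' := ρ₂ / 2) (by linarith) hgd hgper hgB (by positivity)
  obtain ⟨m3, n3⟩ := memK_of_bound l (ρ' := ρ₂ / 2) (by linarith) hhd hhper hhB (by positivity)
  have hadd : ∀ {u v : ℂ}, u ∈ strip (ρ / 4) → v ∈ strip (ρ / 4) → u + v ∈ strip ρ := by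
    intro u v hu hv
    have := add_mul_mem_strip hu hv (c := 1) (by simp)
    rw [Complex.ofReal_one, one_mul] at this
    exact strip_mono (by linarith) this
  have hHd := differentiableOn_chordSq hρ hF hper hB
  have hH : SepHolo (ρ / 4) K (chordSq F) := by
    refine ⟨fun v hv => ?_, fun u hu => ?_, fun u hu v hv => norm_chordSq_le hρ hF hper hB hu hv⟩
    · exact DifferentiableOn.comp (g := chordSq F) (f := fun u => (u, v)) hHd (by fun_prop)
        fun u hu => ⟨hu, hv⟩
    · exact DifferentiableOn.comp (g := chordSq F) (f := fun v => (u, v)) hHd (by fun_prop)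
        fun v hv => ⟨hu, hv⟩
  have hreal := chordSq_real hρ hc hF hper hB hv hch
  have hre : ∀ u ∈ strip ρ₂, ∀ v ∈ strip ρ₂, a / 2 ≤ (chordSq F (u, v)).re := fun u hu v hv =>
    re_chordSq_ge (by positivity) hap hH (fun s σ => by
      obtain ⟨x, hx, hx2, -⟩ := hreal s σ
      rw [hx, Complex.ofReal_re]
      exact hx2) hu hv
  set G : ℂ × ℂ → ℂ := fun p => chordSq F p ^ ((-(1 / 2) : ℝ) : ℂ) with hG
  have hs4 := strip_mono (show ρ₂ ≤ ρ / 4 by linarith)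
  have hslit : ∀ p ∈ strip ρ₂ ×ˢ strip ρ₂, chordSq F p ∈ Complex.slitPlane := fun p hp =>
    Or.inl (lt_of_lt_of_le (by positivity) (hre p.1 hp.1 p.2 hp.2))
  have hGd : DifferentiableOn ℂ G (strip ρ₂ ×ˢ strip ρ₂) := fun p hp =>
    ((hHd.mono (prod_mono hs4 hs4)) p hp).cpow (differentiableWithinAt_const _) (hslit p hp)
  have hGs : SepHolo ρ₂ C G := by
    refine ⟨fun v hv => ?_, fun u hu => ?_, fun u hu v hv => ?_⟩
    · exact DifferentiableOn.comp (g := G) (f := fun u => (u, v)) hGd (by fun_prop)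
        fun u hu => ⟨hu, hv⟩
    · exact DifferentiableOn.comp (g := G) (f := fun v => (u, v)) hGd (by fun_prop)
        fun v hv => ⟨hu, hv⟩
    · simp only [hG]
      rw [Complex.norm_cpow_real]
      exact Real.rpow_le_rpow_of_nonpos (by positivity)
        ((hre u hu v hv).trans (Complex.re_le_norm _)) (by norm_num)
  obtain ⟨m4, n4⟩ := memK₂_of_bound l (ρ' := ρ₂ / 2) hdp hC0 (by positivity) (by
      rw [hd]
      field_simp
      linarith) hGs hGd
    (fun u hu v hv => by
      simp only [hG]
      rw [chordSq_add_left hper (strip_mono (by linarith) (hs4 hu)) (hadd (hs4 hu) (hs4 hv))])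
    (fun u hu v hv => by
      simp only [hG]
      rw [chordSq_add_right hper (hadd (hs4 hu) (hs4 hv))])
  have hfv : ExtendsCurve f v := fun s i => hv i s
  refine ⟨f, deriv f, deriv (deriv f), G, m1, m2, m3, m4, hfv, extendsCurve_deriv hρ hfd hfv,
    extendsCurve_deriv (by positivity) hgd (extendsCurve_deriv hρ hfd hfv), fun s σ => ?_, ?_⟩
  · obtain ⟨x, hx, hx2, hx3, hx4⟩ := hreal s σ
    refine ⟨hx3, ?_⟩
    simp only [hG]
    rw [hx, hx4, Complex.ofReal_cpow (hap.le.trans hx2)]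
  · push_cast
    exact add_le_add (add_le_add (add_le_add n1 n2) n3) n4

/-- The complex numbers as the Euclidean plane. -/
def toPlane : ℂ ≃ₗᵢ[ℝ] Plane := Complex.orthonormalBasisOneI.repr

@[simp] theorem toPlane_zero_apply (z : ℂ) : toPlane z 0 = z.re := by
  simp [toPlane, Complex.orthonormalBasisOneI_repr_apply]

@[simp] theorem toPlane_one_apply (z : ℂ) : toPlane z 1 = z.im := by
  simp [toPlane, Complex.orthonormalBasisOneI_repr_apply]

theorem hasDerivAt_toPlane {c : ℝ → ℂ} {d : ℂ} {s : ℝ} (h : HasDerivAt c d s) :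
    HasDerivAt (fun s => toPlane (c s)) (toPlane d) s :=
  (toPlane.toContinuousLinearEquiv.toContinuousLinearMap.hasFDerivAt (x := c s)).comp_hasDerivAt s h

theorem inner_toPlane (a b : ℂ) : inner ℝ (toPlane a) (toPlane b) = (conj a * b).re := by
  rw [LinearIsometryEquiv.inner_map_map, Complex.inner, mul_comm]

section

variable {β L : ℝ} {c E E' : ℝ → ℂ}

theorem norm_chord (hL : 0 < L) (hE : Continuous E) (hc : ∀ s, HasDerivAt c (L * E s) s) (s σ : ℝ) :
    ‖c (s + σ) - c s‖ = L * |σ| * dq E s σ ^ (1 / 2 : ℝ) := by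
  have h := mul_av (f' := fun s => L * E s) hc (by fun_prop) s σ
  have h2 : av (fun s => L * E s) s σ = L * av E s σ := intervalIntegral.integral_const_mul _ _
  rw [← h, h2, norm_mul, norm_mul, Complex.norm_real, Complex.norm_real, Real.norm_eq_abs,
    Real.norm_eq_abs, abs_of_pos hL, dq, ← Real.sqrt_eq_rpow, Real.sqrt_sq (norm_nonneg _)]
  ring

variable (hβ₁ : 1 < β) (hβ₂ : β < 2) (hL : 0 < L) (hE : ∀ s, HasDerivAt E (E' s) s)
  (hE' : Continuous E') (hc : ∀ s, HasDerivAt c (L * E s) s) (hper : Function.Periodic c 1)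
  (hpos : ∀ s, ∀ σ ∈ 𝕁, 0 < dq E s σ)

include hβ₁ hβ₂ hL hE hE' hc hper hpos

theorem cdeIntegrand_toPlane (s : ℝ) {σ : ℝ} (hσ : σ ∈ 𝕁) :
    cdeIntegrand β (fun s => toPlane (c s)) s σ =
      toPlane ((L ^ (1 - β) : ℝ) * (kap β σ * (av E' s σ * dq E s σ * vq β E s σ))) := by
  have hEc := continuous_of_hasDerivAt hE
  have hd : deriv (fun s => toPlane (c s)) = fun s => toPlane (L * E s) :=
    funext fun s => (hasDerivAt_toPlane (hc s)).deriv
  have hp := hpos s σ hσ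
  rw [cdeIntegrand, hd, ← map_sub, ← map_sub, LinearIsometryEquiv.norm_map, norm_chord hL hEc hc,
    ← map_smul, ← mul_sub, ← mul_av hE hE']
  congr 1
  have h1 : (((L * |σ| * dq E s σ ^ (1 / 2 : ℝ)) ^ β)⁻¹ : ℝ) * L * σ =
      L ^ (1 - β) * kap β σ * (dq E s σ * vq β E s σ) := by
    rw [dq_mul_vq hp, kap, Real.mul_rpow (by positivity) (by positivity),
      Real.mul_rpow hL.le (abs_nonneg σ), ← Real.rpow_mul hp.le, Real.rpow_neg hp.le,
      Real.rpow_sub hL, Real.rpow_one, Real.rpow_neg (abs_nonneg σ),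
      show (1 / 2 * β : ℝ) = β / 2 by ring, mul_inv, mul_inv]
    field_simp
  rw [Complex.real_smul]
  have h2 := congrArg (fun x : ℝ => (x : ℂ)) h1
  push_cast at h2 ⊢
  linear_combination av E' s σ * h2

theorem continuousOn_zetaU_integrand (s : ℝ) :
    ContinuousOn (fun σ => av E' s σ * dq E s σ * vq β E s σ) 𝕁 := by
  have hEc := continuous_of_hasDerivAt hE
  have h1 : Continuous fun σ => av E' s σ :=
    (continuous_av hE').comp (by fun_prop : Continuous fun σ : ℝ => (s, σ))
  have h2 : Continuous fun σ => dq E s σ :=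
    (continuous_dq hEc).comp (by fun_prop : Continuous fun σ : ℝ => (s, σ))
  refine (h1.continuousOn.mul (Complex.continuous_ofReal.comp h2).continuousOn).mul ?_
  unfold vq
  exact (Complex.continuous_ofReal.comp_continuousOn
    (h2.continuousOn.rpow_const fun σ hσ => Or.inl (hpos s σ hσ).ne'))

theorem cdeIntegrand_periodic (s : ℝ) :
    Function.Periodic (cdeIntegrand β (fun s => toPlane (c s)) s) 1 := by
  intro σ
  have hd : deriv (fun s => toPlane (c s)) = fun s => toPlane (L * E s) :=
    funext fun s => (hasDerivAt_toPlane (hc s)).deriv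
  have hEper : Function.Periodic E 1 := fun s => by
    have h1 := (hc (s + 1)).comp_add_const s 1
    rw [show (fun x => c (x + 1)) = c from funext hper] at h1
    have := h1.unique (hc s)
    have hL' : (L : ℂ) ≠ 0 := by exact_mod_cast hL.ne'
    exact mul_left_cancel₀ hL' this
  simp only [cdeIntegrand, hd, ← add_assoc, hper (s + σ), hEper (s + σ)]

theorem intervalIntegrable_cdeIntegrand (s a b : ℝ) :
    IntervalIntegrable (cdeIntegrand β (fun s => toPlane (c s)) s) volume a b := by
  refine (cdeIntegrand_periodic hβ₁ hβ₂ hL hE hE' hc hper hpos s).intervalIntegrable one_ne_zero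
    (t := -(1 / 2)) ?_ a b
  rw [show (-(1 / 2) + 1 : ℝ) = 1 / 2 by norm_num]
  have h := (intervalIntegrable_kap_mul hβ₁ hβ₂
    (continuousOn_zetaU_integrand hβ₁ hβ₂ hL hE hE' hc hper hpos s)).const_mul ((L ^ (1 - β) : ℝ) : ℂ)
  rw [intervalIntegrable_iff_integrableOn_Icc_of_le (by norm_num)] at h ⊢
  have h2 := toPlane.toContinuousLinearEquiv.toContinuousLinearMap.integrable_comp h
  refine h2.congr ((ae_restrict_mem measurableSet_Icc).mono fun σ hσ => ?_)
  exact (cdeIntegrand_toPlane hβ₁ hβ₂ hL hE hE' hc hper hpos s hσ).symm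

theorem cdeIntegral_toPlane (s : ℝ) :
    cdeIntegral β (fun s => toPlane (c s)) s = toPlane ((L ^ (1 - β) : ℝ) * zetaU β E E' s) := by
  have hp := cdeIntegrand_periodic hβ₁ hβ₂ hL hE hE' hc hper hpos s
  have h1 := hp.intervalIntegral_add_eq 0 (-(1 / 2))
  rw [zero_add, show (-(1 / 2) + 1 : ℝ) = 1 / 2 by norm_num] at h1
  have h2 : ∫ σ in (-(1 / 2) : ℝ)..(1 / 2), cdeIntegrand β (fun s => toPlane (c s)) s σ =
      ∫ σ in (-(1 / 2) : ℝ)..(1 / 2), toPlane.toContinuousLinearEquiv.toContinuousLinearMap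
        ((L ^ (1 - β) : ℝ) * (kap β σ * (av E' s σ * dq E s σ * vq β E s σ))) :=
    intervalIntegral.integral_congr fun σ hσ => by
      rw [uIcc_of_le (by norm_num)] at hσ
      exact cdeIntegrand_toPlane hβ₁ hβ₂ hL hE hE' hc hper hpos s hσ
  rw [cdeIntegral, h1, h2, ContinuousLinearMap.intervalIntegral_comp_comm _
    ((intervalIntegrable_kap_mul hβ₁ hβ₂
      (continuousOn_zetaU_integrand hβ₁ hβ₂ hL hE hE' hc hper hpos s)).const_mul _),
    intervalIntegral.integral_const_mul, zetaU, mul_neg, map_neg]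
  rfl

theorem tangentialCoeff_toPlane {Z' : ℝ → ℂ} (hZ : ∀ s, HasDerivAt (zetaU β E E') (Z' s) s) (s : ℝ) :
    tangentialCoeff β (fun s => toPlane (c s)) s = L ^ (-β) *
      (s * (∫ r in (0 : ℝ)..1, (conj (E r) * Z' r).re / ‖E r‖ ^ 2) -
        ∫ r in (0 : ℝ)..s, (conj (E r) * Z' r).re / ‖E r‖ ^ 2) := by
  have h0 : cdeIntegral β (fun s => toPlane (c s)) = _ :=
    funext fun s => cdeIntegral_toPlane hβ₁ hβ₂ hL hE hE' hc hper hpos s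
  have h : ∀ r, inner ℝ (deriv (fun s => toPlane (c s)) r)
      (deriv (cdeIntegral β fun s => toPlane (c s)) r) / ‖deriv (fun s => toPlane (c s)) r‖ ^ 2 =
      L ^ (-β) * ((conj (E r) * Z' r).re / ‖E r‖ ^ 2) := by
    intro r
    rw [h0, (hasDerivAt_toPlane (hc r)).deriv, (hasDerivAt_toPlane ((hZ r).const_mul _)).deriv,
      inner_toPlane, LinearIsometryEquiv.norm_map, norm_mul, Complex.norm_real, Real.norm_eq_abs,
      abs_of_pos hL, map_mul, Complex.conj_ofReal,
      show L * conj (E r) * ((L ^ (1 - β) : ℝ) * Z' r) =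
        ((L * L ^ (1 - β) : ℝ) : ℂ) * (conj (E r) * Z' r) by push_cast; ring, Complex.re_ofReal_mul,
      mul_pow, mul_div_mul_comm]
    congr 1
    rw [Real.rpow_sub hL, Real.rpow_one, Real.rpow_neg hL.le]
    field_simp
  simp only [tangentialCoeff, h, intervalIntegral.integral_const_mul]
  ring

end

/-- Holomorphic functions on a strip have a primitive. -/
theorem exists_primitive_strip {F : ℂ → ℂ} {ρ B : ℝ} (hF : DifferentiableOn ℂ F (strip ρ))
    (hB : ∀ w ∈ strip ρ, ‖F w‖ ≤ B) :
    ∃ P : ℂ → ℂ, P 0 = 0 ∧ (∀ w ∈ strip ρ, HasDerivAt P (F w) w) ∧ ∀ w ∈ strip ρ, ‖P w‖ ≤ ‖w‖ * B := by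
  have hmem : ∀ {ρ' : ℝ} {w : ℂ}, w ∈ strip ρ' → ∀ c ∈ Icc (0 : ℝ) 1, (c : ℂ) * w ∈ strip ρ' := by
    intro ρ' w hw c hc
    change |((c : ℂ) * w).im| < ρ'
    rw [Complex.im_ofReal_mul, abs_mul, abs_of_nonneg hc.1]
    exact lt_of_le_of_lt (mul_le_of_le_one_left (abs_nonneg _) hc.2) hw
  have hd : ∀ {w : ℂ}, w ∈ strip ρ → HasDerivAt F (deriv F w) w := fun hw =>
    (hF.differentiableAt ((isOpen_strip ρ).mem_nhds hw)).hasDerivAt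
  have hcF : ∀ {w : ℂ}, w ∈ strip ρ → ContinuousOn (fun c : ℝ => F (c * w)) (Icc 0 1) := fun hw =>
    hF.continuousOn.comp (by fun_prop) fun c hc => hmem hw c hc
  have hcF' : ∀ {w : ℂ}, w ∈ strip ρ → ContinuousOn (fun c : ℝ => deriv F (c * w)) (Icc 0 1) := fun hw =>
    (hF.deriv (isOpen_strip ρ)).continuousOn.comp (by fun_prop) fun c hc => hmem hw c hc
  refine ⟨fun w => w * ∫ c in (0 : ℝ)..1, F (c * w), by simp, fun w hw => ?_, fun w hw => ?_⟩
  · obtain ⟨ρ', h1, h2⟩ := exists_between (show |w.im| < ρ from hw)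
    have hnb : strip ρ' ∈ nhds w := (isOpen_strip ρ').mem_nhds h1
    have hsub := strip_mono h2.le
    have hmeas : ∀ {f : ℝ → ℂ}, ContinuousOn f (Icc 0 1) →
        AEStronglyMeasurable f (volume.restrict (uIoc 0 1)) := fun hf => by
      rw [uIoc_of_le zero_le_one]
      exact (hf.mono Ioc_subset_Icc_self).aestronglyMeasurable measurableSet_Ioc
    have key := intervalIntegral.hasDerivAt_integral_of_dominated_loc_of_deriv_le (μ := volume)
      (F := fun (v : ℂ) (c : ℝ) => F (c * v)) (F' := fun (v : ℂ) (c : ℝ) => deriv F (c * v) * c)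
      (bound := fun _ => B / (ρ - ρ')) (a := 0) (b := 1) hnb
      (Filter.eventually_of_mem hnb fun v hv => hmeas (hcF (hsub hv)))
      ((hcF (hsub h1)).intervalIntegrable_of_Icc zero_le_one)
      (hmeas ((hcF' (hsub h1)).mul (by fun_prop)))
      (Filter.Eventually.of_forall fun c hc v hv => ?_) (by simp)
      (Filter.Eventually.of_forall fun c hc v hv => ?_)
    · have hP := (hasDerivAt_id w).mul key.2
      have hFTC : ∫ c in (0 : ℝ)..1, (F (c * w) + w * (deriv F (c * w) * c)) = F w := by
        have := intervalIntegral.integral_eq_sub_of_hasDerivAt (a := 0) (b := 1)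
          (f := fun c : ℝ => (c : ℂ) * F (c * w)) (f' := fun c => F (c * w) + w * (deriv F (c * w) * c))
          (fun c hc => by
            rw [uIcc_of_le zero_le_one] at hc
            have e1 : HasDerivAt (fun c : ℝ => (c : ℂ) * w) w c := by
              simpa using (Complex.ofRealCLM.hasDerivAt (x := c)).mul_const w
            have e2 := (hd (hmem (hsub h1) c hc)).comp c e1
            refine ((Complex.ofRealCLM.hasDerivAt (x := c)).mul e2).congr_deriv ?_
            simp
            ring)
          (((hcF (hsub h1)).add (continuousOn_const.mul ((hcF' (hsub h1)).mul
            (by fun_prop)))).intervalIntegrable_of_Icc zero_le_one)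
        simpa using this
      refine hP.congr_deriv ?_
      rw [← hFTC, intervalIntegral.integral_add
        ((hcF (hsub h1)).intervalIntegrable_of_Icc zero_le_one)
        (key.1.const_mul w), intervalIntegral.integral_const_mul]
      simp
    · rw [uIoc_of_le zero_le_one] at hc
      rw [norm_mul, Complex.norm_real, Real.norm_eq_abs, abs_of_pos hc.1]
      have h3 := norm_deriv_le_of_strip h2 hF hB (hmem hv c ⟨hc.1.le, hc.2⟩)
      exact (mul_le_of_le_one_right (norm_nonneg _) hc.2).trans h3
    · rw [uIoc_of_le zero_le_one] at hc
      have e1 : HasDerivAt (fun v : ℂ => (c : ℂ) * v) c v := by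
        simpa using (hasDerivAt_id v).const_mul (c : ℂ)
      exact (hd (hmem (hsub hv) c ⟨hc.1.le, hc.2⟩)).comp v e1
  · rw [norm_mul]
    gcongr
    have := intervalIntegral.norm_integral_le_of_norm_le_const (a := 0) (b := 1) (C := B)
      (f := fun c : ℝ => F (c * w)) fun c hc => by
        rw [uIoc_of_le zero_le_one] at hc
        exact hB _ (hmem hw c ⟨hc.1.le, hc.2⟩)
    simpa using this

theorem abs_sin_pi_add_int (x : ℝ) (n : ℤ) :
    |Real.sin (π * (x + n))| = |Real.sin (π * x)| := by
  rw [show π * (x + n) = π * x + n * π by ring, Real.sin_add_int_mul_pi, abs_mul]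
  simp

/-- The arc-chord condition in quantitative form. -/
theorem ArcChord.exists_chord {v : ℝ → Plane} (hv : Continuous v) (hper : Function.Periodic v 1)
    (h : ArcChord v) : ∃ c > 0, ∀ s σ, c * |Real.sin (π * σ)| ≤ ‖v (s + σ) - v s‖ := by
  have hpi := Real.pi_pos
  set S : ℝ≥0∞ := essSup (fun p : ℝ × ℝ => arcChordFn v p.1 p.2)
    (volume.restrict (Ioc (0 : ℝ) 1 ×ˢ Ioc (0 : ℝ) 1)) with hS
  have hS' : S < ⊤ := h
  set C := S.toReal + 1 with hC
  have hC0 : 0 < C := by positivity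
  refine ⟨1 / (C * π), by positivity, ?_⟩
  have hae : ∀ᵐ p ∂(volume.restrict (Ioc (0 : ℝ) 1 ×ˢ Ioc (0 : ℝ) 1)),
      |Real.sin (π * p.2)| ≤ C * π * ‖v (p.1 + p.2) - v p.1‖ := by
    filter_upwards [ae_le_essSup (f := fun p : ℝ × ℝ => arcChordFn v p.1 p.2)] with p hp
    rw [← hS] at hp
    by_cases hn : ∃ n : ℤ, p.2 = n
    · obtain ⟨n, hn⟩ := hn
      rw [hn, mul_comm, Real.sin_int_mul_pi, abs_zero]
      positivity
    · rw [arcChordFn, if_neg hn] at hp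
      have h1 := ENNReal.div_le_iff_le_mul (b := ENNReal.ofReal π * ‖v (p.1 + p.2) - v p.1‖ₑ)
        (Or.inr (by exact hS'.ne)) (Or.inl (by finiteness)) |>.1 hp
      rw [← ofReal_norm, ← ENNReal.ofReal_toReal hS'.ne, ← ENNReal.ofReal_mul hpi.le,
        ← ENNReal.ofReal_mul (by positivity), ENNReal.ofReal_le_ofReal_iff (by positivity)] at h1
      refine h1.trans ?_
      rw [mul_assoc C]
      gcongr
      rw [hC]; linarith
  set U : Set (ℝ × ℝ) := {p | C * π * ‖v (p.1 + p.2) - v p.1‖ < |Real.sin (π * p.2)|} with hU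
  have hUo : IsOpen U := isOpen_lt (by fun_prop) (by fun_prop)
  have hnull : U ∩ (Ioo 0 1 ×ˢ Ioo 0 1) = ∅ := by
    rw [← (hUo.inter (isOpen_Ioo.prod isOpen_Ioo)).measure_eq_zero_iff (μ := volume)]
    refine measure_mono_null ?_ (ae_restrict_iff' (measurableSet_Ioc.prod measurableSet_Ioc) |>.1 hae)
    rintro p ⟨hp, hp1, hp2⟩ hcon
    exact absurd (hcon ⟨Ioo_subset_Ioc_self hp1, Ioo_subset_Ioc_self hp2⟩) (not_le.2 hp)
  intro s σ
  rw [one_div, inv_mul_le_iff₀ (by positivity)]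
  by_contra! hcon
  have hmem : (Int.fract s, Int.fract σ) ∈ U := by
    have e1 : v (Int.fract s + Int.fract σ) = v (s + σ) := by
      have := hper.sub_zsmul_eq (⌊s⌋ + ⌊σ⌋) (x := s + σ)
      rw [← this]
      congr 1
      rw [← Int.self_sub_floor, ← Int.self_sub_floor, zsmul_eq_mul]
      push_cast
      ring
    have e2 : v (Int.fract s) = v s := by
      have := hper.sub_zsmul_eq ⌊s⌋ (x := s)
      rw [← this]
      simp [← Int.self_sub_floor]
    have e3 : |Real.sin (π * Int.fract σ)| = |Real.sin (π * σ)| := by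
      rw [← abs_sin_pi_add_int (Int.fract σ) ⌊σ⌋, Int.fract_add_floor]
    rw [hU, mem_ofPred_eq, e1, e2, e3]
    exact hcon
  have hlim : Filter.Tendsto (fun ε : ℝ => ((Int.fract s + ε, Int.fract σ + ε) : ℝ × ℝ))
      (nhdsWithin 0 (Ioi 0)) (nhds (Int.fract s, Int.fract σ)) := by
    have : Continuous fun ε : ℝ => ((Int.fract s + ε, Int.fract σ + ε) : ℝ × ℝ) := by fun_prop
    simpa using (this.tendsto 0).mono_left nhdsWithin_le_nhds
  have h1 := Int.fract_lt_one s
  have h2 := Int.fract_lt_one σ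
  obtain ⟨ε, hεU, hε0, hε1⟩ := ((hlim.eventually (hUo.mem_nhds hmem)).and (Ioo_mem_nhdsGT
    (show (0 : ℝ) < min (1 - Int.fract s) (1 - Int.fract σ) from lt_min (by linarith) (by linarith)))).exists
  have h3 := hε1.trans_le (min_le_left _ _)
  have h4 := hε1.trans_le (min_le_right _ _)
  have : ((Int.fract s + ε, Int.fract σ + ε) : ℝ × ℝ) ∈ U ∩ (Ioo 0 1 ×ˢ Ioo 0 1) :=
    ⟨hεU, ⟨by have := Int.fract_nonneg s; simp only; linarith, by simp only; linarith⟩,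
      ⟨by have := Int.fract_nonneg σ; simp only; linarith, by simp only; linarith⟩⟩
  rw [hnull] at this
  exact this

/-- A lower bound for the chord of one period bounds all chords. -/
theorem chord_of_half {v : ℝ → Plane} (hper : Function.Periodic v 1) {c : ℝ} (hc : 0 ≤ c)
    (h : ∀ s, ∀ σ ∈ 𝕁, c * (π * |σ|) ≤ ‖v (s + σ) - v s‖) (s σ : ℝ) :
    c * |Real.sin (π * σ)| ≤ ‖v (s + σ) - v s‖ := by
  have h1 := abs_le.1 (abs_sub_round σ)
  have h2 := h s (σ - round σ) ⟨h1.1, h1.2⟩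
  have h3 : v (s + (σ - round σ)) = v (s + σ) := by
    have := hper.sub_zsmul_eq (round σ) (x := s + σ)
    rw [← this]
    congr 1
    simp
    ring
  rw [h3] at h2
  refine le_trans ?_ h2
  gcongr
  have h4 := abs_sin_pi_add_int (σ - round σ) (round σ)
  rw [sub_add_cancel] at h4
  rw [h4]
  exact (Real.abs_sin_le_abs).trans (by rw [abs_mul, abs_of_pos Real.pi_pos])

theorem mem_strip_conj {ρ : ℝ} {w : ℂ} : conj w ∈ strip ρ ↔ w ∈ strip ρ := by
  simp [strip]

/-- The components of a complex curve inherit its bounded holomorphic extension. -/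
theorem exists_component_ext {Z : ℂ → ℂ} {z : ℝ → ℂ} {ρ B : ℝ} (hZd : DifferentiableOn ℂ Z (strip ρ))
    (hZper : ∀ w ∈ strip ρ, Z (w + 1) = Z w) (hZB : ∀ w ∈ strip ρ, ‖Z w‖ ≤ B)
    (hZz : ∀ s : ℝ, Z s = z s) :
    ∃ F : Fin 2 → ℂ → ℂ, (∀ i, DifferentiableOn ℂ (F i) (strip ρ)) ∧
      (∀ i, ∀ w ∈ strip ρ, F i (w + 1) = F i w) ∧ (∀ i, ∀ w ∈ strip ρ, ‖F i w‖ ≤ B) ∧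
      ∀ i (s : ℝ), F i s = (toPlane (z s) i : ℝ) := by
  obtain ⟨Zc, hZc⟩ : ∃ Zc : ℂ → ℂ, Zc = fun w => conj (Z (conj w)) := ⟨_, rfl⟩
  have hZcd : DifferentiableOn ℂ Zc (strip ρ) := fun w hw => by
    have h1 : DifferentiableAt ℂ Z (conj w) :=
      hZd.differentiableAt ((isOpen_strip ρ).mem_nhds (mem_strip_conj.2 hw))
    have h2 := h1.star_star
    simp only [Complex.star_def, Complex.conj_conj] at h2
    rw [hZc]
    exact h2.differentiableWithinAt
  have hZcB : ∀ w ∈ strip ρ, ‖Zc w‖ ≤ B := fun w hw => by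
    rw [hZc, RCLike.norm_conj]
    exact hZB _ (mem_strip_conj.2 hw)
  have hZcper : ∀ w ∈ strip ρ, Zc (w + 1) = Zc w := fun w hw => by
    simp only [hZc, map_add, map_one]
    rw [hZper _ (mem_strip_conj.2 hw)]
  have hZcz : ∀ s : ℝ, Zc s = conj (z s) := fun s => by
    simp only [hZc, Complex.conj_ofReal, hZz]
  refine ⟨![fun w => (1 / 2) * (Z w + Zc w), fun w => (-Complex.I / 2) * (Z w - Zc w)], ?_, ?_, ?_, ?_⟩
  · refine Fin.forall_fin_two.2 ⟨(hZd.add hZcd).const_mul _, (hZd.sub hZcd).const_mul _⟩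
  · refine Fin.forall_fin_two.2 ⟨fun w hw => ?_, fun w hw => ?_⟩ <;>
      simp [hZper w hw, hZcper w hw]
  · refine Fin.forall_fin_two.2 ⟨fun w hw => ?_, fun w hw => ?_⟩
    · have h1 := (norm_add_le (Z w) (Zc w)).trans (add_le_add (hZB w hw) (hZcB w hw))
      simp only [Matrix.cons_val_zero, norm_mul, norm_div, norm_one, RCLike.norm_ofNat]
      linarith
    · have h1 := (norm_sub_le (Z w) (Zc w)).trans (add_le_add (hZB w hw) (hZcB w hw))
      simp only [Matrix.cons_val_one, Matrix.cons_val_fin_one, norm_mul, norm_div, norm_neg, Complex.norm_I, RCLike.norm_ofNat]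
      linarith
  · refine Fin.forall_fin_two.2 ⟨fun s => ?_, fun s => ?_⟩
    · simp only [Matrix.cons_val_zero, hZz, hZcz, toPlane_zero_apply, Complex.add_conj]
      push_cast
      ring
    · simp only [Matrix.cons_val_one, Matrix.cons_val_fin_one, hZz, hZcz, toPlane_one_apply, Complex.sub_conj]
      push_cast
      linear_combination (-(z s).im : ℂ) * Complex.I_sq

/-- A curve with speed independent of the parameter, from its unit tangent. -/
theorem StripBound.holoCurve {ρ B c L : ℝ} {E z : ℝ → ℂ} (hρ : 0 < ρ) (h : StripBound ρ B c E)
    (hc : 0 < c) (hL₁ : c ≤ L) (hL₂ : L ≤ B) (hz0 : ‖z 0‖ ≤ B) (hz : ∀ s, HasDerivAt z (L * E s) s)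
    (hE : Continuous E) (hper : Function.Periodic z 1) :
    HoloCurve ρ (B + (1 + ρ) * (B * B)) (c * c ^ (1 / 2 : ℝ) / π) fun s => toPlane (z s) := by
  obtain ⟨F, hF, hFper, hFB, hFE⟩ := h.ext
  have hB0 : 0 ≤ B := (norm_nonneg _).trans hz0
  have hL0 : 0 < L := hc.trans_le hL₁
  have h0 : ∀ x : ℝ, (x : ℂ) ∈ strip ρ := fun x => by simp [strip, hρ]
  obtain ⟨P, hP0, hP, hPB⟩ := exists_primitive_strip (F := fun w => L * F w) (B := B * B)
    (hF.const_mul _) fun w hw => by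
      rw [norm_mul, Complex.norm_real, Real.norm_eq_abs, abs_of_pos hL0]
      exact mul_le_mul hL₂ (hFB w hw) (norm_nonneg _) hB0
  obtain ⟨Z, hZ⟩ : ∃ Z : ℂ → ℂ, Z = fun w => z 0 + P w := ⟨_, rfl⟩
  have hZd : DifferentiableOn ℂ Z (strip ρ) := fun w hw =>
    by
    rw [hZ]; exact ((hP w hw).differentiableAt.const_add _).differentiableWithinAt
  have hZz : ∀ s : ℝ, Z s = z s := by
    have h1 : ∀ s : ℝ, HasDerivAt (fun s : ℝ => Z s - z s) 0 s := fun s => by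
      rw [hZ]
      refine ((((hP s (h0 s)).const_add (z 0)).comp_ofReal).sub (hz s)).congr_deriv ?_
      rw [hFE, sub_self]
    intro s
    have h2 := is_const_of_deriv_eq_zero (fun s => (h1 s).differentiableAt) (fun s => (h1 s).deriv) s 0
    simpa [hZ, hP0, sub_eq_zero] using h2
  have hadd : ∀ w, w ∈ strip ρ → w + 1 ∈ strip ρ := fun w hw => by simpa [strip] using hw
  have hZper : ∀ w ∈ strip ρ, Z (w + 1) = Z w := by
    refine eqOn_of_eqOn_real (x := 0) (isOpen_strip ρ) (convex_strip ρ).isPreconnected (f := fun w => Z (w + 1)) ?_ hZd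
      (h0 0) fun y _ => ?_
    · exact DifferentiableOn.comp (g := Z) (f := fun w => w + 1) hZd (by fun_prop) fun w hw => hadd w hw
    · rw [← Complex.ofReal_one, ← Complex.ofReal_add, hZz, hZz, hper]
  have hZB : ∀ w ∈ strip ρ, ‖Z w‖ ≤ B + (1 + ρ) * (B * B) := by
    intro w hw
    have hmem : w - ⌊w.re⌋ ∈ strip ρ := by simpa [strip] using hw
    have h1 : Z (w - ⌊w.re⌋) = Z w := by
      simpa [sub_eq_add_neg] using add_int_of_add_one hZper (-⌊w.re⌋) w hw
    rw [← h1]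
    have h2 : ‖w - ⌊w.re⌋‖ ≤ 1 + ρ := by
      refine (Complex.norm_le_abs_re_add_abs_im _).trans (add_le_add ?_ ?_)
      · have e : (w - ⌊w.re⌋).re = Int.fract w.re := by simp [← Int.self_sub_floor]
        rw [e, abs_of_nonneg (Int.fract_nonneg _)]
        exact (Int.fract_lt_one _).le
      · exact (show |(w - ⌊w.re⌋).im| < ρ from hmem).le
    rw [hZ]
    refine (norm_add_le _ _).trans (add_le_add hz0 ((hPB _ hmem).trans ?_))
    gcongr
  refine ⟨exists_component_ext hZd hZper hZB hZz, ?_⟩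
  · have hpi := Real.pi_pos
    have hc' : 0 ≤ c * c ^ (1 / 2 : ℝ) / π :=
      div_nonneg (mul_nonneg hc.le (Real.rpow_nonneg hc.le _)) hpi.le
    refine chord_of_half (v := fun s => toPlane (z s)) (fun s => congrArg toPlane (hper s)) hc'
      fun s σ hσ => ?_
    have h3 : ‖toPlane (z (s + σ)) - toPlane (z s)‖ = L * |σ| * dq E s σ ^ (1 / 2 : ℝ) := by
      rw [← map_sub, LinearIsometryEquiv.norm_map, norm_chord hL0 hE hz]
    rw [h3]
    have h1 := h.dq_ge s σ hσ
    have h2 : c * c ^ (1 / 2 : ℝ) / π * (π * |σ|) = c * |σ| * c ^ (1 / 2 : ℝ) := by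
      field_simp
    rw [h2]
    exact mul_le_mul (mul_le_mul_of_nonneg_right hL₁ (abs_nonneg σ))
      (Real.rpow_le_rpow hc.le h1 (by norm_num)) (by positivity) (by positivity)

theorem UnitState.continuous_E' {E k k' : ℝ → ℂ} (h : UnitState E k k') :
    Continuous fun s => Complex.I * k s * E s := by
  have h1 := continuous_of_hasDerivAt h.hasDerivAt
  have h2 := continuous_of_hasDerivAt h.hasDerivAt_k
  fun_prop

theorem UnitState.re_conj_mul {β : ℝ} {E k k' : ℝ → ℂ} (h : UnitState E k k') (R : ℂ) (s : ℝ) :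
    (conj (E s) * (E s * (Complex.I * dispU β k' s + R))).re / ‖E s‖ ^ 2 = R.re := by
  have h1 : conj (E s) * E s = 1 := by
    rw [mul_comm, Complex.mul_conj, Complex.normSq_eq_norm_sq, h.norm_eq]
    simp
  have h2 := Complex.conj_eq_iff_im.1 (dispU_conj (β := β) (conj_deriv_of_conj h.conj_k h.hasDerivAt_k) s)
  rw [← mul_assoc, h1, h.norm_eq]
  simp [h2]

theorem eq_mean_sub_integral {lam f : ℝ → ℝ} {m : ℝ} (hf : Continuous f)
    (h : ∀ s, HasDerivAt lam (m - f s) s) (hper : Function.Periodic lam 1) (s : ℝ) :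
    lam s = lam 0 + (s * (∫ r in (0 : ℝ)..1, f r) - ∫ r in (0 : ℝ)..s, f r) := by
  have h1 : ∀ s, lam s - lam 0 = s * m - ∫ r in (0 : ℝ)..s, f r := by
    intro s
    have := intervalIntegral.integral_eq_sub_of_hasDerivAt (a := 0) (b := s)
      (fun x _ => h x) ((continuous_const.sub hf).intervalIntegrable _ _)
    rw [← this, intervalIntegral.integral_sub intervalIntegrable_const (hf.intervalIntegrable _ _)]
    simp
  have h2 := h1 1
  have h3 := hper 0
  rw [zero_add] at h3
  rw [h3, sub_self, one_mul] at h2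
  linear_combination h1 s - s * h2

section

variable {β T : ℝ} {n : ℝ → ℝ} {z : ℝ → ℝ → ℂ} {L m : ℝ → ℝ} {E k k' : ℝ → ℝ → ℂ} {lam : ℝ → ℝ → ℝ}

theorem IsFlow.lam_eq (h : IsFlow β n T z L m E k k' lam) (t s : ℝ) :
    lam t s = lam t 0 + (s * (∫ r in (0 : ℝ)..1, (remU β (E t) (fun s => Complex.I * k t s * E t s) (k t) r).re)
      - ∫ r in (0 : ℝ)..s, (remU β (E t) (fun s => Complex.I * k t s * E t s) (k t) r).re) :=
  eq_mean_sub_integral (Complex.continuous_re.comp (h.continuous_rem t)) (h.hasDerivAt_lam t)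
    (h.periodic_lam t) s

theorem IsFlow.cdeIntegral_eq (hβ₁ : 1 < β) (hβ₂ : β < 2) (h : IsFlow β n T z L m E k k' lam) {t : ℝ}
    (ht : t ∈ Icc 0 T) (s : ℝ) : cdeIntegral β (fun s => toPlane (z t s)) s =
      toPlane ((L t ^ (1 - β) : ℝ) * zetaU β (E t) (fun s => Complex.I * k t s * E t s) s) :=
  cdeIntegral_toPlane hβ₁ hβ₂ (h.pos t) (h.state t).hasDerivAt (h.state t).continuous_E'
    (h.hasDerivAt t ht) (h.periodic t) (h.state t).dq_pos s

theorem IsFlow.tangentialCoeff_eq (hβ₁ : 1 < β) (hβ₂ : β < 2) (h : IsFlow β n T z L m E k k' lam) {t : ℝ}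
    (ht : t ∈ Icc 0 T) (s : ℝ) : tangentialCoeff β (fun s => toPlane (z t s)) s =
      L t ^ (-β) * (lam t s - lam t 0) := by
  have hs := h.state t
  rw [tangentialCoeff_toPlane hβ₁ hβ₂ (h.pos t) hs.hasDerivAt hs.continuous_E'
    (h.hasDerivAt t ht) (h.periodic t) hs.dq_pos (fun s => hasDerivAt_zetaU hβ₁ hβ₂ hs.hasDerivAt
      (fun _ => rfl) hs.hasDerivAt_k hs.continuous_k' hs.norm_eq hs.dq_pos s), h.lam_eq]
  simp only [hs.re_conj_mul]
  ring

theorem IsFlow.hasDerivAt_toPlane (hβ₁ : 1 < β) (hβ₂ : β < 2) (h : IsFlow β n T z L m E k k' lam) {t : ℝ}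
    (ht : t ∈ Icc 0 T) (s : ℝ) : HasDerivAt (fun t => toPlane (z t s))
      (cdeIntegral β (fun s => toPlane (z t s)) s +
        (L t ^ (-β) * lam t s) • deriv (fun s => toPlane (z t s)) s) t := by
  refine (_root_.hasDerivAt_toPlane (h.hasDerivAt_time t ht s)).congr_deriv ?_
  rw [h.cdeIntegral_eq hβ₁ hβ₂ ht, (_root_.hasDerivAt_toPlane (h.hasDerivAt t ht s)).deriv, ← map_smul,
    ← map_add, Complex.real_smul, Real.rpow_sub (h.pos t), Real.rpow_one, Real.rpow_neg (h.pos t).le,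
    div_eq_mul_inv]
  congr 1
  push_cast
  ring

theorem inY_of_holoCurve (l : ℕ) {ρ B c : ℝ} (hρ : 0 < ρ) (hc : 0 < c) (hT : 0 < T)
    {v : ℝ → ℝ → Plane} (hv : ∀ t ∈ Icc 0 T, HoloCurve ρ B c (v t)) :
    ∃ ρ₀ κ : ℝ, 0 < κ ∧ κ * T < ρ₀ ∧ InY l ρ₀ κ T v := by
  obtain ⟨ρ', hρ', M, hM⟩ := exists_inX l hρ hc (B := B)
  refine ⟨ρ', ρ' / (2 * T), by positivity, ?_, M, fun t ht => ?_⟩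
  · field_simp
    linarith
  · refine (hM _ (hv t ht)).mono ?_
    have := ht.1
    have : 0 ≤ ρ' / (2 * T) * t := by positivity
    linarith

end

/-- The complex form of a curve of constant speed which satisfies the arc-chord condition. -/
theorem exists_unit_tangent {v : ℝ → Plane} (hper : Function.Periodic v 1)
    (han : AnalyticOnNhd ℝ v univ) {c : ℝ} (hc : 0 < c)
    (hch : ∀ s σ, c * |Real.sin (π * σ)| ≤ ‖v (s + σ) - v s‖) {L : ℝ}
    (hL : ∀ s, ‖deriv v s‖ = L) :
    0 < L ∧ ∃ (z E : ℝ → ℂ), (∀ s, toPlane (z s) = v s) ∧ AnalyticOnNhd ℝ E univ ∧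
      Function.Periodic E 1 ∧ (∀ s, ‖E s‖ = 1) ∧ (∀ s, ∀ σ ∈ 𝕁, 0 < dq E s σ) ∧
      (∀ s, HasDerivAt z (L * E s) s) ∧ Function.Periodic z 1 := by
  have hd : ∀ s, HasDerivAt v (deriv v s) s := fun s => (han s (mem_univ s)).differentiableAt.hasDerivAt
  have hL0 : 0 < L := by
    refine lt_of_le_of_ne (hL 0 ▸ norm_nonneg _) fun h => ?_
    have h1 : ∀ s, deriv v s = 0 := fun s => by rw [← norm_eq_zero, hL, h]
    have h2 := is_const_of_deriv_eq_zero (fun s => (hd s).differentiableAt) h1 (0 + 1 / 2) 0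
    have h3 := hch 0 (1 / 2)
    rw [h2, sub_self, norm_zero, show π * (1 / 2) = π / 2 by ring, Real.sin_pi_div_two,
      abs_one] at h3
    linarith
  have hLc : (L : ℂ) ≠ 0 := by exact_mod_cast hL0.ne'
  set ι := toPlane.symm.toContinuousLinearEquiv.toContinuousLinearMap with hι
  have hEan : AnalyticOnNhd ℝ (fun s => (L : ℂ)⁻¹ * ι (deriv v s)) univ :=
    analyticOnNhd_const.mul (ι.comp_analyticOnNhd han.deriv)
  have hz : ∀ s, HasDerivAt (fun s => toPlane.symm (v s)) (L * ((L : ℂ)⁻¹ * ι (deriv v s))) s := by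
    intro s
    rw [mul_inv_cancel_left₀ hLc]
    exact ι.hasFDerivAt.comp_hasDerivAt s (hd s)
  have hu : ∀ s, ‖(L : ℂ)⁻¹ * ι (deriv v s)‖ = 1 := by
    intro s
    have : ‖ι (deriv v s)‖ = L := by rw [← hL s]; exact toPlane.symm.norm_map _
    rw [norm_mul, this, norm_inv, Complex.norm_real, Real.norm_eq_abs, abs_of_pos hL0,
      inv_mul_cancel₀ hL0.ne']
  have hEc : Continuous fun s => (L : ℂ)⁻¹ * ι (deriv v s) :=
    continuousOn_univ.1 hEan.continuousOn
  refine ⟨hL0, fun s => toPlane.symm (v s), _, fun s => by simp, hEan, fun s => ?_, hu,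
    fun s σ hσ => ?_, hz, fun s => by simp only [hper s]⟩
  · have : deriv v (s + 1) = deriv v s := by
      rw [← deriv_comp_add_const]
      exact congrArg (deriv · s) (funext hper)
    simp only [this]
  · rcases eq_or_ne σ 0 with rfl | h0
    · have : av (fun s => (L : ℂ)⁻¹ * ι (deriv v s)) s 0 = (L : ℂ)⁻¹ * ι (deriv v s) := by simp [av]
      rw [dq, this, hu]
      norm_num
    · have h1 := norm_chord hL0 hEc hz s σ
      have h2 : 0 < |Real.sin (π * σ)| := by
        refine abs_pos.2 fun h => h0 ?_
        have hpi := Real.pi_pos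
        obtain ⟨k, hk⟩ := Real.sin_eq_zero_iff.1 h
        have h3 : (k : ℝ) = σ := by
          rw [mul_comm] at hk
          exact mul_left_cancel₀ hpi.ne' hk
        have h4 : k = 0 := by
          have e1 : (-1 : ℝ) < k := by linarith [hσ.1]
          have e2 : (k : ℝ) < 1 := by linarith [hσ.2]
          norm_cast at e1 e2
          omega
        rw [← h3, h4, Int.cast_zero]
      have h3 := hch s σ
      rw [← map_sub, LinearIsometryEquiv.norm_map] at h1
      rw [h1] at h3
      have h4 : 0 < c * |Real.sin (π * σ)| := by positivity
      refine lt_of_le_of_ne (by unfold dq; positivity) fun h5 => ?_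
      rw [← h5, Real.zero_rpow (by norm_num), mul_zero] at h3
      linarith

/-- Existence for curves of constant speed. -/
theorem exists_constant_speed_solution {β : ℝ} (hβ₁ : 1 < β) (hβ₂ : β < 2) (l : ℕ) {v : ℝ → Plane}
    (hper : Function.Periodic v 1) (han : AnalyticOnNhd ℝ v univ) {c : ℝ} (hc : 0 < c)
    (hch : ∀ s σ, c * |Real.sin (π * σ)| ≤ ‖v (s + σ) - v s‖) {L : ℝ}
    (hL : ∀ s, ‖deriv v s‖ = L) :
    ∃ T ρ₀ κ : ℝ, 0 < T ∧ 0 < κ ∧ κ * T < ρ₀ ∧ ∃ z : ℝ → ℝ → Plane, InY l ρ₀ κ T z ∧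
      IsCDESolution β T z (fun t => tangentialCoeff β (z t)) ∧ z 0 = v ∧
      ∀ t ∈ Icc 0 T, ∃ L : ℝ, ∀ s, ‖deriv (z t) s‖ = L := by
  obtain ⟨hL0, z₀, E₀, hzv, hE, hEper, hu, hpos, hz, hzper⟩ := exists_unit_tangent hper han hc hch hL
  obtain ⟨T, hT, z, L, m, E, k, k', lam, hF, hz0, ρ, hρ, c, hc, B, hb⟩ :=
    Wien.exists_isFlow hβ₁ hβ₂ (n := fun _ => 0) (by simp) hE hEper hu hpos hL0 hz hzper
  have hhol := fun t ht => (hb t ht).1.holoCurve hρ hc (hb t ht).2.1 (hb t ht).2.2.1 (hb t ht).2.2.2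
    (hF.hasDerivAt t ht) (continuous_of_hasDerivAt (hF.state t).hasDerivAt) (hF.periodic t)
  obtain ⟨ρ₀, κ, hκ, hκT, hY⟩ := inY_of_holoCurve l hρ (by positivity) hT hhol
  have hl0 : ∀ t, lam t 0 = 0 := fun t => by simp [hF.lam_zero t]
  have htc := fun t (ht : t ∈ Icc 0 T) s => hF.tangentialCoeff_eq hβ₁ hβ₂ ht s
  simp only [hl0, sub_zero] at htc
  refine ⟨T, ρ₀, κ, hT, hκ, hκT, fun t s => toPlane (z t s), hY,
    ⟨fun t ht s => by simp only [hF.periodic t s], fun t ht s => ?_, fun t ht => ?_,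
      fun t ht s => ?_, fun t ht s => ?_⟩, funext fun s => by simp only [hz0, hzv], fun t ht => ⟨L t, fun s => ?_⟩⟩
  · rw [htc t ht, htc t ht, hF.periodic_lam t s]
  · rw [htc t ht, hl0, mul_zero]
  · exact intervalIntegrable_cdeIntegrand hβ₁ hβ₂ (hF.pos t) (hF.state t).hasDerivAt
      (hF.state t).continuous_E' (hF.hasDerivAt t ht) (hF.periodic t) (hF.state t).dq_pos s 0 1
  · rw [htc t ht]
    exact (hF.hasDerivAt_toPlane hβ₁ hβ₂ ht s).hasDerivWithinAt
  · rw [(hasDerivAt_toPlane (hF.hasDerivAt t ht s)).deriv, LinearIsometryEquiv.norm_map, norm_mul,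
      Complex.norm_real, (hF.state t).norm_eq, mul_one, Real.norm_eq_abs, abs_of_pos (hF.pos t)]

theorem two_mul_abs_le_sin {x : ℝ} (hx : |x| ≤ 1 / 2) : 2 * |x| ≤ |Real.sin (π * x)| := by
  have h := two_mul_norm_le_sin (v := (x : ℂ)) (by simpa using hx)
  rw [← Complex.ofReal_mul, ← Complex.ofReal_sin, Complex.norm_real, Complex.norm_real] at h
  exact h

/-- Chord-arc bounds persist under reparametrisation by a circle map. -/
theorem chord_comp {v : ℝ → Plane} (hper : Function.Periodic v 1) {c : ℝ} (hc : 0 < c)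
    (hch : ∀ s σ, c * |Real.sin (π * σ)| ≤ ‖v (s + σ) - v s‖) {χ : ℝ → ℝ} {m : ℝ} (hm : 0 < m)
    (hχ : ∀ s, ∀ σ ≥ 0, m * σ ≤ χ (s + σ) - χ s) (hχ1 : ∀ s, χ (s + 1) = χ s + 1) (s σ : ℝ) :
    2 * c * m / π * |Real.sin (π * σ)| ≤ ‖v (χ (s + σ)) - v (χ s)‖ := by
  have hpi := Real.pi_pos
  refine chord_of_half (v := fun s => v (χ s)) (fun s => by simp only [hχ1, hper (χ s)])
    (by positivity) (fun s σ hσ => ?_) s σ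
  have key : ∀ s, ∀ σ, 0 ≤ σ → σ ≤ 1 / 2 → 2 * c * (m * σ) ≤ ‖v (χ (s + σ)) - v (χ s)‖ := by
    intro s σ h0 h1
    set δ := χ (s + σ) - χ s with hδ
    have h2 := hχ s σ h0
    have h3 := hχ (s + σ) (1 - σ) (by linarith)
    rw [show s + σ + (1 - σ) = s + 1 by ring, hχ1] at h3
    have hδ0 : 0 ≤ δ := (by positivity : 0 ≤ m * σ).trans h2
    have h4 : 2 * (m * σ) ≤ |Real.sin (π * δ)| := by
      rcases le_total δ (1 / 2) with h | h
      · have := two_mul_abs_le_sin (x := δ) (by rw [abs_of_nonneg hδ0]; exact h)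
        rw [abs_of_nonneg hδ0] at this
        linarith
      · have hδ1 : δ ≤ 1 := by
          have : 0 ≤ m * (1 - σ) := mul_nonneg hm.le (by linarith)
          linarith
        have := two_mul_abs_le_sin (x := 1 - δ) (by rw [abs_of_nonneg (by linarith)]; linarith)
        rw [abs_of_nonneg (by linarith), show π * (1 - δ) = π - π * δ by ring,
          Real.sin_pi_sub] at this
        nlinarith
    have h5 := hch (χ s) δ
    rw [hδ, add_sub_cancel] at h5
    nlinarith
  rw [show 2 * c * m / π * (π * |σ|) = 2 * c * (m * |σ|) by field_simp]
  rcases le_total 0 σ with h | h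
  · rw [abs_of_nonneg h]
    exact key s σ h hσ.2
  · rw [abs_of_nonpos h]
    have := key (s + σ) (-σ) (by linarith) (by linarith [hσ.1])
    rwa [add_neg_cancel_right, norm_sub_rev] at this

/-- The velocity integral under reparametrisation by a circle map. -/
theorem cdeIntegral_comp {β : ℝ} {w w' : ℝ → Plane} {χ χ' y : ℝ → ℝ} (hw : ∀ u, HasDerivAt w (w' u) u)
    (hχ : ∀ s, HasDerivAt χ (χ' s) s) (hpos : ∀ s, 0 < χ' s) (hχ1 : ∀ s, χ (s + 1) = χ s + 1)
    (hy : ∀ s, y (χ s) * χ' s = 1) (s : ℝ)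
    (hi : IntervalIntegrable (cdeIntegrand β w (χ s)) volume 0 1)
    (hh : IntervalIntegrable (fun η => (y (χ s + η) / y (χ s) - 1) *
      (‖w (χ s + η) - w (χ s)‖ ^ β)⁻¹) volume 0 1) :
    IntervalIntegrable (cdeIntegrand β (fun s => w (χ s)) s) volume 0 1 ∧
    cdeIntegral β (fun s => w (χ s)) s = cdeIntegral β w (χ s) +
      (∫ η in (0 : ℝ)..1, (y (χ s + η) / y (χ s) - 1) * (‖w (χ s + η) - w (χ s)‖ ^ β)⁻¹) • w' (χ s) := by
  have hmono : StrictMono χ := strictMono_of_deriv_pos fun x => by rw [(hχ x).deriv]; exact hpos x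
  have hcont : Continuous χ := continuous_of_hasDerivAt hχ
  have hd : deriv w = w' := funext fun u => (hw u).deriv
  set f : ℝ → ℝ := fun σ => χ (s + σ) - χ s with hf
  have hfd : ∀ σ ∈ Ioc (0 : ℝ) 1, HasDerivWithinAt f (χ' (s + σ)) (Ioc 0 1) σ := fun σ _ =>
    (((hχ (s + σ)).comp_const_add s σ).sub_const _).hasDerivWithinAt
  have hfmono : StrictMono f := fun a b hab => by
    simp only [hf]
    linarith [hmono (show s + a < s + b by linarith)]
  have himg : f '' Ioc 0 1 = Ioc 0 1 := by
    have h0 : f 0 = 0 := by simp [hf]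
    have h1 : f 1 = 1 := by simp [hf, hχ1]
    refine Subset.antisymm ?_ ?_
    · rintro _ ⟨σ, hσ, rfl⟩
      exact ⟨h0 ▸ hfmono hσ.1, h1 ▸ hfmono.monotone hσ.2⟩
    · have := intermediate_value_Ioc (zero_le_one (α := ℝ)) (f := f)
        (by fun_prop : Continuous f).continuousOn
      rwa [h0, h1] at this
  set g : ℝ → Plane := fun η => cdeIntegrand β w (χ s) η -
    ((y (χ s + η) / y (χ s) - 1) * (‖w (χ s + η) - w (χ s)‖ ^ β)⁻¹) • w' (χ s) with hg
  have hdz : deriv (fun s => w (χ s)) = fun s => χ' s • w' (χ s) :=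
    funext fun s => ((hw (χ s)).scomp s (hχ s)).deriv
  have hgf : ∀ σ, |χ' (s + σ)| • g (f σ) = cdeIntegrand β (fun s => w (χ s)) s σ := by
    intro σ
    have e1 : χ s + f σ = χ (s + σ) := by simp [hf]
    have e2 : y (χ s) = (χ' s)⁻¹ := eq_inv_of_mul_eq_one_left (hy s)
    have e3 : y (χ (s + σ)) = (χ' (s + σ))⁻¹ := eq_inv_of_mul_eq_one_left (hy (s + σ))
    simp only [hg, cdeIntegrand, hdz, hd, e1, e2, e3, abs_of_pos (hpos (s + σ))]
    have h1 := (hpos s).ne'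
    have h2 := (hpos (s + σ)).ne'
    rw [div_inv_eq_mul]
    have h3 : χ' (s + σ) * ((((χ' (s + σ))⁻¹ * χ' s) - 1) * (‖w (χ (s + σ)) - w (χ s)‖ ^ β)⁻¹) =
        (‖w (χ (s + σ)) - w (χ s)‖ ^ β)⁻¹ * (χ' s - χ' (s + σ)) := by
      field_simp
    rw [smul_sub, smul_smul, smul_smul, h3]
    module
  have hgint : IntegrableOn g (Ioc 0 1) := by
    rw [intervalIntegrable_iff_integrableOn_Ioc_of_le zero_le_one] at hi hh
    exact hi.sub (hh.smul_const _)
  constructor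
  · rw [intervalIntegrable_iff_integrableOn_Ioc_of_le zero_le_one]
    have := (integrableOn_image_iff_integrableOn_abs_deriv_smul measurableSet_Ioc hfd
      hfmono.injective.injOn g).1 (by rwa [himg])
    simpa only [hgf] using this
  · have h1 := integral_image_eq_integral_abs_deriv_smul measurableSet_Ioc hfd
      hfmono.injective.injOn g
    rw [himg] at h1
    simp only [hgf] at h1
    rw [cdeIntegral, cdeIntegral, intervalIntegral.integral_of_le zero_le_one, ← h1,
      ← intervalIntegral.integral_of_le zero_le_one]
    simp only [hg]
    rw [intervalIntegral.integral_sub hi ⟨Integrable.smul_const hh.1 _, Integrable.smul_const hh.2 _⟩,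
      intervalIntegral.integral_smul_const]
    module

/-- A circle map with a holomorphic extension. -/
structure IsCircleMap (χ χ' : ℝ → ℝ) : Prop where
  hasDerivAt : ∀ s, HasDerivAt χ (χ' s) s
  deriv_pos : ∀ s, 0 < χ' s
  zero : χ 0 = 0
  add_one : ∀ s, χ (s + 1) = χ s + 1
  ext : ∃ ρ > 0, ∃ K, ∃ X : ℂ → ℂ, DifferentiableOn ℂ X (strip ρ) ∧ (∀ w ∈ strip ρ, X (w + 1) = X w + 1) ∧
    (∀ w ∈ strip ρ, |(X w).im| ≤ K * |w.im|) ∧ ∀ s : ℝ, X s = χ s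

/-- A change of the parameter to arclength, with its inverse `Y`. -/
structure IsArclength (v : ℝ → Plane) (L : ℝ) (χ χ' Y : ℝ → ℝ) : Prop extends IsCircleMap χ χ' where
  left_inv : ∀ s, Y (χ s) = s
  right_inv : ∀ u, χ (Y u) = u
  analytic : AnalyticOnNhd ℝ χ univ
  norm_deriv : ∀ s, ‖deriv v s‖ = L * χ' s
  lower : ∃ m > 0, (∀ s, ∀ σ ≥ 0, m * σ ≤ χ (s + σ) - χ s) ∧ ∀ u, ∀ η ≥ 0, m * η ≤ Y (u + η) - Y u

theorem analyticOnNhd_norm {f : ℝ → Plane} (hf : AnalyticOnNhd ℝ f univ) (h : ∀ s, f s ≠ 0) :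
    AnalyticOnNhd ℝ (fun s => ‖f s‖) univ := by
  have h1 : ∀ i, AnalyticOnNhd ℝ (fun s => f s i) univ := fun i =>
    (PiLp.proj (𝕜 := ℝ) 2 (fun _ : Fin 2 => ℝ) i).comp_analyticOnNhd hf
  have h2 : (fun s => ‖f s‖) = fun s => Real.exp ((1 / 2) * Real.log (f s 0 ^ 2 + f s 1 ^ 2)) := by
    ext s
    have h3 : f s 0 ^ 2 + f s 1 ^ 2 = ‖f s‖ ^ 2 := by rw [plane_norm_sq, Fin.sum_univ_two]
    rw [h3, Real.log_pow, ← mul_assoc]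
    norm_num
    rw [Real.exp_log (norm_pos_iff.2 (h s))]
  rw [h2]
  intro s _
  refine (analyticAt_const.mul (((h1 0 s (mem_univ s)).pow 2).add ((h1 1 s (mem_univ s)).pow 2)
    |>.log ?_)).rexp'
  have h3 : f s 0 ^ 2 + f s 1 ^ 2 = ‖f s‖ ^ 2 := by rw [plane_norm_sq, Fin.sum_univ_two]
  simp only [Pi.add_apply, Pi.pow_apply]
  rw [h3]
  have := norm_pos_iff.2 (h s)
  positivity

theorem le_sub_of_deriv_ge {f f' : ℝ → ℝ} (hf : ∀ s, HasDerivAt f (f' s) s) {m : ℝ} (hm : ∀ s, m ≤ f' s)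
    (s σ : ℝ) (hσ : σ ≥ 0) : m * σ ≤ f (s + σ) - f s := by
  have := mul_sub_le_image_sub_of_le_deriv (f := f) (C := m) (fun x => (hf x).differentiableAt)
    (fun x => by rw [(hf x).deriv]; exact hm x) (x := s) (y := s + σ) (by linarith)
  simpa using this

theorem exists_isArclength {v : ℝ → Plane} (hper : Function.Periodic v 1)
    (han : AnalyticOnNhd ℝ v univ) (hreg : ∀ s, deriv v s ≠ 0) :
    ∃ L χ χ' Y, IsArclength v L χ χ' Y := by
  have hdper : ∀ s, deriv v (s + 1) = deriv v s := fun s => by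
    rw [← deriv_comp_add_const]
    exact congrArg (deriv · s) (funext hper)
  have hqan := analyticOnNhd_norm han.deriv hreg
  set q : ℝ → ℝ := fun s => ‖deriv v s‖ with hq
  have hqper : Function.Periodic q 1 := fun s => by simp only [hq, hdper]
  have hqpos : ∀ s, 0 < q s := fun s => norm_pos_iff.2 (hreg s)
  have hqc : Continuous q := continuousOn_univ.1 hqan.continuousOn
  have hK := hqper.compact_of_continuous one_ne_zero hqc
  obtain ⟨a, ha, hqa⟩ : ∃ a > 0, ∀ s, a ≤ q s := by
    obtain ⟨_, ⟨x, rfl⟩, hx⟩ := hK.exists_isLeast (range_nonempty q)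
    exact ⟨q x, hqpos x, fun s => hx (mem_range_self s)⟩
  obtain ⟨b, hqb⟩ : ∃ b, ∀ s, q s ≤ b := by
    obtain ⟨b, -, hx⟩ := hK.exists_isGreatest (range_nonempty q)
    exact ⟨b, fun s => hx (mem_range_self s)⟩
  have hb : 0 < b := ha.trans_le ((hqa 0).trans (hqb 0))
  set L := ∫ s in (0 : ℝ)..1, q s with hL
  have hL0 : 0 < L := intervalIntegral.intervalIntegral_pos_of_pos (hqc.intervalIntegrable _ _) hqpos one_pos
  obtain ⟨ρ, hρ, F, hF, hFper, ⟨B, hFB⟩, hFq⟩ := exists_strip_extension (f := fun s => ((q s / L : ℝ) : ℂ))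
    (by
      have h1 : AnalyticOnNhd ℝ (fun s => q s / L) univ := hqan.div analyticOnNhd_const fun _ _ => hL0.ne'
      exact Complex.ofRealCLM.comp_analyticOnNhd h1)
    (fun s => by simp only [hqper s])
  obtain ⟨X, hX0, hX, -⟩ := exists_primitive_strip hF hFB
  have h0 : ∀ x : ℝ, (x : ℂ) ∈ strip ρ := fun x => by simp [strip, hρ]
  set χ : ℝ → ℝ := fun s => ∫ r in (0 : ℝ)..s, q r / L with hχ
  have hχd : ∀ s, HasDerivAt χ (q s / L) s := fun s =>
    (Continuous.integral_hasStrictDerivAt (by fun_prop) 0 s).hasDerivAt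
  have hXχ : ∀ s : ℝ, X s = χ s := by
    have h1 : ∀ s : ℝ, HasDerivAt (fun s : ℝ => X s - χ s) 0 s := fun s => by
      refine ((hX s (h0 s)).comp_ofReal.sub (hχd s).ofReal_comp).congr_deriv ?_
      rw [hFq, sub_self]
    intro s
    have h2 := is_const_of_deriv_eq_zero (fun s => (h1 s).differentiableAt) (fun s => (h1 s).deriv) s 0
    simpa [hX0, hχ, sub_eq_zero] using h2
  have hχ1 : ∀ s, χ (s + 1) = χ s + 1 := by
    intro s
    have h1 : χ (s + 1) - χ s = ∫ r in s..s + 1, q r / L :=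
      intervalIntegral.integral_interval_sub_left (Continuous.intervalIntegrable (by fun_prop) _ _)
        (Continuous.intervalIntegrable (by fun_prop) _ _)
    have h2 : Function.Periodic (fun r => q r / L) 1 := fun r => by simp only [hqper r]
    rw [h2.intervalIntegral_add_eq s 0, zero_add, intervalIntegral.integral_div, ← hL,
      div_self hL0.ne'] at h1
    linarith
  obtain ⟨Y, hY0, -, hYsurj, hYd⟩ := exists_clock (g := fun s => L / q s)
    (continuous_const.div hqc fun s => (hqpos s).ne') (fun s => div_pos hL0 (hqpos s)) (C := L / a)
    (fun s => div_le_div_of_nonneg_left hL0.le ha (hqa s))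
  have hχY : ∀ u, χ (Y u) = u := by
    have h1 : ∀ u, HasDerivAt (fun u => χ (Y u) - u) 0 u := fun u => by
      refine (((hχd (Y u)).comp u (hYd u)).sub (hasDerivAt_id u)).congr_deriv ?_
      have := (hqpos (Y u)).ne'
      have := hL0.ne'
      field_simp
      simp
    intro u
    have h2 := is_const_of_deriv_eq_zero (fun s => (h1 s).differentiableAt) (fun s => (h1 s).deriv) u 0
    simpa [hY0, hχ, sub_eq_zero] using h2
  have hYχ : ∀ s, Y (χ s) = s := fun s => by
    obtain ⟨u, rfl⟩ := hYsurj s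
    rw [hχY]
  have hadd : ∀ w, w ∈ strip ρ → w + 1 ∈ strip ρ := fun w hw => by simpa [strip] using hw
  have hXdiff : DifferentiableOn ℂ X (strip ρ) := fun w hw => (hX w hw).differentiableAt.differentiableWithinAt
  refine ⟨L, χ, fun s => q s / L, Y, ⟨hχd, fun s => div_pos (hqpos s) hL0, by simp [hχ], hχ1,
    ρ, hρ, B, X, hXdiff, ?_, fun w hw => ?_, hXχ⟩, hYχ, hχY, ?_, fun s => by field_simp; rfl,
    ⟨min (a / L) (L / b), by positivity, ?_, ?_⟩⟩
  · refine eqOn_of_eqOn_real (x := 0) (isOpen_strip ρ) (convex_strip ρ).isPreconnected (f := fun w => X (w + 1))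
      ?_ (hXdiff.add_const _) (h0 0) fun y _ => ?_
    · exact DifferentiableOn.comp (g := X) (f := fun w => w + 1) hXdiff (by fun_prop) fun w hw => hadd w hw
    · rw [← Complex.ofReal_one, ← Complex.ofReal_add, hXχ, hXχ, hχ1, Complex.ofReal_add]
  · have h1 := (convex_strip ρ).norm_image_sub_le_of_norm_hasDerivWithin_le (f := X) (C := B)
      (fun x hx => (hX x hx).hasDerivWithinAt) hFB (h0 w.re) hw
    rw [hXχ] at h1
    have h2 : w - w.re = w.im * Complex.I := by
      apply Complex.ext <;> simp
    rw [h2, norm_mul, Complex.norm_I, mul_one, Complex.norm_real, Real.norm_eq_abs] at h1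
    refine le_trans ?_ h1
    have h3 := Complex.abs_im_le_norm (X w - χ w.re)
    simpa using h3
  · intro s _
    have h1 : AnalyticAt ℂ X s := hXdiff.analyticAt ((isOpen_strip ρ).mem_nhds (h0 s))
    have h2 : AnalyticAt ℝ (fun s : ℝ => X s) s :=
      h1.restrictScalars.comp (Complex.ofRealCLM.analyticAt s)
    have h3 : χ = fun s : ℝ => (X s).re := funext fun s => by rw [hXχ, Complex.ofReal_re]
    rw [h3]
    exact (Complex.reCLM.analyticAt _).comp h2
  · exact le_sub_of_deriv_ge hχd fun s => (min_le_left _ _).trans (by gcongr; exact hqa s)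
  · exact le_sub_of_deriv_ge hYd fun s => (min_le_right _ _).trans (by gcongr; exacts [hqpos _, hqb _])

section

variable {β : ℝ} (hβ₁ : 1 < β) (hβ₂ : β < 2) {y y' : ℝ → ℝ}

include hβ₁ hβ₂ in
theorem integrableOn_weight (hy : ∀ u, HasDerivAt y (y' u) u)
    (hy' : Continuous y') {u : ℝ} (h0 : y u ≠ 0) :
    IntegrableOn (fun σ => (y (u + σ) / y u - 1) * |σ| ^ (-β)) 𝕁 := by
  have h1 := intervalIntegrable_kap_mul hβ₁ hβ₂ (g := fun σ => (y u : ℂ)⁻¹ * av (fun u => (y' u : ℂ)) u σ)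
    (by
      have h : Continuous fun σ => av (fun u => (y' u : ℂ)) u σ :=
        (continuous_av (f := fun u => (y' u : ℂ)) (by fun_prop)).comp
          (by fun_prop : Continuous fun σ : ℝ => (u, σ))
      exact (continuous_const.mul h).continuousOn)
  rw [intervalIntegrable_iff_integrableOn_Icc_of_le (by norm_num)] at h1
  refine h1.re.congr (Filter.Eventually.of_forall fun σ => ?_)
  have h2 := mul_av (f := fun u => (y u : ℂ)) (fun u => (hy u).ofReal_comp) (by fun_prop) u σ
  have h3 : (kap β σ * ((y u : ℂ)⁻¹ * av (fun u => (y' u : ℂ)) u σ)) =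
      (((y (u + σ) / y u - 1) * |σ| ^ (-β) : ℝ) : ℂ) := by
    have h4 : (y u : ℂ) ≠ 0 := by exact_mod_cast h0
    rw [kap]
    push_cast
    field_simp
    linear_combination ((|σ| ^ (-β) : ℝ) : ℂ) * h2
  simp only [h3]
  exact Complex.ofReal_re _

variable {L : ℝ} {c E : ℝ → ℂ} (hL : 0 < L) (hE : Continuous E)
  (hc : ∀ s, HasDerivAt c (L * E s) s)
  (hpos : ∀ s, ∀ σ ∈ 𝕁, 0 < dq E s σ)

include hL hE hc hpos in
theorem inv_norm_chord (s : ℝ) {σ : ℝ} (hσ : σ ∈ 𝕁) :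
    (‖c (s + σ) - c s‖ ^ β)⁻¹ = L ^ (-β) * (|σ| ^ (-β) * (dq E s σ * vq β E s σ)) := by
  have hp := hpos s σ hσ
  rw [norm_chord hL hE hc, dq_mul_vq hp, Real.mul_rpow (by positivity) (by positivity),
    Real.mul_rpow hL.le (abs_nonneg σ), ← Real.rpow_mul hp.le, Real.rpow_neg hp.le,
    Real.rpow_neg hL.le, Real.rpow_neg (abs_nonneg σ), show (1 / 2 * β : ℝ) = β / 2 by ring, mul_inv,
    mul_inv, mul_assoc]

include hβ₁ hβ₂ hL hE hc hpos in
theorem weight_chord (hy : ∀ u, HasDerivAt y (y' u) u) (hy' : Continuous y') (hy1 : Function.Periodic y 1)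
    (hper : Function.Periodic c 1) {u : ℝ} (h0 : y u ≠ 0) :
    IntervalIntegrable (fun η => (y (u + η) / y u - 1) * (‖c (u + η) - c u‖ ^ β)⁻¹) volume 0 1 ∧
    ∫ η in (0 : ℝ)..1, (y (u + η) / y u - 1) * (‖c (u + η) - c u‖ ^ β)⁻¹ =
      L ^ (-β) * ∫ σ in (-(1 / 2) : ℝ)..(1 / 2), (y (u + σ) / y u - 1) * |σ| ^ (-β) *
        (dq E u σ * vq β E u σ) := by
  have h1 : Function.Periodic (fun η => (y (u + η) / y u - 1) * (‖c (u + η) - c u‖ ^ β)⁻¹) 1 := fun η => by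
    simp only [← add_assoc, hy1 (u + η), hper (u + η)]
  have hh : (-(1 / 2) + 1 : ℝ) = 1 / 2 := by norm_num
  have hdq : Continuous fun σ => dq E u σ :=
    (continuous_dq hE).comp (by fun_prop : Continuous fun σ : ℝ => (u, σ))
  have hcont : ContinuousOn (fun σ => dq E u σ * vq β E u σ) 𝕁 :=
    hdq.continuousOn.mul (hdq.continuousOn.rpow_const fun σ hσ => Or.inl (hpos u σ hσ).ne')
  have heq : ∀ σ ∈ 𝕁, (y (u + σ) / y u - 1) * (‖c (u + σ) - c u‖ ^ β)⁻¹ =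
      L ^ (-β) * ((y (u + σ) / y u - 1) * |σ| ^ (-β) * (dq E u σ * vq β E u σ)) := fun σ hσ => by
    rw [inv_norm_chord hL hE hc hpos u hσ]
    ring
  have hint : IntervalIntegrable (fun η => (y (u + η) / y u - 1) * (‖c (u + η) - c u‖ ^ β)⁻¹) volume
      (-(1 / 2)) (-(1 / 2) + 1) := by
    rw [hh, intervalIntegrable_iff_integrableOn_Icc_of_le (by norm_num)]
    exact IntegrableOn.congr_fun (((integrableOn_weight hβ₁ hβ₂ hy hy' h0).mul_continuousOn hcont
      isCompact_Icc).const_mul (L ^ (-β))) (fun σ hσ => (heq σ hσ).symm) measurableSet_Icc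
  refine ⟨h1.intervalIntegrable one_ne_zero hint 0 1, ?_⟩
  have h2 := h1.intervalIntegral_add_eq 0 (-(1 / 2))
  rw [zero_add, hh] at h2
  rw [h2, ← intervalIntegral.integral_const_mul]
  refine intervalIntegral.integral_congr fun σ hσ => ?_
  rw [uIcc_of_le (by norm_num)] at hσ
  exact heq σ hσ

end

theorem HoloCurve.comp {v : ℝ → Plane} {ρ B c c' ρ' K : ℝ} {χ : ℝ → ℝ} {X : ℂ → ℂ}
    (h : HoloCurve ρ B c v) (hX : DifferentiableOn ℂ X (strip ρ'))
    (hX1 : ∀ w ∈ strip ρ', X (w + 1) = X w + 1) (hXK : ∀ w ∈ strip ρ', |(X w).im| ≤ K * |w.im|)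
    (hXχ : ∀ s : ℝ, X s = χ s) (hch : ∀ s σ, c' * |Real.sin (π * σ)| ≤
      ‖v (χ (s + σ)) - v (χ s)‖) :
    HoloCurve (min ρ' (ρ / (|K| + 1))) B c' fun s => v (χ s) := by
  obtain ⟨F, hF, hFper, hFB, hFv⟩ := h.ext
  have hsub : strip (min ρ' (ρ / (|K| + 1))) ⊆ strip ρ' := strip_mono (min_le_left _ _)
  have hmaps : MapsTo X (strip (min ρ' (ρ / (|K| + 1)))) (strip ρ) := fun w hw => by
    have h1 : |w.im| < ρ / (|K| + 1) := lt_of_lt_of_le hw (min_le_right _ _)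
    rw [lt_div_iff₀ (by positivity)] at h1
    refine lt_of_le_of_lt (hXK w (hsub hw)) ?_
    nlinarith [le_abs_self K, abs_nonneg w.im]
  refine ⟨⟨fun i w => F i (X w), fun i => ?_, fun i w hw => ?_, fun i w hw => hFB i _ (hmaps hw),
    fun i s => by simp only [hXχ, hFv]⟩, hch⟩
  · exact DifferentiableOn.comp (g := F i) (f := X) (hF i) (hX.mono hsub) hmaps
  · simp only [hX1 w (hsub hw), hFper i _ (hmaps hw)]

/-- A circle map `χ` which turns `v` into a curve `w` of constant speed; `y` is the derivative of
the inverse of `χ`. -/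
structure IsReparam (v w : ℝ → Plane) (L c : ℝ) (χ χ' y y' : ℝ → ℝ) : Prop
    extends IsCircleMap χ χ' where
  mul_eq_one : ∀ s, y (χ s) * χ' s = 1
  ne_zero : ∀ u, y u ≠ 0
  hasDerivAt_y : ∀ u, HasDerivAt y (y' u) u
  continuous_y' : Continuous y'
  periodic_y : Function.Periodic y 1
  periodic : Function.Periodic w 1
  analytic : AnalyticOnNhd ℝ w univ
  norm_deriv : ∀ u, ‖deriv w u‖ = L
  comp_eq : ∀ s, w (χ s) = v s
  c_pos : 0 < c
  chord : ∀ u η, c * |Real.sin (π * η)| ≤ ‖w (u + η) - w u‖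
  lower : ∃ m > 0, ∀ s, ∀ σ ≥ 0, m * σ ≤ χ (s + σ) - χ s

theorem exists_isReparam {v : ℝ → Plane} (hper : Function.Periodic v 1)
    (han : AnalyticOnNhd ℝ v univ) {c : ℝ} (hc : 0 < c)
    (hch : ∀ s σ, c * |Real.sin (π * σ)| ≤ ‖v (s + σ) - v s‖) :
    ∃ w L c χ χ' y y', IsReparam v w L c χ χ' y y' := by
  have hreg : ∀ s, deriv v s ≠ 0 := by
    intro s h0
    have h1 : HasDerivAt v 0 s := h0 ▸ (han s (mem_univ s)).differentiableAt.hasDerivAt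
    have hc2 : 0 < c * 2 / 2 := by positivity
    have h2 := (hasDerivAt_iff_isLittleO_nhds_zero.1 h1).def hc2
    have h3 : ∀ᶠ σ : ℝ in nhds 0, |σ| < 1 / 2 := by
      have : Filter.Tendsto (fun σ : ℝ => |σ|) (nhds 0) (nhds |0|) := continuous_abs.tendsto 0
      rw [abs_zero] at this
      exact this.eventually (gt_mem_nhds (by norm_num))
    obtain ⟨σ, ⟨hσ1, hσ2⟩, hσ0⟩ := (((h2.and h3).filter_mono nhdsWithin_le_nhds).and
      (self_mem_nhdsWithin : ({0}ᶜ : Set ℝ) ∈ nhdsWithin 0 {0}ᶜ)).exists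
    have h4 := hch s σ
    have h5 := two_mul_abs_le_sin hσ2.le
    have h6 := abs_pos.2 hσ0
    rw [smul_zero, sub_zero, Real.norm_eq_abs] at hσ1
    nlinarith
  obtain ⟨L, χ, χ', Y, hA⟩ := exists_isArclength hper han hreg
  obtain ⟨mm, hm, hmχ, hmY⟩ := hA.lower
  have hY1 : ∀ u, Y (u + 1) = Y u + 1 := fun u => by
    have := hA.add_one (Y u)
    rw [hA.right_inv] at this
    rw [← this, hA.left_inv]
  have hχd : ∀ s, deriv χ s = χ' s := fun s => (hA.hasDerivAt s).deriv
  have hYan : AnalyticOnNhd ℝ Y univ := fun u _ => by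
    have h1 := (analyticAt_comp_iff_of_deriv_ne_zero (g := Y) (hA.analytic (Y u) (mem_univ _))
      (by rw [hχd]; exact (hA.deriv_pos _).ne')).1 (by
        rw [show Y ∘ χ = id from funext hA.left_inv]; exact analyticAt_id)
    rwa [hA.right_inv] at h1
  have hYd : ∀ u, HasDerivAt Y (deriv Y u) u := fun u => (hYan u (mem_univ u)).differentiableAt.hasDerivAt
  set y := deriv Y with hy
  have hyd : ∀ u, HasDerivAt y (deriv y u) u := fun u =>
    (hYan.deriv u (mem_univ u)).differentiableAt.hasDerivAt
  have hyc : Continuous (deriv y) := continuousOn_univ.1 hYan.deriv.deriv.continuousOn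
  have hyper : Function.Periodic y 1 := fun u => by
    rw [hy, ← deriv_comp_add_const, show (fun x => Y (x + 1)) = fun x => Y x + 1 from funext hY1]
    simp
  have hyχ : ∀ s, y (χ s) * χ' s = 1 := fun s => by
    have h1 := (hYd (χ s)).comp s (hA.hasDerivAt s)
    rw [show Y ∘ χ = id from funext hA.left_inv] at h1
    exact h1.unique (hasDerivAt_id s)
  have hyY : ∀ u, y u * χ' (Y u) = 1 := fun u => by
    have := hyχ (Y u)
    rwa [hA.right_inv] at this
  have hy0 : ∀ u, y u ≠ 0 := fun u h => by
    have := hyY u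
    rw [h, zero_mul] at this
    exact zero_ne_one this
  have hypos : ∀ u, 0 < y u := fun u => by
    have h1 := hyY u
    have h2 := hA.deriv_pos (Y u)
    by_contra hcon
    nlinarith
  have hw0an : AnalyticOnNhd ℝ (fun u => v (Y u)) univ := fun u _ =>
    (han (Y u) (mem_univ _)).comp (hYan u (mem_univ u))
  have hw0L : ∀ u, ‖deriv (fun u => v (Y u)) u‖ = L := fun u => by
    have h1 : HasDerivAt v (deriv v (Y u)) (Y u) := (han (Y u) (mem_univ _)).differentiableAt.hasDerivAt
    have h2 : HasDerivAt (fun u => v (Y u)) (y u • deriv v (Y u)) u := h1.scomp u (hYd u)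
    rw [h2.deriv, norm_smul, hA.norm_deriv, Real.norm_eq_abs, abs_of_pos (hypos u)]
    linear_combination L * hyY u
  exact ⟨fun u => v (Y u), L, 2 * c * mm / π, χ, χ', y, deriv y, hA.toIsCircleMap, hyχ, hy0, hyd, hyc, hyper, fun u => by simp only [hY1, hper (Y u)], hw0an,
    hw0L, fun s => by simp only [hA.left_inv], by positivity,
    fun s σ => chord_comp hper hc hch hm hmY hY1 s σ, ⟨mm, hm, hmχ⟩⟩

/-- Existence for curves with arbitrary parametrisation. -/
theorem exists_solution {β : ℝ} (hβ₁ : 1 < β) (hβ₂ : β < 2) (l : ℕ) {v : ℝ → Plane}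
    (hper : Function.Periodic v 1) (han : AnalyticOnNhd ℝ v univ) {c : ℝ} (hc : 0 < c)
    (hch : ∀ s σ, c * |Real.sin (π * σ)| ≤ ‖v (s + σ) - v s‖) :
    ∃ T ρ₀ κ : ℝ, 0 < T ∧ 0 < κ ∧ κ * T < ρ₀ ∧ ∃ (z : ℝ → ℝ → Plane) (lam : ℝ → ℝ → ℝ),
      InY l ρ₀ κ T z ∧ IsCDESolution β T z lam ∧ z 0 = v := by
  obtain ⟨w, L, c₀, χ, χ', y, y', hA⟩ := exists_isReparam hper han hc hch
  obtain ⟨mm, hm, hmχ⟩ := hA.lower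
  obtain ⟨ρX, hρX, K, X, hX, hX1, hXK, hXχ⟩ := hA.ext
  obtain ⟨hL0, z₀, E₀, hzv, hE, hEper, hu, hpos, hz, hzper⟩ := exists_unit_tangent
    hA.periodic hA.analytic hA.c_pos hA.chord hA.norm_deriv
  obtain ⟨T, hT, z, L, m, E, k, k', lam, hF, hz0, ρ, hρ, c₁, hc₁, B, hb⟩ :=
    Wien.exists_isFlow hβ₁ hβ₂ (n := fun σ => (y (0 + σ) / y 0 - 1) * |σ| ^ (-β))
      (integrableOn_weight hβ₁ hβ₂ hA.hasDerivAt_y hA.continuous_y' (hA.ne_zero 0)) hE hEper hu hpos hL0 hz hzper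
  have hEc := fun t => continuous_of_hasDerivAt (hF.state t).hasDerivAt
  obtain ⟨B', c', hc', hhol⟩ : ∃ B', ∃ c' > 0, ∀ t ∈ Icc 0 T,
      HoloCurve ρ B' c' fun s => toPlane (z t s) :=
    ⟨_, c₁ * c₁ ^ (1 / 2 : ℝ) / π,
      div_pos (mul_pos hc₁ (Real.rpow_pos_of_pos hc₁ _)) Real.pi_pos, fun t ht =>
      (hb t ht).1.holoCurve hρ hc₁ (hb t ht).2.1 (hb t ht).2.2.1 (hb t ht).2.2.2
        (hF.hasDerivAt t ht) (hEc t) (hF.periodic t)⟩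
  have hhol' : ∀ t ∈ Icc 0 T, HoloCurve (min ρX (ρ / (|K| + 1))) B' (2 * c' * mm / π)
      fun s => toPlane (z t (χ s)) := fun t ht =>
    HoloCurve.comp (v := fun s => toPlane (z t s)) (hhol t ht) hX hX1 hXK hXχ
      (chord_comp (v := fun s => toPlane (z t s)) (fun s => congrArg toPlane (hF.periodic t s)) hc'
        (hhol t ht).chord hm hmχ hA.add_one)
  obtain ⟨ρ₀, κ, hκ, hκT, hY⟩ := inY_of_holoCurve l (lt_min hρX (by positivity))
    (div_pos (mul_pos (mul_pos two_pos hc') hm) Real.pi_pos) hT hhol'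
  have hwc := fun t (ht : t ∈ Icc 0 T) u => weight_chord hβ₁ hβ₂ (hF.pos t) (hEc t) (hF.hasDerivAt t ht)
    (hF.state t).dq_pos hA.hasDerivAt_y hA.continuous_y' hA.periodic_y (hF.periodic t) (hA.ne_zero u)
  have hnorm : ∀ t a b, ‖toPlane (z t a) - toPlane (z t b)‖ = ‖z t a - z t b‖ := fun t a b => by
    rw [← map_sub, LinearIsometryEquiv.norm_map]
  have hcomp := fun t (ht : t ∈ Icc 0 T) s => cdeIntegral_comp (β := β) (w := fun u => toPlane (z t u))
    (fun u => hasDerivAt_toPlane (hF.hasDerivAt t ht u)) hA.hasDerivAt hA.deriv_pos hA.add_one hA.mul_eq_one s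
    (intervalIntegrable_cdeIntegrand hβ₁ hβ₂ (hF.pos t) (hF.state t).hasDerivAt
      (hF.state t).continuous_E' (hF.hasDerivAt t ht) (hF.periodic t) (hF.state t).dq_pos _ 0 1)
    (by simp only [hnorm]; exact (hwc t ht (χ s)).1)
  simp only [hnorm] at hcomp
  set h : ℝ → ℝ → ℝ := fun t u => ∫ η in (0 : ℝ)..1, (y (u + η) / y u - 1) *
    (‖z t (u + η) - z t u‖ ^ β)⁻¹ with hh
  have hhper : ∀ t, Function.Periodic (h t) 1 := fun t u => by
    simp only [hh, add_right_comm u 1, hF.periodic t _, hA.periodic_y _]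
  refine ⟨T, ρ₀, κ, hT, hκ, hκT, fun t s => toPlane (z t (χ s)),
    fun t s => y (χ s) * (L t ^ (-β) * lam t (χ s) - h t (χ s)), hY,
    ⟨fun t ht s => ?_, fun t ht s => ?_, fun t ht => ?_, fun t ht s => (hcomp t ht s).1,
      fun t ht s => ?_⟩, funext fun s => ?_⟩
  · simp only [hA.add_one, hF.periodic t (χ s)]
  · simp only [hA.add_one, hA.periodic_y (χ s), hF.periodic_lam t (χ s), hhper t (χ s)]
  · simp only [hA.zero, hh]
    rw [(hwc t ht 0).2, hF.lam_zero t, sub_self, mul_zero]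
  · refine (hF.hasDerivAt_toPlane hβ₁ hβ₂ ht (χ s)).hasDerivWithinAt.congr_deriv ?_
    have h1 := hasDerivAt_toPlane (hF.hasDerivAt t ht (χ s))
    have h2 : HasDerivAt (fun s => toPlane (z t (χ s))) (χ' s • toPlane (L t * E t (χ s))) s :=
      h1.scomp s (hA.hasDerivAt s)
    rw [(hcomp t ht s).2, h1.deriv, h2.deriv, smul_smul, add_assoc, ← add_smul]
    congr 2
    simp only [hh]
    linear_combination -(L t ^ (-β) * lam t (χ s) - h t (χ s)) * hA.mul_eq_one s
  · simp only [hz0, hzv, hA.comp_eq]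

/-- The first component of the norm in `X` controls the Fourier coefficients of the curve. -/
theorem InX.norm_coef_le {l : ℕ} {ρ : ℝ} {M : ℝ≥0} {v : ℝ → Plane} (hρ : 0 < ρ) (h : InX l ρ M v)
    (k : ℤ) : ‖∫ s in (0 : ℝ)..1, toPlane.symm (v s) *
      Complex.exp (-(2 * π * Complex.I * k * s))‖ ≤
      2 * M * Real.exp (-(π * ρ * |(k : ℝ)|)) := by
  obtain ⟨f, g, h, G, hf, -, -, -, hfv, -, -, -, hM⟩ := h
  have hcomp : ∀ i, DifferentiableOn ℂ (fun w => f w i) (strip ρ) := fun i =>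
    ((EuclideanSpace.proj (𝕜 := ℂ) i).differentiable.comp_differentiableOn hf.holo)
  have hF : ∀ s : ℝ, f s 0 + Complex.I * f s 1 = toPlane.symm (v s) := fun s => by
    rw [hfv, hfv]
    obtain ⟨z, hz⟩ := toPlane.surjective (v s)
    rw [← hz, LinearIsometryEquiv.symm_apply_apply, toPlane_zero_apply, toPlane_one_apply, mul_comm,
      Complex.re_add_im]
  have hbound : ∀ t : ℝ, |t| < ρ →
      ∫ s in (0 : ℝ)..1, ‖f (s + t * Complex.I) 0 + Complex.I * f (s + t * Complex.I) 1‖ ≤ 2 * M := by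
    intro t ht
    have hmem : ∀ s : ℝ, (s + t * Complex.I : ℂ) ∈ strip ρ := fun s => by simpa [strip] using ht
    have hfc : Continuous fun s : ℝ => f (s + t * Complex.I) :=
      hf.holo.continuousOn.comp_continuous (by fun_prop) hmem
    have hci : ∀ i, Continuous fun s : ℝ => f (s + t * Complex.I) i := fun i =>
      (hcomp i).continuousOn.comp_continuous (f := fun s : ℝ => (s + t * Complex.I : ℂ))
        (by fun_prop) hmem
    have h1 : eLpNorm (fun s : ℝ => f (s + t * Complex.I)) 1 (volume.restrict (Ioc (0 : ℝ) 1)) ≤ M := by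
      have hp : IsProbabilityMeasure (volume.restrict (Ioc (0 : ℝ) 1)) := ⟨by simp⟩
      refine (eLpNorm_le_eLpNorm_of_exponent_le (q := 2) (by norm_num)
        hfc.aestronglyMeasurable).trans ?_
      have h2 : kNorm l ρ f ≤ M := le_trans (by rw [add_assoc, add_assoc]; exact le_self_add) hM
      refine le_trans ?_ h2
      have h3 := Finset.single_le_sum (f := fun a => ⨆ y : ℝ, ⨆ _ : |y| < ρ,
        eLpNorm (fun x : ℝ => iteratedDeriv a f ((x : ℂ) + (y : ℂ) * Complex.I)) 2
          (volume.restrict (Ioc (0 : ℝ) 1))) (s := Finset.range (l + 1)) (fun _ _ => zero_le)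
        (Finset.mem_range.2 (Nat.succ_pos l))
      refine le_trans ?_ h3
      simp only [iteratedDeriv_zero]
      exact le_iSup₂ (f := fun (y : ℝ) (_ : |y| < ρ) => eLpNorm (fun x : ℝ =>
        f ((x : ℂ) + (y : ℂ) * Complex.I)) 2 (volume.restrict (Ioc (0 : ℝ) 1))) t ht
    have h4 : ∫ s in Ioc (0 : ℝ) 1, ‖f (s + t * Complex.I)‖ ≤ M := by
      rw [integral_norm_eq_lintegral_enorm hfc.aestronglyMeasurable, ← eLpNorm_one_eq_lintegral_enorm]
      exact ENNReal.toReal_le_coe_of_le_coe h1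
    rw [intervalIntegral.integral_of_le zero_le_one]
    calc _ ≤ ∫ s in Ioc (0 : ℝ) 1, 2 * ‖f (s + t * Complex.I)‖ := by
          refine integral_mono (Continuous.integrableOn_Ioc ?_) (Continuous.integrableOn_Ioc ?_) fun s => ?_
          · exact ((hci 0).add (continuous_const.mul (hci 1))).norm
          · exact continuous_const.mul hfc.norm
          · refine (norm_add_le _ _).trans ?_
            rw [norm_mul, Complex.norm_I, one_mul]
            have h5 := PiLp.norm_apply_le (f (s + t * Complex.I)) 0
            have h6 := PiLp.norm_apply_le (f (s + t * Complex.I)) 1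
            linarith
      _ ≤ _ := by
        rw [integral_const_mul]
        linarith
  have h8 := _root_.norm_coef_le (f := fun w => f w 0 + Complex.I * f w 1) (y := ρ / 2)
    ((hcomp 0).add ((hcomp 1).const_mul _)) (fun w hw => by simp only [hf.periodic w hw])
    (by rw [abs_of_pos (by positivity)]; linarith) (fun t ht => hbound t (by
      rw [ht, abs_of_pos (by positivity)]; linarith)) k
  simp only [hF] at h8
  refine h8.trans (le_of_eq ?_)
  rw [abs_of_pos (by positivity : 0 < ρ / 2)]
  congr 3
  ring

theorem InX.deriv_ne_zero {l : ℕ} {ρ : ℝ} {M : ℝ≥0} {v : ℝ → Plane} (h : InX l ρ M v) (s : ℝ) :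
    deriv v s ≠ 0 := by
  obtain ⟨f, g, h, G, -, -, -, -, -, -, -, hG, -⟩ := h
  have h1 := (hG s 0).1
  rw [arcChordFn, if_pos ⟨0, by simp⟩] at h1
  intro h2
  simp [h2] at h1

namespace Wien

section

variable {K : Type} [TopologicalSpace K] [CompactSpace K] [FirstCountableTopology K]
  {ω ω' : C(K, ℝ≥0)}

/-- A Fourier multiplier of order one, with passage to a smaller weight. -/
def mulGap (m : ℤ → ℂ) (hm : ∀ k, ‖m k‖ ≤ 1 + 2 * π * |(k : ℝ)|) (a : ℝ) (ha : 0 < a)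
    (h : ∀ x, ω' x + a ≤ ω x) : Wien K ω →L[ℂ] Wien K ω' :=
  (mulData (.id K) (fun k => .const K (m k)) (1 + 2 * π * (1 / a)) (by
    have := Real.pi_pos
    positivity) fun k x => by
    have hpi := Real.pi_pos
    have h1 := h x
    have h2 : Real.exp ((ω' x - ω x) * |(k : ℝ)|) ≤ Real.exp (-(a * |(k : ℝ)|)) := by
      rw [Real.exp_le_exp]
      have := mul_le_mul_of_nonneg_right h1 (abs_nonneg (k : ℝ))
      linarith
    have h3 : Real.exp (-(a * |(k : ℝ)|)) ≤ 1 := by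
      rw [Real.exp_le_one_iff]
      have : 0 ≤ a * |(k : ℝ)| := by positivity
      linarith
    have h4 := mul_exp_le (x := |(k : ℝ)|) ha
    calc _ ≤ (1 + 2 * π * |(k : ℝ)|) * Real.exp (-(a * |(k : ℝ)|)) := by
          exact mul_le_mul (hm k) h2 (Real.exp_pos _).le (by positivity)
      _ = Real.exp (-(a * |(k : ℝ)|)) + 2 * π * (|(k : ℝ)| * Real.exp (-(a * |(k : ℝ)|))) := by
        ring
      _ ≤ _ := by gcongr).op

theorem co_mulGap (m : ℤ → ℂ) (hm : ∀ k, ‖m k‖ ≤ 1 + 2 * π * |(k : ℝ)|) (a : ℝ) (ha : 0 < a)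
    (h : ∀ x, ω' x + a ≤ ω x) (f : Wien K ω) (k : ℤ) (x : K) :
    co (mulGap m hm a ha h f) k x = m k * co f k x := by
  rw [mulGap, co_mulData]
  rfl

/-- Differentiation, with passage to a smaller weight. -/
def der (a : ℝ) (ha : 0 < a) (h : ∀ x, ω' x + a ≤ ω x) : Wien K ω →L[ℂ] Wien K ω' :=
  mulGap (fun k => 2 * π * Complex.I * k) (fun k => by
    simp [abs_of_pos Real.pi_pos]) a ha h

theorem hasDerivAt_der (a : ℝ) (ha : 0 < a) (h : ∀ x, ω' x + a ≤ ω x) (f : Wien K ω) (x : K) (s : ℝ) :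
    HasDerivAt (fun s : ℝ => ev f x s) (ev (der a ha h f) x s) s :=
  hasDerivAt_ev' (fun k => co_mulGap _ _ a ha h f k x) s

/-- A uniformly analytic family of curves, as an element of a Wiener algebra. -/
theorem exists_of_family {T b B : ℝ} (hb : 0 < b) {c : ℝ → ℝ → ℂ}
    (hc : ∀ t ∈ Icc 0 T, Continuous (c t)) (hper : ∀ t ∈ Icc 0 T, Function.Periodic (c t) 1)
    (hct : ∀ s, ContinuousOn (fun t => c t s) (Icc 0 T))
    (h : ∀ t ∈ Icc 0 T, ∀ k : ℤ, ‖∫ s in (0 : ℝ)..1, c t s *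
      Complex.exp (-(2 * π * Complex.I * k * s))‖ ≤ B * Real.exp (-(b * |(k : ℝ)|)))
    {ω : C(Icc (0 : ℝ) T, ℝ≥0)} (hω : ∀ t, (ω t : ℝ) ≤ b / 2) :
    ∃ f : Wien (Icc (0 : ℝ) T) ω, ∀ (t : Icc (0 : ℝ) T) (s : ℝ), ev f t s = c t s := by
  have hsum : Summable fun k : ℤ => B * Real.exp (-(b * |(k : ℝ)|)) :=
    (summable_exp_neg_abs hb).mul_left B
  have hbd : ∀ t ∈ Icc 0 T, ∀ s, ‖c t s‖ ≤ ∑' k : ℤ, B * Real.exp (-(b * |(k : ℝ)|)) := by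
    intro t ht s
    have h1 := hasSum_fourier (hc t ht) (hper t ht)
      (Summable.of_nonneg_of_le (fun _ => norm_nonneg _) (h t ht) hsum) s
    refine (h1.norm_le_of_bounded hsum.hasSum fun k => ?_)
    rw [norm_mul, Complex.norm_exp]
    have : (2 * π * Complex.I * k * s : ℂ).re = 0 := by simp
    rw [this, Real.exp_zero, mul_one]
    exact h t ht k
  refine (exists_of_coef (ω := ω) (F := fun t s => c t s) (a := b / 2) (b := b)
    (c := fun k => |B| * Real.exp (-(b * |(k : ℝ)|))) (fun t => hc t t.2) (fun k => ?_)
    (fun t => hper t t.2) (by linarith) hω (fun k => by positivity) ⟨|B|, fun k => le_rfl⟩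
    fun k t => (h t t.2 k).trans (by gcongr; exact le_abs_self B)).imp fun g hg => hg.1
  simp_rw [intervalIntegral.integral_of_le zero_le_one]
  refine continuous_of_dominated (bound := fun _ => ∑' k : ℤ, B * Real.exp (-(b * |(k : ℝ)|)))
    (fun t => ?_) (fun t => ae_of_all _ fun s => ?_) (integrable_const _) (ae_of_all _ fun s => ?_)
  · have := hc t t.2
    exact Continuous.aestronglyMeasurable (by fun_prop)
  · rw [norm_mul, Complex.norm_exp]
    have : (-(2 * π * Complex.I * k * s) : ℂ).re = 0 := by simp
    rw [this, Real.exp_zero, mul_one]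
    exact hbd t t.2 s
  · exact (continuousOn_iff_continuous_domRestrict.1 (hct s)).mul continuous_const

end

/-- Restriction to a short time interval is close to restriction to the initial time. -/
theorem exists_norm_restr_sub_lt {K : Type} [PseudoMetricSpace K] [CompactSpace K] {a : ℝ≥0}
    {ω' : C(unitInterval, ℝ≥0)} (hω : ∀ r, ω' r ≤ a) (f : Wien K (.const K a)) (x₀ : K) {ε : ℝ}
    (hε : 0 < ε) : ∃ δ > 0, ∀ q : C(unitInterval, K), (∀ r, dist (q r) x₀ < δ) →
      ‖restr q hω f - restr (.const _ x₀) hω f‖ < ε := by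
  let N : C(unitInterval, K) → ℝ := fun q => ∑' k, ‖(cf f k).comp q - (cf f k).comp (.const _ x₀)‖
  have hbd : ∀ k (q : C(unitInterval, K)), ‖(cf f k).comp q‖ ≤ ‖cf f k‖ := fun k q =>
    (ContinuousMap.norm_le _ (norm_nonneg _)).2 fun r => (cf f k).norm_coe_le_norm _
  have hsummable : Summable fun k => ‖cf f k‖ + ‖cf f k‖ := f.summable_cf.add f.summable_cf
  have hbd2 : ∀ k (q : C(unitInterval, K)),
      ‖(cf f k).comp q - (cf f k).comp (.const _ x₀)‖ ≤ ‖cf f k‖ + ‖cf f k‖ := fun k q =>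
    (norm_sub_le _ _).trans (add_le_add (hbd k q) (hbd k _))
  have hN : Continuous N := continuous_tsum
    (fun k => (((ContinuousMap.continuous_postcomp (cf f k))).sub continuous_const).norm)
    hsummable fun k q => by rw [norm_norm]; exact hbd2 k q
  have hN0 : N (.const _ x₀) = 0 := by simp [N]
  obtain ⟨δ, hδ, hδN⟩ := Metric.continuousAt_iff.1 (hN.continuousAt (x := .const _ x₀)) ε hε
  refine ⟨δ, hδ, fun q hq => ?_⟩
  have h1 := hδN (x := q) ((ContinuousMap.dist_lt_iff hδ).2 fun r => hq r)
  rw [hN0, Real.dist_eq, sub_zero] at h1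
  refine lt_of_le_of_lt ?_ ((le_abs_self _).trans_lt h1)
  rw [norm_eq]
  refine (Summable.tsum_le_tsum (fun k => ?_) (Wien.summable_cf _)
    (Summable.of_nonneg_of_le (fun _ => norm_nonneg _) (fun k => hbd2 k q) hsummable))
  refine (ContinuousMap.norm_le _ (norm_nonneg _)).2 fun r => ?_
  have h2 : ∀ (p : C(unitInterval, K)), cf (restr p hω f) k r =
      cf f k (p r) * (Real.exp ((ω' r - a) * |(k : ℝ)|) : ℝ) := by
    intro p
    refine (OpData.cf_op _ f k r).trans ?_
    simp [shiftData, OpData.wker, mul_comm]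
  rw [cf_sub, ContinuousMap.sub_apply, h2, h2, ← sub_mul, norm_mul, Complex.norm_real,
    Real.norm_eq_abs, Real.abs_exp]
  refine (mul_le_of_le_one_right (norm_nonneg _) ?_).trans
    (((cf f k).comp q - (cf f k).comp (.const _ x₀)).norm_coe_le_norm r)
  rw [Real.exp_le_one_iff]
  exact mul_nonpos_of_nonpos_of_nonneg (sub_nonpos.2 (by exact_mod_cast hω r)) (abs_nonneg _)

end Wien

/-- Uniqueness for a linear scalar equation in integrated form. -/
theorem eq_mul_exp_of_integral {y a : ℝ → ℂ} (hy : Continuous y) (ha : Continuous a)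
    (h : ∀ r ∈ Icc (0 : ℝ) 1, y r = y 0 + ∫ r' in (0 : ℝ)..r, a r' * y r') {r : ℝ}
    (hr : r ∈ Icc (0 : ℝ) 1) : y r = y 0 * Complex.exp (∫ r' in (0 : ℝ)..r, a r') := by
  have hA : ∀ r, HasDerivAt (fun r => ∫ r' in (0 : ℝ)..r, a r') (a r) r := fun r =>
    (ha.integral_hasStrictDerivAt 0 r).hasDerivAt
  have hu : ∀ r, HasDerivAt (fun r => y 0 + ∫ r' in (0 : ℝ)..r, a r' * y r') (a r * y r) r := fun r =>
    (((ha.mul hy).integral_hasStrictDerivAt 0 r).hasDerivAt).const_add _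
  have hv := fun r => (hu r).mul (hA r).neg.cexp
  have h1 := constant_of_has_deriv_right_zero (a := 0) (b := 1)
    (continuous_of_hasDerivAt hv).continuousOn (fun x hx => by
      refine ((hv x).congr_deriv ?_).hasDerivWithinAt
      rw [← h x ⟨hx.1, hx.2.le⟩]
      ring) r hr
  simp only [Pi.mul_apply, Pi.neg_apply, intervalIntegral.integral_same, add_zero, neg_zero,
    Complex.exp_zero, mul_one, ← h r hr] at h1
  rw [← h1, mul_assoc, ← Complex.exp_add, neg_add_cancel, Complex.exp_zero, mul_one]

/-- Variation of constants: uniqueness. -/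
theorem eq_duhamel {a : ℝ} {F u : ℝ → ℂ} (hF : Continuous F) (hu : Continuous u)
    (h : ∀ r ∈ Icc (0 : ℝ) 1, u r = ∫ r' in (0 : ℝ)..r, (Complex.I * a * u r' + F r')) {r : ℝ}
    (hr : r ∈ Icc (0 : ℝ) 1) :
    u r = ∫ r' in (0 : ℝ)..r, Complex.exp (Complex.I * (a * (r - r') : ℝ)) * F r' := by
  obtain ⟨w, hw⟩ : ∃ w : ℝ → ℂ, ∀ r, w r =
      ∫ r' in (0 : ℝ)..r, Complex.exp (Complex.I * (a * (r - r') : ℝ)) * F r' := ⟨_, fun _ => rfl⟩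
  have hd := fun r => Wien.volterra_scalar hF hw r
  have hwc := continuous_of_hasDerivAt hd
  have h0 : ∀ r, w r = ∫ r' in (0 : ℝ)..r, (Complex.I * a * w r' + F r') := fun r => by
    have := intervalIntegral.integral_eq_sub_of_hasDerivAt (a := 0) (b := r) (fun x _ => hd x)
      (Continuous.intervalIntegrable (by fun_prop) _ _)
    rw [this, hw 0, intervalIntegral.integral_same, sub_zero]
  have h1 := eq_mul_exp_of_integral (y := fun r => u r - w r) (a := fun _ => Complex.I * a)
    (by fun_prop) (by fun_prop) (fun r hr => by
      rw [h r hr, h0 r, h 0 (by simp), h0 0, intervalIntegral.integral_same,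
        intervalIntegral.integral_same, sub_self, zero_add, ← intervalIntegral.integral_sub
        (Continuous.intervalIntegrable (by fun_prop) _ _)
        (Continuous.intervalIntegrable (by fun_prop) _ _)]
      congr 1
      ext r'
      ring) hr
  rw [h 0 (by simp), h0 0, intervalIntegral.integral_same, intervalIntegral.integral_same, sub_self,
    zero_mul, sub_eq_zero] at h1
  rw [h1, hw]

/-- The tangent of a curve moving with a given velocity. -/
theorem deriv_eq_integral {C D X X' : ℝ → ℝ → ℂ} (hX : Continuous fun p : ℝ × ℝ => X p.1 p.2)
    (hX' : Continuous fun p : ℝ × ℝ => X' p.1 p.2) (hXX' : ∀ r s, HasDerivAt (X r) (X' r s) s)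
    (hC : ∀ r ∈ Icc (0 : ℝ) 1, ∀ s, C r s = C 0 s + ∫ r' in (0 : ℝ)..r, X r' s)
    (hD : ∀ r ∈ Icc (0 : ℝ) 1, ∀ s, HasDerivAt (C r) (D r s) s) {r : ℝ} (hr : r ∈ Icc (0 : ℝ) 1)
    (s : ℝ) : D r s = D 0 s + ∫ r' in (0 : ℝ)..r, X' r' s := by
  have h1 := hasDerivAt_weighted_integral (n := fun _ => 1) hr.1 (by simp)
    (g := fun s r' => X r' s) (g' := fun s r' => X' r' s) (s := s)
    (fun u => (hX.comp (by fun_prop : Continuous fun r : ℝ => (r, u))).continuousOn)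
    ((hX'.comp continuous_swap).continuousOn) fun u r' _ => hXX' r' u
  simp only [Complex.ofReal_one, one_mul] at h1
  have h2 := (hD 0 (by simp) s).add h1
  have h3 : C r = fun s => C 0 s + ∫ r' in (0 : ℝ)..r, X r' s := funext fun s => hC r hr s
  have h4 := hD r hr s
  rw [h3] at h4
  exact h4.unique h2

/-- Maximum principle for a transport equation. -/
theorem le_of_transport {H b H' : ℝ → ℝ → ℝ} {κ : ℝ} (hH : Continuous fun p : ℝ × ℝ => H p.1 p.2)
    (hper : ∀ r ∈ Icc (0 : ℝ) 1, Function.Periodic (H r) 1)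
    (hr : ∀ r ∈ Icc (0 : ℝ) 1, ∀ s,
      HasDerivWithinAt (fun r => H r s) (b r s * H' r s) (Icc 0 1) r)
    (hs : ∀ r ∈ Icc (0 : ℝ) 1, ∀ s, HasDerivAt (H r) (H' r s) s) (h0 : ∀ s, H 0 s = κ) {r : ℝ}
    (hr1 : r ∈ Icc (0 : ℝ) 1) (s : ℝ) : H r s ≤ κ := by
  by_contra! hcon
  have hfr : ∀ r ∈ Icc (0 : ℝ) 1, ∀ s, H r s = H r (Int.fract s) := fun r hr s => by
    have := (hper r hr).sub_zsmul_eq ⌊s⌋ (x := s)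
    simp only [zsmul_eq_mul, mul_one] at this
    rw [← Int.self_sub_floor, this]
  have hfm : ∀ s : ℝ, Int.fract s ∈ Icc (0 : ℝ) 1 := fun s => ⟨Int.fract_nonneg s, (Int.fract_lt_one s).le⟩
  obtain ⟨ε, hε⟩ : ∃ ε, ε = (H r s - κ) / 2 := ⟨_, rfl⟩
  have hεp : 0 < ε := by linarith
  obtain ⟨⟨r₀, s₀⟩, ⟨hr₀, hs₀⟩, hmax⟩ := (isCompact_Icc.prod isCompact_Icc).exists_isMaxOn
    (s := Icc (0 : ℝ) 1 ×ˢ Icc (0 : ℝ) 1) ⟨(0, 0), by simp⟩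
    (f := fun p : ℝ × ℝ => H p.1 p.2 - ε * p.1) (by fun_prop)
  have hmax' : ∀ r ∈ Icc (0 : ℝ) 1, ∀ s, H r s - ε * r ≤ H r₀ s₀ - ε * r₀ := fun r hr s => by
    rw [hfr r hr s]
    exact hmax (show (r, Int.fract s) ∈ Icc (0 : ℝ) 1 ×ˢ Icc (0 : ℝ) 1 from ⟨hr, hfm s⟩)
  have hr₀p : 0 < r₀ := by
    refine lt_of_le_of_ne hr₀.1 fun h => ?_
    have h1 := hmax' r hr1 s
    rw [← h, h0] at h1
    nlinarith [hr1.2]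
  have hH' : H' r₀ s₀ = 0 := IsLocalMax.hasDerivAt_eq_zero
    (Filter.Eventually.of_forall fun s => by have := hmax' r₀ hr₀ s; linarith) (hs r₀ hr₀ s₀)
  have hd : HasDerivWithinAt (fun r => H r s₀ - ε * r) (-ε) (Icc 0 1) r₀ := by
    refine ((hr r₀ hr₀ s₀).sub ((hasDerivWithinAt_id r₀ _).const_mul ε)).congr_deriv ?_
    rw [hH']
    ring
  have h1 := ((hasDerivWithinAt_iff_tendsto_slope.1 hd).mono_left
    (nhdsWithin_mono _ (show Ioo 0 r₀ ⊆ Icc 0 1 \ {r₀} from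
      fun x hx => ⟨⟨hx.1.le, hx.2.le.trans hr₀.2⟩, hx.2.ne⟩))).eventually_lt_const
    (show -ε < 0 by linarith)
  rw [nhdsWithin_Ioo_eq_nhdsLT hr₀p] at h1
  obtain ⟨x, hx, hx1, hx2⟩ := (h1.and (Ioo_mem_nhdsLT hr₀p)).exists
  have h2 := hmax' x ⟨hx1.le, hx2.le.trans hr₀.2⟩ s₀
  rw [slope_def_field, div_lt_iff_of_neg (by linarith), zero_mul] at hx
  linarith

theorem eq_of_transport {H b H' : ℝ → ℝ → ℝ} {κ : ℝ} (hH : Continuous fun p : ℝ × ℝ => H p.1 p.2)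
    (hper : ∀ r ∈ Icc (0 : ℝ) 1, Function.Periodic (H r) 1)
    (hr : ∀ r ∈ Icc (0 : ℝ) 1, ∀ s,
      HasDerivWithinAt (fun r => H r s) (b r s * H' r s) (Icc 0 1) r)
    (hs : ∀ r ∈ Icc (0 : ℝ) 1, ∀ s, HasDerivAt (H r) (H' r s) s) (h0 : ∀ s, H 0 s = κ) {r : ℝ}
    (hr1 : r ∈ Icc (0 : ℝ) 1) (s : ℝ) : H r s = κ := by
  refine le_antisymm (le_of_transport hH hper hr hs h0 hr1 s) ?_
  have := le_of_transport (H := fun r s => -H r s) (H' := fun r s => -H' r s) (b := b) (κ := -κ) hH.neg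
    (fun r hr s => by simp only [hper r hr s])
    (fun r hr1 s => (hr r hr1 s).neg.congr_deriv (by ring)) (fun r hr s => (hs r hr s).neg)
    (fun s => by rw [h0]) hr1 s
  linarith

/-- Two continuous real phases which agree modulo `2π` and at one point are equal. -/
theorem phase_unique {φ Θ : ℝ → ℝ} (hφ : Continuous φ) (hΘ : Continuous Θ) (h0 : φ 0 = Θ 0)
    (h : ∀ r ∈ Icc (0 : ℝ) 1, Complex.exp (Complex.I * φ r) = Complex.exp (Complex.I * Θ r)) {r : ℝ}
    (hr : r ∈ Icc (0 : ℝ) 1) : φ r = Θ r := by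
  by_contra hne
  have hpi := Real.pi_gt_three
  have hpos : 0 < |φ r - Θ r| := abs_pos.2 (sub_ne_zero.2 hne)
  obtain ⟨x, hx, hxe⟩ := intermediate_value_Icc hr.1
    (f := fun r => |φ r - Θ r|) (by fun_prop)
    (show min |φ r - Θ r| 1 ∈ Icc |φ 0 - Θ 0| |φ r - Θ r| from
      ⟨by rw [h0, sub_self, abs_zero]; positivity, min_le_left _ _⟩)
  have h1 : |φ x - Θ x| ≤ 1 := hxe.le.trans (min_le_right _ _)
  have h2 : 0 < |φ x - Θ x| := (lt_min hpos one_pos).trans_eq hxe.symm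
  have h3 : Complex.exp (((φ x - Θ x : ℝ) : ℂ) * Complex.I) = 1 := by
    have h4 := h x ⟨hx.1, hx.2.trans hr.2⟩
    rw [Complex.ofReal_sub, sub_mul, Complex.exp_sub, mul_comm (φ x : ℂ), h4, mul_comm (Θ x : ℂ),
      div_self (Complex.exp_ne_zero _)]
  have h5 : Real.cos (φ x - Θ x) = 1 := by
    have := congrArg Complex.re h3
    rwa [Complex.exp_ofReal_mul_I_re, Complex.one_re] at this
  have h6 := abs_le.1 h1
  have := (Real.cos_eq_one_iff_of_lt_of_lt (by linarith) (by linarith)).1 h5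
  rw [this, abs_zero] at h2
  exact lt_irrefl _ h2

/-- The tangential coefficient `s ∫_0^1 f - ∫_0^s f`. -/
def tang (f : ℝ → ℝ) (s : ℝ) : ℝ := s * (∫ r in (0 : ℝ)..1, f r) - ∫ r in (0 : ℝ)..s, f r

theorem hasDerivAt_tang {f : ℝ → ℝ} (hf : Continuous f) (s : ℝ) :
    HasDerivAt (tang f) ((∫ r in (0 : ℝ)..1, f r) - f s) s := by
  have h1 := (hasDerivAt_id s).mul_const (∫ r in (0 : ℝ)..1, f r)
  rw [one_mul] at h1
  exact h1.sub (hf.integral_hasStrictDerivAt 0 s).hasDerivAt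

theorem continuous_tang {f : ℝ → ℝ → ℝ} (hf : Continuous fun p : ℝ × ℝ => f p.1 p.2) :
    Continuous fun p : ℝ × ℝ => tang (f p.1) p.2 := by
  have h1 : Continuous fun r => ∫ s in (0 : ℝ)..1, f r s :=
    intervalIntegral.continuous_parametric_intervalIntegral_of_continuous' hf _ _
  have h2 : Continuous fun p : ℝ × ℝ => ∫ s in (0 : ℝ)..p.2, f p.1 s :=
    intervalIntegral.continuous_parametric_primitive_of_continuous hf
  unfold tang
  fun_prop

/-- A moving curve whose tangential velocity is `tang` keeps its speed independent of the parameter. -/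
theorem norm_eq_one_of_motion {C p p' Z Z' : ℝ → ℝ → ℂ} {l : ℝ → ℝ} {τ : ℝ} (hl : Continuous l)
    (hl0 : ∀ r, 0 < l r) (hp : ∀ r s, HasDerivAt (p r) (p' r s) s)
    (hZ : ∀ r s, HasDerivAt (Z r) (Z' r s) s) (hpc : Continuous fun q : ℝ × ℝ => p q.1 q.2)
    (hpc' : Continuous fun q : ℝ × ℝ => p' q.1 q.2) (hZc : Continuous fun q : ℝ × ℝ => Z q.1 q.2)
    (hZc' : Continuous fun q : ℝ × ℝ => Z' q.1 q.2) (hper : ∀ r, Function.Periodic (p r) 1)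
    (hp0 : ∀ r s, p r s ≠ 0) (hp1 : ∀ r, ‖p r 0‖ = 1) (hp2 : ∀ s, ‖p 0 s‖ = 1)
    (hC : ∀ r ∈ Icc (0 : ℝ) 1, ∀ s, HasDerivAt (C r) (l r * p r s) s)
    (hCr : ∀ r ∈ Icc (0 : ℝ) 1, ∀ s, C r s = C 0 s + ∫ r' in (0 : ℝ)..r, τ * l r' * (Z r' s +
      tang (fun s => (conj (p r' s) * Z' r' s).re / ‖p r' s‖ ^ 2) s * p r' s)) {r : ℝ}
    (hr : r ∈ Icc (0 : ℝ) 1) (s : ℝ) : ‖p r s‖ = 1 := by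
  obtain ⟨f, hf⟩ : ∃ f : ℝ → ℝ → ℝ, ∀ r s, f r s = (conj (p r s) * Z' r s).re / ‖p r s‖ ^ 2 :=
    ⟨_, fun _ _ => rfl⟩
  simp only [← hf] at hCr
  have hfc : Continuous fun q : ℝ × ℝ => f q.1 q.2 := by
    simp only [hf]
    refine Continuous.div (Complex.continuous_re.comp ((Complex.continuous_conj.comp hpc).mul hZc'))
      (by fun_prop) fun q => ?_
    have := norm_pos_iff.2 (hp0 q.1 q.2)
    positivity
  have hfc1 : ∀ r, Continuous (f r) := fun r => hfc.comp (by fun_prop : Continuous fun s : ℝ => (r, s))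
  obtain ⟨m, hm⟩ : ∃ m : ℝ → ℝ, ∀ r, m r = ∫ s in (0 : ℝ)..1, f r s := ⟨_, fun _ => rfl⟩
  have hmc : Continuous m := by
    rw [funext hm]
    exact intervalIntegral.continuous_parametric_intervalIntegral_of_continuous' hfc _ _
  have hΛ : ∀ r s, HasDerivAt (tang (f r)) (m r - f r s) s := fun r s => by
    rw [hm]; exact hasDerivAt_tang (hfc1 r) s
  have hΛc := continuous_tang hfc
  obtain ⟨X', hX'⟩ : ∃ X' : ℝ → ℝ → ℂ, ∀ r s, X' r s = τ * l r * (Z' r s +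
    (((m r - f r s : ℝ) : ℂ) * p r s + tang (f r) s * p' r s)) := ⟨_, fun _ _ => rfl⟩
  have hXc' : Continuous fun q : ℝ × ℝ => X' q.1 q.2 := by
    simp only [hX']
    fun_prop
  have hD := fun r (hr : r ∈ Icc (0 : ℝ) 1) s => deriv_eq_integral (X := fun r s => τ * l r * (Z r s +
      tang (f r) s * p r s)) (X' := X') (by fun_prop) hXc' (fun r s => by
        refine (((hZ r s).add ((hΛ r s).ofReal_comp.mul (hp r s))).const_mul _).congr_deriv ?_
        rw [hX']) hCr hC hr s
  obtain ⟨D, hDdef⟩ : ∃ D : ℝ → ℝ → ℂ, ∀ r s, D r s = l 0 * p 0 s + ∫ r' in (0 : ℝ)..r, X' r' s :=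
    ⟨_, fun _ _ => rfl⟩
  have hDp : ∀ r ∈ Icc (0 : ℝ) 1, ∀ s, D r s = l r * p r s := fun r hr s => by
    rw [hDdef, hD r hr s]
  have hDr : ∀ r s, HasDerivAt (fun r => D r s) (X' r s) r := fun r s => by
    simp only [hDdef]
    have : Continuous fun r => X' r s := hXc'.comp (by fun_prop : Continuous fun r : ℝ => (r, s))
    exact ((this.integral_hasStrictDerivAt 0 r).hasDerivAt).const_add _
  have hN : ∀ r ∈ Icc (0 : ℝ) 1, ∀ s, HasDerivAt (fun r => ‖D r s‖ ^ 2) (2 * τ * l r * (l r *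
      (m r * ‖p r s‖ ^ 2 + tang (f r) s * (conj (p r s) * p' r s).re))) r := fun r hr s => by
    refine (hDr r s).norm_sq.congr_deriv ?_
    have h1 : f r s * ‖p r s‖ ^ 2 = (conj (p r s) * Z' r s).re := by
      rw [hf, div_mul_cancel₀]
      have := norm_pos_iff.2 (hp0 r s)
      positivity
    have h2 : ‖p r s‖ ^ 2 = (conj (p r s) * p r s).re := by
      rw [mul_comm, Complex.mul_conj, Complex.ofReal_re, Complex.normSq_eq_norm_sq]
    rw [hDp r hr, hX', Complex.inner]
    rw [h2] at h1 ⊢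
    simp only [map_mul, Complex.conj_ofReal, Complex.mul_re, Complex.mul_im, Complex.add_re,
      Complex.add_im, Complex.ofReal_re, Complex.ofReal_im, Complex.conj_re, Complex.conj_im] at h1 ⊢
    linear_combination (-2 * τ * l r ^ 2) * h1
  have l_ne : ∀ r, l r ≠ 0 := fun r => (hl0 r).ne'
  have hDn : ∀ r ∈ Icc (0 : ℝ) 1, ∀ s, ‖D r s‖ ^ 2 = l r ^ 2 * ‖p r s‖ ^ 2 := fun r hr s => by
    rw [hDp r hr, norm_mul, mul_pow, Complex.norm_real, Real.norm_eq_abs, sq_abs]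
  have key := eq_of_transport (H := fun r s => ‖p r s‖ ^ 2) (κ := 1) (b := fun r s => τ * tang (f r) s)
    (H' := fun r s => 2 * (conj (p r s) * p' r s).re) (by fun_prop)
    (fun r _ s => by simp only [hper r s]) (fun r hr s => ?_) (fun r _ s => ?_)
    (fun s => by rw [hp2, one_pow]) hr s
  · exact (pow_eq_one_iff_of_nonneg (norm_nonneg _) two_ne_zero).1 key
  · have hl0 := hl0 r
    have hne : ‖D r 0‖ ^ 2 ≠ 0 := by rw [hDn r hr, hp1]; positivity
    have ht0 : tang (f r) 0 = 0 := by simp [tang]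
    have h1 := ((hN r hr s).div (hN r hr 0) hne).hasDerivWithinAt (s := Icc 0 1)
    refine (h1.congr (fun r hr => ?_) ?_).congr_deriv ?_
    · have := l_ne r
      rw [Pi.div_apply, hDn r hr, hDn r hr, hp1]
      field_simp
    · have := l_ne r
      rw [Pi.div_apply, hDn r hr, hDn r hr, hp1]
      field_simp
    · rw [hDn r hr, hDn r hr, hp1, ht0]
      field_simp
      ring
  · refine (hp r s).norm_sq.congr_deriv ?_
    rw [Complex.inner, mul_comm (p' r s)]

/-- The velocity in the contour dynamics equation with tangential term. -/
def cdeVelocity (β : ℝ) (v : ℝ → Plane) (s : ℝ) : Plane :=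
  cdeIntegral β v s + tangentialCoeff β v s • deriv v s

theorem cdeVelocity_toPlane {β L : ℝ} {c E E' Z' : ℝ → ℂ} (hβ₁ : 1 < β) (hβ₂ : β < 2) (hL : 0 < L)
    (hE : ∀ s, HasDerivAt E (E' s) s) (hE' : Continuous E') (hc : ∀ s, HasDerivAt c (L * E s) s)
    (hper : Function.Periodic c 1) (hpos : ∀ s, ∀ σ ∈ 𝕁, 0 < dq E s σ)
    (hZ : ∀ s, HasDerivAt (zetaU β E E') (Z' s) s) (s : ℝ) :
    cdeVelocity β (fun s => toPlane (c s)) s = toPlane ((L ^ (1 - β) : ℝ) * (zetaU β E E' s +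
      tang (fun r => (conj (E r) * Z' r).re / ‖E r‖ ^ 2) s * E s)) := by
  rw [cdeVelocity, cdeIntegral_toPlane hβ₁ hβ₂ hL hE hE' hc hper hpos,
    tangentialCoeff_toPlane hβ₁ hβ₂ hL hE hE' hc hper hpos hZ, (hasDerivAt_toPlane (hc s)).deriv,
    ← map_smul, ← map_add, Complex.real_smul, Real.rpow_sub hL, Real.rpow_one, Real.rpow_neg hL.le,
    div_eq_mul_inv, tang]
  congr 1
  push_cast
  ring

theorem InX.continuous {l : ℕ} {ρ : ℝ} {M : ℝ≥0} {v : ℝ → Plane} (hρ : 0 < ρ) (h : InX l ρ M v) :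
    Continuous fun s => toPlane.symm (v s) := by
  obtain ⟨f, g, h, G, hf, -, -, -, hfv, -, -, -, hM⟩ := h
  have hcomp : ∀ i, DifferentiableOn ℂ (fun w => f w i) (strip ρ) := fun i =>
    ((EuclideanSpace.proj (𝕜 := ℂ) i).differentiable.comp_differentiableOn hf.holo)
  have hci : ∀ i, Continuous fun s : ℝ => f s i := fun i =>
    (hcomp i).continuousOn.comp_continuous (f := fun s : ℝ => (s : ℂ))
      (by fun_prop) fun s => by simpa [strip] using hρ
  have hF : ∀ s : ℝ, f s 0 + Complex.I * f s 1 = toPlane.symm (v s) := fun s => by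
    rw [hfv, hfv]
    obtain ⟨z, hz⟩ := toPlane.surjective (v s)
    rw [← hz, LinearIsometryEquiv.symm_apply_apply, toPlane_zero_apply, toPlane_one_apply, mul_comm,
      Complex.re_add_im]
  simp_rw [← hF]
  exact (hci 0).add (continuous_const.mul (hci 1))

/-- A moving curve in complex notation: its velocity is `cdeVelocity`, its tangent is `l F`, with `F`
in a Wiener algebra and of unit length at the base point. -/
structure IsMotion {T : ℝ} {a : ℝ≥0} (β : ℝ) (c : ℝ → ℝ → ℂ) (l : C(Icc (0 : ℝ) T, ℝ))
    (F : Wien (Icc (0 : ℝ) T) (.const _ a)) : Prop where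
  pos : ∀ t, 0 < l t
  periodic : ∀ t ∈ Icc 0 T, Function.Periodic (c t) 1
  ne_zero : ∀ (t : Icc (0 : ℝ) T) (s : ℝ), Wien.ev F t s ≠ 0
  norm_zero : ∀ t : Icc (0 : ℝ) T, ‖Wien.ev F t (0 : ℝ)‖ = 1
  hasDerivAt : ∀ (t : Icc (0 : ℝ) T) (s : ℝ), HasDerivAt (c t) (l t * Wien.ev F t s) s
  equation : ∀ t ∈ Icc 0 T, ∀ s, HasDerivWithinAt (fun τ => toPlane (c τ s))
    (cdeVelocity β (fun s => toPlane (c t s)) s) (Icc 0 T) t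

theorem exists_isMotion {β T ρ : ℝ} {l : ℕ} {M : ℝ≥0} (hρ : 0 < ρ) {w : ℝ → ℝ → Plane}
    (hX : ∀ t ∈ Icc 0 T, InX l ρ M (w t))
    (hw : IsCDESolution β T w fun t => tangentialCoeff β (w t)) {a : ℝ≥0} (ha : (a : ℝ) ≤ π * ρ / 4) :
    ∃ (m : C(Icc (0 : ℝ) T, ℝ)) (F : Wien (Icc (0 : ℝ) T) (.const _ a)),
      IsMotion β (fun t s => toPlane.symm (w t s)) m F := by
  have hpi := Real.pi_pos
  have hpr : 0 < π * ρ := by positivity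
  obtain ⟨c, hc⟩ : ∃ c : ℝ → ℝ → ℂ, ∀ t s, c t s = toPlane.symm (w t s) := ⟨_, fun _ _ => rfl⟩
  have hcw : ∀ t s, toPlane (c t s) = w t s := fun t s => by rw [hc]; simp
  obtain ⟨a₀, ha₀⟩ : ∃ a₀ : ℝ≥0, (a₀ : ℝ) = π * ρ / 2 := ⟨⟨_, by positivity⟩, rfl⟩
  obtain ⟨f, hf⟩ := Wien.exists_of_family (T := T) (c := c) (B := 2 * M) hpr
    (fun t ht => (hX t ht).continuous hρ |>.congr fun s => (hc t s).symm)
    (fun t ht s => by rw [hc, hc, hw.periodic t ht s])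
    (fun s t ht => by
      simp only [hc]
      exact (toPlane.symm.continuous.continuousAt.comp_continuousWithinAt
        (hw.equation t ht s).continuousWithinAt))
    (fun t ht k => by simpa only [hc] using (hX t ht).norm_coef_le hρ k)
    (ω := .const _ a₀) (fun t => ha₀.le)
  obtain ⟨g, hg⟩ : ∃ g : Wien (Icc (0 : ℝ) T) (.const _ a), ∀ (t : Icc (0 : ℝ) T) (s : ℝ),
      HasDerivAt (c t) (Wien.ev g t s) s := by
    refine ⟨Wien.der (π * ρ / 4) (by positivity) (fun t => ?_) f, fun t s => ?_⟩
    · simp only [ContinuousMap.const_apply, ha₀]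
      linarith
    · have := Wien.hasDerivAt_der (π * ρ / 4) (by positivity) (ω' := .const _ a) (fun t => by
        simp only [ContinuousMap.const_apply, ha₀]
        linarith) f t s
      simpa only [hf] using this
  have hne : ∀ (t : Icc (0 : ℝ) T) (s : ℝ), Wien.ev g t s ≠ 0 := fun t s h0 => by
    refine (hX t t.2).deriv_ne_zero s ?_
    have h1 := hasDerivAt_toPlane (hg t s)
    simp only [hcw, h0, map_zero] at h1
    exact h1.deriv
  have hcont : Continuous fun t => ‖Wien.ev g t (0 : ℝ)‖ :=
    ((Wien.continuous_ev_param g).comp (by fun_prop : Continuous fun t : Icc (0 : ℝ) T => (t, (0 : ℝ)))).norm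
  obtain ⟨m, hm⟩ : ∃ m : C(Icc (0 : ℝ) T, ℝ), ∀ t, m t = ‖Wien.ev g t (0 : ℝ)‖ := ⟨⟨_, hcont⟩, fun _ => rfl⟩
  have hm0 : ∀ t, 0 < m t := fun t => by rw [hm]; exact norm_pos_iff.2 (hne t 0)
  obtain ⟨mi, hmi⟩ : ∃ mi : C(Icc (0 : ℝ) T, ℂ), ∀ t, mi t = ((m t)⁻¹ : ℝ) :=
    ⟨⟨fun t => ((m t)⁻¹ : ℝ), Complex.continuous_ofReal.comp (m.continuous.inv₀ fun t => (hm0 t).ne')⟩,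
      fun _ => rfl⟩
  have hF : ∀ (t : Icc (0 : ℝ) T) (s : ℝ), Wien.ev (Wien.const mi * g) t s = ((m t)⁻¹ : ℝ) * Wien.ev g t s :=
    fun t s => by rw [Wien.ev_mul _ _ (Wien.inS_ofReal _ _), Wien.ev_const, hmi]
  refine ⟨m, Wien.const mi * g, hm0, fun t ht s => ?_, fun t s => ?_, fun t => ?_, fun t s => ?_,
    fun t ht s => ?_⟩
  · simp only [hw.periodic t ht s]
  · rw [hF]
    exact mul_ne_zero (by exact_mod_cast (inv_pos.2 (hm0 t)).ne') (hne t s)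
  · rw [hF, norm_mul, ← hm, Complex.norm_real, Real.norm_eq_abs, abs_of_pos (inv_pos.2 (hm0 t)),
      inv_mul_cancel₀ (hm0 t).ne']
  · have := hg t s
    rw [show c t = fun s => toPlane.symm (w t s) from funext (hc t)] at this
    rw [hF]
    refine this.congr_deriv ?_
    have h0 : (m t : ℂ) ≠ 0 := by exact_mod_cast (hm0 t).ne'
    push_cast
    field_simp
  · simp only [LinearIsometryEquiv.apply_symm_apply]
    exact hw.equation t ht s

/-- The change of time `dt = τ l^β dr`. -/
theorem exists_time_change {T β : ℝ} (hT : 0 < T) (l : C(Icc (0 : ℝ) T, ℝ)) (hl : ∀ t, 0 < l t)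
    {δ : ℝ} (hδ : 0 < δ) : ∃ τ₀ > 0, ∀ τ : ℝ, 0 < τ → τ ≤ τ₀ → ∃ q : C(unitInterval, Icc (0 : ℝ) T),
      (∀ r, dist (q r) ⟨0, left_mem_Icc.2 hT.le⟩ < δ) ∧ ∀ r ∈ Icc (0 : ℝ) 1, (q (Wien.pI r) : ℝ) =
        ∫ r' in (0 : ℝ)..r, τ * l (q (Wien.pI r')) ^ β := by
  obtain ⟨g, hg⟩ : ∃ g : ℝ → ℝ, ∀ x, g x = l (projIcc 0 T hT.le x) ^ β := ⟨_, fun _ => rfl⟩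
  have hgc' : Continuous fun t : Icc (0 : ℝ) T => l t ^ β :=
    l.continuous.rpow_const fun t => Or.inl (hl t).ne'
  have hgc : Continuous g := by
    rw [funext hg]
    exact hgc'.comp continuous_projIcc
  have : Nonempty (Icc (0 : ℝ) T) := ⟨⟨0, left_mem_Icc.2 hT.le⟩⟩
  obtain ⟨x, -, hx⟩ := isCompact_univ.exists_isMaxOn (univ_nonempty (α := Icc (0 : ℝ) T)) hgc'.continuousOn
  obtain ⟨h, h0, hmono, -, hd⟩ := exists_clock hgc (fun x => by rw [hg]; exact Real.rpow_pos_of_pos (hl _) β)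
    (C := l x ^ β) (fun y => by rw [hg]; exact hx (mem_univ _))
  have hc : Continuous h := continuous_of_hasDerivAt hd
  obtain ⟨τ₀, hτ₀, hh⟩ := Metric.continuousAt_iff.1 (hc.continuousAt (x := 0)) (min δ T) (lt_min hδ hT)
  refine ⟨τ₀ / 2, by positivity, fun τ hτ hττ => ?_⟩
  have hmem : ∀ r ∈ Icc (0 : ℝ) 1, 0 ≤ h (τ * r) ∧ h (τ * r) < min δ T := fun r hr => by
    have h1 : 0 ≤ h (τ * r) := h0 ▸ hmono.monotone (mul_nonneg hτ.le hr.1)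
    refine ⟨h1, ?_⟩
    have h2 := hh (x := τ * r) (by
      rw [Real.dist_eq, sub_zero, abs_of_nonneg (mul_nonneg hτ.le hr.1)]
      nlinarith [hr.2])
    rw [h0, Real.dist_eq, sub_zero] at h2
    exact (le_abs_self _).trans_lt h2
  obtain ⟨q, hq⟩ : ∃ q : C(unitInterval, Icc (0 : ℝ) T), ∀ r : unitInterval,
      q r = projIcc 0 T hT.le (h (τ * r)) :=
    ⟨⟨fun r => projIcc 0 T hT.le (h (τ * r)), continuous_projIcc.comp (by fun_prop)⟩, fun _ => rfl⟩
  have hqv : ∀ r : unitInterval, (q r : ℝ) = h (τ * r) := fun r => by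
    rw [hq, projIcc_of_mem _ ⟨(hmem r r.2).1, ((hmem r r.2).2.trans_le (min_le_right _ _)).le⟩]
  refine ⟨q, fun r => ?_, fun r hr => ?_⟩
  · rw [Subtype.dist_eq, Real.dist_eq, sub_zero, hqv, abs_of_nonneg (hmem r r.2).1]
    exact (hmem r r.2).2.trans_le (min_le_left _ _)
  · have h1 : ∀ r, HasDerivAt (fun r => h (τ * r)) (g (h (τ * r)) * τ) r := fun r => by
      have h2 : HasDerivAt (fun r => τ * r) τ r := by simpa using (hasDerivAt_id r).const_mul τ
      exact (hd (τ * r)).comp r h2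
    have h2 := intervalIntegral.integral_eq_sub_of_hasDerivAt (a := 0) (b := r) (fun x _ => h1 x)
      (Continuous.intervalIntegrable (by fun_prop) _ _)
    have hpr : ∀ x ∈ Icc (0 : ℝ) 1, (Wien.pI x : ℝ) = x := fun x hx => by
      rw [Wien.pI, projIcc_of_mem _ hx]
    rw [mul_zero, h0, sub_zero] at h2
    rw [hqv, hpr r hr, ← h2]
    refine intervalIntegral.integral_congr fun x hx => ?_
    rw [uIcc_of_le hr.1] at hx
    simp only [hg]
    rw [hq, hpr x ⟨hx.1, hx.2.trans hr.2⟩, mul_comm]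

namespace Wien

theorem wt_add_le {ρ : ℝ} (hρ : 0 ≤ ρ) (r : unitInterval) : wt ρ r + π * ρ ≤ wt (2 * ρ) r := by
  have h := wt_ge hρ r
  rw [wt_apply hρ] at h ⊢
  rw [wt_apply (by linarith)]
  linarith

theorem continuous_rl_pI {ω : C(unitInterval, ℝ≥0)} (f : Wien unitInterval ω) :
    Continuous fun p : ℝ × ℝ => rl f (pI p.1) p.2 := by
  have := continuous_pI
  exact (continuous_ev_param f).comp (by fun_prop : Continuous fun p : ℝ × ℝ => (pI p.1, p.2))

theorem IsMotion.norm_eq_one {β T ρ τ : ℝ} {a : ℝ≥0} {c : ℝ → ℝ → ℂ} {l : C(Icc (0 : ℝ) T, ℝ)}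
    {F : Wien (Icc (0 : ℝ) T) (.const _ a)} (hβ₁ : 1 < β) (hβ₂ : β < 2) (hM : IsMotion β c l F)
    (hρ : 0 < ρ) (hω : ∀ r, wt (2 * ρ) r ≤ a) (hω' : ∀ r, wt ρ r ≤ a) {B : Base ρ} {q : C(unitInterval, Icc (0 : ℝ) T)}
    (hq : ∀ r ∈ Icc (0 : ℝ) 1, (q (pI r) : ℝ) = ∫ r' in (0 : ℝ)..r, τ * l (q (pI r')) ^ β)
    (hB : ∀ (r : unitInterval) (σ : Sg) (s : ℝ), 0 < dq (rl (restr q hω' F) r) s σ ∧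
      ev (B.pow β (chord (restr q hω' F))) (r, σ) s = vq β (rl (restr q hω' F) r) s σ)
    (h0 : ∀ s : ℝ, ‖ev F (q 0) s‖ = 1) :
    ∃ p p' Z' : ℝ → ℝ → ℂ, (∀ r s, p r s = ev F (q (pI r)) s) ∧
      (∀ r s, HasDerivAt (p r) (p' r s) s) ∧
      (∀ r s, HasDerivAt (zetaU β (p r) (p' r)) (Z' r s) s) ∧ (∀ r ∈ Icc (0 : ℝ) 1, ∀ s, ‖p r s‖ = 1) ∧
      ∀ r ∈ Icc (0 : ℝ) 1, ∀ s, c (q (pI r)) s = c (q 0) s + ∫ r' in (0 : ℝ)..r, τ * l (q (pI r')) *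
        (zetaU β (p r') (p' r') s +
          tang (fun s => (conj (p r' s) * Z' r' s).re / ‖p r' s‖ ^ 2) s * p r' s) := by
  have hpI := continuous_pI
  have hpi0 : pI 0 = 0 := pI_coe 0
  have hpr : 0 < π * ρ := mul_pos Real.pi_pos hρ
  obtain ⟨P, hP⟩ : ∃ P, P = restr q hω' F := ⟨_, rfl⟩
  obtain ⟨P₂, hP₂⟩ : ∃ P₂, P₂ = restr q hω F := ⟨_, rfl⟩
  have hrl : ∀ r s, rl P r s = ev F (q r) s := fun r s => by
    rw [hP]; exact ev_restr _ _ _ _ (inS_ofReal _ _)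
  have hrl₂ : ∀ r s, rl P₂ r s = ev F (q r) s := fun r s => by
    rw [hP₂]; exact ev_restr _ _ _ _ (inS_ofReal _ _)
  obtain ⟨P', hP'⟩ : ∃ P' : W1 ρ, ∀ r s, HasDerivAt (rl P r) (rl P' r s) s := by
    refine ⟨der (π * ρ) hpr (wt_add_le hρ.le) P₂, fun r s => ?_⟩
    rw [show rl P r = rl P₂ r from funext fun s => (hrl r s).trans (hrl₂ r s).symm]
    exact hasDerivAt_der _ hpr (wt_add_le hρ.le) P₂ r s
  rw [← hP] at hB
  obtain ⟨Z, hZ⟩ : ∃ Z : W1 ρ, ∀ r, rl Z r = zetaU β (rl P r) (rl P' r) :=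
    ⟨zOp β hβ₁ hβ₂ (B.pow β (chord P)) P P', fun r => funext fun s =>
      ev_zOp hβ₁ hβ₂ (fun σ s => (hB r σ s).2) s⟩
  obtain ⟨Z', hZ'⟩ : ∃ Z' : Wien unitInterval 0, ∀ r s, HasDerivAt (rl Z r) (rl Z' r s) s :=
    ⟨der (π * ρ) hpr (fun r => by simpa using wt_ge hρ.le r) Z, fun r s =>
      hasDerivAt_der _ hpr _ Z r s⟩
  have hlc : Continuous fun r => l (q (pI r)) := by fun_prop
  have hne : ∀ r s, rl P r s ≠ 0 := fun r s => by rw [hrl]; exact hM.ne_zero _ _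
  have hfc : Continuous fun p : ℝ × ℝ => (conj (rl P (pI p.1) p.2) * rl Z' (pI p.1) p.2).re /
      ‖rl P (pI p.1) p.2‖ ^ 2 := by
    have h1 := continuous_rl_pI P
    have h2 := continuous_rl_pI Z'
    refine Continuous.div (Complex.continuous_re.comp ((Complex.continuous_conj.comp h1).mul h2))
      (h1.norm.pow 2) fun p => ?_
    have := norm_pos_iff.2 (hne (pI p.1) p.2)
    positivity
  have hXc : ∀ s, Continuous fun r : ℝ => τ * l (q (pI r)) * (rl Z (pI r) s +
      tang (fun s => (conj (rl P (pI r) s) * rl Z' (pI r) s).re / ‖rl P (pI r) s‖ ^ 2) s *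
        rl P (pI r) s) := fun s => by
    have hsl : Continuous fun r : ℝ => (r, s) := by fun_prop
    have h1 := (continuous_rl_pI P).comp hsl
    have h2 := (continuous_rl_pI Z).comp hsl
    have h3 := (continuous_tang (f := fun r s => (conj (rl P (pI r) s) * rl Z' (pI r) s).re /
      ‖rl P (pI r) s‖ ^ 2) hfc).comp hsl
    simp only [Function.comp_def] at h1 h2 h3
    fun_prop
  have hqd : ∀ r ∈ Icc (0 : ℝ) 1, HasDerivWithinAt (fun r => (q (pI r) : ℝ))
      (τ * l (q (pI r)) ^ β) (Icc 0 1) r := fun r hr => by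
    have h1 : Continuous fun r => τ * l (q (pI r)) ^ β :=
      continuous_const.mul (hlc.rpow_const fun r => Or.inl (hM.pos _).ne')
    exact ((h1.integral_hasStrictDerivAt 0 r).hasDerivAt.hasDerivWithinAt).congr hq (hq r hr)
  have hCd : ∀ r ∈ Icc (0 : ℝ) 1, ∀ s, HasDerivWithinAt (fun r => c (q (pI r)) s)
      (τ * l (q (pI r)) * (rl Z (pI r) s +
      tang (fun s => (conj (rl P (pI r) s) * rl Z' (pI r) s).re / ‖rl P (pI r) s‖ ^ 2) s *
        rl P (pI r) s)) (Icc 0 1) r := fun r hr s => by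
    have h1 := (hM.equation (q (pI r)) (q (pI r)).2 s).scomp r (hqd r hr) fun r _ => (q (pI r)).2
    have h2 := toPlane.symm.toContinuousLinearEquiv.toContinuousLinearMap.hasFDerivAt.comp_hasDerivWithinAt
      r h1
    have h3 := cdeVelocity_toPlane (L := l (q (pI r))) (c := c (q (pI r))) (E := rl P (pI r))
      (E' := rl P' (pI r)) (Z' := rl Z' (pI r)) hβ₁ hβ₂ (hM.pos _) (hP' _)
      (continuous_rl _ _) (fun s => by rw [hrl]; exact hM.hasDerivAt _ s)
      (hM.periodic _ (q (pI r)).2) (fun s σ hσ => (hB _ ⟨σ, hσ⟩ s).1)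
      (fun s => by rw [← hZ]; exact hZ' _ s) s
    rw [h3, ← hZ] at h2
    have h4 : (fun r => c (q (pI r)) s) = fun r => toPlane.symm (toPlane (c (q (pI r)) s)) := by simp
    rw [h4]
    refine h2.congr_deriv ?_
    change toPlane.symm _ = _
    rw [map_smul, LinearIsometryEquiv.symm_apply_apply, Complex.real_smul, ← mul_assoc,
      ← Complex.ofReal_mul, mul_assoc, ← Real.rpow_add (hM.pos _)]
    simp
  have hCr : ∀ r ∈ Icc (0 : ℝ) 1, ∀ s, c (q (pI r)) s = c (q 0) s + ∫ r' in (0 : ℝ)..r,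
      τ * l (q (pI r')) * (rl Z (pI r') s +
      tang (fun s => (conj (rl P (pI r') s) * rl Z' (pI r') s).re / ‖rl P (pI r') s‖ ^ 2) s *
        rl P (pI r') s) := fun r hr s => by
    have h1 := intervalIntegral.integral_eq_sub_of_hasDerivAt_of_le hr.1
      (f := fun r => c (q (pI r)) s)
      (fun x hx => ((hCd x ⟨hx.1, hx.2.trans hr.2⟩ s).continuousWithinAt).mono
        (Icc_subset_Icc_right hr.2))
      (fun x hx => (hCd x ⟨hx.1.le, hx.2.le.trans hr.2⟩ s).hasDerivAt
        (Icc_mem_nhds hx.1 (hx.2.trans_le hr.2))) ((hXc s).intervalIntegrable _ _)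
    rw [h1, hpi0]
    ring
  refine ⟨fun r => rl P (pI r), fun r => rl P' (pI r), fun r => rl Z' (pI r), fun r s => hrl _ s,
    fun r s => hP' _ s, fun r s => by rw [← hZ]; exact hZ' _ s, fun r hr s => ?_, fun r hr s => ?_⟩
  · refine norm_eq_one_of_motion (C := fun r s => c (q (pI r)) s) (p := fun r s => rl P (pI r) s)
      (p' := fun r s => rl P' (pI r) s) (Z := fun r s => rl Z (pI r) s)
      (Z' := fun r s => rl Z' (pI r) s) (l := fun r => l (q (pI r))) (τ := τ) hlc
      (fun r => hM.pos _) (fun r s => hP' _ s) (fun r s => hZ' _ s) (continuous_rl_pI P)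
      (continuous_rl_pI P') (continuous_rl_pI Z) (continuous_rl_pI Z') (fun r => rl_periodic _ _)
      (fun r s => hne _ s) (fun r => ?_) (fun s => ?_) (fun r _ s => ?_) (fun r hr s => ?_) hr s
    · rw [hrl]; exact hM.norm_zero _
    · rw [hpi0, hrl]; exact h0 s
    · rw [hrl]; exact hM.hasDerivAt _ s
    · rw [hpi0]; exact hCr r hr s
  · simp only [← hZ]
    exact hCr r hr s

end Wien

namespace Wien

variable {ρ : ℝ}

theorem ev_eq_of_co {K : Type} [TopologicalSpace K] [CompactSpace K] {ω ω' : C(K, ℝ≥0)}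
    {f : Wien K ω} {g : Wien K ω'} (h : ∀ k x, co f k x = co g k x) (x : K) (w : ℂ) :
    ev f x w = ev g x w := by
  rw [ev, ev]
  simp_rw [← co_mul_exp, h]

/-- The angle of a unit tangent field near the base. -/
theorem exists_angle (hρ : 0 < ρ) {B : Base ρ} {e : W1 (2 * ρ)} (he : ∀ r s, rl e r s = rl B.E r s)
    (hu : ∀ r s, ‖rl B.E r s‖ = 1) {δ : ℝ} (hδ : 0 < δ) :
    ∃ ε > 0, ∀ P : W1 (2 * ρ), ‖P - e‖ < ε → (∀ r s, ‖rl P r s‖ = 1) →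
      ∃ ψ : W1 ρ, ‖ψ‖ ≤ δ ∧ (∀ r s, ‖rl (phi ψ) r s‖ < 1) ∧ phi ψ = mB ψ ∧
        ∀ r s, rl (B.tan ψ) r s = rl P r s := by
  have hpi := Real.pi_pos
  obtain ⟨ε₁, hε₁, hlog⟩ := exp_log1p unitInterval (wt (2 * ρ))
  have hee : conjOp e * e = 1 := ext_ev fun r s => by
    rw [ev_mul _ _ (inS_ofReal _ _), ev_conjOp, Complex.conj_ofReal, ev_one]
    have h1 := he r s
    rw [rl] at h1
    rw [h1, mul_comm, Complex.mul_conj, Complex.normSq_eq_norm_sq, hu]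
    simp
  have hm : ∀ k : ℤ, ‖((1 + 2 * π * |(k : ℝ)| : ℝ) : ℂ)‖ ≤ 1 + 2 * π * |(k : ℝ)| := fun k => by
    rw [Complex.norm_real, Real.norm_eq_abs, abs_of_nonneg (by positivity)]
  have hpr : 0 < π * ρ := by positivity
  obtain ⟨J, hJ⟩ : ∃ J : W1 (2 * ρ) →L[ℂ] W1 ρ, ∀ f k r,
      co (J f) k r = ((1 + 2 * π * |(k : ℝ)| : ℝ) : ℂ) * co f k r :=
    ⟨mulGap _ hm _ hpr (wt_add_le hρ.le), fun f k r => co_mulGap _ hm _ hpr _ f k r⟩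
  have hx : ContinuousAt (fun P : W1 (2 * ρ) => conjOp e * P - 1) e :=
    ((continuous_const.mul continuous_id).sub continuous_const).continuousAt
  have hJc : ContinuousAt (fun P : W1 (2 * ρ) => J (-Complex.I • log1p (conjOp e * P - 1))) e := by
    have h1 : ContinuousAt (fun P : W1 (2 * ρ) => log1p (conjOp e * P - 1)) e := by
      refine ContinuousAt.comp (g := log1p) ?_ hx
      rw [hee, sub_self]
      exact contDiffAt_log1p.continuousAt
    have h2 : ContinuousAt (fun P : W1 (2 * ρ) => -Complex.I • log1p (conjOp e * P - 1)) e :=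
      h1.const_smul (-Complex.I)
    exact ContinuousAt.comp (g := J) J.continuous.continuousAt h2
  obtain ⟨ε₂, hε₂, h2⟩ := Metric.continuousAt_iff.1 hx ε₁ hε₁
  obtain ⟨ε₃, hε₃, h3⟩ := Metric.continuousAt_iff.1 hJc δ hδ
  refine ⟨min ε₂ ε₃, lt_min hε₂ hε₃, fun P hP hPu => ?_⟩
  have hd : dist P e < min ε₂ ε₃ := by rwa [dist_eq_norm]
  have hx1 : ‖conjOp e * P - 1‖ < ε₁ := by
    have := h2 (hd.trans_le (min_le_left _ _))
    rwa [hee, sub_self, dist_zero_right] at this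
  have hψ : ‖J (-Complex.I • log1p (conjOp e * P - 1))‖ < δ := by
    have := h3 (hd.trans_le (min_le_right _ _))
    rwa [hee, sub_self, log1p_zero, smul_zero, map_zero, dist_zero_right] at this
  obtain ⟨hl1, hl2⟩ := hlog _ hx1
  obtain ⟨φ, hφ⟩ : ∃ φ : W1 (2 * ρ), φ = -Complex.I • log1p (conjOp e * P - 1) := ⟨_, rfl⟩
  rw [← hφ] at hψ
  have hφ1 : ∀ (r : unitInterval) (s : ℝ), ‖ev φ r s‖ < 1 := fun r s => by
    rw [hφ, ev_smul, norm_mul, norm_neg, Complex.norm_I, one_mul]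
    exact (norm_ev_le _ (inS_ofReal _ _)).trans_lt hl2
  have hexp : ∀ (r : unitInterval) (s : ℝ),
      Complex.exp (Complex.I * ev φ r s) = conj (rl B.E r s) * rl P r s := fun r s => by
    have h4 : Complex.I * ev φ r s = ev (log1p (conjOp e * P - 1)) r s := by
      rw [hφ, ev_smul]
      linear_combination (-ev (log1p (conjOp e * P - 1)) r s) * Complex.I_sq
    rw [h4, ← ev_exp _ (inS_ofReal _ _), hl1, add_sub_cancel, ev_mul _ _ (inS_ofReal _ _), ev_conjOp,
      Complex.conj_ofReal, ← he]
    rfl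
  have hmB : ∀ k r, co (mB (J φ)) k r = co φ k r := fun k r => by
    rw [co_mB, hJ]
    have h5 : ((1 + 2 * π * |(k : ℝ)| : ℝ) : ℂ) ≠ 0 := by
      exact_mod_cast (by positivity : (0 : ℝ) < 1 + 2 * π * |(k : ℝ)|).ne'
    push_cast at h5 ⊢
    field_simp
  have hev := fun r (s : ℝ) => ev_eq_of_co hmB r s
  have him : ∀ (r : unitInterval) (s : ℝ), (ev φ r s).im = 0 := fun r s => by
    have h6 : ‖Complex.exp (Complex.I * ev φ r s)‖ = 1 := by
      rw [hexp, norm_mul, RCLike.norm_conj, hu, hPu, one_mul]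
    rw [Complex.norm_exp] at h6
    simpa using h6
  have hphi : phi (J φ) = mB (J φ) := ext_ev fun r s => by
    rw [phi, ev_reOp, hev, ← Complex.re_add_im (ev φ r s), him]
    simp
  refine ⟨J φ, hψ.le, fun r s => ?_, hphi, fun r s => ?_⟩
  · rw [hphi, rl, hev]
    exact hφ1 r s
  · rw [rl_tan, hphi, rl, rl, hev, hexp, ← mul_assoc]
    have h7 : ev B.E r s * conj (rl B.E r s) = 1 := by
      change rl B.E r s * _ = 1
      rw [Complex.mul_conj, Complex.normSq_eq_norm_sq, hu]
      simp
    rw [h7, one_mul]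

/-- The Fourier coefficients of a time integral. -/
theorem co_eq_integral_of_ev {ω ω' : C(unitInterval, ℝ≥0)} {f : Wien unitInterval ω}
    {g : Wien unitInterval ω'}
    (h : ∀ (r : unitInterval) (s : ℝ), ev f r s = ∫ r' in (0 : ℝ)..r, ev g (pI r') s)
    (k : ℤ) (r : unitInterval) : co f k r = ∫ r' in (0 : ℝ)..r, co g k (pI r') := by
  have hpI := continuous_pI
  have hg : Continuous fun p : ℝ × ℝ => ev g (pI p.1) p.2 :=
    (continuous_ev_param g).comp (by fun_prop : Continuous fun p : ℝ × ℝ => (pI p.1, p.2))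
  simp_rw [co_eq_integral, h, ← intervalIntegral.integral_mul_const]
  obtain ⟨G, hG⟩ : ∃ G : ℝ → ℝ → ℂ, ∀ s x,
      G s x = ev g (pI x) s * Complex.exp (-(2 * π * Complex.I * k * s)) := ⟨_, fun _ _ => rfl⟩
  have hGc : Continuous fun p : ℝ × ℝ => G p.1 p.2 := by
    simp_rw [hG]
    have := hg.comp continuous_swap
    simp only [Function.comp_def, Prod.fst_swap, Prod.snd_swap] at this
    fun_prop
  simp_rw [← hG]
  simp only [intervalIntegral.integral_of_le r.2.1, intervalIntegral.integral_of_le zero_le_one]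
  refine integral_integral_swap ?_
  rw [Measure.prod_restrict]
  exact (hGc.continuousOn.integrableOn_compact (isCompact_Icc.prod isCompact_Icc)).mono_set
    (prod_mono Ioc_subset_Icc_self Ioc_subset_Icc_self)

end Wien

namespace Wien

variable {ρ β : ℝ} (hβ₁ : 1 < β) (hβ₂ : β < 2) (n : ℝ → ℝ)
  (hn : IntegrableOn n 𝕁)

/-- The angle of a moving curve solves the fixed point equation. -/
theorem eq_volterra_of_angle (hρ : 0 < ρ) {B : Base ρ} {ψ : W1 ρ} {τ : ℝ} (hphi : phi ψ = mB ψ)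
    (h : ∀ (r : unitInterval) (s : ℝ), rl (phi ψ) r s =
      ∫ r' in (0 : ℝ)..r, τ * rl (B.rate hβ₁ hβ₂ n hn hρ ψ) (pI r') s) :
    ψ = (τ : ℂ) • (volterra (dsym β) τ ρ hρ).op (B.nonlin β hβ₁ hβ₂ n hn ψ) := by
  obtain ⟨N, hN⟩ : ∃ N, N = B.nonlin β hβ₁ hβ₂ n hn ψ := ⟨_, rfl⟩
  have hco : ∀ k r, co (B.rate hβ₁ hβ₂ n hn hρ ψ) k r =
      Complex.I * dsym β k * co (phi ψ) k r + co N k r := fun k r => by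
    rw [Base.rate, co_add, co_dispOp, ← hN]
    exact congrArg _ (co_restr_id _ _ _ _)
  have h1 := co_eq_integral_of_ev (f := phi ψ) (g := (τ : ℂ) • B.rate hβ₁ hβ₂ n hn hρ ψ)
    (fun r s => by simp_rw [ev_smul]; exact h r s)
  rw [← hN]
  refine ext_co fun k r => ?_
  have hc := continuous_co_pI N k
  have hpr : ∀ {x : ℝ} (hx : x ∈ Icc (0 : ℝ) 1), pI x = ⟨x, hx⟩ := fun hx => projIcc_of_mem _ hx
  have h2 := eq_duhamel (a := τ * dsym β k) (F := fun r => τ * co N k (pI r))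
    (u := fun r => co (phi ψ) k (pI r)) (by fun_prop) (continuous_co_pI _ _)
    (fun x hx => by
      rw [h1, hpr hx]
      refine intervalIntegral.integral_congr fun y _ => ?_
      simp only [co_smul, hco]
      push_cast
      ring) r.2
  rw [pI_coe, hphi, co_mB] at h2
  rw [co_smul, co_volterra]
  have h3 : ((1 + 2 * π * |(k : ℝ)| : ℝ) : ℂ) ≠ 0 := by exact_mod_cast (one_add_pos k).ne'
  have h4 : co ψ k r = (1 + 2 * π * |(k : ℝ)| : ℝ) * ∫ r' in (0 : ℝ)..r,
      Complex.exp (Complex.I * (τ * dsym β k * (r - r') : ℝ)) * (τ * co N k (pI r')) := by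
    rw [← h2, ← mul_assoc, ← Complex.ofReal_mul, mul_inv_cancel₀ (one_add_pos k).ne']
    simp
  rw [h4, mul_left_comm, ← intervalIntegral.integral_const_mul (τ : ℂ)]
  push_cast
  congr 1
  refine intervalIntegral.integral_congr fun y _ => ?_
  simp only [pI]
  ring

/-- The velocity of a unit state, from its normal part. -/
theorem rl_vel_eq (h0 : ∀ σ, n σ = 0) (hρ : 0 < ρ) {B : Base ρ} {ψ : W1 ρ} {r : unitInterval}
    (hψ : UnitState (rl (B.tan ψ) r) (rl (B.kk ψ) r) (fun s => rl B.k' r s + rl (phi2 hρ ψ) r s))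
    (hV : ∀ (σ : Sg) (s : ℝ), ev (B.vv β ψ) (r, σ) s = vq β (rl (B.tan ψ) r) s σ)
    {p p' Z' : ℝ → ℂ} (hp : ∀ s, rl (B.tan ψ) r s = p s) (hp' : ∀ s, HasDerivAt p (p' s) s)
    (hZ : ∀ s, HasDerivAt (zetaU β p p') (Z' s) s) (s : ℝ) :
    rl (B.vel hβ₁ hβ₂ n hn ψ) r s =
      zetaU β p p' s + tang (fun s => (conj (p s) * Z' s).re / ‖p s‖ ^ 2) s * p s := by
  obtain rfl : rl (B.tan ψ) r = p := funext hp
  obtain rfl : rl (B.tan' ψ) r = p' := funext fun s => by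
    rw [rl_tan']; exact (hψ.hasDerivAt s).unique (hp' s)
  obtain ⟨h1, h2, h3, h4⟩ := ll_props hβ₁ hβ₂ n hn hV
  have h5 : ∀ s, (conj (rl (B.tan ψ) r s) * Z' s).re / ‖rl (B.tan ψ) r s‖ ^ 2 =
      (rl (B.rr β hβ₁ hβ₂ ψ) r s).re := fun s => by
    have h6 := hasDerivAt_zetaU hβ₁ hβ₂ (E' := rl (B.tan' ψ) r)
      (fun s => by rw [rl_tan']; exact hψ.hasDerivAt s) (fun s => rl_tan' B ψ r s)
      hψ.hasDerivAt_k hψ.continuous_k' hψ.norm_eq hψ.dq_pos s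
    rw [(hZ s).unique h6, ← h1, hψ.re_conj_mul]
  simp_rw [h5]
  have h9 := eq_mean_sub_integral (lam := fun s => (rl (B.ll β hβ₁ hβ₂ n hn ψ) r s).re)
    (f := fun s => (rl (B.rr β hβ₁ hβ₂ ψ) r s).re) (m := (co (B.rr β hβ₁ hβ₂ ψ) 0 r).re)
    (Complex.continuous_re.comp (continuous_rl _ _))
    (fun s => by
      have h10 : HasDerivAt (fun s => (rl (B.ll β hβ₁ hβ₂ n hn ψ) r s).re) _ s :=
        Complex.reCLM.hasFDerivAt.comp_hasDerivAt s (h3 s)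
      exact h10.congr_deriv (by simp)) (fun s => by simp only [rl_periodic _ _ s]) s
  rw [rl_vel hβ₁ hβ₂ n hn hV, ← Complex.conj_eq_iff_re.1 (h2 s)]
  have h11 : rl (B.ll β hβ₁ hβ₂ n hn ψ) r 0 = 0 := by
    rw [h4]
    simp [h0]
  rw [h9, h11, Complex.zero_re, zero_add, tang]

/-- A moving curve with unit tangent in the chart given by the base has the angle of a fixed point. -/
theorem eq_volterra_of_motion (hρ : 0 < ρ) {B : Base ρ} (hB : IsBase β B) {ψ : W1 ρ} {τ : ℝ}
    (hconst : ∀ r s, rl B.E r s = rl B.E 0 s) (hphi : phi ψ = mB ψ)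
    (hsmall : ∀ r s, ‖rl (phi ψ) r s‖ < 1)
    (hψ : IsState β hρ B ψ)
    (h0 : ∀ s, rl (B.tan ψ) 0 s = rl B.E 0 s) {l : ℝ → ℝ} (hl : Continuous l) (hlpos : ∀ r, 0 < l r)
    {C : ℝ → ℝ → ℂ} (hC : ∀ r ∈ Icc (0 : ℝ) 1, ∀ s, C r s = C 0 s + ∫ r' in (0 : ℝ)..r,
      τ * l r' * rl (B.vel hβ₁ hβ₂ n hn ψ) (pI r') s)
    (hCs : ∀ r ∈ Icc (0 : ℝ) 1, ∀ s, HasDerivAt (C r) (l r * rl (B.tan ψ) (pI r) s) s) :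
    ψ = (τ : ℂ) • (volterra (dsym β) τ ρ hρ).op (B.nonlin β hβ₁ hβ₂ n hn ψ) ∧
      ∀ r ∈ Icc (0 : ℝ) 1, l r = l 0 * Real.exp (∫ r' in (0 : ℝ)..r, τ * B.mean hβ₁ hβ₂ ψ (pI r')) := by
  obtain ⟨R, hR⟩ : ∃ R, R = B.rate hβ₁ hβ₂ n hn hρ ψ := ⟨_, rfl⟩
  obtain ⟨m, hm⟩ : ∃ m : ℝ → ℝ, ∀ r, m r = B.mean hβ₁ hβ₂ ψ (pI r) := ⟨_, fun _ => rfl⟩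
  have hpi0 : pI 0 = 0 := pI_coe 0
  have hmc : Continuous m := by
    rw [funext hm]
    exact Complex.continuous_re.comp (continuous_co_pI _ _)
  have hsl : ∀ s : ℝ, Continuous fun r : ℝ => (r, s) := fun s => by fun_prop
  have hRre : ∀ r s, ((rl R r s).re : ℂ) = rl R r s := fun r s => by
    refine Complex.conj_eq_iff_re.1 ?_
    rw [hR, rl_rate, map_add, nonlin_real hβ₁ hβ₂ n hn hρ hB hψ]
    have h1 := conj_deriv_of_conj (hψ r).1.conj_k (hψ r).1.hasDerivAt_k
    have h2 := conj_deriv_of_conj (hB.state r).conj_k (hB.state r).hasDerivAt_k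
    rw [dispU_conj fun s => ?_]
    have := h1 s
    rw [map_add, h2] at this
    exact add_left_cancel this
  have hRc := continuous_rl_pI R
  have hVc := continuous_rl_pI (B.vel hβ₁ hβ₂ n hn ψ)
  have hEc := continuous_rl_pI (B.tan ψ)
  have hD := fun r (hr : r ∈ Icc (0 : ℝ) 1) s => deriv_eq_integral
    (X := fun r s => τ * l r * rl (B.vel hβ₁ hβ₂ n hn ψ) (pI r) s)
    (X' := fun r s => τ * l r * (rl (B.tan ψ) (pI r) s * (Complex.I * rl R (pI r) s + m r)))
    (by fun_prop) (by fun_prop) (fun r s => by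
      rw [hR, hm]
      exact (hasDerivAt_vel hβ₁ hβ₂ n hn hρ (hψ _).1 (hψ _).2 s).const_mul _) hC hCs hr s
  have hexp : ∀ r ∈ Icc (0 : ℝ) 1, ∀ s, l r * rl (B.tan ψ) (pI r) s = l 0 * rl B.E 0 s *
      Complex.exp (((∫ r' in (0 : ℝ)..r, τ * m r' : ℝ) : ℂ) +
        Complex.I * (∫ r' in (0 : ℝ)..r, τ * (rl R (pI r') s).re : ℝ)) := fun r hr s => by
    have h1 := hEc.comp (hsl s)
    have h2 := hRc.comp (hsl s)
    simp only [Function.comp_def] at h1 h2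
    have h3 := eq_mul_exp_of_integral (y := fun r => l r * rl (B.tan ψ) (pI r) s)
      (a := fun r => τ * (Complex.I * rl R (pI r) s + m r)) (by fun_prop) (by fun_prop)
      (fun r hr => by
        rw [hD r hr s]
        congr 1
        refine intervalIntegral.integral_congr fun y _ => ?_
        ring) hr
    simp only [hpi0, h0] at h3
    rw [h3, ← intervalIntegral.integral_ofReal, ← intervalIntegral.integral_ofReal,
      ← intervalIntegral.integral_const_mul, ← intervalIntegral.integral_add
      (Continuous.intervalIntegrable (by fun_prop) _ _)
      (Continuous.intervalIntegrable (by
        have := Complex.continuous_re.comp h2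
        simp only [Function.comp_def] at this
        fun_prop) _ _)]
    congr 2
    refine intervalIntegral.integral_congr fun y _ => ?_
    rw [← hRre]
    push_cast
    simp only [Complex.ofReal_re]
    ring
  have hu := fun r s => (hψ r).1.norm_eq s
  have hl' : ∀ r ∈ Icc (0 : ℝ) 1, l r = l 0 * Real.exp (∫ r' in (0 : ℝ)..r, τ * m r') := fun r hr => by
    have h1 := congrArg norm (hexp r hr 0)
    rw [norm_mul, norm_mul, norm_mul, hu, (hB.state 0).norm_eq, Complex.norm_exp, Complex.norm_real,
      Complex.norm_real, Real.norm_of_nonneg (hlpos _).le, Real.norm_of_nonneg (hlpos _).le] at h1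
    simpa using h1
  refine ⟨eq_volterra_of_angle hβ₁ hβ₂ n hn hρ hphi fun r s => ?_, fun r hr => ?_⟩
  · have hph0 : (rl (phi ψ) 0 s).re = 0 := by
      have h1 := h0 s
      have hE : rl B.E 0 s ≠ 0 := norm_ne_zero_iff.1 (by rw [(hB.state 0).norm_eq]; simp)
      rw [rl_tan, mul_eq_left₀ hE, Complex.exp_eq_one_iff] at h1
      obtain ⟨k, hk⟩ := h1
      have h2 : rl (phi ψ) 0 s = ((k * (2 * π) : ℝ) : ℂ) := by
        have h3 : Complex.I * rl (phi ψ) 0 s = Complex.I * ((k * (2 * π) : ℝ) : ℂ) := by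
          rw [hk]; push_cast; ring
        exact mul_left_cancel₀ Complex.I_ne_zero h3
      have h4 := hsmall 0 s
      rw [h2, Complex.norm_real, Real.norm_eq_abs, abs_mul, abs_of_pos Real.two_pi_pos] at h4
      have h5 : |(k : ℝ)| < 1 := by nlinarith [Real.pi_gt_three, abs_nonneg (k : ℝ)]
      have h6 : k = 0 := Int.abs_lt_one_iff.1 (by exact_mod_cast h5)
      rw [h2, h6]
      simp
    have hre : ∀ r s, ((rl (phi ψ) r s).re : ℂ) = rl (phi ψ) r s := fun r s => by
      rw [rl_phi, Complex.ofReal_re]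
    have h1 := (continuous_rl_pI (phi ψ)).comp (hsl s)
    have h2 := Complex.continuous_re.comp (hRc.comp (hsl s))
    simp only [Function.comp_def] at h1 h2
    have h3 := phase_unique (φ := fun r => (rl (phi ψ) (pI r) s).re)
      (Θ := fun r => ∫ r' in (0 : ℝ)..r, τ * (rl R (pI r') s).re)
      (Complex.continuous_re.comp h1)
      (intervalIntegral.continuous_primitive
        (fun _ _ => Continuous.intervalIntegrable (by fun_prop) _ _) 0)
      (by simp only [hpi0, hph0, intervalIntegral.integral_same]) (fun r hr => by
        have h4 := hexp r hr s
        rw [rl_tan, hconst, hl' r hr, Complex.exp_add] at h4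
        have h5 : ((l 0 * Real.exp (∫ r' in (0 : ℝ)..r, τ * m r') : ℝ) : ℂ) ≠ 0 := by
          exact_mod_cast (mul_pos (hlpos 0) (Real.exp_pos _)).ne'
        have hE : rl B.E 0 s ≠ 0 := norm_ne_zero_iff.1 (by rw [(hB.state 0).norm_eq]; simp)
        rw [hre]
        refine mul_left_cancel₀ (mul_ne_zero h5 hE) ?_
        rw [← mul_assoc] at h4
        rw [h4]
        push_cast
        ring) r.2
    simp only [pI_coe] at h3
    rw [← hre, h3, ← intervalIntegral.integral_ofReal, ← hR]
    refine intervalIntegral.integral_congr fun y _ => ?_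
    rw [← hRre]
    push_cast
    simp
  · rw [hl' r hr]
    simp only [hm]

end Wien

namespace Wien

variable {ρ β : ℝ} (hβ₁ : 1 < β) (hβ₂ : β < 2) (n : ℝ → ℝ)
  (hn : IntegrableOn n 𝕁)

/-- A motion is given, for a short time, by a small fixed point. -/
theorem IsMotion.exists_fixedPoint {T : ℝ} {a : ℝ≥0} {c : ℝ → ℝ → ℂ} {l : C(Icc (0 : ℝ) T, ℝ)}
    {F : Wien (Icc (0 : ℝ) T) (.const _ a)} (hM : IsMotion β c l F) (hT : 0 < T) (hn0 : ∀ σ, n σ = 0)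
    (hρ : 0 < ρ) (hω : ∀ r, wt (2 * ρ) r ≤ a) {B : Base ρ} (hB : IsBase β B) {E₀ : ℝ → ℂ}
    (hBE : ∀ r s, rl B.E r s = E₀ s) {L₀ : ℝ} (hL₀ : 0 < L₀)
    (hz : ∀ s, HasDerivAt (c 0) (L₀ * E₀ s) s) {δ : ℝ} (hδ : 0 < δ) :
    ∃ τ₀ > 0, ∀ τ : ℝ, 0 < τ → τ ≤ τ₀ → ∃ ψ : W1 ρ, ‖ψ‖ ≤ δ ∧
      ψ = (τ : ℂ) • (volterra (dsym β) τ ρ hρ).op (B.nonlin β hβ₁ hβ₂ n hn ψ) ∧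
      ∃ q : C(unitInterval, Icc (0 : ℝ) T),
        (∀ r ∈ Icc (0 : ℝ) 1, (q (pI r) : ℝ) = ∫ r' in (0 : ℝ)..r,
          τ * (L₀ * Real.exp (∫ x in (0 : ℝ)..r', τ * B.mean hβ₁ hβ₂ ψ (pI x))) ^ β) ∧
        ∀ r ∈ Icc (0 : ℝ) 1, ∀ s, c (q (pI r)) s = c 0 s + ∫ r' in (0 : ℝ)..r,
          τ * (L₀ * Real.exp (∫ x in (0 : ℝ)..r', τ * B.mean hβ₁ hβ₂ ψ (pI x)) : ℝ) *
            rl (B.vel hβ₁ hβ₂ n hn ψ) (pI r') s := by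
  have hpi0 : pI 0 = 0 := pI_coe 0
  have hω' : ∀ r, wt ρ r ≤ a := fun r => by
    have h1 := wt_add_le hρ.le r
    have h2 : (wt (2 * ρ) r : ℝ) ≤ a := hω r
    have h3 := mul_pos Real.pi_pos hρ
    exact NNReal.coe_le_coe.1 (by linarith)
  obtain ⟨t₀, ht₀⟩ : ∃ t₀ : Icc (0 : ℝ) T, t₀ = ⟨0, left_mem_Icc.2 hT.le⟩ := ⟨_, rfl⟩
  have ht₀' : (t₀ : ℝ) = 0 := by rw [ht₀]
  have hu : ∀ r s, ‖rl B.E r s‖ = 1 := fun r s => (hB.state r).norm_eq s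
  have hlF : ∀ s, (L₀ : ℂ) * E₀ s = l t₀ * ev F t₀ s := fun s => by
    have := hM.hasDerivAt t₀ s
    rw [ht₀'] at this
    exact (hz s).unique this
  have hl0 : L₀ = l t₀ := by
    have h2 := congrArg norm (hlF 0)
    have h3 := hM.norm_zero t₀
    rwa [norm_mul, norm_mul, h3, ← hBE 0, hu,
      Complex.norm_real, Complex.norm_real, Real.norm_of_nonneg hL₀.le,
      Real.norm_of_nonneg (hM.pos _).le, mul_one, mul_one] at h2
  have hF0 : ∀ s : ℝ, ev F t₀ s = E₀ s := fun s => by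
    have h4 := hlF s
    rw [← hl0] at h4
    exact (mul_left_cancel₀ (by exact_mod_cast hL₀.ne') h4).symm
  obtain ⟨δ₁, hδ₁, hst⟩ := exists_state β hρ B hB
  obtain ⟨ε₁, hε₁, hpow⟩ := exists_pow β B hB
  have hbase : restr (.const _ t₀) hω' F = B.E := ext_ev fun r s => by
    refine (ev_restr _ _ _ _ (inS_ofReal _ _)).trans ?_
    exact (hF0 s).trans (hBE r s).symm
  obtain ⟨ε₂, hε₂, hang⟩ := exists_angle (e := restr (.const _ t₀) hω F) (B := B) hρ
    (fun r s => by
      refine (ev_restr _ _ _ _ (inS_ofReal _ _)).trans ?_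
      exact (hF0 s).trans (hBE r s).symm) hu (lt_min hδ hδ₁)
  obtain ⟨d₁, hd₁, hc₁⟩ := exists_norm_restr_sub_lt hω' F t₀ hε₁
  obtain ⟨d₂, hd₂, hc₂⟩ := exists_norm_restr_sub_lt hω F t₀ hε₂
  obtain ⟨τ₀, hτ₀, hq⟩ := exists_time_change (β := β) hT l hM.pos (lt_min hd₁ hd₂)
  refine ⟨τ₀, hτ₀, fun τ hτ hττ => ?_⟩
  obtain ⟨q, hqd, hqi⟩ := hq τ hτ hττ
  rw [← ht₀] at hqd
  have hq0 : q 0 = t₀ := Subtype.ext (by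
    have := hqi 0 (by simp)
    rw [hpi0, intervalIntegral.integral_same] at this
    exact this.trans ht₀'.symm)
  have hP₁ := hc₁ q fun r => (hqd r).trans_le (min_le_left _ _)
  have hP₂ := hc₂ q fun r => (hqd r).trans_le (min_le_right _ _)
  rw [hbase] at hP₁
  obtain ⟨p, p', Z', hp, hp', hZ', hpu, hcq⟩ := IsMotion.norm_eq_one hβ₁ hβ₂ hM hρ hω hω' (B := B) hqi
    (hpow _ hP₁) (fun s => by rw [hq0, hF0, ← hBE 0, hu])
  have hP₂' : ∀ r s, rl (restr q hω F) r s = p r s := fun r s => by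
    rw [hp, pI_coe]
    exact ev_restr _ _ _ _ (inS_ofReal _ _)
  obtain ⟨ψ, hψδ, hψ1, hphi, htan⟩ := hang _ hP₂ fun r s => by rw [hP₂', hpu r r.2]
  have hψ := hst ψ (hψδ.trans (min_le_right _ _))
  have htan' : ∀ r s, rl (B.tan ψ) (pI r) s = p r s := fun r s => by
    rw [htan, hP₂', hp, hp, pI_coe]
  have hq0' : c (q 0) = c 0 := by rw [hq0, ht₀']
  have hC : ∀ r ∈ Icc (0 : ℝ) 1, ∀ s, c (q (pI r)) s = c 0 s + ∫ r' in (0 : ℝ)..r,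
      τ * l (q (pI r')) * rl (B.vel hβ₁ hβ₂ n hn ψ) (pI r') s := fun r hr s => by
    rw [hcq r hr s, hq0']
    congr 1
    refine intervalIntegral.integral_congr fun x _ => ?_
    rw [rl_vel_eq hβ₁ hβ₂ n hn hn0 hρ (hψ _).1 (hψ _).2 (htan' x) (hp' x) (hZ' x)]
  obtain ⟨hfix, hl⟩ := eq_volterra_of_motion (τ := τ) hβ₁ hβ₂ n hn hρ hB
    (fun r s => by rw [hBE, hBE]) hphi hψ1 hψ
    (fun s => by rw [← hpi0, htan', hp, hpi0, hq0, hF0, hBE]) (l := fun r => l (q (pI r)))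
    (by have := continuous_pI; fun_prop) (fun r => hM.pos _) (C := fun r s => c (q (pI r)) s)
    (fun r hr s => by simp only [hpi0]; rw [hC r hr s, hq0'])
    (fun r hr s => by rw [htan', hp]; exact hM.hasDerivAt _ s)
  simp only [hpi0, hq0, ← hl0] at hl
  refine ⟨ψ, hψδ.trans (min_le_left _ _), hfix, q, fun r hr => ?_, fun r hr s => ?_⟩
  · rw [hqi r hr]
    refine intervalIntegral.integral_congr fun x hx => ?_
    rw [uIcc_of_le hr.1] at hx
    rw [hl x ⟨hx.1, hx.2.trans hr.2⟩]
  · rw [hC r hr s]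
    congr 1
    refine intervalIntegral.integral_congr fun x hx => ?_
    rw [uIcc_of_le hr.1] at hx
    rw [hl x ⟨hx.1, hx.2.trans hr.2⟩]

end Wien

/-- Motions from the same initial curve agree for a short time. -/
theorem eq_of_isMotion {β T₁ T₂ : ℝ} (hβ₁ : 1 < β) (hβ₂ : β < 2) {a₁ a₂ : ℝ≥0} (ha₁ : 0 < a₁) (ha₂ : 0 < a₂)
    {c₁ c₂ : ℝ → ℝ → ℂ} {l₁ : C(Icc (0 : ℝ) T₁, ℝ)} {l₂ : C(Icc (0 : ℝ) T₂, ℝ)}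
    {F₁ : Wien (Icc (0 : ℝ) T₁) (.const _ a₁)} {F₂ : Wien (Icc (0 : ℝ) T₂) (.const _ a₂)}
    (hM₁ : IsMotion β c₁ l₁ F₁) (hM₂ : IsMotion β c₂ l₂ F₂) (hT₁ : 0 < T₁) (hT₂ : 0 < T₂)
    (h0 : c₁ 0 = c₂ 0) {E₀ : ℝ → ℂ} (hE : AnalyticOnNhd ℝ E₀ univ)
    (hper : Function.Periodic E₀ 1) (hu : ∀ s, ‖E₀ s‖ = 1)
    (hpos : ∀ s, ∀ σ ∈ 𝕁, 0 < dq E₀ s σ) {L₀ : ℝ} (hL₀ : 0 < L₀)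
    (hz : ∀ s, HasDerivAt (c₁ 0) (L₀ * E₀ s) s) :
    ∃ ε > 0, ∀ t ∈ Icc 0 ε, ∀ s, c₁ t s = c₂ t s := by
  have hpi := Real.pi_pos
  obtain ⟨n, hn0⟩ : ∃ n : ℝ → ℝ, ∀ σ, n σ = 0 := ⟨fun _ => 0, fun _ => rfl⟩
  have hn : IntegrableOn n 𝕁 := by
    rw [show n = fun _ => 0 from funext hn0]
    exact integrableOn_zero
  obtain ⟨ρ₀, hρ₀, hbase⟩ := Wien.exists_base β hE hper hu hpos
  obtain ⟨a, ha, haa₁, haa₂⟩ : ∃ a : ℝ≥0, 0 < a ∧ a ≤ a₁ ∧ a ≤ a₂ :=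
    ⟨min a₁ a₂, lt_min ha₁ ha₂, min_le_left _ _, min_le_right _ _⟩
  obtain ⟨ρ, hρ, hρρ₀, hρa⟩ : ∃ ρ > 0, ρ ≤ ρ₀ ∧ 4 * π * ρ ≤ a := by
    have ha' : (0 : ℝ) < a := ha
    refine ⟨min ρ₀ (a / (4 * π)), lt_min hρ₀ (by positivity), min_le_left _ _, ?_⟩
    have := min_le_right ρ₀ (a / (4 * π))
    rwa [le_div_iff₀' (by positivity)] at this
  have hω : ∀ r, Wien.wt (2 * ρ) r ≤ a := fun r => NNReal.coe_le_coe.1 (by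
    rw [Wien.wt_apply (by linarith)]
    have := r.2.1
    have : 0 ≤ π * ρ * r := by positivity
    linarith)
  obtain ⟨B, hB, hBE⟩ := hbase ρ hρ hρρ₀
  obtain ⟨δ₀, hδ₀, -, τu, hτu, huniq⟩ := exists_unique_small_fixedPoint (B.nonlin β hβ₁ hβ₂ n hn)
    (B.contDiffAt_nonlin β hβ₁ hβ₂ n hn) (fun T => (Wien.volterra (Wien.dsym β) T ρ hρ).op) (1 + 2 / ρ)
    (fun T f => Wien.OpData.norm_op_le _ f)
  obtain ⟨τ₁, hτ₁, hf₁⟩ := Wien.IsMotion.exists_fixedPoint hβ₁ hβ₂ n hn hM₁ hT₁ hn0 hρ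
    (fun r => (hω r).trans haa₁) hB hBE hL₀ hz hδ₀
  obtain ⟨τ₂, hτ₂, hf₂⟩ := Wien.IsMotion.exists_fixedPoint hβ₁ hβ₂ n hn hM₂ hT₂ hn0 hρ
    (fun r => (hω r).trans haa₂) hB hBE hL₀ (by rwa [← h0]) hδ₀
  obtain ⟨τ, hτ, h1, h2, h3⟩ : ∃ τ > 0, τ ≤ τu ∧ τ ≤ τ₁ ∧ τ ≤ τ₂ :=
    ⟨min τu (min τ₁ τ₂), lt_min hτu (lt_min hτ₁ hτ₂), min_le_left _ _,
      (min_le_right _ _).trans (min_le_left _ _), (min_le_right _ _).trans (min_le_right _ _)⟩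
  obtain ⟨ψ₁, hψ₁, hfix₁, q₁, hq₁, hc₁⟩ := hf₁ τ hτ h2
  obtain ⟨ψ₂, hψ₂, hfix₂, q₂, hq₂, hc₂⟩ := hf₂ τ hτ h3
  obtain rfl := huniq τ hτ h1 ψ₁ ψ₂ hψ₁ hψ₂ hfix₁ hfix₂
  have hpI := Wien.continuous_pI
  obtain ⟨g, hg⟩ : ∃ g : ℝ → ℝ, ∀ r, g r = q₁ (Wien.pI r) := ⟨_, fun _ => rfl⟩
  have hgc : Continuous g := by
    rw [funext hg]
    fun_prop
  have hg0 : g 0 = 0 := by rw [hg, hq₁ 0 (by simp), intervalIntegral.integral_same]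
  have hg1 : 0 < g 1 := by
    have hmc : Continuous fun r => B.mean hβ₁ hβ₂ ψ₁ (Wien.pI r) :=
      Complex.continuous_re.comp (Wien.continuous_co_pI _ _)
    rw [hg, hq₁ 1 (by simp)]
    refine intervalIntegral.intervalIntegral_pos_of_pos
      (Continuous.intervalIntegrable ?_ _ _) (fun x => by positivity) one_pos
    refine continuous_const.mul (Continuous.rpow_const ?_ fun x => Or.inl (by positivity))
    exact continuous_const.mul (Real.continuous_exp.comp (intervalIntegral.continuous_primitive
        (fun _ _ => Continuous.intervalIntegrable (by fun_prop) _ _) 0))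
  refine ⟨g 1, hg1, fun t ht s => ?_⟩
  rw [← hg0] at ht
  obtain ⟨r, hr, rfl⟩ := intermediate_value_Icc zero_le_one hgc.continuousOn ht
  have h4 : (q₂ (Wien.pI r) : ℝ) = g r := by rw [hg, hq₁ r hr, hq₂ r hr]
  rw [← h4, hc₂ r hr s, h4, hg, hc₁ r hr s, h0]

theorem InX.analyticOnNhd {l : ℕ} {ρ : ℝ} {M : ℝ≥0} {v : ℝ → Plane} (hρ : 0 < ρ) (h : InX l ρ M v) :
    AnalyticOnNhd ℝ v univ := by
  obtain ⟨f, -, -, -, hf, -, -, -, hfv, -⟩ := h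
  obtain ⟨A, hA⟩ : ∃ A : CPlane →L[ℝ] Plane, ∀ x i, A x i = (x i).re :=
    ⟨(EuclideanSpace.equiv (Fin 2) ℝ).symm.toContinuousLinearMap ∘L ContinuousLinearMap.pi fun i =>
      Complex.reCLM ∘L (EuclideanSpace.proj (𝕜 := ℂ) (ι := Fin 2) i).restrictScalars ℝ,
      fun _ _ => rfl⟩
  have h1 : v = fun x : ℝ => A (f x) := funext fun x => by
    ext i
    rw [hA, hfv, Complex.ofReal_re]
  have h2 : AnalyticOnNhd ℝ f (strip ρ) := (hf.holo.analyticOnNhd (isOpen_strip ρ)).restrictScalars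
  have h3 : AnalyticOnNhd ℝ (fun x : ℝ => f x) univ := fun x _ =>
    AnalyticAt.comp (g := f) (h2 _ (by simpa [strip] using hρ)) (Complex.ofRealCLM.analyticAt x)
  rw [h1]
  exact A.comp_analyticOnNhd h3

theorem InX.arcChord {l : ℕ} {ρ : ℝ} {M : ℝ≥0} {v : ℝ → Plane} (hρ : 0 < ρ) (h : InX l ρ M v) :
    ArcChord v := by
  obtain ⟨-, -, -, G, -, -, -, hG, -, -, -, hGv, -⟩ := h
  have hc : ContinuousOn (fun p : ℝ × ℝ => G ((p.1 : ℂ), (p.2 : ℂ))) (Icc 0 1 ×ˢ Icc 0 1) :=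
    hG.holo.continuousOn.comp (by fun_prop) fun p _ => by simpa [strip] using hρ
  obtain ⟨C, hC⟩ := (isCompact_Icc.prod isCompact_Icc).exists_bound_of_continuousOn hc
  refine (essSup_le_of_ae_le (ENNReal.ofReal C) ?_).trans_lt ENNReal.ofReal_lt_top
  filter_upwards [ae_restrict_mem (measurableSet_Ioc.prod measurableSet_Ioc)] with p hp
  have h1 := hC p ⟨Ioc_subset_Icc_self hp.1, Ioc_subset_Icc_self hp.2⟩
  obtain ⟨h2, h3⟩ := hGv p.1 p.2
  rw [h3, Complex.norm_real, Real.norm_of_nonneg ENNReal.toReal_nonneg] at h1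
  rw [← ENNReal.ofReal_toReal h2]
  exact ENNReal.ofReal_le_ofReal h1

theorem IsCDESolution.shift {β T t₀ : ℝ} {z : ℝ → ℝ → Plane} {lam : ℝ → ℝ → ℝ}
    (h : IsCDESolution β T z lam) (ht₀ : 0 ≤ t₀) :
    IsCDESolution β (T - t₀) (fun t => z (t₀ + t)) fun t => lam (t₀ + t) := by
  have hmem : MapsTo (fun t => t₀ + t) (Icc 0 (T - t₀)) (Icc 0 T) := fun t ht =>
    ⟨by linarith [ht.1], by linarith [ht.2]⟩
  refine ⟨fun t ht => h.periodic _ (hmem ht), fun t ht => h.periodic_lam _ (hmem ht),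
    fun t ht => h.lam_zero _ (hmem ht), fun t ht => h.integrable _ (hmem ht), fun t ht s => ?_⟩
  have h1 : HasDerivWithinAt (fun t => t₀ + t) 1 (Icc 0 (T - t₀)) t :=
    (hasDerivWithinAt_id t _).const_add t₀
  have h2 := (h.equation _ (hmem ht) s).scomp t h1 hmem
  rwa [one_smul] at h2

theorem exists_eq_of_isCDESolution {β T ρ : ℝ} {l : ℕ} {M₁ M₂ : ℝ≥0} (hβ₁ : 1 < β) (hβ₂ : β < 2)
    (hρ : 0 < ρ) (hT : 0 < T) {v w : ℝ → ℝ → Plane} (hXv : ∀ t ∈ Icc 0 T, InX l ρ M₁ (v t))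
    (hXw : ∀ t ∈ Icc 0 T, InX l ρ M₂ (w t))
    (hv : IsCDESolution β T v fun t => tangentialCoeff β (v t))
    (hw : IsCDESolution β T w fun t => tangentialCoeff β (w t)) (h0 : v 0 = w 0) {L : ℝ}
    (hL : ∀ s, ‖deriv (v 0) s‖ = L) : ∃ ε > 0, ∀ t ∈ Icc 0 ε, v t = w t := by
  have h0T : (0 : ℝ) ∈ Icc 0 T := left_mem_Icc.2 hT.le
  have han := (hXv 0 h0T).analyticOnNhd hρ
  obtain ⟨c, hc, hch⟩ := ((hXv 0 h0T).arcChord hρ).exists_chord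
    (continuousOn_univ.1 han.continuousOn) (hv.periodic 0 h0T)
  obtain ⟨hL₀, z, E, hz, hE, hEper, hu, hpos, hzd, -⟩ :=
    exists_unit_tangent (hv.periodic 0 h0T) han hc hch hL
  obtain ⟨a, ha⟩ : ∃ a : ℝ≥0, (a : ℝ) = π * ρ / 4 :=
    ⟨⟨_, by have := Real.pi_pos; positivity⟩, rfl⟩
  have ha0 : 0 < a := NNReal.coe_pos.1 (by rw [ha]; have := Real.pi_pos; positivity)
  obtain ⟨m₁, F₁, hM₁⟩ := exists_isMotion hρ hXv hv ha.le
  obtain ⟨m₂, F₂, hM₂⟩ := exists_isMotion hρ hXw hw ha.le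
  have hz0 : (fun s => toPlane.symm (v 0 s)) = z := funext fun s => by rw [← hz]; simp
  obtain ⟨ε, hε, heq⟩ := eq_of_isMotion hβ₁ hβ₂ ha0 ha0 hM₁ hM₂ hT hT (by simp only [h0]) hE hEper hu
    hpos hL₀ (by simp only [hz0]; exact hzd)
  exact ⟨ε, hε, fun t ht => funext fun s => toPlane.symm.injective (heq t ht s)⟩

theorem InY.eq_of_isCDESolution {β T ρ₀ κ : ℝ} {l : ℕ} (hβ₁ : 1 < β) (hβ₂ : β < 2) (hκ : 0 ≤ κ)
    (hρ : κ * T < ρ₀) {v w : ℝ → ℝ → Plane} (hXv : InY l ρ₀ κ T v) (hXw : InY l ρ₀ κ T w)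
    (hv : IsCDESolution β T v fun t => tangentialCoeff β (v t))
    (hw : IsCDESolution β T w fun t => tangentialCoeff β (w t)) (h0 : v 0 = w 0)
    (hL : ∀ t ∈ Icc 0 T, ∃ L, ∀ s, ‖deriv (v t) s‖ = L) : ∀ t ∈ Icc 0 T, v t = w t := by
  obtain ⟨M₁, hM₁⟩ := hXv
  obtain ⟨M₂, hM₂⟩ := hXw
  have hcont : ∀ {u : ℝ → ℝ → Plane}, (IsCDESolution β T u fun t => tangentialCoeff β (u t)) →
      ContinuousOn u (Icc 0 T) := fun hu => continuousOn_pi.2 fun s t ht =>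
    (hu.equation t ht s).continuousWithinAt
  refine IsClosed.Icc_subset_of_forall_mem_nhdsWithin (s := {t | v t = w t}) ?_ h0 fun t ht => ?_
  · rw [inter_comm]
    exact ((hcont hv).prodMk (hcont hw)).preimage_isClosed_of_isClosed isClosed_Icc isClosed_diagonal
  · obtain ⟨htA, ht0, htT⟩ := ht
    obtain ⟨L, hL⟩ := hL t ⟨ht0, htT.le⟩
    have hmem : ∀ r ∈ Icc 0 (T - t), t + r ∈ Icc 0 T := fun r hr =>
      ⟨by linarith [hr.1], by linarith [hr.2]⟩
    have hle : ∀ r ∈ Icc 0 (T - t), ρ₀ - κ * T ≤ ρ₀ - κ * (t + r) := fun r hr => by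
      have := mul_le_mul_of_nonneg_left (hmem r hr).2 hκ
      linarith
    obtain ⟨ε, hε, heq⟩ := exists_eq_of_isCDESolution hβ₁ hβ₂ (sub_pos.2 hρ) (sub_pos.2 htT)
      (fun r hr => (hM₁ _ (hmem r hr)).mono (hle r hr)) (fun r hr => (hM₂ _ (hmem r hr)).mono (hle r hr))
      (hv.shift ht0) (hw.shift ht0) (by simpa using htA) (L := L) (by simpa using hL)
    filter_upwards [Ioc_mem_nhdsGT (show t < t + ε by linarith)] with r hr
    have := heq (r - t) ⟨by linarith [hr.1], by linarith [hr.2]⟩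
    simpa using this

end

theorem theorem1 (β : ℝ) (hβ₁ : 1 < β) (hβ₂ : β < 2) (l : ℕ) (hl : 2 ≤ l)
    (z₀ : ℝ → Plane) (hper : Function.Periodic z₀ 1) (han : AnalyticOnNhd ℝ z₀ Set.univ)
    (hac : ArcChord z₀) :
    (∃ T ρ₀ κ : ℝ, 0 < T ∧ 0 < κ ∧ κ * T < ρ₀ ∧
      ∃ (z : ℝ → ℝ → Plane) (lam : ℝ → ℝ → ℝ),
        InY l ρ₀ κ T z ∧ IsCDESolution β T z lam ∧ z 0 = z₀) ∧
    ((∃ L : ℝ, ∀ s : ℝ, ‖deriv z₀ s‖ = L) →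
      ∃ T ρ₀ κ : ℝ, 0 < T ∧ 0 < κ ∧ κ * T < ρ₀ ∧
        ∃ z : ℝ → ℝ → Plane,
          (InY l ρ₀ κ T z ∧ IsCDESolution β T z (fun t => tangentialCoeff β (z t)) ∧
            z 0 = z₀) ∧
          (∀ t ∈ Set.Icc 0 T, ∃ L : ℝ, ∀ s : ℝ, ‖deriv (z t) s‖ = L) ∧
          ∀ w : ℝ → ℝ → Plane,
            InY l ρ₀ κ T w → IsCDESolution β T w (fun t => tangentialCoeff β (w t)) →
            w 0 = z₀ → ∀ t ∈ Set.Icc 0 T, ∀ s : ℝ, w t s = z t s) := by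
  obtain ⟨c, hc, hch⟩ := hac.exists_chord (continuousOn_univ.1 han.continuousOn) hper
  refine ⟨exists_solution hβ₁ hβ₂ l hper han hc hch, fun ⟨L, hL⟩ => ?_⟩
  obtain ⟨T, ρ₀, κ, hT, hκ, hρ, z, hzY, hz, hz0, hzL⟩ :=
    exists_constant_speed_solution hβ₁ hβ₂ l hper han hc hch hL
  refine ⟨T, ρ₀, κ, hT, hκ, hρ, z, ⟨hzY, hz, hz0⟩, hzL, fun w hwY hw hw0 t ht s => ?_⟩
  rw [hzY.eq_of_isCDESolution hβ₁ hβ₂ hκ.le hρ hwY hz hw (hz0.trans hw0.symm) hzL t ht]
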